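/- Let $p\ge 1$. Let $f:\mathbb R\times\mathbb R\to\mathbb R$, $(x,\alpha)\mapsto f(x,\alpha)$, be of class $C^{p+7}$ and satisfy the (asymmetric) pitchfork conditions $$f(0,\alpha)=0\ (|\alpha|\le\alpha_0),\quad f_x(0,0)=0,\quad f_{xx}(0,0)=0,\quad f_{xxx}(0,0)\ne0,\quad f_{x\alpha}(0,0)\neq 0 .$$ Let $\Phi(h,\cdot,\alpha)$ be the time-$h$ map of $\dot x=f(x,\alpha)$ near the origin, and let $\varphi(h,x,\alpha)$ be a one-step method that is sufficiently smooth (of class $C^k$ up to the boundary on a box $0\le h\le h_0$, $|x|\le\varepsilon_0$, $|\alpha|\le\alpha_0$, with $k=k(p)$) and satisfies on this box $$|\Phi(h,x,\alpha)-\varphi(h,x,\alpha)|\le \mathrm{const}\cdot h^{p+1},\quad \varphi(h,0,\alpha)=0,\quad \varphi_x(h,0,0)=1,\quad \varphi_{xx}(h,0,0)=0 .$$ **Conjugacy and estimate.** After decreasing $h_0,\varepsilon_0,\alpha_0>0$ there are a sign $s\in\{1,-1\}$, constants $\varepsilon_1,\beta_1,C>0$, $0<\varepsilon_2\le\varepsilon_0$,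 $0<\alpha_2\le\alpha_0$, and invertible coordinate changes $\chi(h,\cdot,\alpha),\tilde\chi(h,\cdot,\alpha)$ and parameter changes $b(h,\cdot),\tilde b(h,\cdot)$, which fix $0$, are of class $C^{p+2}$ with nonvanishing derivative, are $Ch^p$-close to each other, and transform $\Phi$ and $\varphi$ respectively into normal forms $$\mathcal N_\Phi(h,y,\beta)=(1+h\beta)y+s\,hy^3+hy^4\eta_4(h,y,\beta),\qquad \mathcal N_\varphi(h,y,\beta)=(1+h\beta)y+s\,hy^3+hy^4\tilde\eta_4(h,y,\beta)$$ on $0\le h\le h_0$, $|y|\le\varepsilon_1$, $|\beta|\le\beta_1$, where $\eta_4,\tilde\eta_4$ are of class $C^{p+2}$ and $|\eta_4-\tilde\eta_4|\le Ch^p$, such that the following holds for all $0<h\le h_0$. (i) For $|\beta|\le\beta_1$ let $g,G$ be $\mathcal N_\varphi(h,\cdot,\beta),\mathcal N_\Phi(h,\cdot,\beta)$ if $s=-1$, and their inverses on $[-\varepsilon_1,\varepsilon_1]$ if $s=1$. There is an increasing homeomorphism $J(h,\cdot,\beta)$ of $[-\varepsilon_1,\varepsilon_1]$ onto itself which is the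 fundamental-domain conjugacy: for each starting point $a=\pm\varepsilon_1$ and, if $-s\beta>0$, also $a=\pm\sqrt{|\beta|/8}$, $J$ is affine on the interval between $a$ and $g(a)$ with $J(a)=a$, $J(g(a))=G(a)$; it is extended to the forward iterates of this interval under $g$ by $J=G\circ J\circ g^{-1}$ and, when $a=\pm\sqrt{|\beta|/8}$, also to the backward iterates by $J=G^{-1}\circ J\circ g$; it maps $0$ to $0$ and the positive (negative) fixed point of $g$ in $[-\varepsilon_1,\varepsilon_1]$, if there is one, to that of $G$. It satisfies $J(h,\mathcal N_\varphi(h,y,\beta),\beta)=\mathcal N_\Phi(h,J(h,y,\beta),\beta)$ whenever $|y|\le\varepsilon_1$ and $|\mathcal N_\varphi(h,y,\beta)|\le\varepsilon_1$, and $$|y-J(h,y,\beta)|\le C\,h^p\qquad(0<h\le h_0,\ |y|\le\varepsilon_1,\ |\beta|\le\beta_1).$$ (ii) In the original coordinates: there are $\tilde\alpha=\tilde\alpha(h,\alpha)$, a homeomorphism in $\alpha\in[-\alpha_2,\alpha_2]$ onto its image with $\tilde b(h,\tilde\alpha)=b(h,\alpha)$ and $|\alpha-\tilde\alpha|\le Ch^p$,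 and maps $\hat J(h,\cdot,\alpha)$, homeomorphisms of $[-\varepsilon_2,\varepsilon_2]$ onto their images, determined by $J\big(h,\tilde\chi(h,\hat J(h,x,\alpha),\tilde\alpha),b(h,\alpha)\big)=\chi(h,x,\alpha)$, with $$\hat J(h,\Phi(h,x,\alpha),\alpha)=\varphi(h,\hat J(h,x,\alpha),\tilde\alpha)\ \text{ whenever } |x|,|\Phi(h,x,\alpha)|\le\varepsilon_2,\qquad |x-\hat J(h,x,\alpha)|\le C\,h^p$$ for $|x|\le\varepsilon_2$, $|\alpha|\le\alpha_2$. **Optimality in $h$.** For every $p\ge1$ there are $f,\Phi,\varphi$ as above (with $\varphi$ of class $C^k$ for every $k$) for which the order $h^p$ cannot be improved: on every sufficiently small box and for every parameter alignment $\alpha\mapsto\tilde\alpha(h,\alpha)$ there are $c,h_1>0$ such that every family $\hat J$ of homeomorphisms onto their images that conjugates $\Phi$ and $\varphi$ on this box as in (ii), constructed in whatever way, satisfies, for each $0<h\le h_1$, the lower bound $|x-\hat J(h,x,\alpha)|\ge c\,h^p$ at some point $(x,\alpha)$ of the box. Moreover these $\Phi,\varphi$ have normal forms $\mathcal N_\Phi,\mathcal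 N_\varphi$ as above such that the same lower bound holds for all conjugacies $J$ between $\mathcal N_\varphi$ and $\mathcal N_\Phi$ (with the same $\beta$) on every smaller box. -/

import Mathlib

open Set

namespace Pitchfork

/-- The box `[0, h₀] × [-ε₀, ε₀] × [-α₀, α₀]` of triples (step size, state, parameter). -/
def box (h₀ ε₀ α₀ : ℝ) : Set (ℝ × ℝ × ℝ) :=
  Icc 0 h₀ ×ˢ (Icc (-ε₀) ε₀ ×ˢ Icc (-α₀) α₀)

/-- A function of three real variables is of class `C^n` on the closed box (up to the boundary). -/
def SmoothOnBox (n : ℕ) (g : ℝ → ℝ → ℝ → ℝ) (h₀ ε₀ α₀ : ℝ) : Prop :=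
  ContDiffOn ℝ (n : WithTop ℕ∞) (fun q : ℝ × ℝ × ℝ => g q.1 q.2.1 q.2.2) (box h₀ ε₀ α₀)

/-- The (asymmetric) pitchfork conditions on the right-hand side `f (x, α)` of `x' = f (x, α)`. -/
structure PitchforkODE (f : ℝ → ℝ → ℝ) (α₀ : ℝ) : Prop where
  equilibrium : ∀ α ∈ Icc (-α₀) α₀, f 0 α = 0
  f_x : deriv (fun x => f x 0) 0 = 0
  f_xx : iteratedDeriv 2 (fun x => f x 0) 0 = 0
  f_xxx : iteratedDeriv 3 (fun x => f x 0) 0 ≠ 0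
  f_xα : deriv (fun α => deriv (fun x => f x α) 0) 0 ≠ 0

/-- `Φ h x α` is the value at time `h` of the solution of `u' = f (u, α)`, `u 0 = x`,
for `h ∈ [0, h₀]`, `|x| ≤ ε₀`, `|α| ≤ α₀`. -/
def IsTimeMap (f : ℝ → ℝ → ℝ) (Φ : ℝ → ℝ → ℝ → ℝ) (h₀ ε₀ α₀ : ℝ) : Prop :=
  ∀ x ∈ Icc (-ε₀) ε₀, ∀ α ∈ Icc (-α₀) α₀,
    Φ 0 x α = x ∧
    ∀ t ∈ Icc 0 h₀, HasDerivWithinAt (fun t => Φ t x α) (f (Φ t x α) α) (Icc 0 h₀) t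

/-- The standing hypotheses: `f` is `C^(p+7)` and has a pitchfork at the origin, `Φ` is its
time-`h` map, and `φ` is a `C^k` one-step method of order `p` that keeps the origin fixed and
satisfies `φ_x (h, 0, 0) = 1`, `φ_xx (h, 0, 0) = 0`. -/
structure Setting (p k : ℕ) (f : ℝ → ℝ → ℝ) (Φ φ : ℝ → ℝ → ℝ → ℝ) (h₀ ε₀ α₀ : ℝ) : Prop where
  h₀_pos : 0 < h₀
  ε₀_pos : 0 < ε₀
  α₀_pos : 0 < α₀
  f_smooth : ContDiff ℝ ((p + 7 : ℕ) : WithTop ℕ∞) (fun q : ℝ × ℝ => f q.1 q.2)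
  pitchfork : PitchforkODE f α₀
  timeMap : IsTimeMap f Φ h₀ ε₀ α₀
  φ_smooth : SmoothOnBox k φ h₀ ε₀ α₀
  order : ∃ c : ℝ, ∀ h ∈ Icc 0 h₀, ∀ x ∈ Icc (-ε₀) ε₀, ∀ α ∈ Icc (-α₀) α₀,
    |Φ h x α - φ h x α| ≤ c * h ^ (p + 1)
  φ_equilibrium : ∀ h ∈ Icc 0 h₀, ∀ α ∈ Icc (-α₀) α₀, φ h 0 α = 0
  φ_x : ∀ h ∈ Icc 0 h₀, deriv (fun x => φ h x 0) 0 = 1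
  φ_xx : ∀ h ∈ Icc 0 h₀, iteratedDeriv 2 (fun x => φ h x 0) 0 = 0

/-- The pitchfork normal form `(1 + hβ) x + s h x³ + h x⁴ r (h, x, β)`. -/
def normalForm (s : ℝ) (r : ℝ → ℝ → ℝ → ℝ) (h x β : ℝ) : ℝ :=
  (1 + h * β) * x + s * h * x ^ 3 + h * x ^ 4 * r h x β

/-- The coordinate change `y = χ (h, x, α)` and the parameter change `β = b (h, α)`, of class
`C^n` and invertible with `C^n` inverse, fix the origin and turn the map `x ↦ M (h, x, α)` into
the normal form with sign `s` and `C^n` tail `r` on the domain `|y| ≤ ε₁`, `|β| ≤ β₁`. -/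
structure IsReduction (n : ℕ) (s : ℝ) (M : ℝ → ℝ → ℝ → ℝ) (h₀ ε₀ α₀ ε₁ β₁ : ℝ)
    (χ : ℝ → ℝ → ℝ → ℝ) (b : ℝ → ℝ → ℝ) (r : ℝ → ℝ → ℝ → ℝ) : Prop where
  χ_smooth : SmoothOnBox n χ h₀ ε₀ α₀
  χ_zero : ∀ h ∈ Icc 0 h₀, ∀ α ∈ Icc (-α₀) α₀, χ h 0 α = 0
  χ_deriv : ∀ h ∈ Icc 0 h₀, ∀ α ∈ Icc (-α₀) α₀, ∀ x ∈ Icc (-ε₀) ε₀,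
    0 < derivWithin (fun x => χ h x α) (Icc (-ε₀) ε₀) x
  χ_cover : ∀ h ∈ Icc 0 h₀, ∀ α ∈ Icc (-α₀) α₀,
    Icc (-ε₁) ε₁ ⊆ (fun x => χ h x α) '' Icc (-ε₀) ε₀
  b_smooth : ContDiffOn ℝ (n : WithTop ℕ∞) (fun q : ℝ × ℝ => b q.1 q.2)
    (Icc 0 h₀ ×ˢ Icc (-α₀) α₀)
  b_zero : ∀ h ∈ Icc 0 h₀, b h 0 = 0
  b_deriv : ∀ h ∈ Icc 0 h₀, ∀ α ∈ Icc (-α₀) α₀,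
    derivWithin (fun α => b h α) (Icc (-α₀) α₀) α ≠ 0
  b_cover : ∀ h ∈ Icc 0 h₀, Icc (-β₁) β₁ ⊆ (fun α => b h α) '' Icc (-α₀) α₀
  r_smooth : SmoothOnBox n r h₀ ε₁ β₁
  transforms : ∀ h ∈ Icc 0 h₀, ∀ α ∈ Icc (-α₀) α₀, ∀ x ∈ Icc (-ε₀) ε₀,
    M h x α ∈ Icc (-ε₀) ε₀ → χ h x α ∈ Icc (-ε₁) ε₁ → b h α ∈ Icc (-β₁) β₁ →
    χ h (M h x α) α = normalForm s r h (χ h x α) (b h α)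

/-- Normal form reductions of `Φ` and of `φ`, with the same sign `s = ±1`, whose coordinate
changes, parameter changes and tails are `C h^p`-close to each other. -/
structure IsReductionPair (p : ℕ) (s : ℝ) (Φ φ : ℝ → ℝ → ℝ → ℝ) (h₀ ε₀ α₀ ε₁ β₁ C : ℝ)
    (χ : ℝ → ℝ → ℝ → ℝ) (b : ℝ → ℝ → ℝ) (r : ℝ → ℝ → ℝ → ℝ)
    (χ' : ℝ → ℝ → ℝ → ℝ) (b' : ℝ → ℝ → ℝ) (r' : ℝ → ℝ → ℝ → ℝ) : Prop where
  h₀_pos : 0 < h₀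
  ε₀_pos : 0 < ε₀
  α₀_pos : 0 < α₀
  ε₁_pos : 0 < ε₁
  β₁_pos : 0 < β₁
  sign : s = 1 ∨ s = -1
  exact : IsReduction (p + 2) s Φ h₀ ε₀ α₀ ε₁ β₁ χ b r
  discrete : IsReduction (p + 2) s φ h₀ ε₀ α₀ ε₁ β₁ χ' b' r'
  χ_close : ∀ h ∈ Icc 0 h₀, ∀ x ∈ Icc (-ε₀) ε₀, ∀ α ∈ Icc (-α₀) α₀,
    |χ h x α - χ' h x α| ≤ C * h ^ p
  b_close : ∀ h ∈ Icc 0 h₀, ∀ α ∈ Icc (-α₀) α₀, |b h α - b' h α| ≤ C * h ^ p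
  r_close : ∀ h ∈ Icc 0 h₀, ∀ y ∈ Icc (-ε₁) ε₁, ∀ β ∈ Icc (-β₁) β₁,
    |r h y β - r' h y β| ≤ C * h ^ p

/-- `M₁` and `M₂` are conjugate on `|x| ≤ ε`: for every `0 < h ≤ h₀` and `|α| ≤ α₀`, the map
`J (h, ·, α)` is a homeomorphism of `[-ε, ε]` onto its image with
`J (h, M₁ (h, x, α), α) = M₂ (h, J (h, x, α), τ (h, α))` as long as `M₁ (h, x, α)` stays in
`[-ε, ε]`; the alignment `τ (h, ·)` of the parameter is a homeomorphism onto its image. -/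
structure IsConjugacyFamily (M₁ M₂ : ℝ → ℝ → ℝ → ℝ) (h₀ ε α₀ : ℝ)
    (τ : ℝ → ℝ → ℝ) (J : ℝ → ℝ → ℝ → ℝ) : Prop where
  τ_continuous : ∀ h ∈ Ioc 0 h₀, ContinuousOn (τ h) (Icc (-α₀) α₀)
  τ_injective : ∀ h ∈ Ioc 0 h₀, InjOn (τ h) (Icc (-α₀) α₀)
  J_continuous : ∀ h ∈ Ioc 0 h₀, ∀ α ∈ Icc (-α₀) α₀,
    ContinuousOn (fun x => J h x α) (Icc (-ε) ε)
  J_injective : ∀ h ∈ Ioc 0 h₀, ∀ α ∈ Icc (-α₀) α₀, InjOn (fun x => J h x α) (Icc (-ε) ε)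
  conj : ∀ h ∈ Ioc 0 h₀, ∀ α ∈ Icc (-α₀) α₀, ∀ x ∈ Icc (-ε) ε,
    M₁ h x α ∈ Icc (-ε) ε → J h (M₁ h x α) α = M₂ h (J h x α) (τ h α)

/-- The affine map with `a ↦ a` and `g a ↦ G a`, used on the first fundamental domain
between `a` and `g a`. -/
noncomputable def startMap (g G : ℝ → ℝ) (a u : ℝ) : ℝ :=
  a + (G a - a) / (g a - a) * (u - a)

/-- For `s = -1` the normal form maps `[-ε, ε]` into itself and is iterated as it is;
for `s = 1` its inverse branch on `[-ε, ε]` does so and is iterated instead. -/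
noncomputable def inward (s ε : ℝ) (N : ℝ → ℝ) : ℝ → ℝ :=
  open Classical in if s < 0 then N else Function.invFunOn N (Icc (-ε) ε)

/-- The method of fundamental domains for two self-maps `g`, `G` of `[-ε, ε]`.
In the outer region the starting points are `z₀ = ± ε`, and `J` is prescribed on the domains
between `z_n = g^[n] z₀` and `z_{n+1}`. In the inner region, present if `0 < a`, the starting points
are `x₀ = ± a`; `J` is prescribed on the domains between the forward iterates `x_n = g^[n] x₀`, and
on those between the backward iterates `y_n` of `x₀`. On the first fundamental domain `J` is
affine, and then it is extended recursively by `J = G ∘ J ∘ g⁻¹` (forward) and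
`J = G⁻¹ ∘ J ∘ g` (backward). Finally fixed points of `g` go to the corresponding ones of `G`. -/
structure IsFundamentalDomainMap (ε a : ℝ) (g G J : ℝ → ℝ) : Prop where
  outer : ∀ z ∈ ({-ε, ε} : Set ℝ), ∀ n : ℕ, ∀ u ∈ uIcc z (g z),
    J (g^[n] u) = G^[n] (startMap g G z u)
  inner_forward : 0 < a → ∀ x₀ ∈ ({-a, a} : Set ℝ), ∀ n : ℕ, ∀ u ∈ uIcc x₀ (g x₀),
    J (g^[n] u) = G^[n] (startMap g G x₀ u)
  inner_backward : 0 < a → ∀ x₀ ∈ ({-a, a} : Set ℝ), ∀ n : ℕ, ∀ y ∈ Icc (-ε) ε,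
    g^[n] y ∈ uIcc x₀ (g x₀) →
      J y ∈ Icc (-ε) ε ∧ G^[n] (J y) = startMap g G x₀ (g^[n] y)
  fixed_zero : J 0 = 0
  fixed_side : ∀ w ∈ Icc (-ε) ε, ∀ w' ∈ Icc (-ε) ε, 0 < w * w' → g w = w → G w' = w' → J w = w'

/-- The fundamental-domain conjugacy, at fixed `h` and `β`, between the normal form `N'` of the
discretization and the normal form `N` of the time-`h` map, both with sign `s`. The inner region
is present if `-s β > 0`, and its starting points are then `± √(|β| / 8)`. -/
def IsFundamentalDomainConjugacy (s ε β : ℝ) (N' N J : ℝ → ℝ) : Prop :=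
  IsFundamentalDomainMap ε (Real.sqrt (-s * β / 8)) (inward s ε N') (inward s ε N) J

/-- No conjugacy of `M₁` and `M₂` with parameter alignment `τ` on the given domain is closer to
the identity than a constant multiple of `h^p`, for any small `h`. -/
def NoBetterThan (p : ℕ) (M₁ M₂ : ℝ → ℝ → ℝ → ℝ) (h₀ ε α₀ : ℝ) (τ : ℝ → ℝ → ℝ) : Prop :=
  ∃ c > 0, ∃ h₁ ∈ Ioc 0 h₀, ∀ J, IsConjugacyFamily M₁ M₂ h₀ ε α₀ τ J →
    ∀ h ∈ Ioc 0 h₁, ∃ α ∈ Icc (-α₀) α₀, ∃ x ∈ Icc (-ε) ε, c * h ^ p ≤ |x - J h x α|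

end Pitchfork

/-!
Write `Φ` for the time-`h` map and `φ` for the method. Both fix `0` and agree with the identity at
`h = 0`, so that division by `h`, `x` and `α` (`exists_eq_mul_of_eq_zero`, `exists_expansion`)
gives `M (h, x, α) = x + h * (α A₁ x + α A₂ x² + a₃ x³ + x⁴ R)` for each of them, with smooth
coefficients up to the boundary of the box. Smoothness of `Φ` up to the boundary comes from that
of solutions of ordinary differential equations (`contDiffOn_timeMap`). Since `(Φ - φ) / h^(p+1)`
is smooth as well, the coefficients of `Φ` and `φ` differ by `O(h^p)` (`Setting.exists_jets`). An
explicit change `y = κ (x + c x²)` with the parameter `β = α A₁` then removes the quadratic term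
and scales the cubic coefficient to `s = ±1` (`IsJet.exists_reduction`). All its ingredients are
algebraic in the coefficients, so the two reductions are again `O(h^p)`-close (`PowClose`,
`exists_expandingPair`).

For the conjugacy of the normal forms, let `g` and `G` be the maps, or their inverses, which move
points inwards at the ends of the interval. They are extended to increasing bijections of the
line. The orbit of a starting point `a` is parametrized by a function `L_g` that is affine from
`a` to `g a` on `[0, 1]` and satisfies `L_g (t + 1) = g (L_g t)` (`orbitParam`). Then
`L_G ∘ L_g⁻¹` is the fundamental-domain conjugacy on the part of the line swept out by the orbit, and the
pieces are glued at the fixed points (`exists_line_conj`).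

The estimate rests on two facts about `g` and `G`, with `δ` a multiple of `h^p` (`HalfEstimate`).
First, `G z ≤ (1 + δ) g (z / (1 + δ))` for `z ≥ 0`, and likewise with `g` and `G` interchanged:
stretching an orbit by `1 + δ` gains a cubic term that dominates the difference of the quartic
tails (`cubicMap_ratio`, `inwardIso_ratio`). This property survives iteration, and hence compares
the forward orbits from a common starting point uniformly in time, including the limiting fixed
points. Second, if `-s β > 0`, the maps expand distances on `|y| ≤ √(|β| / 8)` at a rate
`h |β| / 4`, while they differ by at most `h |β| δ / 4`; a distance of at most `δ` is therefore preserved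
by backward iteration (`inwardIso_backward`). The starting points `± √(|β| / 8)` are chosen so
that the second fact covers their backward orbits and the first their forward orbits
(`exists_fundamentalDomainConjugacy`). Neither bound degenerates as `β → 0`. The coordinate
changes expand distances by a uniform factor, which carries the estimate over to the original
coordinates (`IsExpandingPair.exists_original_conjugacy`).

For the optimality, take `f (x, α) = α x - x³`, whose flow is explicit, and a method whose nonzero
fixed points are the solutions of `α = x² - h^p x³`. A conjugacy maps fixed points to fixed
points. The fixed points of `Φ` for a given `α` are symmetric about `0`, but the sum of the two
nonzero fixed points of `φ` is of exact order `h^p` whatever its parameter, so no alignment of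
parameters can remove the discrepancy (`noBetterThan_model`). In the normal forms the positive
fixed points at the same `β` differ by a multiple of `h^p` (`noBetterThan_model_normalForms`).
-/

namespace Pitchfork

open Filter Topology MeasureTheory

/-! ### Integrals with parameters, division, and inverse functions -/

theorem continuousOn_paramIntegral {E F : Type} [NormedAddCommGroup E] [NormedSpace ℝ E]
    [NormedAddCommGroup F] [NormedSpace ℝ F] {K : Set E} (hK : IsCompact K)
    {G : ℝ × E → F} (hG : ContinuousOn G (Icc 0 1 ×ˢ K)) :
    ContinuousOn (fun q => ∫ s in (0 : ℝ)..1, G (s, q)) K := by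
  obtain ⟨C, hC⟩ := (isCompact_Icc.prod hK).exists_bound_of_continuousOn hG
  have hsec : ∀ q ∈ K, ContinuousOn (fun s : ℝ => G (s, q)) (Icc 0 1) := fun q hq =>
    hG.comp (by fun_prop) (fun s hs => ⟨hs, hq⟩)
  intro q hq
  refine intervalIntegral.continuousWithinAt_of_dominated_interval (bound := fun _ => C) ?_ ?_
    intervalIntegrable_const ?_
  · filter_upwards [self_mem_nhdsWithin] with q' hq'
    rw [uIoc_of_le zero_le_one]
    exact ((hsec q' hq').mono Ioc_subset_Icc_self).aestronglyMeasurable measurableSet_Ioc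
  · filter_upwards [self_mem_nhdsWithin] with q' hq'
    refine Eventually.of_forall fun t ht => hC _ ⟨?_, hq'⟩
    rw [uIoc_of_le zero_le_one] at ht
    exact Ioc_subset_Icc_self ht
  · refine Eventually.of_forall fun t ht => ?_
    rw [uIoc_of_le zero_le_one] at ht
    have : ContinuousOn (fun q => G (t, q)) K :=
      hG.comp (by fun_prop) (fun s hs => ⟨Ioc_subset_Icc_self ht, hs⟩)
    exact this q hq

/-- Differentiation under the integral sign at points of a compact convex set, including its
boundary. -/
theorem hasFDerivWithinAt_paramIntegral {E F : Type} [NormedAddCommGroup E] [NormedSpace ℝ E]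
    [NormedAddCommGroup F] [NormedSpace ℝ F] {K : Set E} (hK : IsCompact K) (hc : Convex ℝ K)
    {G : ℝ × E → F} {D : ℝ × E → E →L[ℝ] F} (hG : ContinuousOn G (Icc 0 1 ×ˢ K))
    (hD : ContinuousOn D (Icc 0 1 ×ˢ K))
    (hGD : ∀ s ∈ Icc (0 : ℝ) 1, ∀ q ∈ K, HasFDerivWithinAt (fun q => G (s, q)) (D (s, q)) K q)
    {q : E} (hq : q ∈ K) :
    HasFDerivWithinAt (fun q => ∫ s in (0 : ℝ)..1, G (s, q)) (∫ s in (0 : ℝ)..1, D (s, q)) K q := by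
  have hsec : ∀ q ∈ K, IntervalIntegrable (fun s : ℝ => G (s, q)) volume 0 1 := fun q hq => by
    apply ContinuousOn.intervalIntegrable
    rw [uIcc_of_le zero_le_one]
    exact hG.comp (by fun_prop) (fun s hs => ⟨hs, hq⟩)
  have hsecD : IntervalIntegrable (fun s : ℝ => D (s, q)) volume 0 1 := by
    apply ContinuousOn.intervalIntegrable
    rw [uIcc_of_le zero_le_one]
    exact hD.comp (by fun_prop) (fun s hs => ⟨hs, hq⟩)
  have hsecDa : ∀ e : E, IntervalIntegrable (fun s : ℝ => D (s, q) e) volume 0 1 := fun e => by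
    apply ContinuousOn.intervalIntegrable
    rw [uIcc_of_le zero_le_one]
    exact (hD.comp (by fun_prop) (fun s hs => ⟨hs, hq⟩)).clm_apply continuousOn_const
  rw [hasFDerivWithinAt_iff_isLittleO, Asymptotics.isLittleO_iff]
  intro ε hε
  -- uniform continuity of `D` makes the mean value inequality uniform in the variable `s`
  have hunif := (isCompact_Icc.prod hK).uniformContinuousOn_of_continuous hD
  rw [Metric.uniformContinuousOn_iff] at hunif
  obtain ⟨δ, hδ, hunif⟩ := hunif ε hε
  have hball : Metric.ball q δ ∈ 𝓝[K] q := mem_nhdsWithin_of_mem_nhds (Metric.ball_mem_nhds q hδ)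
  filter_upwards [self_mem_nhdsWithin, hball] with q' hq' hb
  have hint : (∫ s in (0 : ℝ)..1, D (s, q)) (q' - q) = ∫ s in (0 : ℝ)..1, D (s, q) (q' - q) := by
    rw [ContinuousLinearMap.intervalIntegral_apply hsecD]
  rw [hint, ← intervalIntegral.integral_sub (hsec q' hq') (hsec q hq),
    ← intervalIntegral.integral_sub ((hsec q' hq').sub (hsec q hq))
      (hsecDa _)]
  have := intervalIntegral.norm_integral_le_of_norm_le_const (a := (0:ℝ)) (b := 1)
    (C := ε * ‖q' - q‖) (f := fun s => G (s, q') - G (s, q) - D (s, q) (q' - q)) ?_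
  · simpa using this
  intro s hs
  rw [uIoc_of_le zero_le_one] at hs
  have hs' := Ioc_subset_Icc_self hs
  refine Convex.norm_image_sub_le_of_norm_hasFDerivWithin_le' (s := K ∩ Metric.ball q δ)
    (f := fun q => G (s, q)) (f' := fun q => D (s, q))
    (fun x hx => (hGD s hs' x hx.1).mono inter_subset_left) ?_ (hc.inter (convex_ball q δ))
    ⟨hq, Metric.mem_ball_self hδ⟩ ⟨hq', hb⟩
  intro x hx
  have := hunif (s, x) ⟨hs', hx.1⟩ (s, q) ⟨hs', hq⟩ (by
    rw [Prod.dist_eq]; simpa [hδ] using hx.2)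
  rw [dist_eq_norm] at this
  exact this.le

theorem contDiffOn_paramIntegral {E F : Type} [NormedAddCommGroup E] [NormedSpace ℝ E]
    [NormedAddCommGroup F] [NormedSpace ℝ F] {K : Set E} (hK : IsCompact K) (hc : Convex ℝ K)
    (hu : UniqueDiffOn ℝ K) {n : ℕ} {G : ℝ × E → F} (hG : ContDiffOn ℝ n G (Icc 0 1 ×ˢ K)) :
    ContDiffOn ℝ n (fun q => ∫ s in (0 : ℝ)..1, G (s, q)) K := by
  induction n generalizing F with
  | zero =>
    simp only [Nat.cast_zero, contDiffOn_zero] at hG ⊢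
    exact continuousOn_paramIntegral hK hG
  | succ n ih =>
    have huu : UniqueDiffOn ℝ (Icc (0:ℝ) 1 ×ˢ K) := (uniqueDiffOn_Icc zero_lt_one).prod hu
    have hG' := hG
    push_cast at hG' ⊢
    rw [contDiffOn_succ_iff_fderivWithin huu] at hG'
    rw [contDiffOn_succ_iff_hasFDerivWithinAt_of_uniqueDiffOn hu]
    refine ⟨by simp, fun q => ∫ s in (0 : ℝ)..1,
      (fderivWithin ℝ G (Icc 0 1 ×ˢ K) (s, q)).comp (ContinuousLinearMap.inr ℝ ℝ E), ?_, ?_⟩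
    · refine ih (G := fun z => (fderivWithin ℝ G (Icc 0 1 ×ˢ K) z).comp
        (ContinuousLinearMap.inr ℝ ℝ E)) ?_
      exact hG'.2.2.clm_comp contDiffOn_const
    · intro q hq
      refine hasFDerivWithinAt_paramIntegral (D := fun z => (fderivWithin ℝ G (Icc 0 1 ×ˢ K) z).comp
        (ContinuousLinearMap.inr ℝ ℝ E)) hK hc hG.continuousOn
        (hG'.2.2.continuousOn.clm_comp continuousOn_const) ?_ hq
      intro s hs q hq
      have h1 : HasFDerivWithinAt (fun q : E => (s, q)) (ContinuousLinearMap.inr ℝ ℝ E) K q :=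
        (hasFDerivAt_prodMk_right s q).hasFDerivWithinAt
      exact ((hG'.1 (s, q) ⟨hs, hq⟩).hasFDerivWithinAt).comp q h1 (fun q hq => ⟨hs, hq⟩)

/-- Division by a linear functional: a `C^(n+1)` function on a compact convex set that vanishes on
the slice `l = 0` is `l` times a `C^n` function. -/
theorem exists_eq_mul_of_eq_zero {E : Type} [NormedAddCommGroup E] [NormedSpace ℝ E]
    {K : Set E} (hK : IsCompact K) (hc : Convex ℝ K) (hu : UniqueDiffOn ℝ K)
    (l : E →L[ℝ] ℝ) (e : E) (hP : ∀ q ∈ K, q - l q • e ∈ K)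
    {n : ℕ} {g : E → ℝ} (hg : ContDiffOn ℝ (n + 1 : ℕ) g K) (h0 : ∀ q ∈ K, g (q - l q • e) = 0) :
    ∃ g₁ : E → ℝ, ContDiffOn ℝ n g₁ K ∧ ∀ q ∈ K, g q = l q * g₁ q := by
  have hg' := hg
  push_cast at hg'
  rw [contDiffOn_succ_iff_fderivWithin hu] at hg'
  have hmem : ∀ s ∈ Icc (0:ℝ) 1, ∀ q ∈ K, q - (1 - s) • l q • e ∈ K := by
    intro s hs q hq
    have := hc (hP q hq) hq (a := 1 - s) (b := s) (by linarith [hs.2]) hs.1 (by ring)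
    convert this using 1
    module
  have hmaps : MapsTo (fun z : ℝ × E => z.2 - (1 - z.1) • l z.2 • e) (Icc 0 1 ×ˢ K) K :=
    fun z hz => hmem z.1 hz.1 z.2 hz.2
  refine ⟨fun q => ∫ s in (0:ℝ)..1, fderivWithin ℝ g K (q - (1 - s) • l q • e) e, ?_, ?_⟩
  · refine contDiffOn_paramIntegral hK hc hu
      (G := fun z : ℝ × E => fderivWithin ℝ g K (z.2 - (1 - z.1) • l z.2 • e) e) ?_
    refine ContDiffOn.clm_apply (hg'.2.2.comp ?_ hmaps) contDiffOn_const
    apply ContDiff.contDiffOn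
    fun_prop
  · intro q hq
    have hder : ∀ s ∈ Icc (0:ℝ) 1, HasDerivWithinAt (fun s : ℝ => g (q - (1 - s) • l q • e))
        (fderivWithin ℝ g K (q - (1 - s) • l q • e) (l q • e)) (Icc 0 1) s := by
      intro s hs
      have h1 : HasDerivWithinAt (fun s : ℝ => q - (1 - s) • l q • e) (l q • e) (Icc 0 1) s := by
        have := (((hasDerivWithinAt_id s (Icc (0:ℝ) 1)).const_sub 1).smul_const
          (l q • e)).const_sub q
        simpa using this
      exact ((hg'.1 _ (hmem s hs q hq)).hasFDerivWithinAt).comp_hasDerivWithinAt s h1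
        (fun t ht => hmem t ht q hq)
    have hcont : ContinuousOn (fun s : ℝ => fderivWithin ℝ g K (q - (1 - s) • l q • e) (l q • e))
        (Icc 0 1) := by
      refine ContinuousOn.clm_apply (hg'.2.2.continuousOn.comp (by fun_prop)
        (fun s hs => hmem s hs q hq)) continuousOn_const
    have hFTC := intervalIntegral.integral_eq_sub_of_hasDerivAt_of_le (a := (0:ℝ)) (b := 1)
      zero_le_one (fun s hs => (hder s hs).continuousWithinAt)
      (fun s hs => (hder s (Ioo_subset_Icc_self hs)).hasDerivAt (Icc_mem_nhds hs.1 hs.2))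
      (by
        apply ContinuousOn.intervalIntegrable
        rwa [uIcc_of_le zero_le_one])
    simp only [sub_self, zero_smul, sub_zero, one_smul, h0 q hq] at hFTC
    rw [← hFTC, ← intervalIntegral.integral_const_mul]
    simp

/-- Cancellation of a linear functional between continuous functions on a convex set. -/
theorem eqOn_of_mul_eqOn {E : Type} [NormedAddCommGroup E] [NormedSpace ℝ E]
    {K : Set E} (hc : Convex ℝ K) (l : E →L[ℝ] ℝ) {q₁ : E} (hq₁ : q₁ ∈ K) (hl : l q₁ ≠ 0)
    {u v : E → ℝ} (hu : ContinuousOn u K) (hv : ContinuousOn v K)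
    (h : ∀ q ∈ K, l q * u q = l q * v q) : ∀ q ∈ K, u q = v q := by
  intro q hq
  by_cases hlq : l q = 0
  swap
  · exact mul_left_cancel₀ hlq (h q hq)
  have hmem : ∀ t ∈ Icc (0:ℝ) 1, q + t • (q₁ - q) ∈ K := fun t ht => by
    have := hc hq hq₁ (a := 1 - t) (b := t) (by linarith [ht.2]) ht.1 (by ring)
    convert this using 1
    module
  have hlim : ∀ w : E → ℝ, ContinuousOn w K →
      Tendsto (fun t : ℝ => w (q + t • (q₁ - q))) (𝓝[Ioc 0 1] 0) (𝓝 (w q)) := by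
    intro w hw
    have h1 : ContinuousOn (fun t : ℝ => w (q + t • (q₁ - q))) (Icc 0 1) :=
      hw.comp (by fun_prop) hmem
    have h2 := (h1 0 (by simp)).mono_left (nhdsWithin_mono 0 (Ioc_subset_Icc_self))
    simpa using h2
  have hne : (𝓝[Ioc (0:ℝ) 1] 0).NeBot := by
    rw [nhdsWithin_Ioc_eq_nhdsGT zero_lt_one]; infer_instance
  refine tendsto_nhds_unique_of_eventuallyEq (hlim u hu) (hlim v hv) ?_
  filter_upwards [self_mem_nhdsWithin] with t ht
  have hm := hmem t ⟨ht.1.le, ht.2⟩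
  refine mul_left_cancel₀ ?_ (h _ hm)
  simp only [map_add, map_smul, map_sub, hlq, sub_zero, zero_add, smul_eq_mul]
  exact mul_ne_zero ht.1.ne' hl

theorem exists_lipschitz_of_contDiffOn {E : Type} [NormedAddCommGroup E] [NormedSpace ℝ E]
    {K : Set E} (hK : IsCompact K) (hc : Convex ℝ K) (hu : UniqueDiffOn ℝ K) {g : E → ℝ}
    (hg : ContDiffOn ℝ 1 g K) :
    ∃ L : ℝ, 0 ≤ L ∧ ∀ q ∈ K, ∀ q' ∈ K, |g q - g q'| ≤ L * ‖q - q'‖ := by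
  have hcont : ContinuousOn (fderivWithin ℝ g K) K := hg.continuousOn_fderivWithin hu le_rfl
  obtain ⟨C, hC⟩ := hK.exists_bound_of_continuousOn hcont
  refine ⟨max C 0, le_max_right _ _, fun q hq q' hq' => ?_⟩
  exact hc.norm_image_sub_le_of_norm_fderivWithin_le
    (hg.differentiableOn one_ne_zero) (fun x hx => (hC x hx).trans (le_max_left _ _)) hq' hq

theorem le_deriv_of_expanding {a b m x d : ℝ} {u : ℝ → ℝ} (hab : a < b)
    (hd : HasDerivWithinAt u d (Icc a b) x) (hx : x ∈ Icc a b)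
    (hexp : ∀ x ∈ Icc a b, ∀ x' ∈ Icc a b, x' ≤ x → m * (x - x') ≤ u x - u x') : m ≤ d := by
  have h2 := hasDerivWithinAt_iff_tendsto_slope.1 hd
  have hne : (𝓝[Icc a b \ {x}] x).NeBot :=
    accPt_principal_iff_nhdsWithin.1
      (uniqueDiffWithinAt_iff_accPt.1 ((uniqueDiffOn_Icc hab) x hx))
  refine ge_of_tendsto h2 ?_
  filter_upwards [self_mem_nhdsWithin] with y hy
  have hyne : y ≠ x := hy.2
  rw [slope_def_field]
  rcases lt_or_gt_of_ne hyne with h | h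
  · rw [← neg_div_neg_eq, le_div_iff₀ (by linarith)]
    have := hexp x hx y hy.1 h.le
    linarith
  · rw [le_div_iff₀ (by linarith)]
    exact hexp y hy.1 x hx h.le

/-- Inverse function theorem up to the boundary, for a scalar function `u (q, ·)` that depends on a
parameter `q` and expands distances by a factor of at least `m`. -/
theorem exists_param_inverse {Q : Type} [NormedAddCommGroup Q] [NormedSpace ℝ Q] {K : Set Q}
    (hK : IsCompact K) (hc : Convex ℝ K) (hu : UniqueDiffOn ℝ K) {ρ m : ℝ} (hρ : 0 < ρ)
    (hm : 0 < m) {n : ℕ} (hn : 1 ≤ n) {u : Q → ℝ → ℝ}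
    (hsm : ContDiffOn ℝ n (fun z : Q × ℝ => u z.1 z.2) (K ×ˢ Icc (-ρ) ρ))
    (hexp : ∀ q ∈ K, ∀ x ∈ Icc (-ρ) ρ, ∀ x' ∈ Icc (-ρ) ρ, x' ≤ x → m * (x - x') ≤ u q x - u q x')
    (hzero : ∀ q ∈ K, u q 0 = 0) :
    ∃ v : Q → ℝ → ℝ, (∀ q ∈ K, ∀ y ∈ Icc (-(m * ρ)) (m * ρ),
      v q y ∈ Icc (-ρ) ρ ∧ m * |v q y| ≤ |y| ∧ u q (v q y) = y) ∧
      ContDiffOn ℝ n (fun z : Q × ℝ => v z.1 z.2) (K ×ˢ Icc (-(m * ρ)) (m * ρ)) := by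
  have h0mem : (0:ℝ) ∈ Icc (-ρ) ρ := ⟨by linarith, hρ.le⟩
  have hconv : Convex ℝ (K ×ˢ Icc (-ρ) ρ) := hc.prod (convex_Icc _ _)
  have hcomp : IsCompact (K ×ˢ Icc (-ρ) ρ) := hK.prod isCompact_Icc
  have hudom : UniqueDiffOn ℝ (K ×ˢ Icc (-ρ) ρ) := hu.prod (uniqueDiffOn_Icc (by linarith))
  have hmρ : 0 < m * ρ := mul_pos hm hρ
  have hutgt : UniqueDiffOn ℝ (K ×ˢ Icc (-(m * ρ)) (m * ρ)) :=
    hu.prod (uniqueDiffOn_Icc (by linarith))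
  have habs : ∀ q ∈ K, ∀ x ∈ Icc (-ρ) ρ, ∀ x' ∈ Icc (-ρ) ρ, m * |x - x'| ≤ |u q x - u q x'| := by
    intro q hq x hx x' hx'
    rcases le_total x' x with h | h
    · rw [abs_of_nonneg (sub_nonneg.2 h)]
      exact (hexp q hq x hx x' hx' h).trans (le_abs_self _)
    · rw [abs_sub_comm, abs_sub_comm (u q x), abs_of_nonneg (sub_nonneg.2 h)]
      exact (hexp q hq x' hx' x hx h).trans (le_abs_self _)
  have hex : ∀ q ∈ K, ∀ y ∈ Icc (-(m * ρ)) (m * ρ), ∃ x ∈ Icc (-ρ) ρ, u q x = y := by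
    intro q hq y hy
    have hcq : ContinuousOn (u q) (Icc (-ρ) ρ) :=
      hsm.continuousOn.comp (f := fun x : ℝ => (q, x)) (by fun_prop) (fun x hx => ⟨hq, hx⟩)
    have h1 := hexp q hq ρ ⟨by linarith, le_rfl⟩ 0 h0mem hρ.le
    have h2 := hexp q hq 0 h0mem (-ρ) ⟨le_rfl, by linarith⟩ (by linarith)
    rw [hzero q hq] at h1 h2
    exact intermediate_value_Icc (by linarith) hcq ⟨by linarith [hy.1], by linarith [hy.2]⟩
  choose! v hv using hex
  have hvlip : ∃ L : ℝ, ∀ z ∈ K ×ˢ Icc (-(m * ρ)) (m * ρ), ∀ z' ∈ K ×ˢ Icc (-(m * ρ)) (m * ρ),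
      |v z.1 z.2 - v z'.1 z'.2| ≤ L * ‖z - z'‖ := by
    obtain ⟨L, hL0, hL⟩ := exists_lipschitz_of_contDiffOn hcomp hconv hudom
      (hsm.of_le (by exact_mod_cast hn))
    refine ⟨(1 + L) / m, fun z hz z' hz' => ?_⟩
    obtain ⟨ha, ha'⟩ := hv z.1 hz.1 z.2 hz.2
    obtain ⟨hb, hb'⟩ := hv z'.1 hz'.1 z'.2 hz'.2
    have h1 := habs z.1 hz.1 _ ha _ hb
    have h2 := hL (z.1, v z'.1 z'.2) ⟨hz.1, hb⟩ (z'.1, v z'.1 z'.2) ⟨hz'.1, hb⟩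
    simp only [Prod.mk_sub_mk, sub_self, Prod.norm_mk, norm_zero, norm_nonneg, sup_of_le_left] at h2
    have h3 : ‖z.1 - z'.1‖ ≤ ‖z - z'‖ := norm_fst_le (z - z')
    have h4 : ‖z.2 - z'.2‖ ≤ ‖z - z'‖ := norm_snd_le (z - z')
    rw [Real.norm_eq_abs] at h4
    rw [ha'] at h1
    rw [hb'] at h2
    have h5 : |z.2 - u z.1 (v z'.1 z'.2)| ≤ |z.2 - z'.2| + |u z.1 (v z'.1 z'.2) - z'.2| := by
      rw [abs_sub_comm (u z.1 _)]
      exact abs_sub_le _ _ _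
    rw [div_mul_eq_mul_div, le_div_iff₀ hm]
    nlinarith [mul_le_mul_of_nonneg_left h3 hL0]
  obtain ⟨L, hL⟩ := hvlip
  have hvcont : ContinuousOn (fun z : Q × ℝ => v z.1 z.2) (K ×ˢ Icc (-(m * ρ)) (m * ρ)) := by
    intro z hz
    have hlim : Tendsto (fun z' : Q × ℝ => L * ‖z' - z‖) (𝓝[K ×ˢ Icc (-(m * ρ)) (m * ρ)] z)
        (𝓝 0) := by
      have : Continuous (fun z' : Q × ℝ => L * ‖z' - z‖) := by fun_prop
      have := this.continuousWithinAt (s := K ×ˢ Icc (-(m * ρ)) (m * ρ)) (x := z)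
      simpa [ContinuousWithinAt] using this
    rw [ContinuousWithinAt, tendsto_iff_norm_sub_tendsto_zero]
    refine squeeze_zero' (Eventually.of_forall fun _ => norm_nonneg _) ?_ hlim
    filter_upwards [self_mem_nhdsWithin] with z' hz'
    exact hL z' hz' z hz
  refine ⟨v, fun q hq y hy => ⟨(hv q hq y hy).1, ?_, (hv q hq y hy).2⟩, ?_⟩
  · have := habs q hq _ (hv q hq y hy).1 0 h0mem
    rwa [hzero q hq, (hv q hq y hy).2, sub_zero, sub_zero] at this
  -- bootstrap: the derivative of `v` is a smooth expression in the derivative of `u` at `v`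
  set S := K ×ˢ Icc (-ρ) ρ with hS
  set T := K ×ˢ Icc (-(m * ρ)) (m * ρ) with hT
  set U : Q × ℝ → ℝ := fun z => u z.1 z.2 with hU
  set DU := fderivWithin ℝ U S with hDU
  set Θ : Q × ℝ → Q × ℝ := fun z => (z.1, v z.1 z.2) with hΘ
  have hΘmaps : MapsTo Θ T S := fun z hz => ⟨hz.1, (hv z.1 hz.1 z.2 hz.2).1⟩
  have hΘcont : ContinuousOn Θ T := continuousOn_fst.prodMk hvcont
  have hUdiff : ∀ z ∈ S, HasFDerivWithinAt U (DU z) S z := fun z hz =>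
    ((hsm.differentiableOn (by
      have : n ≠ 0 := by omega
      exact_mod_cast this)) z hz).hasFDerivWithinAt
  have hpos : ∀ z ∈ S, m ≤ DU z (0, 1) := by
    intro z hz
    have h1 : HasDerivWithinAt (fun x : ℝ => U (z.1, x)) (DU z (0, 1)) (Icc (-ρ) ρ) z.2 := by
      have hl : HasDerivWithinAt (fun x : ℝ => (z.1, x)) ((0 : Q), (1 : ℝ)) (Icc (-ρ) ρ) z.2 :=
        (hasDerivWithinAt_const _ _ _).prodMk (hasDerivWithinAt_id _ _)
      exact (hUdiff z hz).comp_hasDerivWithinAt z.2 hl (fun x hx => (⟨hz.1, hx⟩ : (z.1, x) ∈ S))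
    exact le_deriv_of_expanding (by linarith) h1 hz.2 (hexp z.1 hz.1)
  set V' : Q × ℝ → Q × ℝ →L[ℝ] ℝ := fun w => (DU w (0, 1))⁻¹ •
    (ContinuousLinearMap.snd ℝ Q ℝ - ((DU w).comp (ContinuousLinearMap.inl ℝ Q ℝ)).comp
      (ContinuousLinearMap.fst ℝ Q ℝ)) with hV'
  have hvder : ∀ z ∈ T, HasFDerivWithinAt (fun z : Q × ℝ => v z.1 z.2) (V' (Θ z)) T z := by
    intro z hz
    have hΨ : HasFDerivWithinAt (fun w : Q × ℝ => (w.1, U w))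
        ((ContinuousLinearMap.fst ℝ Q ℝ).prod (DU (Θ z))) S (Θ z) :=
      hasFDerivWithinAt_fst.prodMk (hUdiff _ (hΘmaps hz))
    have hne : DU (Θ z) (0, 1) ≠ 0 := (hm.trans_le (hpos _ (hΘmaps hz))).ne'
    have hinv : Function.LeftInverse ((ContinuousLinearMap.fst ℝ Q ℝ).prod (V' (Θ z)))
        ((ContinuousLinearMap.fst ℝ Q ℝ).prod (DU (Θ z))) := by
      rintro ⟨a, x⟩
      have hsplit : DU (Θ z) (a, x) = DU (Θ z) (a, 0) + x * DU (Θ z) (0, 1) := by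
        rw [← smul_eq_mul, ← map_smul, ← map_add]; simp
      simp only [hV', ContinuousLinearMap.prod_apply, ContinuousLinearMap.coe_fst',
        _root_.smul_apply, _root_.sub_apply,
        ContinuousLinearMap.coe_snd', ContinuousLinearMap.comp_apply,
        ContinuousLinearMap.inl_apply, smul_eq_mul, Prod.mk.injEq, true_and]
      rw [hsplit]
      field_simp
      ring
    have hΘder : HasFDerivWithinAt Θ ((ContinuousLinearMap.fst ℝ Q ℝ).prod (V' (Θ z))) T z := by
      refine hΨ.of_comp_of_leftInverse ?_ (hasFDerivWithinAt_id z T) ?_ hinv hz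
      · exact (hΘcont z hz).tendsto_nhdsWithin hΘmaps
      · filter_upwards [self_mem_nhdsWithin] with w hw
        simp only [hΘ, hU, Function.comp_apply, (hv w.1 hw.1 w.2 hw.2).2, id]
    exact hΘder.snd
  have key : ∀ j : ℕ, j ≤ n → ContDiffOn ℝ j (fun z : Q × ℝ => v z.1 z.2) T := by
    intro j
    induction j with
    | zero => intro _; simpa [contDiffOn_zero] using hvcont
    | succ j ih =>
      intro hj
      push_cast
      rw [contDiffOn_succ_iff_hasFDerivWithinAt_of_uniqueDiffOn hutgt]
      refine ⟨by simp, fun z => V' (Θ z), ?_, hvder⟩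
      have hDUsm : ContDiffOn ℝ j DU S := hsm.fderivWithin hudom (by exact_mod_cast hj)
      have hV'sm : ContDiffOn ℝ j V' S := by
        refine ContDiffOn.smul (ContDiffOn.inv (hDUsm.clm_apply contDiffOn_const)
          (fun z hz => (hm.trans_le (hpos z hz)).ne')) ?_
        exact contDiffOn_const.sub ((hDUsm.clm_comp contDiffOn_const).clm_comp contDiffOn_const)
      exact hV'sm.comp (contDiffOn_fst.prodMk (ih (by omega))) hΘmaps
  exact key n le_rfl

/-! ### Boxes and the regularity of the time-`h` map -/

theorem isCompact_box (h₀ ε₀ α₀ : ℝ) : IsCompact (box h₀ ε₀ α₀) :=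
  isCompact_Icc.prod (isCompact_Icc.prod isCompact_Icc)

theorem convex_box (h₀ ε₀ α₀ : ℝ) : Convex ℝ (box h₀ ε₀ α₀) :=
  (convex_Icc _ _).prod ((convex_Icc _ _).prod (convex_Icc _ _))

theorem uniqueDiffOn_box {h₀ ε₀ α₀ : ℝ} (hh : 0 < h₀) (hε : 0 < ε₀) (hα : 0 < α₀) :
    UniqueDiffOn ℝ (box h₀ ε₀ α₀) :=
  (uniqueDiffOn_Icc hh).prod ((uniqueDiffOn_Icc (by linarith)).prod
    (uniqueDiffOn_Icc (by linarith)))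

theorem mem_box {h₀ ε₀ α₀ h x α : ℝ} :
    (h, x, α) ∈ box h₀ ε₀ α₀ ↔ h ∈ Icc 0 h₀ ∧ x ∈ Icc (-ε₀) ε₀ ∧ α ∈ Icc (-α₀) α₀ := by
  simp only [box, mem_prod]

theorem box_mono {h₀ ε₀ α₀ h₁ ε₁ α₁ : ℝ} (hh : h₁ ≤ h₀) (hε : ε₁ ≤ ε₀) (hα : α₁ ≤ α₀) :
    box h₁ ε₁ α₁ ⊆ box h₀ ε₀ α₀ :=
  prod_mono (Icc_subset_Icc_right hh)
    (prod_mono (Icc_subset_Icc (by linarith) hε) (Icc_subset_Icc (by linarith) hα))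

theorem exists_bound_box {h₀ ε₀ α₀ : ℝ} {g : ℝ × ℝ × ℝ → ℝ} (hg : ContinuousOn g (box h₀ ε₀ α₀)) :
    ∃ C : ℝ, 0 ≤ C ∧ ∀ q ∈ box h₀ ε₀ α₀, |g q| ≤ C := by
  obtain ⟨C, hC⟩ := (isCompact_box h₀ ε₀ α₀).exists_bound_of_continuousOn hg
  exact ⟨max C 0, le_max_right _ _, fun q hq => (hC q hq).trans (le_max_left _ _)⟩

/-- The primitive `∫₀ᵗ u (τ, x, α) dτ` in the time variable, written over a fixed interval. -/
noncomputable def timeInt (u : ℝ × ℝ × ℝ → ℝ) (q : ℝ × ℝ × ℝ) : ℝ :=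
  q.1 * ∫ s in (0:ℝ)..1, u (s * q.1, q.2)

theorem timeScale_mem {H ε A s : ℝ} {q : ℝ × ℝ × ℝ} (hs : s ∈ Icc (0:ℝ) 1) (hq : q ∈ box H ε A) :
    (s * q.1, q.2) ∈ box H ε A := by
  refine ⟨⟨mul_nonneg hs.1 hq.1.1, ?_⟩, hq.2⟩
  have := hq.1.1
  have := hq.1.2
  show s * q.1 ≤ H
  nlinarith [hs.1, hs.2]

theorem contDiffOn_timeInt {H ε A : ℝ} (hH : 0 < H) (hε : 0 < ε) (hA : 0 < A) {n : ℕ}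
    {u : ℝ × ℝ × ℝ → ℝ} (hu : ContDiffOn ℝ n u (box H ε A)) :
    ContDiffOn ℝ n (timeInt u) (box H ε A) := by
  refine contDiffOn_fst.mul (contDiffOn_paramIntegral (isCompact_box _ _ _) (convex_box _ _ _)
    (uniqueDiffOn_box hH hε hA) (G := fun z : ℝ × ℝ × ℝ × ℝ => u (z.1 * z.2.1, z.2.2)) ?_)
  exact hu.comp (ContDiff.contDiffOn (by fun_prop)) (fun z hz => timeScale_mem hz.1 hz.2)

theorem continuousOn_timeInt {H ε A : ℝ} (hH : 0 < H) (hε : 0 < ε) (hA : 0 < A)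
    {u : ℝ × ℝ × ℝ → ℝ} (hu : ContinuousOn u (box H ε A)) :
    ContinuousOn (timeInt u) (box H ε A) := by
  have := contDiffOn_timeInt hH hε hA (n := 0) (contDiffOn_zero.2 hu)
  exact contDiffOn_zero.1 this

theorem timeInt_zero (u : ℝ × ℝ × ℝ → ℝ) (p : ℝ × ℝ) : timeInt u (0, p) = 0 := by
  simp [timeInt]

theorem hasDerivWithinAt_timeInt {H ε A : ℝ} (hH : 0 < H)
    {u : ℝ × ℝ × ℝ → ℝ} (hu : ContinuousOn u (box H ε A)) {p : ℝ × ℝ}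
    (hp : p ∈ Icc (-ε) ε ×ˢ Icc (-A) A) {t : ℝ} (ht : t ∈ Icc 0 H) :
    HasDerivWithinAt (fun t => timeInt u (t, p)) (u (t, p)) (Icc 0 H) t := by
  have hc : ContinuousOn (fun t => u (t, p)) (Icc 0 H) :=
    hu.comp (by fun_prop) (fun t ht => ⟨ht, hp⟩)
  set v := IccExtend hH.le ((Icc 0 H).domRestrict fun t => u (t, p)) with hv
  have hvc : Continuous v := (continuousOn_iff_continuous_domRestrict.1 hc).Icc_extend'
  have hvu : ∀ t ∈ Icc 0 H, v t = u (t, p) := fun t ht => by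
    rw [hv, IccExtend_of_mem _ _ ht]; rfl
  have h1 : HasDerivAt (fun t => ∫ s in (0:ℝ)..t, v s) (v t) t :=
    intervalIntegral.integral_hasDerivAt_right (hvc.intervalIntegrable _ _)
      hvc.aestronglyMeasurable.stronglyMeasurableAtFilter hvc.continuousAt
  rw [← hvu t ht]
  refine (h1.hasDerivWithinAt (s := Icc 0 H)).congr_of_mem ?_ ht
  intro r hr
  have h2 := intervalIntegral.mul_integral_comp_mul_right (f := v) (a := 0) (b := 1) r
  simp only [zero_mul, one_mul] at h2
  rw [← h2, timeInt]
  congr 1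
  refine intervalIntegral.integral_congr (fun s hs => ?_)
  rw [uIcc_of_le zero_le_one] at hs
  refine (hvu _ ⟨mul_nonneg hs.1 hr.1, ?_⟩).symm
  nlinarith [hs.1, hs.2, hr.1, hr.2]

/-- Variation of constants for a scalar linear equation on `[0, H]`. -/
theorem linear_ode_solution {H : ℝ} {w a b I K : ℝ → ℝ}
    (hw : ∀ t ∈ Icc 0 H, HasDerivWithinAt w (a t * w t + b t) (Icc 0 H) t)
    (hI : ∀ t ∈ Icc 0 H, HasDerivWithinAt I (a t) (Icc 0 H) t)
    (hK : ∀ t ∈ Icc 0 H, HasDerivWithinAt K (Real.exp (-I t) * b t) (Icc 0 H) t)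
    (hI0 : I 0 = 0) (hK0 : K 0 = 0) {t : ℝ} (ht : t ∈ Icc 0 H) :
    w t = Real.exp (I t) * (w 0 + K t) := by
  have hder : ∀ t ∈ Icc 0 H,
      HasDerivWithinAt (fun t => Real.exp (-I t) * w t - K t) 0 (Icc 0 H) t := by
    intro t ht
    have := (((hI t ht).neg.exp).mul (hw t ht)).sub (hK t ht)
    refine HasDerivWithinAt.congr_deriv this ?_
    simp only [Pi.neg_apply]
    ring
  have := constant_of_has_deriv_right_zero (f := fun t => Real.exp (-I t) * w t - K t)
    (a := 0) (b := H) (fun t ht => (hder t ht).continuousWithinAt)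
    (fun t ht => ((hder t (Ico_subset_Icc_self ht)).mono_of_mem_nhdsWithin
      (Icc_mem_nhdsGE_of_mem ht))) t ht
  simp only [hI0, hK0, neg_zero, Real.exp_zero, one_mul, sub_zero] at this
  have h2 : w 0 + K t = Real.exp (-I t) * w t := by linarith
  rw [h2, ← mul_assoc, ← Real.exp_add]
  simp

/-- A solution that starts close to an equilibrium stays in the unit ball. -/
theorem abs_solution_le {H L ε : ℝ} {k u : ℝ → ℝ}
    (hu : ∀ t ∈ Icc 0 H, HasDerivWithinAt u (k (u t)) (Icc 0 H) t)
    (hk : ∀ y, |y| ≤ 1 → |k y| ≤ L * |y|) (hL : 0 ≤ L) (hε : 0 < ε) (hu0 : |u 0| ≤ ε)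
    (hsmall : ε * Real.exp ((L + 1) * H) ≤ 1) {t : ℝ} (ht : t ∈ Icc 0 H) :
    |u t| ≤ ε * Real.exp ((L + 1) * t) := by
  refine image_norm_le_of_norm_deriv_right_lt_deriv_boundary (f' := fun t => k (u t))
    (a := 0) (b := H) (B := fun t => ε * Real.exp ((L + 1) * t))
    (B' := fun t => ε * (Real.exp ((L + 1) * t) * (L + 1)))
    (fun t ht => (hu t ht).continuousWithinAt)
    (fun t ht => (hu t (Ico_subset_Icc_self ht)).mono_of_mem_nhdsWithin (Icc_mem_nhdsGE_of_mem ht))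
    (by simpa using hu0) ?_ ?_ ht
  · intro x
    have : HasDerivAt (fun t : ℝ => (L + 1) * t) (L + 1) x := by
      simpa using (hasDerivAt_id x).const_mul (L + 1)
    exact (this.exp).const_mul ε
  · intro x hx hB
    rw [Real.norm_eq_abs] at hB ⊢
    have hle : |u x| ≤ 1 := by
      rw [hB]
      refine le_trans ?_ hsmall
      gcongr
      exact hx.2.le
    have h1 := hk _ hle
    rw [hB] at h1
    have : 0 < ε * Real.exp ((L + 1) * x) := by positivity
    nlinarith

theorem sub_eq_mul_integral {k k' : ℝ → ℝ} (hk : ∀ y, HasDerivAt k (k' y) y) (hk' : Continuous k')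
    (u v : ℝ) : k u - k v = (∫ s in (0:ℝ)..1, k' (v + s * (u - v))) * (u - v) := by
  have := intervalIntegral.integral_unitInterval_deriv_eq_sub (f := k) (f' := k') (z₀ := v)
    (z₁ := u - v) (by fun_prop) (fun t _ => hk _)
  simp only [smul_eq_mul, add_sub_cancel] at this
  rw [← this, mul_comm]

/-- Continuous coefficients times linear increments are differentiable at the base point. -/
theorem hasFDerivWithinAt_of_eq_mul {E : Type} [NormedAddCommGroup E] [NormedSpace ℝ E]
    {S : Set E} {q₀ : E} {m : E → ℝ} (hm : ContinuousWithinAt m S q₀) (l : E →L[ℝ] ℝ) :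
    HasFDerivWithinAt (fun q => m q * l (q - q₀)) (m q₀ • l) S q₀ := by
  rw [hasFDerivWithinAt_iff_isLittleO]
  have h1 : (fun q => m q - m q₀) =o[𝓝[S] q₀] (fun _ => (1:ℝ)) := by
    rw [Asymptotics.isLittleO_one_iff]
    have : Tendsto (fun q => m q - m q₀) (𝓝[S] q₀) (𝓝 (m q₀ - m q₀)) :=
      Tendsto.sub_const hm (m q₀)
    simpa using this
  have h2 : (fun q => l (q - q₀)) =O[𝓝[S] q₀] (fun q => q - q₀) := l.isBigO_sub _ _
  have h3 := h1.mul_isBigO h2.norm_right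
  simp only [one_mul] at h3
  refine (h3.congr_left (f₂ := fun q => m q * l (q - q₀) - m q₀ * l (q₀ - q₀) -
    (m q₀ • l) (q - q₀)) ?_).of_norm_right
  intro q
  simp
  ring

/-- The time-`h` map of a `C^m` vector field with equilibrium `0` is of class `C^m` in `(h, x, α)`
up to the boundary of a small box, where it is bounded by `1` and by a multiple of `|x|`. The
difference of two solutions solves a scalar linear equation whose coefficients are Hadamard
quotients of `f`; variation of constants expresses the first derivatives of the time-`h` map through
the map itself, which gains one order of differentiability after another. -/
theorem contDiffOn_timeMap {m : ℕ} (hm : 1 ≤ m) {f : ℝ → ℝ → ℝ} {Φ : ℝ → ℝ → ℝ → ℝ} {H E A : ℝ}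
    (hH : 0 < H) (hE : 0 < E) (hA : 0 < A) (hf : ContDiff ℝ m (fun q : ℝ × ℝ => f q.1 q.2))
    (hf0 : ∀ α ∈ Icc (-A) A, f 0 α = 0) (hΦ : IsTimeMap f Φ H E A) :
    ∃ ε ∈ Ioc 0 E, ContDiffOn ℝ m (fun q : ℝ × ℝ × ℝ => Φ q.1 q.2.1 q.2.2) (box H ε A) ∧
      (∀ q ∈ box H ε A, |Φ q.1 q.2.1 q.2.2| ≤ 1) ∧
      ∃ C : ℝ, 0 ≤ C ∧ ∀ q ∈ box H ε A, |Φ q.1 q.2.1 q.2.2| ≤ C * |q.2.1| := by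
  set fu : ℝ × ℝ → ℝ := fun q => f q.1 q.2 with hfu
  have hdiff : Differentiable ℝ fu := hf.differentiable (by
    have : m ≠ 0 := by omega
    exact_mod_cast this)
  set fx : ℝ × ℝ → ℝ := fun q => fderiv ℝ fu q (1, 0) with hfx
  set fa : ℝ × ℝ → ℝ := fun q => fderiv ℝ fu q (0, 1) with hfa
  have hfd : ContDiff ℝ (m - 1 : ℕ) (fderiv ℝ fu) := hf.fderiv_right (by
    have : m - 1 + 1 ≤ m := by omega
    exact_mod_cast this)
  have hfxs : ContDiff ℝ (m - 1 : ℕ) fx := hfd.clm_apply contDiff_const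
  have hfas : ContDiff ℝ (m - 1 : ℕ) fa := hfd.clm_apply contDiff_const
  have hfxd : ∀ α y, HasDerivAt (fun x => f x α) (fx (y, α)) y := fun α y =>
    (hdiff (y, α)).hasFDerivAt.comp_hasDerivAt (f := fun x => (x, α)) y
      ((hasDerivAt_id y).prodMk (hasDerivAt_const y α))
  have hfad : ∀ x y, HasDerivAt (fun α => f x α) (fa (x, y)) y := fun x y =>
    (hdiff (x, y)).hasFDerivAt.comp_hasDerivAt (f := fun α => (x, α)) y
      ((hasDerivAt_const y x).prodMk (hasDerivAt_id y))
  -- the Hadamard quotients of `f` in the state and in the parameter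
  set a : ℝ × ℝ × ℝ → ℝ := fun z => ∫ s in (0:ℝ)..1, fx (z.2.1 + s * (z.1 - z.2.1), z.2.2) with ha
  set b : ℝ × ℝ × ℝ → ℝ := fun z => ∫ s in (0:ℝ)..1, fa (z.1, z.2.2 + s * (z.2.1 - z.2.2)) with hb
  have hac : Continuous a :=
    intervalIntegral.continuous_parametric_intervalIntegral_of_continuous'
      (f := fun (z : ℝ × ℝ × ℝ) (s : ℝ) => fx (z.2.1 + s * (z.1 - z.2.1), z.2.2))
      (by unfold Function.uncurry; fun_prop) 0 1
  have hbc : Continuous b :=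
    intervalIntegral.continuous_parametric_intervalIntegral_of_continuous'
      (f := fun (z : ℝ × ℝ × ℝ) (s : ℝ) => fa (z.1, z.2.2 + s * (z.2.1 - z.2.2)))
      (by unfold Function.uncurry; fun_prop) 0 1
  have haeq : ∀ u v α, f u α - f v α = a (u, v, α) * (u - v) := fun u v α =>
    sub_eq_mul_integral (hfxd α) (by fun_prop) u v
  have hbeq : ∀ x α α', f x α - f x α' = b (x, α, α') * (α - α') := fun x α α' =>
    sub_eq_mul_integral (hfad x) (by fun_prop) α α'
  have haa : ∀ u α, a (u, u, α) = fx (u, α) := fun u α => by simp [ha]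
  have hbb : ∀ x α, b (x, α, α) = fa (x, α) := fun x α => by simp [hb]
  -- bounds on the compact region visited by the solutions
  set Q : Set (ℝ × ℝ × ℝ) := Icc (-1) 1 ×ˢ (Icc (-1) 1 ×ˢ Icc (-A) A) with hQ
  set Q' : Set (ℝ × ℝ × ℝ) := Icc (-1) 1 ×ˢ (Icc (-A) A ×ˢ Icc (-A) A) with hQ'
  obtain ⟨L₁, hL₁⟩ := (isCompact_Icc.prod (isCompact_Icc.prod isCompact_Icc) :
    IsCompact Q).exists_bound_of_continuousOn hac.continuousOn
  obtain ⟨L₂, hL₂⟩ := (isCompact_Icc.prod (isCompact_Icc.prod isCompact_Icc) :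
    IsCompact Q').exists_bound_of_continuousOn hbc.continuousOn
  set L := max (max L₁ L₂) 0 with hLdef
  have hL0 : 0 ≤ L := le_max_right _ _
  have haL : ∀ u v α, |u| ≤ 1 → |v| ≤ 1 → α ∈ Icc (-A) A → |a (u, v, α)| ≤ L :=
    fun u v α hu hv hα => (hL₁ (u, v, α) ⟨abs_le.1 hu, abs_le.1 hv, hα⟩).trans
      ((le_max_left _ _).trans (le_max_left _ _))
  have hbL : ∀ u α α', |u| ≤ 1 → α ∈ Icc (-A) A → α' ∈ Icc (-A) A → |b (u, α, α')| ≤ L :=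
    fun u α α' hu hα hα' => (hL₂ (u, α, α') ⟨abs_le.1 hu, hα, hα'⟩).trans
      ((le_max_right _ _).trans (le_max_left _ _))
  -- solutions that start in `[-ε, ε]` stay in `[-1, 1]` up to time `H`
  set ε := min E (Real.exp (-((L + 1) * H))) with hεdef
  have hε : 0 < ε := lt_min hE (Real.exp_pos _)
  have hεE : ε ≤ E := min_le_left _ _
  have hεsm : ε * Real.exp ((L + 1) * H) ≤ 1 := by
    calc ε * Real.exp ((L + 1) * H) ≤ Real.exp (-((L + 1) * H)) * Real.exp ((L + 1) * H) := by
          gcongr; exact min_le_right _ _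
      _ = 1 := by rw [← Real.exp_add]; simp
  have hsub : Icc (-ε) ε ⊆ Icc (-E) E := Icc_subset_Icc (by linarith) hεE
  have hode : ∀ x ∈ Icc (-ε) ε, ∀ α ∈ Icc (-A) A, Φ 0 x α = x ∧ ∀ t ∈ Icc 0 H,
      HasDerivWithinAt (fun t => Φ t x α) (f (Φ t x α) α) (Icc 0 H) t :=
    fun x hx α hα => hΦ x (hsub hx) α hα
  have hΦ1 : ∀ t ∈ Icc 0 H, ∀ x ∈ Icc (-ε) ε, ∀ α ∈ Icc (-A) A, |Φ t x α| ≤ 1 := by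
    intro t ht x hx α hα
    refine (abs_solution_le (k := fun y => f y α) (hode x hx α hα).2 (L := L) ?_ hL0 hε ?_
      hεsm ht).trans (le_trans ?_ hεsm)
    · intro y hy
      have := haeq y 0 α
      rw [hf0 α hα, sub_zero, sub_zero] at this
      rw [this, abs_mul]
      gcongr
      exact haL y 0 α hy (by simp) hα
    · rw [(hode x hx α hα).1]; exact abs_le.2 hx
    · gcongr; exact ht.2
  -- the linear equation for the difference of two solutions
  have hwder : ∀ x ∈ Icc (-ε) ε, ∀ α ∈ Icc (-A) A, ∀ x' ∈ Icc (-ε) ε, ∀ α' ∈ Icc (-A) A,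
      ∀ t ∈ Icc 0 H, HasDerivWithinAt (fun t => Φ t x α - Φ t x' α')
        (a (Φ t x α, Φ t x' α', α) * (Φ t x α - Φ t x' α') +
          b (Φ t x' α', α, α') * (α - α')) (Icc 0 H) t := by
    intro x hx α hα x' hx' α' hα' t ht
    have := ((hode x hx α hα).2 t ht).sub ((hode x' hx' α' hα').2 t ht)
    refine HasDerivWithinAt.congr_deriv this ?_
    rw [← haeq, ← hbeq]; ring
  have hlip : ∃ C : ℝ, 0 ≤ C ∧ ∀ t ∈ Icc 0 H, ∀ x ∈ Icc (-ε) ε, ∀ α ∈ Icc (-A) A,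
      ∀ x' ∈ Icc (-ε) ε, ∀ α' ∈ Icc (-A) A,
      |Φ t x α - Φ t x' α'| ≤ C * (|x - x'| + |α - α'|) := by
    refine ⟨Real.exp ((L + 1) * H), (Real.exp_pos _).le, fun t ht x hx α hα x' hx' α' hα' => ?_⟩
    have h1 := norm_le_gronwallBound_of_norm_deriv_right_le (a := 0) (b := H)
      (δ := |x - x'|) (K := L + 1) (ε := L * |α - α'|)
      (fun t ht => (hwder x hx α hα x' hx' α' hα' t ht).continuousWithinAt)
      (fun t ht => (hwder x hx α hα x' hx' α' hα' t (Ico_subset_Icc_self ht)).mono_of_mem_nhdsWithin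
        (Icc_mem_nhdsGE_of_mem ht)) ?_ ?_ t ht
    · rw [Real.norm_eq_abs, gronwallBound_of_K_ne_0 (by positivity), sub_zero] at h1
      refine h1.trans ?_
      have h2 : Real.exp ((L + 1) * t) ≤ Real.exp ((L + 1) * H) := by
        gcongr; exact ht.2
      have h3 : L * |α - α'| / (L + 1) ≤ |α - α'| := by
        rw [div_le_iff₀ (by positivity)]
        nlinarith [abs_nonneg (α - α')]
      have h4 : 1 ≤ Real.exp ((L + 1) * t) := Real.one_le_exp (mul_nonneg (by positivity) ht.1)
      have h5 : L * |α - α'| / (L + 1) * (Real.exp ((L + 1) * t) - 1) ≤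
          |α - α'| * Real.exp ((L + 1) * H) := by
        apply mul_le_mul h3 (by linarith) (by linarith) (abs_nonneg _)
      nlinarith [mul_le_mul_of_nonneg_left h2 (abs_nonneg (x - x'))]
    · rw [(hode x hx α hα).1, (hode x' hx' α' hα').1, Real.norm_eq_abs]
    · intro t ht
      have ht' := Ico_subset_Icc_self ht
      rw [Real.norm_eq_abs, Real.norm_eq_abs]
      refine (abs_add_le _ _).trans ?_
      rw [abs_mul, abs_mul]
      have h1 := haL _ _ α (hΦ1 t ht' x hx α hα) (hΦ1 t ht' x' hx' α' hα') hα
      have h2 := hbL _ α α' (hΦ1 t ht' x' hx' α' hα') hα hα'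
      gcongr
      linarith
  obtain ⟨C, hC0, hC⟩ := hlip
  set D := box H ε A with hD
  set Φu : ℝ × ℝ × ℝ → ℝ := fun q => Φ q.1 q.2.1 q.2.2 with hΦu
  have hΦcont : ContinuousOn Φu D := by
    intro q hq
    rw [ContinuousWithinAt, tendsto_iff_norm_sub_tendsto_zero]
    have hlim : Tendsto (fun z : ℝ × ℝ × ℝ => C * (|z.2.1 - q.2.1| + |z.2.2 - q.2.2|) +
        |Φ z.1 q.2.1 q.2.2 - Φ q.1 q.2.1 q.2.2|) (𝓝[D] q) (𝓝 0) := by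
      have h1 : ContinuousOn (fun t => Φ t q.2.1 q.2.2) (Icc 0 H) := fun t ht =>
        ((hode _ hq.2.1 _ hq.2.2).2 t ht).continuousWithinAt
      have h2 : ContinuousOn (fun z : ℝ × ℝ × ℝ => Φ z.1 q.2.1 q.2.2) D :=
        h1.comp (f := fun z : ℝ × ℝ × ℝ => z.1) (by fun_prop) (fun z hz => hz.1)
      have h3 : ContinuousOn (fun z : ℝ × ℝ × ℝ => C * (|z.2.1 - q.2.1| + |z.2.2 - q.2.2|) +
        |Φ z.1 q.2.1 q.2.2 - Φ q.1 q.2.1 q.2.2|) D :=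
        (Continuous.continuousOn (by fun_prop)).add (h2.sub continuousOn_const).abs
      have := h3 q hq
      simpa [ContinuousWithinAt] using this
    refine squeeze_zero' (Eventually.of_forall fun _ => norm_nonneg _) ?_ hlim
    filter_upwards [self_mem_nhdsWithin] with z hz
    have h1 := hC z.1 hz.1 _ hz.2.1 _ hz.2.2 _ hq.2.1 _ hq.2.2
    rw [Real.norm_eq_abs]
    exact (abs_sub_le _ (Φ z.1 q.2.1 q.2.2) _).trans (by linarith)
  -- the first derivatives of the flow
  set m₁ : ℝ × ℝ × ℝ → ℝ := fun q => Real.exp (timeInt (fun q => fx (Φu q, q.2.2)) q) with hm₁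
  set m₂ : ℝ × ℝ × ℝ → ℝ := fun q => Real.exp (timeInt (fun q => fx (Φu q, q.2.2)) q) *
    timeInt (fun q => Real.exp (-timeInt (fun q => fx (Φu q, q.2.2)) q) * fa (Φu q, q.2.2)) q
    with hm₂
  set D' : ℝ × ℝ × ℝ → ℝ × ℝ × ℝ →L[ℝ] ℝ := fun q =>
    fu (Φu q, q.2.2) • ContinuousLinearMap.fst ℝ ℝ (ℝ × ℝ) +
    (m₁ q • (ContinuousLinearMap.fst ℝ ℝ ℝ).comp (ContinuousLinearMap.snd ℝ ℝ (ℝ × ℝ)) +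
    m₂ q • (ContinuousLinearMap.snd ℝ ℝ ℝ).comp (ContinuousLinearMap.snd ℝ ℝ (ℝ × ℝ))) with hD'
  have hfder : ∀ q ∈ D, HasFDerivWithinAt Φu (D' q) D q := by
    intro q hq
    set ua : ℝ × ℝ × ℝ → ℝ := fun z => a (Φu z, Φ z.1 q.2.1 q.2.2, z.2.2) with hua
    set ub : ℝ × ℝ × ℝ → ℝ := fun z => Real.exp (-timeInt ua z) *
      b (Φ z.1 q.2.1 q.2.2, z.2.2, q.2.2) with hub
    have hΦq : ContinuousOn (fun z : ℝ × ℝ × ℝ => Φ z.1 q.2.1 q.2.2) D := by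
      have h1 : ContinuousOn (fun t => Φ t q.2.1 q.2.2) (Icc 0 H) := fun t ht =>
        ((hode _ hq.2.1 _ hq.2.2).2 t ht).continuousWithinAt
      exact h1.comp (f := fun z : ℝ × ℝ × ℝ => z.1) (by fun_prop) (fun z hz => hz.1)
    have huac : ContinuousOn ua D := hac.comp_continuousOn
      (hΦcont.prodMk (hΦq.prodMk (Continuous.continuousOn (by fun_prop))))
    have hIac : ContinuousOn (timeInt ua) D := continuousOn_timeInt hH hε hA huac
    have hubc : ContinuousOn ub D := by
      have : ContinuousOn (fun z : ℝ × ℝ × ℝ => b (Φ z.1 q.2.1 q.2.2, z.2.2, q.2.2)) D :=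
        hbc.comp_continuousOn (hΦq.prodMk (Continuous.continuousOn (by fun_prop)))
      exact (hIac.neg.rexp).mul this
    have hIbc : ContinuousOn (timeInt ub) D := continuousOn_timeInt hH hε hA hubc
    -- variation of constants; the derivatives of the flow are the coefficients at `z = q`
    have hformula : ∀ z ∈ D, Φu z = Φ z.1 q.2.1 q.2.2 +
        (Real.exp (timeInt ua z) * (z.2.1 - q.2.1) +
          Real.exp (timeInt ua z) * timeInt ub z * (z.2.2 - q.2.2)) := by
      rintro ⟨t, x, α⟩ hz
      have h1 := linear_ode_solution (H := H) (w := fun t => Φ t x α - Φ t q.2.1 q.2.2)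
        (a := fun t => ua (t, x, α)) (b := fun t => b (Φ t q.2.1 q.2.2, α, q.2.2) * (α - q.2.2))
        (I := fun t => timeInt ua (t, x, α)) (K := fun t => timeInt ub (t, x, α) * (α - q.2.2))
        (hwder x hz.2.1 α hz.2.2 _ hq.2.1 _ hq.2.2)
        (fun t ht => hasDerivWithinAt_timeInt hH huac hz.2 ht)
        (fun t ht => by
          have := (hasDerivWithinAt_timeInt hH hubc hz.2 ht).mul_const (α - q.2.2)
          refine HasDerivWithinAt.congr_deriv this ?_
          simp only [hub]; ring)
        (timeInt_zero _ _) (by simp [timeInt_zero]) hz.1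
      simp only [(hode x hz.2.1 α hz.2.2).1, (hode _ hq.2.1 _ hq.2.2).1] at h1
      simp only [hΦu]
      linarith
    have hd0 : HasFDerivWithinAt (fun z : ℝ × ℝ × ℝ => Φ z.1 q.2.1 q.2.2)
        (fu (Φu q, q.2.2) • ContinuousLinearMap.fst ℝ ℝ (ℝ × ℝ)) D q := by
      have h1 := (hode _ hq.2.1 _ hq.2.2).2 q.1 hq.1
      exact h1.comp_hasFDerivWithinAt (f := fun z : ℝ × ℝ × ℝ => z.1) q hasFDerivWithinAt_fst
        (fun z hz => hz.1)
    have hd1 := hasFDerivWithinAt_of_eq_mul (hIac.rexp q hq)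
      ((ContinuousLinearMap.fst ℝ ℝ ℝ).comp (ContinuousLinearMap.snd ℝ ℝ (ℝ × ℝ)))
    have hd2 := hasFDerivWithinAt_of_eq_mul ((hIac.rexp.mul hIbc) q hq)
      ((ContinuousLinearMap.snd ℝ ℝ ℝ).comp (ContinuousLinearMap.snd ℝ ℝ (ℝ × ℝ)))
    have hd := hd0.add (hd1.add hd2)
    have hI1 : ∀ z : ℝ × ℝ × ℝ, z.2 = q.2 →
        timeInt ua z = timeInt (fun q => fx (Φu q, q.2.2)) z := by
      intro z hz
      simp only [timeInt, hua, hΦu, hz, haa]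
    have hI2 : timeInt ub q = timeInt (fun q => Real.exp (-timeInt (fun q => fx (Φu q, q.2.2)) q) *
        fa (Φu q, q.2.2)) q := by
      unfold timeInt
      congr 1
      refine intervalIntegral.integral_congr (fun s _ => ?_)
      simp only [hub]
      rw [hI1 (s * q.1, q.2) rfl, hbb]
      rfl
    have hval : D' q = fu (Φu q, q.2.2) • ContinuousLinearMap.fst ℝ ℝ (ℝ × ℝ) +
      (Real.exp (timeInt ua q) •
        (ContinuousLinearMap.fst ℝ ℝ ℝ).comp (ContinuousLinearMap.snd ℝ ℝ (ℝ × ℝ)) +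
      (Real.exp (timeInt ua q) * timeInt ub q) •
        (ContinuousLinearMap.snd ℝ ℝ ℝ).comp (ContinuousLinearMap.snd ℝ ℝ (ℝ × ℝ))) := by
      simp only [hD', hm₁, hm₂, hI1 q rfl, hI2]
    rw [hval]
    refine HasFDerivWithinAt.congr' hd (fun z hz => ?_) hq
    simp only [hformula z hz]
    simp
  -- bootstrap: the derivative of the flow is a smooth expression in the flow
  have key : ∀ j : ℕ, j ≤ m → ContDiffOn ℝ j Φu D := by
    intro j
    induction j with
    | zero => intro _; simpa [contDiffOn_zero] using hΦcont
    | succ j ih =>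
      intro hj
      push_cast
      rw [contDiffOn_succ_iff_hasFDerivWithinAt_of_uniqueDiffOn (uniqueDiffOn_box hH hε hA)]
      refine ⟨by simp, D', ?_, hfder⟩
      have hpair : ContDiffOn ℝ j (fun q : ℝ × ℝ × ℝ => (Φu q, q.2.2)) D :=
        (ih (by omega)).prodMk (ContDiff.contDiffOn (by fun_prop))
      have hle : ((j : ℕ) : WithTop ℕ∞) ≤ ((m - 1 : ℕ) : WithTop ℕ∞) := by
        have : j ≤ m - 1 := by omega
        exact_mod_cast this
      have h0 : ContDiffOn ℝ j (fun q => fu (Φu q, q.2.2)) D :=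
        (hf.of_le (by
          have : j ≤ m := by omega
          exact_mod_cast this)).comp_contDiffOn hpair
      have h1 : ContDiffOn ℝ j (fun q => fx (Φu q, q.2.2)) D :=
        (hfxs.of_le hle).comp_contDiffOn hpair
      have h2 : ContDiffOn ℝ j (fun q => fa (Φu q, q.2.2)) D :=
        (hfas.of_le hle).comp_contDiffOn hpair
      have h3 := contDiffOn_timeInt hH hε hA h1
      have h4 := contDiffOn_timeInt hH hε hA (h3.neg.exp.mul h2)
      exact (h0.smul contDiffOn_const).add ((h3.exp.smul contDiffOn_const).add
        ((h3.exp.mul h4).smul contDiffOn_const))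
  refine ⟨ε, ⟨hε, hεE⟩, key m le_rfl, fun q hq => hΦ1 _ hq.1 _ hq.2.1 _ hq.2.2, C, hC0,
    fun q hq => ?_⟩
  -- a solution that starts at the equilibrium is confined to `[-e, e]` for every `e > 0`
  have hzero : Φ q.1 0 q.2.2 = 0 := by
    have h0m : (0:ℝ) ∈ Icc (-ε) ε := ⟨by linarith, hε.le⟩
    by_contra hne
    have hpos : 0 < |Φ q.1 0 q.2.2| := abs_pos.2 hne
    set e := min ε (|Φ q.1 0 q.2.2| / (2 * Real.exp ((L + 1) * q.1))) with he
    have hepos : 0 < e := lt_min hε (by positivity)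
    have := abs_solution_le (k := fun y => f y q.2.2) (hode 0 h0m _ hq.2.2).2 (L := L)
      (fun y hy => by
        have := haeq y 0 q.2.2
        rw [hf0 _ hq.2.2, sub_zero, sub_zero] at this
        rw [this, abs_mul]
        gcongr
        exact haL y 0 _ hy (by simp) hq.2.2) hL0 hepos
      (by rw [(hode 0 h0m _ hq.2.2).1]; simpa using hepos.le)
      (le_trans (by gcongr; exact min_le_left _ _) hεsm) hq.1
    have h2 : e * Real.exp ((L + 1) * q.1) ≤ |Φ q.1 0 q.2.2| / 2 := by
      calc e * Real.exp ((L + 1) * q.1) ≤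
          |Φ q.1 0 q.2.2| / (2 * Real.exp ((L + 1) * q.1)) * Real.exp ((L + 1) * q.1) := by
            gcongr; exact min_le_right _ _
        _ = |Φ q.1 0 q.2.2| / 2 := by field_simp
    linarith
  have := hC q.1 hq.1 _ hq.2.1 _ hq.2.2 0 ⟨by linarith, hε.le⟩ _ hq.2.2
  simpa [hzero] using this

/-! ### Division by coordinates on a box and Taylor coefficients -/

theorem le_of_le_of_ne_zero {E : Type} [NormedAddCommGroup E] [NormedSpace ℝ E]
    {K : Set E} (hc : Convex ℝ K) (l : E →L[ℝ] ℝ) {q₁ : E} (hq₁ : q₁ ∈ K) (hl : l q₁ ≠ 0)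
    {u v : E → ℝ} (hu : ContinuousOn u K) (hv : ContinuousOn v K)
    (h : ∀ q ∈ K, l q ≠ 0 → u q ≤ v q) : ∀ q ∈ K, u q ≤ v q := by
  intro q hq
  have := eqOn_of_mul_eqOn hc l hq₁ hl (u := fun q => max (u q) (v q)) (v := v) (hu.sup hv) hv
    (fun q hq => by
      by_cases hlq : l q = 0
      · simp [hlq]
      · rw [max_eq_right (h q hq hlq)]) q hq
  rw [← this]
  exact le_max_left _ _

theorem eq_of_eq_of_ne_zero {E : Type} [NormedAddCommGroup E] [NormedSpace ℝ E]
    {K : Set E} (hc : Convex ℝ K) (l : E →L[ℝ] ℝ) {q₁ : E} (hq₁ : q₁ ∈ K) (hl : l q₁ ≠ 0)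
    {u v : E → ℝ} (hu : ContinuousOn u K) (hv : ContinuousOn v K)
    (h : ∀ q ∈ K, l q ≠ 0 → u q = v q) : ∀ q ∈ K, u q = v q :=
  eqOn_of_mul_eqOn hc l hq₁ hl hu hv fun q hq => by
    by_cases hlq : l q = 0
    · simp [hlq]
    · rw [h q hq hlq]

section Box
variable {H ε A : ℝ}

theorem eqOn_box_of_pos (hH : 0 < H) (hε : 0 < ε) (hA : 0 < A) {u v : ℝ × ℝ × ℝ → ℝ}
    (hu : ContinuousOn u (box H ε A)) (hv : ContinuousOn v (box H ε A))
    (h : ∀ q ∈ box H ε A, 0 < q.1 → u q = v q) : ∀ q ∈ box H ε A, u q = v q :=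
  eq_of_eq_of_ne_zero (convex_box _ _ _) (ContinuousLinearMap.fst ℝ ℝ (ℝ × ℝ)) (q₁ := (H, 0, 0))
    (mem_box.2 ⟨⟨hH.le, le_rfl⟩, ⟨by linarith, hε.le⟩, ⟨by linarith, hA.le⟩⟩) hH.ne' hu hv
    (fun q hq hne => h q hq (lt_of_le_of_ne hq.1.1 (Ne.symm hne)))

theorem exists_div_state (hH : 0 < H) (hε : 0 < ε) (hA : 0 < A) {n : ℕ} {g : ℝ × ℝ × ℝ → ℝ}
    (hg : ContDiffOn ℝ (n + 1 : ℕ) g (box H ε A))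
    (h0 : ∀ h ∈ Icc 0 H, ∀ α ∈ Icc (-A) A, g (h, 0, α) = 0) :
    ∃ g₁ : ℝ × ℝ × ℝ → ℝ, ContDiffOn ℝ n g₁ (box H ε A) ∧
      ∀ q ∈ box H ε A, g q = q.2.1 * g₁ q := by
  refine exists_eq_mul_of_eq_zero (isCompact_box _ _ _) (convex_box _ _ _)
    (uniqueDiffOn_box hH hε hA)
    ((ContinuousLinearMap.fst ℝ ℝ ℝ).comp (ContinuousLinearMap.snd ℝ ℝ (ℝ × ℝ))) (0, 1, 0) ?_ hg ?_
  · rintro ⟨h, x, α⟩ hq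
    rw [mem_box] at hq
    simpa [mem_box, hq.1, hq.2.2] using hε.le
  · rintro ⟨h, x, α⟩ hq
    rw [mem_box] at hq
    simpa using h0 h hq.1 α hq.2.2

theorem exists_div_step (hH : 0 < H) (hε : 0 < ε) (hA : 0 < A) {n : ℕ} {g : ℝ × ℝ × ℝ → ℝ}
    (hg : ContDiffOn ℝ (n + 1 : ℕ) g (box H ε A))
    (h0 : ∀ x ∈ Icc (-ε) ε, ∀ α ∈ Icc (-A) A, g (0, x, α) = 0) :
    ∃ g₁ : ℝ × ℝ × ℝ → ℝ, ContDiffOn ℝ n g₁ (box H ε A) ∧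
      ∀ q ∈ box H ε A, g q = q.1 * g₁ q := by
  refine exists_eq_mul_of_eq_zero (isCompact_box _ _ _) (convex_box _ _ _)
    (uniqueDiffOn_box hH hε hA) (ContinuousLinearMap.fst ℝ ℝ (ℝ × ℝ)) (1, 0, 0) ?_ hg ?_
  · rintro ⟨h, x, α⟩ hq
    rw [mem_box] at hq
    simpa [mem_box, hq.2.1, hq.2.2] using hH.le
  · rintro ⟨h, x, α⟩ hq
    rw [mem_box] at hq
    simpa using h0 x hq.2.1 α hq.2.2

theorem exists_div_param (hH : 0 < H) (hA : 0 < A) {n : ℕ} {g : ℝ → ℝ → ℝ}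
    (hg : ContDiffOn ℝ (n + 1 : ℕ) (fun q : ℝ × ℝ => g q.1 q.2) (Icc 0 H ×ˢ Icc (-A) A))
    (h0 : ∀ h ∈ Icc 0 H, g h 0 = 0) :
    ∃ g₁ : ℝ → ℝ → ℝ, ContDiffOn ℝ n (fun q : ℝ × ℝ => g₁ q.1 q.2) (Icc 0 H ×ˢ Icc (-A) A) ∧
      ∀ h ∈ Icc 0 H, ∀ α ∈ Icc (-A) A, g h α = α * g₁ h α := by
  obtain ⟨g₁, h₁, h₂⟩ := exists_eq_mul_of_eq_zero (isCompact_Icc.prod isCompact_Icc)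
    ((convex_Icc _ _).prod (convex_Icc _ _))
    ((uniqueDiffOn_Icc hH).prod (uniqueDiffOn_Icc (show -A < A by linarith)))
    (ContinuousLinearMap.snd ℝ ℝ ℝ) (0, 1) (by
      rintro ⟨h, α⟩ hq
      simpa [hq.1.1, hq.1.2] using hA.le) hg (by
      rintro ⟨h, α⟩ hq
      simpa using h0 h hq.1)
  exact ⟨fun h α => g₁ (h, α), h₁, fun h hh α hα => h₂ (h, α) ⟨hh, hα⟩⟩

/-- A smooth function of size `O(h^k)` is `h^k` times a smooth function. -/
theorem exists_div_step_pow (hH : 0 < H) (hε : 0 < ε) (hA : 0 < A) {n k : ℕ} {c : ℝ}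
    {g : ℝ × ℝ × ℝ → ℝ} (hg : ContDiffOn ℝ (n + k : ℕ) g (box H ε A))
    (hb : ∀ q ∈ box H ε A, |g q| ≤ c * q.1 ^ k) :
    ∃ g₁ : ℝ × ℝ × ℝ → ℝ, ContDiffOn ℝ n g₁ (box H ε A) ∧
      ∀ q ∈ box H ε A, g q = q.1 ^ k * g₁ q := by
  induction k generalizing g with
  | zero => exact ⟨g, hg, fun q _ => by simp⟩
  | succ k ih =>
    obtain ⟨g₁, h₁, h₂⟩ := exists_div_step (n := n + k) hH hε hA hg (by
      intro x hx α hα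
      have := hb (0, x, α) (mem_box.2 ⟨⟨le_rfl, hH.le⟩, hx, hα⟩)
      simpa using this)
    obtain ⟨g₂, h₃, h₄⟩ := ih h₁ (by
      refine le_of_le_of_ne_zero (convex_box _ _ _) (ContinuousLinearMap.fst ℝ ℝ (ℝ × ℝ))
        (q₁ := (H, 0, 0)) (mem_box.2 ⟨⟨hH.le, le_rfl⟩, ⟨by linarith, hε.le⟩, ⟨by linarith, hA.le⟩⟩)
        hH.ne' h₁.continuousOn.abs (by fun_prop) ?_
      intro q hq hne
      have hpos : 0 < q.1 := lt_of_le_of_ne hq.1.1 (Ne.symm hne)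
      have := hb q hq
      rw [h₂ q hq, abs_mul, abs_of_pos hpos, pow_succ] at this
      have h5 : q.1 * |g₁ q| ≤ q.1 * (c * q.1 ^ k) := by linarith
      exact le_of_mul_le_mul_left h5 hpos)
    exact ⟨g₂, h₃, fun q hq => by rw [h₂ q hq, h₄ q hq, pow_succ]; ring⟩

/-- First-order division step in the state: `G = a (h, α) + x G₁`. -/
theorem exists_expansion_step (hH : 0 < H) (hε : 0 < ε) (hA : 0 < A) {n : ℕ} {G : ℝ × ℝ × ℝ → ℝ}
    (hG : ContDiffOn ℝ (n + 1 : ℕ) G (box H ε A)) :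
    ∃ (a : ℝ → ℝ → ℝ) (G₁ : ℝ × ℝ × ℝ → ℝ),
      ContDiffOn ℝ (n + 1 : ℕ) (fun q : ℝ × ℝ => a q.1 q.2) (Icc 0 H ×ˢ Icc (-A) A) ∧
      ContDiffOn ℝ n G₁ (box H ε A) ∧
      ∀ q ∈ box H ε A, G q = a q.1 q.2.2 + q.2.1 * G₁ q := by
  have h0 : (0:ℝ) ∈ Icc (-ε) ε := ⟨by linarith, hε.le⟩
  obtain ⟨G₁, h₁, h₂⟩ := exists_div_state (n := n) (g := fun q => G q - G (q.1, 0, q.2.2)) hH hε hA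
    (hG.sub (hG.comp (ContDiff.contDiffOn (by fun_prop)) (fun q hq => ⟨hq.1, h0, hq.2.2⟩)))
    (by intros; simp)
  refine ⟨fun h α => G (h, 0, α), G₁, ?_, h₁, fun q hq => by rw [← h₂ q hq]; ring⟩
  exact hG.comp (ContDiff.contDiffOn (by fun_prop)) (fun q hq => ⟨hq.1, h0, hq.2⟩)

/-- Third-order expansion in the state of a function that vanishes at the equilibrium. Each
coefficient costs one order of differentiability. -/
theorem exists_expansion (hH : 0 < H) (hε : 0 < ε) (hA : 0 < A) {n : ℕ} {F : ℝ × ℝ × ℝ → ℝ}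
    (hF : ContDiffOn ℝ (n + 4 : ℕ) F (box H ε A))
    (h0 : ∀ h ∈ Icc 0 H, ∀ α ∈ Icc (-A) A, F (h, 0, α) = 0) :
    ∃ (a₁ a₂ a₃ : ℝ → ℝ → ℝ) (R : ℝ × ℝ × ℝ → ℝ),
      ContDiffOn ℝ (n + 3 : ℕ) (fun q : ℝ × ℝ => a₁ q.1 q.2) (Icc 0 H ×ˢ Icc (-A) A) ∧
      ContDiffOn ℝ (n + 2 : ℕ) (fun q : ℝ × ℝ => a₂ q.1 q.2) (Icc 0 H ×ˢ Icc (-A) A) ∧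
      ContDiffOn ℝ (n + 1 : ℕ) (fun q : ℝ × ℝ => a₃ q.1 q.2) (Icc 0 H ×ˢ Icc (-A) A) ∧
      ContDiffOn ℝ n R (box H ε A) ∧
      ∀ q ∈ box H ε A, F q = a₁ q.1 q.2.2 * q.2.1 + a₂ q.1 q.2.2 * q.2.1 ^ 2 +
        a₃ q.1 q.2.2 * q.2.1 ^ 3 + q.2.1 ^ 4 * R q := by
  obtain ⟨F₁, h₁, e₁⟩ := exists_div_state (n := n + 3) hH hε hA hF h0
  obtain ⟨a₁, F₂, s₁, h₂, e₂⟩ := exists_expansion_step (n := n + 2) hH hε hA h₁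
  obtain ⟨a₂, F₃, s₂, h₃, e₃⟩ := exists_expansion_step (n := n + 1) hH hε hA h₂
  obtain ⟨a₃, R, s₃, h₄, e₄⟩ := exists_expansion_step (n := n) hH hε hA h₃
  refine ⟨a₁, a₂, a₃, R, s₁, s₂, s₃, h₄, fun q hq => ?_⟩
  rw [e₁ q hq, e₂ q hq, e₃ q hq, e₄ q hq]
  ring

end Box

theorem coeff_eq_zero_of_isLittleO {k : ℕ} {c C : ℝ} {S : ℝ → ℝ}
    (hS : ∀ᶠ x in 𝓝 (0:ℝ), |S x| ≤ C)
    (h : (fun x : ℝ => c * x ^ k + x ^ (k + 1) * S x) =o[𝓝 0] fun x : ℝ => x ^ k) : c = 0 := by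
  have h1 : Tendsto (fun x : ℝ => (c * x ^ k + x ^ (k + 1) * S x) / x ^ k) (𝓝[≠] 0) (𝓝 0) :=
    (h.tendsto_div_nhds_zero).mono_left nhdsWithin_le_nhds
  have h2 : Tendsto (fun x : ℝ => x * S x) (𝓝[≠] 0) (𝓝 0) := by
    have : Tendsto (fun x : ℝ => |x| * C) (𝓝[≠] 0) (𝓝 0) := by
      have h3 : Continuous (fun x : ℝ => |x| * C) := by fun_prop
      have := (h3.tendsto 0).mono_left (nhdsWithin_le_nhds (s := {0}ᶜ))
      simpa using this
    refine squeeze_zero_norm' ?_ this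
    filter_upwards [nhdsWithin_le_nhds hS] with x hx
    rw [Real.norm_eq_abs, abs_mul]
    gcongr
  have h3 : Tendsto (fun x : ℝ => c + x * S x) (𝓝[≠] 0) (𝓝 (c + 0)) := tendsto_const_nhds.add h2
  have h4 := tendsto_nhds_unique_of_eventuallyEq h1 h3 (by
    filter_upwards [self_mem_nhdsWithin] with x hx
    have : x ≠ 0 := hx
    field_simp
    ring)
  linarith

/-- Taylor's formula at `0`, with two-sided derivatives in place of those within `[-ε, ε]`. -/
theorem taylor_zero_isLittleO {g : ℝ → ℝ} {ε : ℝ} (hε : 0 < ε) {n : ℕ}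
    (hg : ContDiffOn ℝ n g (Icc (-ε) ε)) :
    (fun x => g x - ∑ k ∈ Finset.range (n + 1), iteratedDeriv k g 0 / k.factorial * x ^ k)
      =o[𝓝 0] fun x => x ^ n := by
  have h0 : (0:ℝ) ∈ Icc (-ε) ε := ⟨by linarith, hε.le⟩
  have hnhds : Icc (-ε) ε ∈ 𝓝 (0:ℝ) := Icc_mem_nhds (by linarith) hε
  have h := taylor_isLittleO (convex_Icc _ _) h0 hg
  rw [nhdsWithin_eq_nhds.2 hnhds] at h
  refine (h.congr_left fun x => ?_).congr_right fun x => by simp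
  rw [taylor_within_apply]
  congr 1
  refine Finset.sum_congr rfl fun k hk => ?_
  rw [iteratedDerivWithin_eq_iteratedDeriv (uniqueDiffOn_Icc (by linarith)) _ h0]
  · simp; ring
  · refine (hg.contDiffAt hnhds).of_le ?_
    have : k ≤ n := by simpa [Nat.lt_succ_iff] using hk
    exact_mod_cast this

theorem hasDerivAt_mul_of_continuousAt {S : ℝ → ℝ} (hS : ContinuousAt S 0) :
    HasDerivAt (fun x => x * S x) (S 0) 0 := by
  rw [hasDerivAt_iff_tendsto_slope]
  refine (hS.tendsto.mono_left nhdsWithin_le_nhds).congr' ?_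
  filter_upwards [self_mem_nhdsWithin] with x hx
  have : x ≠ 0 := hx
  rw [slope_def_field]
  field_simp
  simp

/-! ### Expansions of the time-`h` map and of its discretization -/

/-- The third-order expansion
`M (h, x, α) = x + h (α A₁ x + α A₂ x² + a₃ x³ + x⁴ R)` of a one-step map with a pitchfork, with
coefficients `A₁`, `A₂`, `a₃` depending on `(h, α)` and a tail `R`, all of class `C^n` on the
closed box. -/
structure IsJet (n : ℕ) (M : ℝ → ℝ → ℝ → ℝ) (h₀ ε₀ α₀ : ℝ) (A₁ A₂ a₃ : ℝ → ℝ → ℝ)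
    (R : ℝ → ℝ → ℝ → ℝ) : Prop where
  A₁_smooth : ContDiffOn ℝ n (fun q : ℝ × ℝ => A₁ q.1 q.2) (Icc 0 h₀ ×ˢ Icc (-α₀) α₀)
  A₂_smooth : ContDiffOn ℝ n (fun q : ℝ × ℝ => A₂ q.1 q.2) (Icc 0 h₀ ×ˢ Icc (-α₀) α₀)
  a₃_smooth : ContDiffOn ℝ n (fun q : ℝ × ℝ => a₃ q.1 q.2) (Icc 0 h₀ ×ˢ Icc (-α₀) α₀)
  R_smooth : SmoothOnBox n R h₀ ε₀ α₀
  expand : ∀ h ∈ Icc 0 h₀, ∀ x ∈ Icc (-ε₀) ε₀, ∀ α ∈ Icc (-α₀) α₀,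
    M h x α = x + h * (α * A₁ h α * x + α * A₂ h α * x ^ 2 + a₃ h α * x ^ 3 + x ^ 4 * R h x α)

/-- Two expansions whose coefficients and tails differ by at most `C h^p` on the box. -/
structure JetsClose (p : ℕ) (h₀ ε₀ α₀ C : ℝ) (A₁ A₂ a₃ : ℝ → ℝ → ℝ) (R : ℝ → ℝ → ℝ → ℝ)
    (A₁' A₂' a₃' : ℝ → ℝ → ℝ) (R' : ℝ → ℝ → ℝ → ℝ) : Prop where
  A₁_close : ∀ h ∈ Icc 0 h₀, ∀ α ∈ Icc (-α₀) α₀, |A₁ h α - A₁' h α| ≤ C * h ^ p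
  A₂_close : ∀ h ∈ Icc 0 h₀, ∀ α ∈ Icc (-α₀) α₀, |A₂ h α - A₂' h α| ≤ C * h ^ p
  a₃_close : ∀ h ∈ Icc 0 h₀, ∀ α ∈ Icc (-α₀) α₀, |a₃ h α - a₃' h α| ≤ C * h ^ p
  R_close : ∀ h ∈ Icc 0 h₀, ∀ x ∈ Icc (-ε₀) ε₀, ∀ α ∈ Icc (-α₀) α₀,
    |R h x α - R' h x α| ≤ C * h ^ p

section
variable {H ε A : ℝ}

theorem eqOn_rect_of_pos (hH : 0 < H) (hA : 0 < A) {u v : ℝ → ℝ → ℝ}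
    (hu : ContinuousOn (fun q : ℝ × ℝ => u q.1 q.2) (Icc 0 H ×ˢ Icc (-A) A))
    (hv : ContinuousOn (fun q : ℝ × ℝ => v q.1 q.2) (Icc 0 H ×ˢ Icc (-A) A))
    (h : ∀ h ∈ Ioc 0 H, ∀ α ∈ Icc (-A) A, u h α = v h α) :
    ∀ h ∈ Icc 0 H, ∀ α ∈ Icc (-A) A, u h α = v h α := fun t ht α hα =>
  eq_of_eq_of_ne_zero (K := Icc 0 H ×ˢ Icc (-A) A) (u := fun q : ℝ × ℝ => u q.1 q.2)
    (v := fun q : ℝ × ℝ => v q.1 q.2) ((convex_Icc _ _).prod (convex_Icc _ _))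
    (ContinuousLinearMap.fst ℝ ℝ ℝ) (q₁ := (H, 0)) ⟨⟨hH.le, le_rfl⟩, ⟨by linarith, hA.le⟩⟩ hH.ne'
    hu hv
    (fun q hq hne => h _ ⟨lt_of_le_of_ne hq.1.1 (Ne.symm hne), hq.1.2⟩ _ hq.2) (t, α) ⟨ht, hα⟩

theorem cubic_expansion_unique (hε : 0 < ε) {c₁ c₂ c₃ C : ℝ} {S : ℝ → ℝ}
    (hS : ∀ x ∈ Icc (-ε) ε, |S x| ≤ C)
    (h : ∀ x ∈ Icc (-ε) ε, c₁ * x + c₂ * x ^ 2 + c₃ * x ^ 3 + x ^ 4 * S x = 0) :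
    c₁ = 0 ∧ c₂ = 0 ∧ c₃ = 0 := by
  have hnhds : Icc (-ε) ε ∈ 𝓝 (0:ℝ) := Icc_mem_nhds (by linarith) hε
  have hle : ∀ x ∈ Icc (-ε) ε, |x| ≤ ε := fun x hx => abs_le.2 hx
  have e1 : c₁ = 0 := by
    refine coeff_eq_zero_of_isLittleO (k := 1) (C := |c₂| + |c₃| * ε + ε ^ 2 * C)
      (S := fun x => c₂ + c₃ * x + x ^ 2 * S x) ?_ ?_
    · filter_upwards [hnhds] with x hx
      have hC : 0 ≤ C := (abs_nonneg _).trans (hS x hx)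
      refine (abs_add_le _ _).trans (add_le_add ((abs_add_le _ _).trans
        (add_le_add le_rfl ?_)) ?_)
      · rw [abs_mul]; gcongr; exact hle x hx
      · rw [abs_mul, abs_pow]
        have := hle x hx
        have := hS x hx
        gcongr
    · refine (Asymptotics.isLittleO_zero _ _).congr' ?_ EventuallyEq.rfl
      filter_upwards [hnhds] with x hx
      rw [← h x hx]; ring
  have e2 : c₂ = 0 := by
    refine coeff_eq_zero_of_isLittleO (k := 2) (C := |c₃| + ε * C)
      (S := fun x => c₃ + x * S x) ?_ ?_
    · filter_upwards [hnhds] with x hx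
      refine (abs_add_le _ _).trans (add_le_add le_rfl ?_)
      rw [abs_mul]
      have := hle x hx
      have := hS x hx
      gcongr
    · refine (Asymptotics.isLittleO_zero _ _).congr' ?_ EventuallyEq.rfl
      filter_upwards [hnhds] with x hx
      rw [← h x hx, e1]; ring
  refine ⟨e1, e2, ?_⟩
  refine coeff_eq_zero_of_isLittleO (k := 3) (C := C) (S := S) ?_ ?_
  · filter_upwards [hnhds] with x hx using hS x hx
  · refine (Asymptotics.isLittleO_zero _ _).congr' ?_ EventuallyEq.rfl
    filter_upwards [hnhds] with x hx
    rw [← h x hx, e1, e2]; ring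

/-- If a cubic expansion with bounded tail is `o(x²)`, its first two coefficients vanish. -/
theorem coeffs_eq_zero_of_isLittleO_sq (hε : 0 < ε) {c₁ c₂ c₃ C : ℝ} {g S : ℝ → ℝ}
    (hS : ∀ x ∈ Icc (-ε) ε, |S x| ≤ C)
    (h : ∀ x ∈ Icc (-ε) ε, g x = c₁ * x + c₂ * x ^ 2 + c₃ * x ^ 3 + x ^ 4 * S x)
    (hg : g =o[𝓝 0] fun x : ℝ => x ^ 2) : c₁ = 0 ∧ c₂ = 0 := by
  have hnhds : Icc (-ε) ε ∈ 𝓝 (0:ℝ) := Icc_mem_nhds (by linarith) hε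
  have hle : ∀ x ∈ Icc (-ε) ε, |x| ≤ ε := fun x hx => abs_le.2 hx
  have hb : ∀ x ∈ Icc (-ε) ε, |c₃ + x * S x| ≤ |c₃| + ε * C := fun x hx => by
    refine (abs_add_le _ _).trans (add_le_add le_rfl ?_)
    rw [abs_mul]
    have := hle x hx
    have := hS x hx
    gcongr
  have e1 : c₁ = 0 := by
    refine coeff_eq_zero_of_isLittleO (k := 1) (C := |c₂| + ε * (|c₃| + ε * C))
      (S := fun x => c₂ + x * (c₃ + x * S x)) ?_ ?_
    · filter_upwards [hnhds] with x hx
      refine (abs_add_le _ _).trans (add_le_add le_rfl ?_)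
      rw [abs_mul]
      have := hle x hx
      have := hb x hx
      gcongr
    · have h1 : (fun x : ℝ => x ^ 2) =o[𝓝 0] fun x : ℝ => x ^ 1 :=
        Asymptotics.isLittleO_pow_pow (by norm_num)
      refine (hg.trans h1).congr' ?_ EventuallyEq.rfl
      filter_upwards [hnhds] with x hx
      rw [h x hx]; ring
  refine ⟨e1, coeff_eq_zero_of_isLittleO (k := 2) (C := |c₃| + ε * C)
      (S := fun x => c₃ + x * S x) ?_ ?_⟩
  · filter_upwards [hnhds] with x hx using hb x hx
  · refine hg.congr' ?_ EventuallyEq.rfl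
    filter_upwards [hnhds] with x hx
    rw [h x hx, e1]; ring

end

/-- The expansions of `Φ` and `φ` in the state, to third order, with `O(h^p)`-close coefficients:
`Φ - φ = h^(p+1) Δ` with `Δ` of class `C^6`, and the expansion of `Δ` supplies the differences. -/
theorem Setting.exists_jets {p : ℕ} (hp : 1 ≤ p) {f : ℝ → ℝ → ℝ} {Φ φ : ℝ → ℝ → ℝ → ℝ} {H E A : ℝ}
    (hS : Setting p (p + 7) f Φ φ H E A) :
    ∃ ε ∈ Ioc 0 E, ∃ (C : ℝ) (A₁ A₂ a₃ : ℝ → ℝ → ℝ) (R : ℝ → ℝ → ℝ → ℝ) (A₁' A₂' a₃' : ℝ → ℝ → ℝ)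
      (R' : ℝ → ℝ → ℝ → ℝ),
      IsJet (p + 2) Φ H ε A A₁ A₂ a₃ R ∧ IsJet (p + 2) φ H ε A A₁' A₂' a₃' R' ∧
      JetsClose p H ε A C A₁ A₂ a₃ R A₁' A₂' a₃' R' ∧ A₁ 0 0 ≠ 0 ∧ a₃ 0 0 ≠ 0 := by
  obtain ⟨hH, hE, hA, hf, hpf, hΦ, hφ, ⟨c, hord⟩, hφ0, hφx, hφxx⟩ := hS
  obtain ⟨ε, ⟨hε, hεE⟩, hΦs, hΦ1, CΦ, hCΦ0, hCΦ⟩ :=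
    contDiffOn_timeMap (m := p + 7) (by omega) hH hE hA hf hpf.equilibrium hΦ
  have hsub : Icc (-ε) ε ⊆ Icc (-E) E := Icc_subset_Icc (by linarith) hεE
  have hbsub : box H ε A ⊆ box H E A := box_mono le_rfl hεE le_rfl
  set B := box H ε A with hB
  have hφs : ContDiffOn ℝ (p + 7 : ℕ) (fun q : ℝ × ℝ × ℝ => φ q.1 q.2.1 q.2.2) B := hφ.mono hbsub
  have h0H : (0:ℝ) ∈ Icc 0 H := ⟨le_rfl, hH.le⟩
  have h0A : (0:ℝ) ∈ Icc (-A) A := ⟨by linarith, hA.le⟩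
  have h0ε : (0:ℝ) ∈ Icc (-ε) ε := ⟨by linarith, hε.le⟩
  have hnhds : Icc (-ε) ε ∈ 𝓝 (0:ℝ) := Icc_mem_nhds (by linarith) hε
  have hΦ0 : ∀ x ∈ Icc (-ε) ε, ∀ α ∈ Icc (-A) A, Φ 0 x α = x := fun x hx α hα =>
    (hΦ x (hsub hx) α hα).1
  -- difference quotients in the step size
  obtain ⟨Δ, hΔs, hΔ⟩ := exists_div_step_pow (n := 6) (k := p + 1) (c := c) hH hε hA
    (g := fun q => Φ q.1 q.2.1 q.2.2 - φ q.1 q.2.1 q.2.2)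
    ((hΦs.sub hφs).of_le (by norm_cast; omega))
    (fun q hq => hord _ hq.1 _ (hsub hq.2.1) _ hq.2.2)
  obtain ⟨F, hFs, hF⟩ := exists_div_step (n := p + 6) hH hε hA
    (g := fun q => Φ q.1 q.2.1 q.2.2 - q.2.1)
    (hΦs.sub (ContDiff.contDiffOn (by fun_prop))) (fun x hx α hα => by simp [hΦ0 x hx α hα])
  obtain ⟨F', hFs', hF'⟩ := exists_div_step (n := p + 6) hH hε hA
    (g := fun q => φ q.1 q.2.1 q.2.2 - q.2.1)
    (hφs.sub (ContDiff.contDiffOn (by fun_prop))) (fun x hx α hα => by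
      have := hΔ (0, x, α) (mem_box.2 ⟨h0H, hx, hα⟩)
      simp only [hΦ0 x hx α hα, ne_eq, Nat.add_eq_zero_iff, one_ne_zero, and_false,
        not_false_eq_true, zero_pow, zero_mul] at this
      simp only
      linarith)
  -- one power of `h` is lost: `Δ` is the quotient of `Φ - φ` by `h^(p+1)`, while `F` and `F'` are
  -- quotients by `h`
  have hFF : ∀ q ∈ B, F q - F' q = q.1 ^ p * Δ q := by
    refine eqOn_box_of_pos hH hε hA (hFs.continuousOn.sub hFs'.continuousOn)
      ((continuous_fst.pow p).continuousOn.mul hΔs.continuousOn) (fun q hq hpos => ?_)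
    have h1 := hF q hq
    have h2 := hF' q hq
    have h3 := hΔ q hq
    have h4 : q.1 * (F q - F' q) = q.1 * (q.1 ^ p * Δ q) := by
      rw [pow_succ] at h3
      linear_combination h3 - h1 + h2
    exact mul_left_cancel₀ hpos.ne' h4
  have hvanish : ∀ G : ℝ × ℝ × ℝ → ℝ, ContinuousOn G B →
      (∀ h ∈ Ioc 0 H, ∀ α ∈ Icc (-A) A, G (h, 0, α) = 0) →
      ∀ h ∈ Icc 0 H, ∀ α ∈ Icc (-A) A, G (h, 0, α) = 0 := by
    intro G hG hG0
    refine eqOn_rect_of_pos (u := fun h α => G (h, 0, α)) (v := fun _ _ => 0) hH hA ?_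
      continuousOn_const hG0
    exact hG.comp (by fun_prop) (fun q hq => ⟨hq.1, h0ε, hq.2⟩)
  have hF0 := hvanish F hFs.continuousOn (fun h hh α hα => by
    have hq : (h, (0:ℝ), α) ∈ B := mem_box.2 ⟨⟨hh.1.le, hh.2⟩, h0ε, hα⟩
    have h1 := hF _ hq
    have h2 := hCΦ _ hq
    simp only [abs_zero, mul_zero, abs_nonpos_iff] at h2
    simp only [h2, sub_zero] at h1
    exact (mul_eq_zero.1 h1.symm).resolve_left hh.1.ne')
  have hF0' := hvanish F' hFs'.continuousOn (fun h hh α hα => by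
    have hq : (h, (0:ℝ), α) ∈ B := mem_box.2 ⟨⟨hh.1.le, hh.2⟩, h0ε, hα⟩
    have h1 := hF' _ hq
    simp only [hφ0 h ⟨hh.1.le, hh.2⟩ α hα, sub_zero] at h1
    exact (mul_eq_zero.1 h1.symm).resolve_left hh.1.ne')
  have hΔ0 := hvanish Δ hΔs.continuousOn (fun h hh α hα => by
    have hq : (h, (0:ℝ), α) ∈ B := mem_box.2 ⟨⟨hh.1.le, hh.2⟩, h0ε, hα⟩
    have h1 := hFF _ hq
    rw [hF0 h ⟨hh.1.le, hh.2⟩ α hα, hF0' h ⟨hh.1.le, hh.2⟩ α hα, sub_zero] at h1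
    exact (mul_eq_zero.1 h1.symm).resolve_left (pow_ne_zero _ hh.1.ne'))
  -- expansions in the state
  obtain ⟨a₁, a₂, a₃, R, s₁, s₂, s₃, sR, hexp⟩ := exists_expansion (n := p + 2) hH hε hA hFs hF0
  obtain ⟨a₁', a₂', a₃', R', s₁', s₂', s₃', sR', hexp'⟩ :=
    exists_expansion (n := p + 2) hH hε hA hFs' hF0'
  obtain ⟨d₁, d₂, d₃, S, t₁, t₂, t₃, tS, hexpd⟩ := exists_expansion (n := 2) hH hε hA hΔs hΔ0
  obtain ⟨CR, hCR0, hCR⟩ := exists_bound_box sR.continuousOn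
  obtain ⟨CR', hCR0', hCR'⟩ := exists_bound_box sR'.continuousOn
  obtain ⟨CS, hCS0, hCS⟩ := exists_bound_box tS.continuousOn
  have hdiff : ∀ h ∈ Icc 0 H, ∀ α ∈ Icc (-A) A, a₁ h α - a₁' h α - h ^ p * d₁ h α = 0 ∧
      a₂ h α - a₂' h α - h ^ p * d₂ h α = 0 ∧ a₃ h α - a₃' h α - h ^ p * d₃ h α = 0 := by
    intro h hh α hα
    have hpow : 0 ≤ h ^ p := pow_nonneg hh.1 p
    refine cubic_expansion_unique hε (C := CR + CR' + h ^ p * CS)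
      (S := fun x => R (h, x, α) - R' (h, x, α) - h ^ p * S (h, x, α)) (fun x hx => ?_)
      (fun x hx => ?_)
    · have hq : (h, x, α) ∈ B := mem_box.2 ⟨hh, hx, hα⟩
      refine (abs_sub _ _).trans (add_le_add ((abs_sub _ _).trans (add_le_add (hCR _ hq)
        (hCR' _ hq))) ?_)
      rw [abs_mul, abs_of_nonneg hpow]
      exact mul_le_mul_of_nonneg_left (hCS _ hq) hpow
    · have hq : (h, x, α) ∈ B := mem_box.2 ⟨hh, hx, hα⟩
      have e1 := hFF _ hq
      rw [hexp _ hq, hexp' _ hq, hexpd _ hq] at e1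
      simp only at e1
      linear_combination e1
  have hRdiff : ∀ q ∈ B, R q - R' q = q.1 ^ p * S q := by
    refine eq_of_eq_of_ne_zero (convex_box _ _ _)
      ((ContinuousLinearMap.fst ℝ ℝ ℝ).comp (ContinuousLinearMap.snd ℝ ℝ (ℝ × ℝ))) (q₁ := (0, ε, 0))
      (mem_box.2 ⟨h0H, ⟨by linarith, le_rfl⟩, h0A⟩) hε.ne' (sR.continuousOn.sub sR'.continuousOn)
      ((continuous_fst.pow p).continuousOn.mul tS.continuousOn) (fun q hq hne => ?_)
    have e1 := hFF _ hq
    obtain ⟨e2, e3, e4⟩ := hdiff _ hq.1 _ hq.2.2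
    rw [hexp _ hq, hexp' _ hq, hexpd _ hq] at e1
    have hx : q.2.1 ≠ 0 := hne
    have : q.2.1 ^ 4 * (R q - R' q) = q.2.1 ^ 4 * (q.1 ^ p * S q) := by
      linear_combination e1 - q.2.1 * e2 - q.2.1 ^ 2 * e3 - q.2.1 ^ 3 * e4
    exact mul_left_cancel₀ (pow_ne_zero 4 hx) this
  -- the vector field is the expansion at step size zero
  have hfF : ∀ x ∈ Icc (-ε) ε, ∀ α ∈ Icc (-A) A, f x α = F (0, x, α) := by
    intro x hx α hα
    have h1 := (hΦ x (hsub hx) α hα).2 0 h0H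
    rw [hΦ0 x hx α hα] at h1
    have hc : ContinuousWithinAt (fun t => F (t, x, α)) (Icc 0 H) 0 :=
      (hFs.continuousOn.comp (f := fun t : ℝ => (t, x, α)) (by fun_prop)
        (fun t ht => mem_box.2 ⟨ht, hx, hα⟩)) 0 h0H
    have h2 := (hasFDerivWithinAt_of_eq_mul hc (ContinuousLinearMap.id ℝ ℝ)).hasDerivWithinAt
    have h3 : HasDerivWithinAt (fun t => Φ t x α) (F (0, x, α)) (Icc 0 H) 0 := by
      refine ((h2.const_add x).congr_of_mem (fun t ht => ?_) h0H).congr_deriv (by simp)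
      have := hF (t, x, α) (mem_box.2 ⟨ht, hx, hα⟩)
      simp only at this
      simp only [ContinuousLinearMap.id_apply, sub_zero]
      linarith
    exact (uniqueDiffOn_Icc hH 0 h0H).eq_deriv _ h1 h3
  have hfsec : ContDiff ℝ (p + 7 : ℕ) (fun x => f x 0) :=
    ContDiff.comp (g := fun q : ℝ × ℝ => f q.1 q.2) (f := fun x : ℝ => (x, (0 : ℝ))) hf
      (by fun_prop)
  have hf00 : f 0 0 = 0 := hpf.equilibrium 0 h0A
  have htay : (fun x => f x 0 - iteratedDeriv 3 (fun x => f x 0) 0 / 6 * x ^ 3) =o[𝓝 0]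
      fun x : ℝ => x ^ 3 := by
    have := taylor_zero_isLittleO hε (n := 3) (hfsec.of_le (by norm_cast; omega)).contDiffOn
    refine this.congr_left fun x => ?_
    simp [Finset.sum_range_succ, hf00, hpf.f_x, hpf.f_xx, iteratedDeriv_one, Nat.factorial]
  have hexpf : ∀ x ∈ Icc (-ε) ε, f x 0 = a₁ 0 0 * x + a₂ 0 0 * x ^ 2 + a₃ 0 0 * x ^ 3 +
      x ^ 4 * R (0, x, 0) := fun x hx => by
    rw [hfF x hx 0 h0A, hexp _ (mem_box.2 ⟨h0H, hx, h0A⟩)]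
  have hCRx : ∀ h ∈ Icc 0 H, ∀ x ∈ Icc (-ε) ε, |R (h, x, 0)| ≤ CR := fun h hh x hx =>
    hCR _ (mem_box.2 ⟨hh, hx, h0A⟩)
  have hcub : ∀ k : ℝ, (fun x : ℝ => k * x ^ 3) =o[𝓝 0] fun x : ℝ => x ^ 2 := fun k =>
    (Asymptotics.isLittleO_pow_pow (by norm_num)).const_mul_left k
  have hfo2 : (fun x => f x 0) =o[𝓝 0] fun x : ℝ => x ^ 2 := by
    have h2 := (htay.trans (by simpa using hcub 1)).add
      (hcub (iteratedDeriv 3 (fun x => f x 0) 0 / 6))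
    refine h2.congr_left fun x => ?_
    ring
  obtain ⟨ha10, ha20⟩ := coeffs_eq_zero_of_isLittleO_sq hε (hCRx 0 h0H) hexpf hfo2
  have ha30 : a₃ 0 0 ≠ 0 := by
    have : a₃ 0 0 - iteratedDeriv 3 (fun x => f x 0) 0 / 6 = 0 := by
      refine coeff_eq_zero_of_isLittleO (k := 3) (C := CR) (S := fun x => R (0, x, 0)) ?_ ?_
      · filter_upwards [hnhds] with x hx using hCRx 0 h0H x hx
      · refine htay.congr' ?_ EventuallyEq.rfl
        filter_upwards [hnhds] with x hx
        rw [hexpf x hx, ha10, ha20]; ring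
    have h3 := hpf.f_xxx
    intro h
    apply h3
    linarith
  -- at the bifurcation parameter the linear and quadratic coefficients vanish, since
  -- `f (x, 0) = O(x³)` and `Φ = O(x)` give `Φ - x = O(h x³)`
  have hvan : ∀ h ∈ Icc 0 H, a₁ h 0 = 0 ∧ a₂ h 0 = 0 := by
    intro h hh
    rcases eq_or_lt_of_le hh.1 with h0 | hpos
    · rw [← h0]; exact ⟨ha10, ha20⟩
    have hfbd : ∀ x ∈ Icc (-ε) ε, |f x 0| ≤ (|a₃ 0 0| + ε * CR) * |x| ^ 3 := by
      intro x hx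
      have : f x 0 = (a₃ 0 0 + x * R (0, x, 0)) * x ^ 3 := by
        rw [hexpf x hx, ha10, ha20]; ring
      rw [this, abs_mul, abs_pow]
      gcongr
      refine (abs_add_le _ _).trans (add_le_add le_rfl ?_)
      rw [abs_mul]
      have h1 : |x| ≤ ε := abs_le.2 hx
      have h2 := hCRx 0 h0H x hx
      gcongr
    set K := (|a₃ 0 0| + ε * CR) * CΦ ^ 3 with hK
    have hKbd : ∀ x : ℝ, x ∈ Icc (-ε) ε → CΦ * |x| ≤ ε → |F (h, x, 0)| ≤ K * |x| ^ 3 := by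
      intro x hx hxs
      have hder := (hΦ x (hsub hx) 0 h0A).2
      have h1 := (convex_Icc (0:ℝ) H).norm_image_sub_le_of_norm_hasDerivWithin_le
        (f := fun t => Φ t x 0) (C := K * |x| ^ 3) hder (fun t ht => ?_) h0H hh
      · rw [hΦ0 x hx 0 h0A] at h1
        have h2 := hF (h, x, 0) (mem_box.2 ⟨hh, hx, h0A⟩)
        simp only at h2
        rw [h2, sub_zero, norm_mul, Real.norm_eq_abs, Real.norm_eq_abs, abs_of_pos hpos] at h1
        have h3 : h * |F (h, x, 0)| ≤ h * (K * |x| ^ 3) := by linarith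
        exact le_of_mul_le_mul_left h3 hpos
      · have h4 := hCΦ (t, x, 0) (mem_box.2 ⟨ht, hx, h0A⟩)
        simp only at h4
        rw [Real.norm_eq_abs]
        refine (hfbd _ (abs_le.1 (h4.trans hxs))).trans ?_
        rw [hK, mul_assoc, ← mul_pow]
        gcongr
    refine coeffs_eq_zero_of_isLittleO_sq hε (hCRx h hh) (c₃ := a₃ h 0) (g := fun x => F (h, x, 0))
      (fun x hx => hexp _ (mem_box.2 ⟨hh, hx, h0A⟩)) ?_
    have h3 : (fun x : ℝ => K * |x| ^ 3) =o[𝓝 0] fun x : ℝ => x ^ 2 := by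
      refine ((hcub K).norm_left).congr_left ?_ |>.trans_isBigO (Asymptotics.isBigO_refl _ _) |>
        fun h => h
      intro x
      rw [norm_mul, norm_pow, Real.norm_eq_abs, Real.norm_eq_abs, abs_of_nonneg (by positivity)]
    refine Asymptotics.IsBigO.trans_isLittleO (Asymptotics.IsBigO.of_bound 1 ?_) h3
    have hsm : ∀ᶠ x in 𝓝 (0:ℝ), CΦ * |x| < ε := by
      have : Continuous (fun x : ℝ => CΦ * |x|) := by fun_prop
      exact this.continuousAt.eventually_lt continuousAt_const (by simpa using hε)
    filter_upwards [hnhds, hsm] with x hx hxs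
    rw [one_mul, Real.norm_eq_abs, Real.norm_eq_abs]
    exact (hKbd x hx hxs.le).trans (le_abs_self _)
  -- for `φ` the same is the condition on its first two derivatives
  have hvan' : ∀ h ∈ Ioc 0 H, a₁' h 0 = 0 ∧ a₂' h 0 = 0 := by
    intro h hh
    have hh' : h ∈ Icc 0 H := ⟨hh.1.le, hh.2⟩
    have hsec : ContDiffOn ℝ 2 (fun x => φ h x 0) (Icc (-ε) ε) := by
      have : ContDiffOn ℝ (p + 7 : ℕ) (fun x => φ h x 0) (Icc (-ε) ε) :=
        hφs.comp (f := fun x : ℝ => (h, x, (0:ℝ))) (ContDiff.contDiffOn (by fun_prop))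
          (fun x hx => mem_box.2 ⟨hh', hx, h0A⟩)
      exact this.of_le (by norm_cast; omega)
    have ht := taylor_zero_isLittleO hε (n := 2) hsec
    have ht' : (fun x => φ h x 0 - x) =o[𝓝 0] fun x : ℝ => x ^ 2 := by
      refine ht.congr_left fun x => ?_
      simp [Finset.sum_range_succ, hφ0 h hh' 0 h0A, hφx h hh', hφxx h hh', iteratedDeriv_one]
    refine coeffs_eq_zero_of_isLittleO_sq hε (C := CR') (c₃ := a₃' h 0)
      (S := fun x => R' (h, x, 0))
      (g := fun x => F' (h, x, 0))
      (fun x hx => hCR' _ (mem_box.2 ⟨hh', hx, h0A⟩))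
      (fun x hx => hexp' _ (mem_box.2 ⟨hh', hx, h0A⟩)) ?_
    refine (ht'.const_mul_left h⁻¹).congr' ?_ EventuallyEq.rfl
    filter_upwards [hnhds] with x hx
    have := hF' (h, x, 0) (mem_box.2 ⟨hh', hx, h0A⟩)
    simp only at this
    rw [this, inv_mul_cancel_left₀ hh.1.ne']
  have hpos_ext : ∀ u : ℝ → ℝ → ℝ,
      ContinuousOn (fun q : ℝ × ℝ => u q.1 q.2) (Icc 0 H ×ˢ Icc (-A) A) →
      (∀ h ∈ Ioc 0 H, u h 0 = 0) → ∀ h ∈ Icc 0 H, u h 0 = 0 := by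
    intro u hu hu0 h hh
    refine eqOn_rect_of_pos (u := fun h _ => u h 0) (v := fun _ _ => 0) hH hA ?_
      continuousOn_const (fun h hh _ _ => hu0 h hh) h hh 0 h0A
    exact hu.comp (f := fun q : ℝ × ℝ => (q.1, (0:ℝ))) (by fun_prop) (fun q hq => ⟨hq.1, h0A⟩)
  have hd : ∀ h ∈ Ioc 0 H, d₁ h 0 = 0 ∧ d₂ h 0 = 0 := by
    intro h hh
    have hh' : h ∈ Icc 0 H := ⟨hh.1.le, hh.2⟩
    obtain ⟨e1, e2, _⟩ := hdiff h hh' 0 h0A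
    rw [(hvan h hh').1, (hvan' h hh).1] at e1
    rw [(hvan h hh').2, (hvan' h hh).2] at e2
    have hne : h ^ p ≠ 0 := pow_ne_zero _ hh.1.ne'
    constructor
    · exact (mul_eq_zero.1 (show h ^ p * d₁ h 0 = 0 by linarith)).resolve_left hne
    · exact (mul_eq_zero.1 (show h ^ p * d₂ h 0 = 0 by linarith)).resolve_left hne
  -- division by the parameter
  obtain ⟨A₁, sA₁, hA₁⟩ := exists_div_param (n := p + 2) hH hA
    (s₁.of_le (by norm_cast; omega)) (fun h hh => (hvan h hh).1)
  obtain ⟨A₂, sA₂, hA₂⟩ := exists_div_param (n := p + 2) hH hA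
    (s₂.of_le (by norm_cast; omega)) (fun h hh => (hvan h hh).2)
  obtain ⟨A₁', sA₁', hA₁'⟩ := exists_div_param (n := p + 2) hH hA
    (s₁'.of_le (by norm_cast; omega)) (hpos_ext _ s₁'.continuousOn fun h hh => (hvan' h hh).1)
  obtain ⟨A₂', sA₂', hA₂'⟩ := exists_div_param (n := p + 2) hH hA
    (s₂'.of_le (by norm_cast; omega)) (hpos_ext _ s₂'.continuousOn fun h hh => (hvan' h hh).2)
  obtain ⟨D₁, sD₁, hD₁⟩ := exists_div_param (n := 0) hH hA
    (t₁.of_le (by norm_num)) (hpos_ext _ t₁.continuousOn fun h hh => (hd h hh).1)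
  obtain ⟨D₂, sD₂, hD₂⟩ := exists_div_param (n := 0) hH hA
    (t₂.of_le (by norm_num)) (hpos_ext _ t₂.continuousOn fun h hh => (hd h hh).2)
  have hcancel : ∀ u v w : ℝ → ℝ → ℝ,
      ContinuousOn (fun q : ℝ × ℝ => u q.1 q.2) (Icc 0 H ×ˢ Icc (-A) A) →
      ContinuousOn (fun q : ℝ × ℝ => v q.1 q.2) (Icc 0 H ×ˢ Icc (-A) A) →
      ContinuousOn (fun q : ℝ × ℝ => w q.1 q.2) (Icc 0 H ×ˢ Icc (-A) A) →
      (∀ h ∈ Icc 0 H, ∀ α ∈ Icc (-A) A, α * u h α - α * v h α - h ^ p * (α * w h α) = 0) →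
      ∀ q ∈ Icc 0 H ×ˢ Icc (-A) A, u q.1 q.2 - v q.1 q.2 = q.1 ^ p * w q.1 q.2 := by
    intro u v w hu hv hw huvw
    refine eqOn_of_mul_eqOn (K := Icc 0 H ×ˢ Icc (-A) A) (u := fun q => u q.1 q.2 - v q.1 q.2)
      (v := fun q => q.1 ^ p * w q.1 q.2) ((convex_Icc _ _).prod (convex_Icc _ _))
      (ContinuousLinearMap.snd ℝ ℝ ℝ) (q₁ := (0, A)) ⟨h0H, ⟨by linarith, le_rfl⟩⟩ hA.ne'
      (hu.sub hv) ((continuous_fst.pow p).continuousOn.mul hw) (fun q hq => ?_)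
    have := huvw q.1 hq.1 q.2 hq.2
    simp only [ContinuousLinearMap.coe_snd']
    linear_combination this
  have hc1 := hcancel A₁ A₁' D₁ sA₁.continuousOn sA₁'.continuousOn sD₁.continuousOn
    (fun h hh α hα => by
      have := (hdiff h hh α hα).1
      rwa [hA₁ h hh α hα, hA₁' h hh α hα, hD₁ h hh α hα] at this)
  have hc2 := hcancel A₂ A₂' D₂ sA₂.continuousOn sA₂'.continuousOn sD₂.continuousOn
    (fun h hh α hα => by
      have := (hdiff h hh α hα).2.1
      rwa [hA₂ h hh α hα, hA₂' h hh α hα, hD₂ h hh α hα] at this)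
  have hrect : IsCompact (Icc (0:ℝ) H ×ˢ Icc (-A) A) := isCompact_Icc.prod isCompact_Icc
  obtain ⟨C₁, hC₁⟩ := hrect.exists_bound_of_continuousOn sD₁.continuousOn
  obtain ⟨C₂, hC₂⟩ := hrect.exists_bound_of_continuousOn sD₂.continuousOn
  obtain ⟨C₃, hC₃⟩ := hrect.exists_bound_of_continuousOn t₃.continuousOn
  set C := max (max C₁ C₂) (max C₃ CS) with hC
  have hclose : ∀ h ∈ Icc 0 H, ∀ a b d k : ℝ, a - b = h ^ p * d → |d| ≤ k → k ≤ C →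
      |a - b| ≤ C * h ^ p := by
    intro h hh a b d k hab hd hk
    have : 0 ≤ h ^ p := pow_nonneg hh.1 p
    rw [hab, abs_mul, abs_of_nonneg this, mul_comm]
    exact mul_le_mul_of_nonneg_right (hd.trans hk) this
  refine ⟨ε, ⟨hε, hεE⟩, C, A₁, A₂, a₃, fun h x α => R (h, x, α), A₁', A₂', a₃',
    fun h x α => R' (h, x, α), ⟨sA₁, sA₂, s₃.of_le (by norm_cast; omega), sR, ?_⟩,
    ⟨sA₁', sA₂', s₃'.of_le (by norm_cast; omega), sR', ?_⟩, ⟨?_, ?_, ?_, ?_⟩, ?_, ha30⟩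
  · intro h hh x hx α hα
    have hq : (h, x, α) ∈ B := mem_box.2 ⟨hh, hx, hα⟩
    have h1 := hF _ hq
    rw [hexp _ hq] at h1
    simp only [hA₁ h hh α hα, hA₂ h hh α hα] at h1
    linarith
  · intro h hh x hx α hα
    have hq : (h, x, α) ∈ B := mem_box.2 ⟨hh, hx, hα⟩
    have h1 := hF' _ hq
    rw [hexp' _ hq] at h1
    simp only [hA₁' h hh α hα, hA₂' h hh α hα] at h1
    linarith
  · exact fun h hh α hα => hclose h hh _ _ _ C₁ (hc1 (h, α) ⟨hh, hα⟩) (hC₁ (h, α) ⟨hh, hα⟩)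
      ((le_max_left _ _).trans (le_max_left _ _))
  · exact fun h hh α hα => hclose h hh _ _ _ C₂ (hc2 (h, α) ⟨hh, hα⟩) (hC₂ (h, α) ⟨hh, hα⟩)
      ((le_max_right _ _).trans (le_max_left _ _))
  · exact fun h hh α hα => hclose h hh _ _ _ C₃ (by linarith [(hdiff h hh α hα).2.2])
      (hC₃ (h, α) ⟨hh, hα⟩) ((le_max_left _ _).trans (le_max_right _ _))
  · exact fun h hh x hx α hα => hclose h hh _ _ _ CS (hRdiff _ (mem_box.2 ⟨hh, hx, hα⟩))
      (hCS _ (mem_box.2 ⟨hh, hx, hα⟩)) ((le_max_right _ _).trans (le_max_right _ _))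
  · have hAnhds : Icc (-A) A ∈ 𝓝 (0:ℝ) := Icc_mem_nhds (by linarith) hA
    have hder : ∀ α ∈ Icc (-A) A, deriv (fun x => f x α) 0 = α * A₁ 0 α := by
      intro α hα
      have hcont : ContinuousAt (fun x => a₁ 0 α + a₂ 0 α * x + a₃ 0 α * x ^ 2 +
          x ^ 3 * R (0, x, α)) 0 := by
        have : ContinuousAt (fun x => R (0, x, α)) 0 :=
          (sR.continuousOn.comp (f := fun x : ℝ => ((0:ℝ), x, α)) (by fun_prop)
            (fun x hx => mem_box.2 ⟨h0H, hx, hα⟩)).continuousAt hnhds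
        exact ContinuousAt.add (Continuous.continuousAt (by fun_prop))
          (ContinuousAt.mul (Continuous.continuousAt (by fun_prop)) this)
      have h1 := hasDerivAt_mul_of_continuousAt hcont
      have h2 : HasDerivAt (fun x => f x α) (a₁ 0 α) 0 := by
        refine (h1.congr_of_eventuallyEq ?_).congr_deriv (by simp)
        filter_upwards [hnhds] with x hx
        rw [hfF x hx α hα, hexp _ (mem_box.2 ⟨h0H, hx, hα⟩)]
        simp only
        ring
      rw [h2.deriv, hA₁ 0 h0H α hα]
    have hcont : ContinuousAt (fun α => A₁ 0 α) 0 :=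
      (sA₁.continuousOn.comp (f := fun α : ℝ => ((0:ℝ), α)) (by fun_prop)
        (fun α hα => ⟨h0H, hα⟩)).continuousAt hAnhds
    have h1 := hasDerivAt_mul_of_continuousAt hcont
    have h2 : HasDerivAt (fun α => deriv (fun x => f x α) 0) (A₁ 0 0) 0 := by
      refine h1.congr_of_eventuallyEq ?_
      filter_upwards [hAnhds] with α hα using hder α hα
    have h3 := hpf.f_xα
    rwa [h2.deriv] at h3

/-! ### Coordinate changes to the normal form -/

/-- The linear coefficient `b` of the expansion, which is the parameter change. -/
noncomputable def jetParam (A₁ : ℝ → ℝ → ℝ) (h α : ℝ) : ℝ := α * A₁ h α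

/-- The coefficient `c` in `x + c x²`, chosen so that this coordinate change removes the quadratic
term of the expansion. -/
noncomputable def jetQuad (A₁ A₂ : ℝ → ℝ → ℝ) (h α : ℝ) : ℝ :=
  -A₂ h α / (A₁ h α * (1 + h * jetParam A₁ h α))

/-- The cubic coefficient after the removal of the quadratic term. -/
noncomputable def jetCubic (A₁ A₂ a₃ : ℝ → ℝ → ℝ) (h α : ℝ) : ℝ :=
  a₃ h α + 2 * jetQuad A₁ A₂ h α * (α * A₂ h α) * (1 + h * jetParam A₁ h α)

/-- The scaling that normalizes the cubic coefficient to `s`. -/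
noncomputable def jetScale (s : ℝ) (A₁ A₂ a₃ : ℝ → ℝ → ℝ) (h α : ℝ) : ℝ :=
  Real.sqrt (s * jetCubic A₁ A₂ a₃ h α)

/-- The coordinate change `κ (x + c x²)`. -/
noncomputable def jetChart (s : ℝ) (A₁ A₂ a₃ : ℝ → ℝ → ℝ) (h x α : ℝ) : ℝ :=
  jetScale s A₁ A₂ a₃ h α * (x + jetQuad A₁ A₂ h α * x ^ 2)

/-- The tail of the normal form, written in the original coordinates. -/
noncomputable def jetTail (s : ℝ) (A₁ A₂ a₃ : ℝ → ℝ → ℝ) (R : ℝ → ℝ → ℝ → ℝ) (h x α : ℝ) : ℝ :=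
  (R h x α + 2 * jetQuad A₁ A₂ h α * (a₃ h α + x * R h x α) +
    jetQuad A₁ A₂ h α * h * (2 * jetParam A₁ h α * a₃ h α + (α * A₂ h α) ^ 2 +
      x * (2 * jetParam A₁ h α * R h x α + 2 * (α * A₂ h α) * a₃ h α) +
      x ^ 2 * (2 * (α * A₂ h α) * R h x α + a₃ h α ^ 2) + 2 * x ^ 3 * a₃ h α * R h x α +
      x ^ 4 * R h x α ^ 2) -
    jetCubic A₁ A₂ a₃ h α * (3 * jetQuad A₁ A₂ h α + 3 * jetQuad A₁ A₂ h α ^ 2 * x +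
      jetQuad A₁ A₂ h α ^ 3 * x ^ 2)) *
  (jetScale s A₁ A₂ a₃ h α ^ 3 * (1 + jetQuad A₁ A₂ h α * x) ^ 4)⁻¹

/-- The algebra of the coordinate change `κ (x + c x²)`: the choice of `c` removes the quadratic
term, the cubic coefficient becomes `k₃` and is scaled to `s`, and the remaining terms are divisible
by the fourth power of the new coordinate. -/
theorem chart_transforms_algebra {s h b a₂ a₃ c κ x R k₃ T : ℝ} (hc : a₂ + c * b * (1 + h * b) = 0)
    (hk : k₃ = a₃ + 2 * c * a₂ * (1 + h * b)) (hκ : s * κ ^ 2 = k₃) (hκ0 : κ ≠ 0)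
    (hx : 1 + c * x ≠ 0)
    (hT : T = (R + 2 * c * (a₃ + x * R) + c * h * (2 * b * a₃ + a₂ ^ 2 +
      x * (2 * b * R + 2 * a₂ * a₃) + x ^ 2 * (2 * a₂ * R + a₃ ^ 2) + 2 * x ^ 3 * a₃ * R +
      x ^ 4 * R ^ 2) - k₃ * (3 * c + 3 * c ^ 2 * x + c ^ 3 * x ^ 2)) *
      (κ ^ 3 * (1 + c * x) ^ 4)⁻¹) :
    κ * ((x + h * (b * x + a₂ * x ^ 2 + a₃ * x ^ 3 + x ^ 4 * R)) +
      c * (x + h * (b * x + a₂ * x ^ 2 + a₃ * x ^ 3 + x ^ 4 * R)) ^ 2) =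
    (1 + h * b) * (κ * (x + c * x ^ 2)) + s * h * (κ * (x + c * x ^ 2)) ^ 3 +
      h * (κ * (x + c * x ^ 2)) ^ 4 * T := by
  have h4 : (κ * (x + c * x ^ 2)) ^ 4 * T = κ * x ^ 4 * (R + 2 * c * (a₃ + x * R) +
      c * h * (2 * b * a₃ + a₂ ^ 2 +
      x * (2 * b * R + 2 * a₂ * a₃) + x ^ 2 * (2 * a₂ * R + a₃ ^ 2) + 2 * x ^ 3 * a₃ * R +
      x ^ 4 * R ^ 2) - k₃ * (3 * c + 3 * c ^ 2 * x + c ^ 3 * x ^ 2)) := by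
    rw [hT]
    have : x + c * x ^ 2 = x * (1 + c * x) := by ring
    rw [this]
    generalize R + 2 * c * (a₃ + x * R) + _ - _ = X
    generalize 1 + c * x = Y at hx
    field_simp
  rw [mul_assoc h, h4]
  linear_combination (κ * h * x ^ 2) * hc - (h * κ * x ^ 3 * (1 + c * x) ^ 3) * hκ -
    (h * κ * x ^ 3) * hk

/-- Quantitative nondegeneracy of an expansion on a small box, with a common lower bound `m`. The
signs `s` and `σ` are those of the cubic coefficient and of the `α`-derivative of the linear one. -/
structure IsGoodJet (m s σ h₀ ε₀ α₀ : ℝ) (A₁ A₂ a₃ : ℝ → ℝ → ℝ) : Prop where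
  A₁_lower : ∀ h ∈ Icc 0 h₀, ∀ α ∈ Icc (-α₀) α₀, m ≤ |A₁ h α|
  param_expand : ∀ h ∈ Icc 0 h₀, ∀ α ∈ Icc (-α₀) α₀, ∀ α' ∈ Icc (-α₀) α₀, α' ≤ α →
    m * (α - α') ≤ σ * jetParam A₁ h α - σ * jetParam A₁ h α'
  param_lower : ∀ h ∈ Icc 0 h₀, ∀ α ∈ Icc (-α₀) α₀, 1 / 2 ≤ 1 + h * jetParam A₁ h α
  cubic_lower : ∀ h ∈ Icc 0 h₀, ∀ α ∈ Icc (-α₀) α₀, m ≤ s * jetCubic A₁ A₂ a₃ h α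
  quad_small : ∀ h ∈ Icc 0 h₀, ∀ α ∈ Icc (-α₀) α₀, |jetQuad A₁ A₂ h α| * ε₀ ≤ 1 / 8

theorem IsGoodJet.mono {m m' s σ h₀ ε₀ α₀ : ℝ} {A₁ A₂ a₃ : ℝ → ℝ → ℝ}
    (hg : IsGoodJet m s σ h₀ ε₀ α₀ A₁ A₂ a₃) (hm : m' ≤ m) :
    IsGoodJet m' s σ h₀ ε₀ α₀ A₁ A₂ a₃ :=
  ⟨fun h hh α hα => hm.trans (hg.A₁_lower h hh α hα),
    fun h hh α hα α' hα' hle => (mul_le_mul_of_nonneg_right hm (sub_nonneg.2 hle)).trans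
      (hg.param_expand h hh α hα α' hα' hle), hg.param_lower,
    fun h hh α hα => hm.trans (hg.cubic_lower h hh α hα), hg.quad_small⟩

theorem exists_lower_near_zero {H A : ℝ} {u : ℝ → ℝ → ℝ}
    (hH : 0 < H) (hA : 0 < A)
    (hu : ContinuousOn (fun q : ℝ × ℝ => u q.1 q.2) (Icc 0 H ×ˢ Icc (-A) A)) (h0 : 0 < u 0 0) :
    ∃ δ > 0, ∀ h ∈ Icc 0 H, ∀ α ∈ Icc (-A) A, h ≤ δ → |α| ≤ δ → u 0 0 / 2 ≤ u h α := by
  have h1 := hu (0, 0) ⟨⟨le_rfl, hH.le⟩, ⟨by linarith, hA.le⟩⟩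
  rw [Metric.continuousWithinAt_iff] at h1
  obtain ⟨δ, hδ, h2⟩ := h1 (u 0 0 / 2) (by linarith)
  refine ⟨δ / 2, by linarith, fun h hh α hα hhδ hαδ => ?_⟩
  have h3 := h2 (x := (h, α)) ⟨hh, hα⟩ (by
    rw [Prod.dist_eq, Real.dist_eq, Real.dist_eq, sub_zero, sub_zero, abs_of_nonneg hh.1]
    exact max_lt (by linarith) (by linarith))
  rw [Real.dist_eq, abs_lt] at h3
  simp only at h3
  linarith [h3.1]

theorem IsJet.mono {n : ℕ} {M : ℝ → ℝ → ℝ → ℝ} {H E A h₀ ε₀ α₀ : ℝ} {A₁ A₂ a₃ : ℝ → ℝ → ℝ}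
    {R : ℝ → ℝ → ℝ → ℝ} (hj : IsJet n M H E A A₁ A₂ a₃ R) (hh : h₀ ≤ H) (hε : ε₀ ≤ E)
    (hα : α₀ ≤ A) : IsJet n M h₀ ε₀ α₀ A₁ A₂ a₃ R := by
  have hs : Icc 0 h₀ ×ˢ Icc (-α₀) α₀ ⊆ Icc 0 H ×ˢ Icc (-A) A :=
    prod_mono (Icc_subset_Icc_right hh) (Icc_subset_Icc (by linarith) hα)
  exact ⟨hj.A₁_smooth.mono hs, hj.A₂_smooth.mono hs, hj.a₃_smooth.mono hs,
    ContDiffOn.mono hj.R_smooth (box_mono hh hε hα), fun h hh' x hx α hα' =>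
    hj.expand h (Icc_subset_Icc_right hh hh') x (Icc_subset_Icc (by linarith) hε hx) α
      (Icc_subset_Icc (by linarith) hα hα')⟩

theorem abs_expansion_le {h x b a₂ a₃ R B δ : ℝ} (hh : 0 ≤ h) (hhδ : h ≤ δ) (hx : |x| ≤ 1)
    (hb : |b| ≤ B) (ha₂ : |a₂| ≤ B) (ha₃ : |a₃| ≤ B) (hR : |R| ≤ B) (hδ : δ * (8 * B) ≤ 1) :
    |x + h * (b * x + a₂ * x ^ 2 + a₃ * x ^ 3 + x ^ 4 * R)| ≤ 2 * |x| := by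
  have h5 : x + h * (b * x + a₂ * x ^ 2 + a₃ * x ^ 3 + x ^ 4 * R) =
    x * (1 + h * (b + a₂ * x + a₃ * x ^ 2 + x ^ 3 * R)) := by ring
  rw [h5, abs_mul, mul_comm]
  refine mul_le_mul_of_nonneg_right ?_ (abs_nonneg _)
  refine (abs_add_le _ _).trans ?_
  rw [abs_one, abs_mul, abs_of_nonneg hh]
  have h6 : |b + a₂ * x + a₃ * x ^ 2 + x ^ 3 * R| ≤ 4 * B := by
    have k2 : |a₂ * x| ≤ B := by
      rw [abs_mul]
      exact (mul_le_of_le_one_right (abs_nonneg _) hx).trans ha₂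
    have k3 : |a₃ * x ^ 2| ≤ B := by
      rw [abs_mul, abs_pow]
      exact (mul_le_of_le_one_right (abs_nonneg _) (pow_le_one₀ (abs_nonneg _) hx)).trans ha₃
    have k4 : |x ^ 3 * R| ≤ B := by
      rw [abs_mul, abs_pow]
      exact (mul_le_of_le_one_left (abs_nonneg _) (pow_le_one₀ (abs_nonneg _) hx)).trans hR
    calc _ ≤ |b| + |a₂ * x| + |a₃ * x ^ 2| + |x ^ 3 * R| :=
          (abs_add_le _ _).trans (add_le_add ((abs_add_le _ _).trans
            (add_le_add (abs_add_le _ _) le_rfl)) le_rfl)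
      _ ≤ 4 * B := by linarith
  have h7 : h * |b + a₂ * x + a₃ * x ^ 2 + x ^ 3 * R| ≤ δ * (4 * B) :=
    mul_le_mul hhδ h6 (abs_nonneg _) (hh.trans hhδ)
  linarith

/-- A nondegenerate expansion is quantitatively nondegenerate on every sufficiently small box, where
moreover the map at most doubles `|x|`. -/
theorem IsJet.exists_good {n : ℕ} (hn : 1 ≤ n) {M : ℝ → ℝ → ℝ → ℝ} {H E A : ℝ}
    {A₁ A₂ a₃ : ℝ → ℝ → ℝ} {R : ℝ → ℝ → ℝ → ℝ} (hH : 0 < H) (hA : 0 < A)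
    (hj : IsJet n M H E A A₁ A₂ a₃ R) {s σ : ℝ} (hs : s = 1 ∨ s = -1) (hσ : σ = 1 ∨ σ = -1)
    (hA₁ : 0 < σ * A₁ 0 0) (ha₃ : 0 < s * a₃ 0 0) :
    ∃ δ > 0, ∃ m > 0, ∀ h₀ ≤ H, ∀ ε₀ ≤ E, ∀ α₀ ≤ A, h₀ ≤ δ → ε₀ ≤ δ → α₀ ≤ δ →
      IsGoodJet m s σ h₀ ε₀ α₀ A₁ A₂ a₃ ∧
      ∀ h ∈ Icc 0 h₀, ∀ x ∈ Icc (-ε₀) ε₀, ∀ α ∈ Icc (-α₀) α₀, |M h x α| ≤ 2 * |x| := by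
  have hrect : IsCompact (Icc (0:ℝ) H ×ˢ Icc (-A) A) := isCompact_Icc.prod isCompact_Icc
  obtain ⟨B₁, hB₁⟩ := hrect.exists_bound_of_continuousOn hj.A₁_smooth.continuousOn
  obtain ⟨B₂, hB₂⟩ := hrect.exists_bound_of_continuousOn hj.A₂_smooth.continuousOn
  obtain ⟨B₃, hB₃⟩ := hrect.exists_bound_of_continuousOn hj.a₃_smooth.continuousOn
  obtain ⟨B₄, hB40, hB₄⟩ := exists_bound_box (ContDiffOn.continuousOn hj.R_smooth)
  obtain ⟨L, hL0, hL⟩ := exists_lipschitz_of_contDiffOn hrect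
    ((convex_Icc _ _).prod (convex_Icc _ _))
    ((uniqueDiffOn_Icc hH).prod (uniqueDiffOn_Icc (show -A < A by linarith)))
    (hj.A₁_smooth.of_le (by exact_mod_cast hn))
  set B := max (max 1 B₁) (max B₂ (max B₃ B₄)) with hB
  have hB1 : 1 ≤ B := (le_max_left _ _).trans (le_max_left _ _)
  have hb₁ : ∀ h ∈ Icc 0 H, ∀ α ∈ Icc (-A) A, |A₁ h α| ≤ B := fun h hh α hα =>
    (hB₁ (h, α) ⟨hh, hα⟩).trans ((le_max_right _ _).trans (le_max_left _ _))
  have hb₂ : ∀ h ∈ Icc 0 H, ∀ α ∈ Icc (-A) A, |A₂ h α| ≤ B := fun h hh α hα =>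
    (hB₂ (h, α) ⟨hh, hα⟩).trans ((le_max_left _ _).trans (le_max_right _ _))
  have hb₃ : ∀ h ∈ Icc 0 H, ∀ α ∈ Icc (-A) A, |a₃ h α| ≤ B := fun h hh α hα =>
    (hB₃ (h, α) ⟨hh, hα⟩).trans ((le_max_left _ _).trans ((le_max_right _ _).trans
      (le_max_right _ _)))
  have hb₄ : ∀ h ∈ Icc 0 H, ∀ x ∈ Icc (-E) E, ∀ α ∈ Icc (-A) A, |R h x α| ≤ B :=
    fun h hh x hx α hα => (hB₄ (h, x, α) (mem_box.2 ⟨hh, hx, hα⟩)).trans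
      ((le_max_right _ _).trans ((le_max_right _ _).trans (le_max_right _ _)))
  obtain ⟨δ₁, hδ₁, hlow₁⟩ := exists_lower_near_zero (u := fun h α => σ * A₁ h α) hH hA
    (continuousOn_const.mul hj.A₁_smooth.continuousOn) hA₁
  obtain ⟨δ₃, hδ₃, hlow₃⟩ := exists_lower_near_zero (u := fun h α => s * a₃ h α) hH hA
    (continuousOn_const.mul hj.a₃_smooth.continuousOn) ha₃
  set m₁ := σ * A₁ 0 0 / 2 with hm₁
  set m₃ := s * a₃ 0 0 / 2 with hm₃
  have hm₁0 : 0 < m₁ := by rw [hm₁]; linarith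
  have hσ1 : |σ| = 1 := by rcases hσ with h | h <;> simp [h]
  have hs1 : |s| = 1 := by rcases hs with h | h <;> simp [h]
  -- all the constraints on the size of the box
  set δ := min (min (min δ₁ δ₃) (min 1 (1 / (8 * B)))) (min (min (m₁ / (2 * (L + 1)))
    (m₁ / (16 * B))) (m₁ * m₃ / (16 * B ^ 2))) with hδ
  have hBpos : 0 < B := by linarith
  refine ⟨δ, by positivity, min (m₁ / 2) (m₃ / 2), by positivity, ?_⟩
  intro h₀ hh₀ ε₀ hε₀ α₀ hα₀ hhδ hεδ hαδ
  have e1 : δ ≤ δ₁ := (min_le_left _ _).trans ((min_le_left _ _).trans (min_le_left _ _))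
  have e3 : δ ≤ δ₃ := (min_le_left _ _).trans ((min_le_left _ _).trans (min_le_right _ _))
  have e4 : δ ≤ 1 := (min_le_left _ _).trans ((min_le_right _ _).trans (min_le_left _ _))
  have e5 : δ * (8 * B) ≤ 1 := by
    rw [← le_div_iff₀ (by positivity)]
    exact (min_le_left _ _).trans ((min_le_right _ _).trans (min_le_right _ _))
  have e6 : δ * (2 * (L + 1)) ≤ m₁ := by
    rw [← le_div_iff₀ (by positivity)]
    exact (min_le_right _ _).trans ((min_le_left _ _).trans (min_le_left _ _))
  have e7 : δ * (16 * B) ≤ m₁ := by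
    rw [← le_div_iff₀ (by positivity)]
    exact (min_le_right _ _).trans ((min_le_left _ _).trans (min_le_right _ _))
  have e8 : δ * (16 * B ^ 2) ≤ m₁ * m₃ := by
    rw [← le_div_iff₀ (by positivity)]
    exact (min_le_right _ _).trans (min_le_right _ _)
  have hδ0 : 0 < δ := by positivity
  have hh' : ∀ h ∈ Icc 0 h₀, h ∈ Icc 0 H := fun h hh => Icc_subset_Icc_right hh₀ hh
  have hα' : ∀ α ∈ Icc (-α₀) α₀, α ∈ Icc (-A) A := fun α hα => Icc_subset_Icc (by linarith) hα₀ hα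
  have hαabs : ∀ α ∈ Icc (-α₀) α₀, |α| ≤ δ := fun α hα => (abs_le.2 hα).trans hαδ
  have hlow1 : ∀ h ∈ Icc 0 h₀, ∀ α ∈ Icc (-α₀) α₀, m₁ ≤ σ * A₁ h α := fun h hh α hα =>
    hlow₁ h (hh' h hh) α (hα' α hα) (hh.2.trans (hhδ.trans e1)) ((hαabs α hα).trans e1)
  have hlow3 : ∀ h ∈ Icc 0 h₀, ∀ α ∈ Icc (-α₀) α₀, m₃ ≤ s * a₃ h α := fun h hh α hα =>
    hlow₃ h (hh' h hh) α (hα' α hα) (hh.2.trans (hhδ.trans e3)) ((hαabs α hα).trans e3)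
  have hA₁l : ∀ h ∈ Icc 0 h₀, ∀ α ∈ Icc (-α₀) α₀, m₁ ≤ |A₁ h α| := fun h hh α hα => by
    have := (hlow1 h hh α hα).trans (le_abs_self _)
    rwa [abs_mul, hσ1, one_mul] at this
  have hpar : ∀ h ∈ Icc 0 h₀, ∀ α ∈ Icc (-α₀) α₀, |jetParam A₁ h α| ≤ δ * B := fun h hh α hα => by
    rw [jetParam, abs_mul]
    exact mul_le_mul (hαabs α hα) (hb₁ h (hh' h hh) α (hα' α hα)) (abs_nonneg _) hδ0.le
  have hlin : ∀ h ∈ Icc 0 h₀, ∀ α ∈ Icc (-α₀) α₀, |h * jetParam A₁ h α| ≤ 1 / 2 :=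
    fun h hh α hα => by
      rw [abs_mul, abs_of_nonneg hh.1]
      have h1 := hpar h hh α hα
      have h2 : h ≤ 1 := hh.2.trans (hhδ.trans e4)
      nlinarith [abs_nonneg (jetParam A₁ h α), hh.1]
  have hlin' : ∀ h ∈ Icc 0 h₀, ∀ α ∈ Icc (-α₀) α₀, 1 / 2 ≤ 1 + h * jetParam A₁ h α :=
    fun h hh α hα => by linarith [(abs_le.1 (hlin h hh α hα)).1]
  have hquad : ∀ h ∈ Icc 0 h₀, ∀ α ∈ Icc (-α₀) α₀, |jetQuad A₁ A₂ h α| * m₁ ≤ 2 * B :=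
    fun h hh α hα => by
      have h1 := hlin' h hh α hα
      have h2 := hA₁l h hh α hα
      have h3 := hb₂ h (hh' h hh) α (hα' α hα)
      rw [jetQuad, abs_div, abs_neg, abs_mul,
        abs_of_pos (show 0 < 1 + h * jetParam A₁ h α by linarith), div_mul_eq_mul_div,
        div_le_iff₀ (mul_pos (hm₁0.trans_le h2) (by linarith))]
      have h4 : m₁ * (1 / 2) ≤ |A₁ h α| * (1 + h * jetParam A₁ h α) :=
        mul_le_mul h2 h1 (by norm_num) (abs_nonneg _)
      have h5 : |A₂ h α| * m₁ ≤ B * m₁ := mul_le_mul_of_nonneg_right h3 hm₁0.le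
      have h6 := mul_le_mul_of_nonneg_left h4 hBpos.le
      linarith
  refine ⟨⟨fun h hh α hα => ?_, fun h hh α hα β hβ hle => ?_, hlin', fun h hh α hα => ?_,
    fun h hh α hα => ?_⟩, fun h hh x hx α hα => ?_⟩
  · refine (min_le_left _ _).trans (le_trans ?_ (hA₁l h hh α hα))
    linarith
  · have h1 := hlow1 h hh α hα
    have h2 := hL (h, α) ⟨hh' h hh, hα' α hα⟩ (h, β) ⟨hh' h hh, hα' β hβ⟩
    simp only [Prod.mk_sub_mk, sub_self, Prod.norm_mk, norm_zero, Real.norm_eq_abs,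
      abs_nonneg, sup_of_le_right] at h2
    have h3 : |σ * (β * (A₁ h α - A₁ h β))| ≤ δ * (L * |α - β|) := by
      rw [abs_mul, hσ1, one_mul, abs_mul]
      exact mul_le_mul (hαabs β hβ) h2 (abs_nonneg _) hδ0.le
    rw [abs_of_nonneg (sub_nonneg.2 hle)] at h3
    have h4 := neg_le_of_abs_le h3
    have h5 : min (m₁ / 2) (m₃ / 2) * (α - β) ≤ m₁ / 2 * (α - β) :=
      mul_le_mul_of_nonneg_right (min_le_left _ _) (sub_nonneg.2 hle)
    have h6 : m₁ * (α - β) ≤ σ * A₁ h α * (α - β) :=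
      mul_le_mul_of_nonneg_right h1 (sub_nonneg.2 hle)
    have h7 : δ * L * (α - β) ≤ m₁ / 2 * (α - β) :=
      mul_le_mul_of_nonneg_right (by nlinarith) (sub_nonneg.2 hle)
    simp only [jetParam]
    have h8 : σ * (α * A₁ h α) - σ * (β * A₁ h β) =
      σ * A₁ h α * (α - β) + σ * (β * (A₁ h α - A₁ h β)) := by ring
    rw [h8]
    linarith
  · have h1 := hlow3 h hh α hα
    have h2 : |s * (2 * jetQuad A₁ A₂ h α * (α * A₂ h α) * (1 + h * jetParam A₁ h α))| ≤
        m₃ / 2 := by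
      rw [abs_mul, hs1, one_mul, abs_mul, abs_mul, abs_mul, abs_mul]
      have h3 := hquad h hh α hα
      have h4 : |1 + h * jetParam A₁ h α| ≤ 2 := by
        refine (abs_add_le _ _).trans ?_
        rw [abs_one]; linarith [hlin h hh α hα]
      have h5 : |α| * |A₂ h α| ≤ δ * B :=
        mul_le_mul (hαabs α hα) (hb₂ h (hh' h hh) α (hα' α hα)) (abs_nonneg _) hδ0.le
      rw [abs_two]
      have h6 : |jetQuad A₁ A₂ h α| ≤ 2 * B / m₁ := by rwa [le_div_iff₀ hm₁0]
      calc 2 * |jetQuad A₁ A₂ h α| * (|α| * |A₂ h α|) * |1 + h * jetParam A₁ h α|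
          ≤ 2 * (2 * B / m₁) * (δ * B) * 2 := by gcongr
        _ = δ * (16 * B ^ 2) / (2 * m₁) := by field_simp; ring
        _ ≤ m₁ * m₃ / (2 * m₁) := by gcongr
        _ = m₃ / 2 := by field_simp
    have h3 := neg_le_of_abs_le h2
    refine (min_le_right _ _).trans ?_
    rw [jetCubic, mul_add]
    linarith
  · have h1 := hquad h hh α hα
    rcases le_or_gt ε₀ 0 with hneg | hpos
    · nlinarith [abs_nonneg (jetQuad A₁ A₂ h α)]
    have h2 : |jetQuad A₁ A₂ h α| ≤ 2 * B / m₁ := by rwa [le_div_iff₀ hm₁0]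
    calc |jetQuad A₁ A₂ h α| * ε₀ ≤ 2 * B / m₁ * δ := by gcongr
      _ = δ * (16 * B) / (8 * m₁) := by field_simp; ring
      _ ≤ m₁ / (8 * m₁) := by gcongr
      _ = 1 / 8 := by field_simp
  · have hxE : x ∈ Icc (-E) E := Icc_subset_Icc (by linarith) hε₀ hx
    rw [hj.expand h (hh' h hh) x hxE α (hα' α hα)]
    have hx1 : |x| ≤ 1 := (abs_le.2 hx).trans (hεδ.trans e4)
    have h1 := hpar h hh α hα
    have h2 : |α * A₂ h α| ≤ δ * B := by
      rw [abs_mul]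
      exact mul_le_mul (hαabs α hα) (hb₂ h (hh' h hh) α (hα' α hα)) (abs_nonneg _) hδ0.le
    have h3 := hb₃ h (hh' h hh) α (hα' α hα)
    have h4 := hb₄ h (hh' h hh) x hxE α (hα' α hα)
    have hδB : δ * B ≤ B := mul_le_of_le_one_left hBpos.le e4
    exact abs_expansion_le hh.1 (hh.2.trans hhδ) hx1 (h1.trans hδB) (h2.trans hδB) h3 h4 e5

/-! ### Smoothness and invertibility of the coordinate changes -/

section
variable {n : ℕ} {M : ℝ → ℝ → ℝ → ℝ} {m s σ h₀ ε₀ α₀ : ℝ} {A₁ A₂ a₃ : ℝ → ℝ → ℝ}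
  {R : ℝ → ℝ → ℝ → ℝ}

theorem IsJet.param_smooth (hj : IsJet n M h₀ ε₀ α₀ A₁ A₂ a₃ R) :
    ContDiffOn ℝ n (fun q : ℝ × ℝ => jetParam A₁ q.1 q.2) (Icc 0 h₀ ×ˢ Icc (-α₀) α₀) :=
  contDiffOn_snd.mul hj.A₁_smooth

theorem IsJet.quad_smooth (hj : IsJet n M h₀ ε₀ α₀ A₁ A₂ a₃ R) (hm : 0 < m)
    (hg : IsGoodJet m s σ h₀ ε₀ α₀ A₁ A₂ a₃) :
    ContDiffOn ℝ n (fun q : ℝ × ℝ => jetQuad A₁ A₂ q.1 q.2) (Icc 0 h₀ ×ˢ Icc (-α₀) α₀) := by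
  refine hj.A₂_smooth.neg.div (hj.A₁_smooth.mul
    (contDiffOn_const.add (contDiffOn_fst.mul hj.param_smooth))) (fun q hq => ?_)
  refine mul_ne_zero (abs_pos.1 (hm.trans_le (hg.A₁_lower _ hq.1 _ hq.2))) ?_
  have := hg.param_lower _ hq.1 _ hq.2
  exact ne_of_gt (by linarith)

theorem IsJet.cubic_smooth (hj : IsJet n M h₀ ε₀ α₀ A₁ A₂ a₃ R) (hm : 0 < m)
    (hg : IsGoodJet m s σ h₀ ε₀ α₀ A₁ A₂ a₃) :
    ContDiffOn ℝ n (fun q : ℝ × ℝ => jetCubic A₁ A₂ a₃ q.1 q.2) (Icc 0 h₀ ×ˢ Icc (-α₀) α₀) :=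
  hj.a₃_smooth.add (((contDiffOn_const.mul (hj.quad_smooth hm hg)).mul
    (contDiffOn_snd.mul hj.A₂_smooth)).mul
      (contDiffOn_const.add (contDiffOn_fst.mul hj.param_smooth)))

theorem IsJet.scale_smooth (hj : IsJet n M h₀ ε₀ α₀ A₁ A₂ a₃ R) (hm : 0 < m)
    (hg : IsGoodJet m s σ h₀ ε₀ α₀ A₁ A₂ a₃) :
    ContDiffOn ℝ n (fun q : ℝ × ℝ => jetScale s A₁ A₂ a₃ q.1 q.2) (Icc 0 h₀ ×ˢ Icc (-α₀) α₀) :=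
  (contDiffOn_const.mul (hj.cubic_smooth hm hg)).sqrt
    (fun _ hq => (hm.trans_le (hg.cubic_lower _ hq.1 _ hq.2)).ne')

theorem contDiffOn_rect_to_box {u : ℝ → ℝ → ℝ}
    (hu : ContDiffOn ℝ n (fun q : ℝ × ℝ => u q.1 q.2) (Icc 0 h₀ ×ˢ Icc (-α₀) α₀)) :
    ContDiffOn ℝ n (fun q : ℝ × ℝ × ℝ => u q.1 q.2.2) (box h₀ ε₀ α₀) :=
  hu.comp (f := fun q : ℝ × ℝ × ℝ => (q.1, q.2.2)) (ContDiff.contDiffOn (by fun_prop))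
    (fun q hq => ⟨hq.1, hq.2.2⟩)

theorem IsJet.chart_smooth (hj : IsJet n M h₀ ε₀ α₀ A₁ A₂ a₃ R) (hm : 0 < m)
    (hg : IsGoodJet m s σ h₀ ε₀ α₀ A₁ A₂ a₃) :
    SmoothOnBox n (jetChart s A₁ A₂ a₃) h₀ ε₀ α₀ := by
  have hx : ContDiffOn ℝ n (fun q : ℝ × ℝ × ℝ => q.2.1) (box h₀ ε₀ α₀) :=
    ContDiff.contDiffOn (by fun_prop)
  exact (contDiffOn_rect_to_box (hj.scale_smooth hm hg)).mul
    (hx.add ((contDiffOn_rect_to_box (hj.quad_smooth hm hg)).mul (hx.pow 2)))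

theorem IsGoodJet.scale_lower (hg : IsGoodJet m s σ h₀ ε₀ α₀ A₁ A₂ a₃) {h α : ℝ}
    (hh : h ∈ Icc 0 h₀) (hα : α ∈ Icc (-α₀) α₀) : Real.sqrt m ≤ jetScale s A₁ A₂ a₃ h α :=
  Real.sqrt_le_sqrt (hg.cubic_lower h hh α hα)

theorem IsGoodJet.abs_quad_mul_le (hg : IsGoodJet m s σ h₀ ε₀ α₀ A₁ A₂ a₃) {h x α : ℝ}
    (hh : h ∈ Icc 0 h₀) (hx : x ∈ Icc (-ε₀) ε₀) (hα : α ∈ Icc (-α₀) α₀) :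
    |jetQuad A₁ A₂ h α * x| ≤ 1 / 8 := by
  rw [abs_mul]
  exact (mul_le_mul_of_nonneg_left (abs_le.2 hx) (abs_nonneg _)).trans (hg.quad_small h hh α hα)

theorem IsJet.tail_smooth (hj : IsJet n M h₀ ε₀ α₀ A₁ A₂ a₃ R) (hm : 0 < m)
    (hg : IsGoodJet m s σ h₀ ε₀ α₀ A₁ A₂ a₃) :
    SmoothOnBox n (jetTail s A₁ A₂ a₃ R) h₀ ε₀ α₀ := by
  have hx : ContDiffOn ℝ n (fun q : ℝ × ℝ × ℝ => q.2.1) (box h₀ ε₀ α₀) :=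
    ContDiff.contDiffOn (by fun_prop)
  have hh : ContDiffOn ℝ n (fun q : ℝ × ℝ × ℝ => q.1) (box h₀ ε₀ α₀) :=
    ContDiff.contDiffOn (by fun_prop)
  have hα : ContDiffOn ℝ n (fun q : ℝ × ℝ × ℝ => q.2.2) (box h₀ ε₀ α₀) :=
    ContDiff.contDiffOn (by fun_prop)
  have hκ := contDiffOn_rect_to_box (ε₀ := ε₀) (hj.scale_smooth hm hg)
  have hc := contDiffOn_rect_to_box (ε₀ := ε₀) (hj.quad_smooth hm hg)
  have hk := contDiffOn_rect_to_box (ε₀ := ε₀) (hj.cubic_smooth hm hg)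
  have hb := contDiffOn_rect_to_box (ε₀ := ε₀) hj.param_smooth
  have h3 := contDiffOn_rect_to_box (ε₀ := ε₀) hj.a₃_smooth
  have h2 := hα.mul (contDiffOn_rect_to_box (ε₀ := ε₀) hj.A₂_smooth)
  have hR : ContDiffOn ℝ n (fun q : ℝ × ℝ × ℝ => R q.1 q.2.1 q.2.2) (box h₀ ε₀ α₀) := hj.R_smooth
  have two : ∀ c : ℝ, ContDiffOn ℝ n (fun _ : ℝ × ℝ × ℝ => c) (box h₀ ε₀ α₀) :=
    fun c => contDiffOn_const
  refine ContDiffOn.mul ?_ (ContDiffOn.inv ((hκ.pow 3).mul (((two 1).add (hc.mul hx)).pow 4)) ?_)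
  · exact ((hR.add (((two 2).mul hc).mul (h3.add (hx.mul hR)))).add ((hc.mul hh).mul
      (((((((two 2).mul hb).mul h3).add (h2.pow 2)).add
        (hx.mul ((((two 2).mul hb).mul hR).add (((two 2).mul h2).mul h3)))).add
        ((hx.pow 2).mul ((((two 2).mul h2).mul hR).add (h3.pow 2)))).add
        ((((two 2).mul (hx.pow 3)).mul h3).mul hR) |>.add ((hx.pow 4).mul (hR.pow 2))))).sub
      (hk.mul ((((two 3).mul hc).add (((two 3).mul (hc.pow 2)).mul hx)).add
        ((hc.pow 3).mul (hx.pow 2))))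
  · intro q hq
    have h1 := (Real.sqrt_pos.2 hm).trans_le (hg.scale_lower hq.1 hq.2.2)
    have h2 := (abs_le.1 (hg.abs_quad_mul_le hq.1 hq.2.1 hq.2.2)).1
    have h3 : 0 < 1 + jetQuad A₁ A₂ q.1 q.2.2 * q.2.1 := by linarith
    positivity

theorem IsGoodJet.chart_expand (hg : IsGoodJet m s σ h₀ ε₀ α₀ A₁ A₂ a₃) {h α : ℝ}
    (hh : h ∈ Icc 0 h₀) (hα : α ∈ Icc (-α₀) α₀) {x x' : ℝ} (hx : x ∈ Icc (-ε₀) ε₀)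
    (hx' : x' ∈ Icc (-ε₀) ε₀) (hle : x' ≤ x) :
    Real.sqrt m / 2 * (x - x') ≤ jetChart s A₁ A₂ a₃ h x α - jetChart s A₁ A₂ a₃ h x' α := by
  have h1 := (abs_le.1 (hg.abs_quad_mul_le hh hx hα)).1
  have h2 := (abs_le.1 (hg.abs_quad_mul_le hh hx' hα)).1
  have h3 := hg.scale_lower hh hα
  have h4 : jetChart s A₁ A₂ a₃ h x α - jetChart s A₁ A₂ a₃ h x' α =
    jetScale s A₁ A₂ a₃ h α * (1 + jetQuad A₁ A₂ h α * x + jetQuad A₁ A₂ h α * x') * (x - x') := by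
    simp only [jetChart]; ring
  rw [h4]
  refine mul_le_mul_of_nonneg_right ?_ (sub_nonneg.2 hle)
  rw [div_eq_mul_one_div]
  exact mul_le_mul h3 (by linarith) (by norm_num) ((Real.sqrt_nonneg m).trans h3)

/-- The normal form of a map with a nondegenerate expansion. The tail `r` is the one computed in the
original coordinates, transported by the coordinate and parameter changes. -/
theorem IsJet.exists_reduction (hn : 1 ≤ n) (hh₀ : 0 < h₀) (hε₀ : 0 < ε₀) (hα₀ : 0 < α₀)
    (hm : 0 < m) (hs : s = 1 ∨ s = -1) (hσ : σ = 1 ∨ σ = -1)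
    (hj : IsJet n M h₀ ε₀ α₀ A₁ A₂ a₃ R) (hg : IsGoodJet m s σ h₀ ε₀ α₀ A₁ A₂ a₃) :
    ∃ r, IsReduction n s M h₀ ε₀ α₀ (Real.sqrt m / 2 * ε₀ / 2) (m * α₀) (jetChart s A₁ A₂ a₃)
        (jetParam A₁) r ∧
      (∀ h ∈ Icc 0 h₀, ∀ α ∈ Icc (-α₀) α₀,
        ∀ y ∈ Icc (-(Real.sqrt m / 2 * ε₀ / 2)) (Real.sqrt m / 2 * ε₀ / 2),
        ∃ x ∈ Icc (-(ε₀ / 2)) (ε₀ / 2), jetChart s A₁ A₂ a₃ h x α = y) ∧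
      ∀ h ∈ Icc 0 h₀, ∀ β ∈ Icc (-(m * α₀)) (m * α₀), ∃ α ∈ Icc (-α₀) α₀, jetParam A₁ h α = β ∧
        ∀ y ∈ Icc (-(Real.sqrt m / 2 * ε₀ / 2)) (Real.sqrt m / 2 * ε₀ / 2),
        ∃ x ∈ Icc (-(ε₀ / 2)) (ε₀ / 2), jetChart s A₁ A₂ a₃ h x α = y ∧
          r h y β = jetTail s A₁ A₂ a₃ R h x α := by
  have hσ2 : σ * σ = 1 := by rcases hσ with h | h <;> simp [h]
  have hs2 : s * s = 1 := by rcases hs with h | h <;> simp [h]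
  set μ := Real.sqrt m / 2 with hμ
  have hμ0 : 0 < μ := by have := Real.sqrt_pos.2 hm; positivity
  set K : Set (ℝ × ℝ) := Icc 0 h₀ ×ˢ Icc (-α₀) α₀ with hK
  have hKc : IsCompact K := isCompact_Icc.prod isCompact_Icc
  have hKconv : Convex ℝ K := (convex_Icc _ _).prod (convex_Icc _ _)
  have hKu : UniqueDiffOn ℝ K := (uniqueDiffOn_Icc hh₀).prod (uniqueDiffOn_Icc (by linarith))
  -- `ξ` inverts the coordinate change, `v` the parameter change after multiplication by `σ`
  obtain ⟨ξ, hξ, hξs⟩ := exists_param_inverse hKc hKconv hKu hε₀ hμ0 hn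
    (u := fun q x => jetChart s A₁ A₂ a₃ q.1 x q.2)
    ((hj.chart_smooth hm hg).comp (f := fun z : (ℝ × ℝ) × ℝ => (z.1.1, z.2, z.1.2))
      (ContDiff.contDiffOn (by fun_prop)) (fun z hz => mem_box.2 ⟨hz.1.1, hz.2, hz.1.2⟩))
    (fun q hq x hx x' hx' hle => hg.chart_expand hq.1 hq.2 hx hx' hle)
    (fun q _ => by simp [jetChart])
  obtain ⟨v, hv, hvs⟩ := exists_param_inverse isCompact_Icc (convex_Icc 0 h₀)
    (uniqueDiffOn_Icc hh₀) hα₀ hm hn (u := fun h α => σ * jetParam A₁ h α)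
    (contDiffOn_const.mul hj.param_smooth)
    (fun h hh α hα α' hα' hle => hg.param_expand h hh α hα α' hα' hle)
    (fun h _ => by simp [jetParam])
  have hσmem : ∀ β ∈ Icc (-(m * α₀)) (m * α₀), σ * β ∈ Icc (-(m * α₀)) (m * α₀) := by
    intro β hβ
    rw [mem_Icc] at hβ ⊢
    rcases hσ with h | h
    · rw [h, one_mul]; exact hβ
    · rw [h]; constructor <;> linarith [hβ.1, hβ.2]
  have hσcancel : ∀ a b : ℝ, σ * a = σ * b → a = b := fun a b hab => by
    have : σ * (σ * a) = σ * (σ * b) := by rw [hab]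
    rwa [← mul_assoc, ← mul_assoc, hσ2, one_mul, one_mul] at this
  set w : ℝ → ℝ → ℝ := fun h β => v h (σ * β) with hw
  have hwmem : ∀ h ∈ Icc 0 h₀, ∀ β ∈ Icc (-(m * α₀)) (m * α₀), w h β ∈ Icc (-α₀) α₀ ∧
      jetParam A₁ h (w h β) = β := fun h hh β hβ => by
    obtain ⟨k1, _, k3⟩ := hv h hh (σ * β) (hσmem β hβ)
    exact ⟨k1, hσcancel _ _ k3⟩
  have hεle : μ * ε₀ / 2 ≤ μ * ε₀ := by have := mul_pos hμ0 hε₀; linarith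
  have hsub : Icc (-(μ * ε₀ / 2)) (μ * ε₀ / 2) ⊆ Icc (-(μ * ε₀)) (μ * ε₀) :=
    Icc_subset_Icc (by linarith) hεle
  have hws : ContDiffOn ℝ n (fun q : ℝ × ℝ => w q.1 q.2) (Icc 0 h₀ ×ˢ Icc (-(m * α₀)) (m * α₀)) :=
    hvs.comp (f := fun q : ℝ × ℝ => (q.1, σ * q.2)) (ContDiff.contDiffOn (by fun_prop))
      (fun q hq => ⟨hq.1, hσmem _ hq.2⟩)
  have hchart_inj : ∀ h ∈ Icc 0 h₀, ∀ α ∈ Icc (-α₀) α₀,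
      InjOn (fun x => jetChart s A₁ A₂ a₃ h x α) (Icc (-ε₀) ε₀) := by
    intro h hh α hα x hx x' hx' heq
    have heq' : jetChart s A₁ A₂ a₃ h x α = jetChart s A₁ A₂ a₃ h x' α := heq
    rcases le_total x' x with hle | hle
    · have := hg.chart_expand hh hα hx hx' hle
      rw [heq', sub_self] at this
      have : x - x' ≤ 0 := by nlinarith
      linarith
    · have := hg.chart_expand hh hα hx' hx hle
      rw [heq', sub_self] at this
      have : x' - x ≤ 0 := by nlinarith
      linarith
  have hparam_inj : ∀ h ∈ Icc 0 h₀, InjOn (jetParam A₁ h) (Icc (-α₀) α₀) := by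
    intro h hh α hα α' hα' heq
    rcases le_total α' α with hle | hle
    · have := hg.param_expand h hh α hα α' hα' hle
      rw [heq, sub_self] at this
      have : α - α' ≤ 0 := by nlinarith
      linarith
    · have := hg.param_expand h hh α' hα' α hα hle
      rw [heq, sub_self] at this
      have : α' - α ≤ 0 := by nlinarith
      linarith
  set r : ℝ → ℝ → ℝ → ℝ := fun h y β =>
    jetTail s A₁ A₂ a₃ R h (ξ (h, w h β) y) (w h β) with hr
  have hne : (n : WithTop ℕ∞) ≠ 0 := by
    have : n ≠ 0 := by omega
    exact_mod_cast this
  -- on half of the range of the coordinate change the preimages lie in `|x| ≤ ε₀ / 2`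
  have hhalf : ∀ h ∈ Icc 0 h₀, ∀ α ∈ Icc (-α₀) α₀, ∀ y ∈ Icc (-(μ * ε₀ / 2)) (μ * ε₀ / 2),
      ξ (h, α) y ∈ Icc (-(ε₀ / 2)) (ε₀ / 2) ∧ jetChart s A₁ A₂ a₃ h (ξ (h, α) y) α = y := by
    intro h hh α hα y hy
    obtain ⟨_, l2, l3⟩ := hξ (h, α) ⟨hh, hα⟩ y (hsub hy)
    refine ⟨abs_le.1 (le_of_mul_le_mul_left ?_ hμ0), l3⟩
    have := l2.trans (abs_le.2 hy)
    linarith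
  refine ⟨r, ⟨hj.chart_smooth hm hg, fun h _ α _ => by simp [jetChart], ?_, ?_, hj.param_smooth,
    fun h _ => by simp [jetParam], ?_, ?_, ?_, ?_⟩, ?_, ?_⟩
  · intro h hh α hα x hx
    have hd : HasDerivAt (fun x => jetChart s A₁ A₂ a₃ h x α)
        (jetScale s A₁ A₂ a₃ h α * (1 + jetQuad A₁ A₂ h α * (2 * x))) x := by
      have h1 := ((hasDerivAt_id x).add (((hasDerivAt_id x).pow 2).const_mul
        (jetQuad A₁ A₂ h α))).const_mul (jetScale s A₁ A₂ a₃ h α)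
      refine HasDerivAt.congr_deriv h1 ?_
      simp
    rw [hd.hasDerivWithinAt.derivWithin (uniqueDiffOn_Icc (by linarith) x hx)]
    have h1 := (abs_le.1 (hg.abs_quad_mul_le hh hx hα)).1
    have h2 := (Real.sqrt_pos.2 hm).trans_le (hg.scale_lower hh hα)
    exact mul_pos h2 (by linarith)
  · intro h hh α hα y hy
    obtain ⟨k1, _, k3⟩ := hξ (h, α) ⟨hh, hα⟩ y (hsub hy)
    exact ⟨_, k1, k3⟩
  · intro h hh α hα
    have hd : DifferentiableWithinAt ℝ (fun α => jetParam A₁ h α) (Icc (-α₀) α₀) α :=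
      (hj.param_smooth.comp (f := fun α : ℝ => (h, α)) (ContDiff.contDiffOn (by fun_prop))
        (fun α hα => ⟨hh, hα⟩)).differentiableOn hne α hα
    have h1 := le_deriv_of_expanding (by linarith) (hd.hasDerivWithinAt.const_mul σ) hα
      (fun x hx x' hx' hle => hg.param_expand h hh x hx x' hx' hle)
    intro h0
    rw [h0, mul_zero] at h1
    linarith
  · intro h hh β hβ
    obtain ⟨k1, k2⟩ := hwmem h hh β hβ
    exact ⟨_, k1, k2⟩
  · have hmap : MapsTo (fun q : ℝ × ℝ × ℝ => ((q.1, w q.1 q.2.2), q.2.1))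
        (box h₀ (μ * ε₀ / 2) (m * α₀)) (K ×ˢ Icc (-(μ * ε₀)) (μ * ε₀)) :=
      fun q hq => ⟨⟨hq.1, (hwmem _ hq.1 _ hq.2.2).1⟩, hsub hq.2.1⟩
    have hw3 : ContDiffOn ℝ n (fun q : ℝ × ℝ × ℝ => w q.1 q.2.2) (box h₀ (μ * ε₀ / 2) (m * α₀)) :=
      contDiffOn_rect_to_box hws
    have hξ3 : ContDiffOn ℝ n (fun q : ℝ × ℝ × ℝ => ξ (q.1, w q.1 q.2.2) q.2.1)
        (box h₀ (μ * ε₀ / 2) (m * α₀)) :=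
      hξs.comp ((contDiffOn_fst.prodMk hw3).prodMk (ContDiff.contDiffOn (by fun_prop))) hmap
    exact (hj.tail_smooth hm hg).comp (contDiffOn_fst.prodMk (hξ3.prodMk hw3))
      (fun q hq => mem_box.2 ⟨hq.1, (hξ _ (hmap hq).1 _ (hmap hq).2).1, (hwmem _ hq.1 _ hq.2.2).1⟩)
  · intro h hh α hα x hx hMx hχ hb
    obtain ⟨k1, k2⟩ := hwmem h hh _ hb
    have hwα : w h (jetParam A₁ h α) = α := hparam_inj h hh k1 hα k2
    obtain ⟨l1, _, l3⟩ := hξ (h, α) ⟨hh, hα⟩ _ (hsub hχ)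
    have hξx : ξ (h, α) (jetChart s A₁ A₂ a₃ h x α) = x := hchart_inj h hh α hα l1 hx l3
    have hrx : r h (jetChart s A₁ A₂ a₃ h x α) (jetParam A₁ h α) =
        jetTail s A₁ A₂ a₃ R h x α := by
      simp only [hr, hwα, hξx]
    rw [normalForm, hrx, hj.expand h hh x hx α hα]
    have hsc := (Real.sqrt_pos.2 hm).trans_le (hg.scale_lower hh hα)
    have hq := (abs_le.1 (hg.abs_quad_mul_le hh hx hα)).1
    have hlin := hg.param_lower h hh α hα
    have hA1 : A₁ h α ≠ 0 := abs_pos.1 (hm.trans_le (hg.A₁_lower h hh α hα))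
    have hκ2 : s * jetScale s A₁ A₂ a₃ h α ^ 2 = jetCubic A₁ A₂ a₃ h α := by
      rw [jetScale, Real.sq_sqrt (hm.le.trans (hg.cubic_lower h hh α hα)), ← mul_assoc, hs2,
        one_mul]
    refine chart_transforms_algebra ?_ rfl hκ2 hsc.ne' (by
      have : 0 < 1 + jetQuad A₁ A₂ h α * x := by linarith
      exact this.ne') rfl
    have hne2 : 1 + h * (α * A₁ h α) ≠ 0 := by
      rw [jetParam] at hlin
      exact ne_of_gt (by linarith)
    rw [jetQuad, jetParam]
    generalize 1 + h * (α * A₁ h α) = Y at hne2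
    field_simp
    ring
  · exact fun h hh α hα y hy => ⟨_, hhalf h hh α hα y hy⟩
  · intro h hh β hβ
    obtain ⟨k1, k2⟩ := hwmem h hh β hβ
    exact ⟨w h β, k1, k2, fun y hy => ⟨_, (hhalf h hh _ k1 y hy).1, (hhalf h hh _ k1 y hy).2, rfl⟩⟩

end

/-! ### Closeness of order `h^p` -/

/-- Two bounded functions on `S` whose difference is `O(h^p)`, where `h` is the first coordinate. -/
def PowClose (p : ℕ) (S : Set (ℝ × ℝ × ℝ)) (u u' : ℝ × ℝ × ℝ → ℝ) : Prop :=
  ∃ C : ℝ, 0 ≤ C ∧ ∀ q ∈ S, |u q| ≤ C ∧ |u' q| ≤ C ∧ |u q - u' q| ≤ C * q.1 ^ p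

namespace PowClose
variable {p : ℕ} {S : Set (ℝ × ℝ × ℝ)} {u u' v v' : ℝ × ℝ × ℝ → ℝ}

theorem of_bound {C : ℝ} (hS : ∀ q ∈ S, 0 ≤ q.1) (hC : ∀ q ∈ S, |u q| ≤ C) : PowClose p S u u := by
  refine ⟨max C 0, le_max_right _ _, fun q hq => ?_⟩
  have h1 := (hC q hq).trans (le_max_left C 0)
  refine ⟨h1, h1, ?_⟩
  rw [sub_self, abs_zero]
  exact mul_nonneg (le_max_right _ _) (pow_nonneg (hS q hq) p)

theorem const (hS : ∀ q ∈ S, 0 ≤ q.1) (c : ℝ) : PowClose p S (fun _ => c) (fun _ => c) :=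
  of_bound hS (fun _ _ => le_rfl)

theorem add (hu : PowClose p S u u') (hv : PowClose p S v v') :
    PowClose p S (fun q => u q + v q) (fun q => u' q + v' q) := by
  obtain ⟨C, hC, h1⟩ := hu
  obtain ⟨D, hD, h2⟩ := hv
  refine ⟨C + D, by linarith, fun q hq => ?_⟩
  obtain ⟨a1, a2, a3⟩ := h1 q hq
  obtain ⟨b1, b2, b3⟩ := h2 q hq
  refine ⟨(abs_add_le _ _).trans (by linarith), (abs_add_le _ _).trans (by linarith), ?_⟩
  have : u q + v q - (u' q + v' q) = (u q - u' q) + (v q - v' q) := by ring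
  rw [this]
  exact (abs_add_le _ _).trans (by linarith)

theorem mul (hu : PowClose p S u u') (hv : PowClose p S v v') :
    PowClose p S (fun q => u q * v q) (fun q => u' q * v' q) := by
  obtain ⟨C, hC, h1⟩ := hu
  obtain ⟨D, hD, h2⟩ := hv
  refine ⟨2 * (C * D), by positivity, fun q hq => ?_⟩
  obtain ⟨a1, a2, a3⟩ := h1 q hq
  obtain ⟨b1, b2, b3⟩ := h2 q hq
  have hCD : 0 ≤ C * D := mul_nonneg hC hD
  refine ⟨?_, ?_, ?_⟩
  · rw [abs_mul]
    have := mul_le_mul a1 b1 (abs_nonneg _) hC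
    linarith
  · rw [abs_mul]
    have := mul_le_mul a2 b2 (abs_nonneg _) hC
    linarith
  · have : u q * v q - u' q * v' q = (u q - u' q) * v q + u' q * (v q - v' q) := by ring
    rw [this]
    refine (abs_add_le _ _).trans ?_
    rw [abs_mul, abs_mul]
    have k1 := mul_le_mul a3 b1 (abs_nonneg _) ((abs_nonneg _).trans a3)
    have k2 := mul_le_mul a2 b3 (abs_nonneg _) hC
    linarith

theorem neg (hu : PowClose p S u u') : PowClose p S (fun q => -u q) (fun q => -u' q) := by
  obtain ⟨C, hC, h1⟩ := hu
  refine ⟨C, hC, fun q hq => ?_⟩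
  obtain ⟨a1, a2, a3⟩ := h1 q hq
  refine ⟨by rwa [abs_neg], by rwa [abs_neg], ?_⟩
  rwa [neg_sub_neg, abs_sub_comm]

theorem sub (hu : PowClose p S u u') (hv : PowClose p S v v') :
    PowClose p S (fun q => u q - v q) (fun q => u' q - v' q) := by
  simpa only [sub_eq_add_neg] using hu.add hv.neg

theorem pow (hS : ∀ q ∈ S, 0 ≤ q.1) (hu : PowClose p S u u') (k : ℕ) :
    PowClose p S (fun q => u q ^ k) (fun q => u' q ^ k) := by
  induction k with
  | zero => simpa using const hS 1
  | succ k ih => simpa only [pow_succ] using ih.mul hu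

theorem inv {m : ℝ} (hm : 0 < m) (hu : PowClose p S u u') (hum : ∀ q ∈ S, m ≤ |u q|)
    (hum' : ∀ q ∈ S, m ≤ |u' q|) : PowClose p S (fun q => (u q)⁻¹) (fun q => (u' q)⁻¹) := by
  obtain ⟨C, hC, h1⟩ := hu
  refine ⟨max m⁻¹ (C / m ^ 2), le_max_of_le_left (by positivity), fun q hq => ?_⟩
  obtain ⟨a1, a2, a3⟩ := h1 q hq
  have k1 := hum q hq
  have k2 := hum' q hq
  have n1 : 0 < |u q| := hm.trans_le k1
  have n2 : 0 < |u' q| := hm.trans_le k2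
  refine ⟨?_, ?_, ?_⟩
  · rw [abs_inv]
    exact (inv_anti₀ hm k1).trans (le_max_left _ _)
  · rw [abs_inv]
    exact (inv_anti₀ hm k2).trans (le_max_left _ _)
  · rw [inv_sub_inv (abs_pos.1 n1) (abs_pos.1 n2), abs_div, abs_mul, abs_sub_comm]
    have h3 : m ^ 2 ≤ |u q| * |u' q| := by rw [sq]; exact mul_le_mul k1 k2 hm.le n1.le
    have h4 : 0 ≤ C * q.1 ^ p := (abs_nonneg _).trans a3
    calc |u q - u' q| / (|u q| * |u' q|) ≤ (C * q.1 ^ p) / m ^ 2 :=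
          div_le_div₀ h4 a3 (by positivity) h3
      _ = C / m ^ 2 * q.1 ^ p := by ring
      _ ≤ max m⁻¹ (C / m ^ 2) * q.1 ^ p := by
          rcases le_or_gt 0 (q.1 ^ p) with h | h
          · exact mul_le_mul_of_nonneg_right (le_max_right _ _) h
          · have hC0 : C = 0 := by nlinarith
            rw [hC0] at h4 a3 a1
            have := abs_nonpos_iff.1 a1
            rw [this, abs_zero] at n1
            exact absurd n1 (lt_irrefl 0)

theorem sqrt {m : ℝ} (hm : 0 < m) (hu : PowClose p S u u') (hum : ∀ q ∈ S, m ≤ u q)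
    (hum' : ∀ q ∈ S, m ≤ u' q) :
    PowClose p S (fun q => Real.sqrt (u q)) (fun q => Real.sqrt (u' q)) := by
  obtain ⟨C, hC, h1⟩ := hu
  have hsm := Real.sqrt_pos.2 hm
  refine ⟨max (Real.sqrt C) (C / Real.sqrt m), le_max_of_le_left (Real.sqrt_nonneg C),
    fun q hq => ?_⟩
  obtain ⟨a1, a2, a3⟩ := h1 q hq
  have k1 := Real.sqrt_le_sqrt (hum q hq)
  have k2 := Real.sqrt_le_sqrt (hum' q hq)
  refine ⟨?_, ?_, ?_⟩
  · rw [abs_of_nonneg (Real.sqrt_nonneg _)]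
    exact (Real.sqrt_le_sqrt ((le_abs_self _).trans a1)).trans (le_max_left _ _)
  · rw [abs_of_nonneg (Real.sqrt_nonneg _)]
    exact (Real.sqrt_le_sqrt ((le_abs_self _).trans a2)).trans (le_max_left _ _)
  · have h3 : (Real.sqrt (u q) - Real.sqrt (u' q)) * (Real.sqrt (u q) + Real.sqrt (u' q)) =
        u q - u' q := by
      have e1 := Real.mul_self_sqrt (hm.le.trans (hum q hq))
      have e2 := Real.mul_self_sqrt (hm.le.trans (hum' q hq))
      linear_combination e1 - e2
    have h4 : |Real.sqrt (u q) - Real.sqrt (u' q)| * Real.sqrt m ≤ C * q.1 ^ p := by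
      rw [← h3, abs_mul] at a3
      refine le_trans (mul_le_mul_of_nonneg_left ?_ (abs_nonneg _)) a3
      exact le_trans (by linarith) (le_abs_self _)
    have h5 : 0 ≤ C * q.1 ^ p := (abs_nonneg _).trans a3
    calc |Real.sqrt (u q) - Real.sqrt (u' q)| ≤ C * q.1 ^ p / Real.sqrt m := by
          rwa [le_div_iff₀ hsm]
      _ = C / Real.sqrt m * q.1 ^ p := by ring
      _ ≤ max (Real.sqrt C) (C / Real.sqrt m) * q.1 ^ p := by
          rcases le_or_gt 0 (q.1 ^ p) with h | h
          · exact mul_le_mul_of_nonneg_right (le_max_right _ _) h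
          · have hC0 : C = 0 := by nlinarith
            rw [hC0, abs_nonpos_iff] at a1
            have := hum q hq
            rw [a1] at this
            linarith

end PowClose

section
variable {p n : ℕ} {M M' : ℝ → ℝ → ℝ → ℝ} {m s σ h₀ ε₀ α₀ C : ℝ} {A₁ A₂ a₃ : ℝ → ℝ → ℝ}
  {R : ℝ → ℝ → ℝ → ℝ} {A₁' A₂' a₃' : ℝ → ℝ → ℝ} {R' : ℝ → ℝ → ℝ → ℝ}

theorem powClose_of_continuousOn {u u' : ℝ × ℝ × ℝ → ℝ} (hu : ContinuousOn u (box h₀ ε₀ α₀))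
    (hu' : ContinuousOn u' (box h₀ ε₀ α₀))
    (h : ∀ q ∈ box h₀ ε₀ α₀, |u q - u' q| ≤ C * q.1 ^ p) : PowClose p (box h₀ ε₀ α₀) u u' := by
  obtain ⟨B, hB0, hB⟩ := exists_bound_box hu
  obtain ⟨B', hB0', hB'⟩ := exists_bound_box hu'
  refine ⟨max (max B B') C, le_max_of_le_left (le_max_of_le_left hB0), fun q hq =>
    ⟨(hB q hq).trans ((le_max_left _ _).trans (le_max_left _ _)),
      (hB' q hq).trans ((le_max_right _ _).trans (le_max_left _ _)), (h q hq).trans ?_⟩⟩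
  exact mul_le_mul_of_nonneg_right (le_max_right _ _) (pow_nonneg hq.1.1 p)

/-- The coordinate changes, parameter changes and tails computed from cst `O(h^p)`-close expansions
are `O(h^p)`-close. -/
theorem JetsClose.reductions_close (hm : 0 < m)
    (hj : IsJet n M h₀ ε₀ α₀ A₁ A₂ a₃ R) (hg : IsGoodJet m s σ h₀ ε₀ α₀ A₁ A₂ a₃)
    (hj' : IsJet n M' h₀ ε₀ α₀ A₁' A₂' a₃' R') (hg' : IsGoodJet m s σ h₀ ε₀ α₀ A₁' A₂' a₃')
    (hc : JetsClose p h₀ ε₀ α₀ C A₁ A₂ a₃ R A₁' A₂' a₃' R') :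
    PowClose p (box h₀ ε₀ α₀) (fun q => jetChart s A₁ A₂ a₃ q.1 q.2.1 q.2.2)
      (fun q => jetChart s A₁' A₂' a₃' q.1 q.2.1 q.2.2) ∧
    PowClose p (box h₀ ε₀ α₀) (fun q => jetParam A₁ q.1 q.2.2)
      (fun q => jetParam A₁' q.1 q.2.2) ∧
    PowClose p (box h₀ ε₀ α₀) (fun q => jetTail s A₁ A₂ a₃ R q.1 q.2.1 q.2.2)
      (fun q => jetTail s A₁' A₂' a₃' R' q.1 q.2.1 q.2.2) := by
  have hS : ∀ q ∈ box h₀ ε₀ α₀, 0 ≤ q.1 := fun q hq => hq.1.1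
  have cst : ∀ c : ℝ, PowClose p (box h₀ ε₀ α₀) (fun _ => c) (fun _ => c) := fun c =>
    PowClose.const hS c
  have self : ∀ u : ℝ × ℝ × ℝ → ℝ, Continuous u → PowClose p (box h₀ ε₀ α₀) u u := fun u hu => by
    obtain ⟨B, _, hB⟩ := exists_bound_box (hu.continuousOn (s := box h₀ ε₀ α₀))
    exact PowClose.of_bound hS hB
  have hh := self (fun q => q.1) (by fun_prop)
  have hx := self (fun q => q.2.1) (by fun_prop)
  have hα := self (fun q => q.2.2) (by fun_prop)
  have h1 := powClose_of_continuousOn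
    (contDiffOn_rect_to_box (ε₀ := ε₀) hj.A₁_smooth).continuousOn
    (contDiffOn_rect_to_box (ε₀ := ε₀) hj'.A₁_smooth).continuousOn
    (fun q hq => hc.A₁_close _ hq.1 _ hq.2.2)
  have hA2 := powClose_of_continuousOn
    (contDiffOn_rect_to_box (ε₀ := ε₀) hj.A₂_smooth).continuousOn
    (contDiffOn_rect_to_box (ε₀ := ε₀) hj'.A₂_smooth).continuousOn
    (fun q hq => hc.A₂_close _ hq.1 _ hq.2.2)
  have h3 := powClose_of_continuousOn
    (contDiffOn_rect_to_box (ε₀ := ε₀) hj.a₃_smooth).continuousOn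
    (contDiffOn_rect_to_box (ε₀ := ε₀) hj'.a₃_smooth).continuousOn
    (fun q hq => hc.a₃_close _ hq.1 _ hq.2.2)
  have hR := powClose_of_continuousOn (ContDiffOn.continuousOn hj.R_smooth)
    (ContDiffOn.continuousOn hj'.R_smooth) (fun q hq => hc.R_close _ hq.1 _ hq.2.1 _ hq.2.2)
  have hb : PowClose p (box h₀ ε₀ α₀) (fun q => jetParam A₁ q.1 q.2.2)
      (fun q => jetParam A₁' q.1 q.2.2) := hα.mul h1
  have h2 := hα.mul hA2
  have hlin := (cst 1).add (hh.mul hb)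
  have hlow : ∀ {A₁ A₂ a₃ : ℝ → ℝ → ℝ}, IsGoodJet m s σ h₀ ε₀ α₀ A₁ A₂ a₃ →
      ∀ q ∈ box h₀ ε₀ α₀, m * (1 / 2) ≤ |A₁ q.1 q.2.2 * (1 + q.1 * jetParam A₁ q.1 q.2.2)| := by
    intro A₁ A₂ a₃ hg q hq
    rw [abs_mul]
    exact mul_le_mul (hg.A₁_lower _ hq.1 _ hq.2.2)
      ((hg.param_lower _ hq.1 _ hq.2.2).trans (le_abs_self _)) (by norm_num) (abs_nonneg _)
  have hq : PowClose p (box h₀ ε₀ α₀) (fun q => jetQuad A₁ A₂ q.1 q.2.2)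
      (fun q => jetQuad A₁' A₂' q.1 q.2.2) := by
    simpa only [jetQuad, div_eq_mul_inv] using
      hA2.neg.mul ((h1.mul hlin).inv (by positivity) (hlow hg) (hlow hg'))
  have hk : PowClose p (box h₀ ε₀ α₀) (fun q => jetCubic A₁ A₂ a₃ q.1 q.2.2)
      (fun q => jetCubic A₁' A₂' a₃' q.1 q.2.2) := h3.add ((((cst 2).mul hq).mul h2).mul hlin)
  have hκ : PowClose p (box h₀ ε₀ α₀) (fun q => jetScale s A₁ A₂ a₃ q.1 q.2.2)
      (fun q => jetScale s A₁' A₂' a₃' q.1 q.2.2) := ((cst s).mul hk).sqrt hm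
        (fun q hq => hg.cubic_lower _ hq.1 _ hq.2.2) (fun q hq => hg'.cubic_lower _ hq.1 _ hq.2.2)
  -- the tail is a rational expression in quantities already compared; its denominator is bounded
  -- below because `|c x| ≤ 1 / 8`
  refine ⟨hκ.mul (hx.add (hq.mul (hx.pow hS 2))), hb, PowClose.mul ?_ (PowClose.inv
    (m := Real.sqrt m ^ 3 * (1 / 2) ^ 4) ?_ ((hκ.pow hS 3).mul
      (((cst 1).add (hq.mul hx)).pow hS 4)) ?_ ?_)⟩
  · exact ((hR.add (((cst 2).mul hq).mul (h3.add (hx.mul hR)))).add ((hq.mul hh).mul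
      (((((((cst 2).mul hb).mul h3).add (h2.pow hS 2)).add
        (hx.mul ((((cst 2).mul hb).mul hR).add (((cst 2).mul h2).mul h3)))).add
        ((hx.pow hS 2).mul ((((cst 2).mul h2).mul hR).add (h3.pow hS 2)))).add
        ((((cst 2).mul (hx.pow hS 3)).mul h3).mul hR) |>.add
          ((hx.pow hS 4).mul (hR.pow hS 2))))).sub
      (hk.mul ((((cst 3).mul hq).add (((cst 3).mul (hq.pow hS 2)).mul hx)).add
        ((hq.pow hS 3).mul (hx.pow hS 2))))
  · have := Real.sqrt_pos.2 hm; positivity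
  all_goals
    intro q hq
  · have k1 := hg.scale_lower hq.1 hq.2.2
    have k2 := (abs_le.1 (hg.abs_quad_mul_le hq.1 hq.2.1 hq.2.2)).1
    refine le_trans ?_ (le_abs_self _)
    have := Real.sqrt_nonneg m
    exact mul_le_mul (pow_le_pow_left₀ this k1 3) (pow_le_pow_left₀ (by norm_num) (by linarith) 4)
      (by norm_num) (pow_nonneg (this.trans k1) 3)
  · have k1 := hg'.scale_lower hq.1 hq.2.2
    have k2 := (abs_le.1 (hg'.abs_quad_mul_le hq.1 hq.2.1 hq.2.2)).1
    refine le_trans ?_ (le_abs_self _)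
    have := Real.sqrt_nonneg m
    exact mul_le_mul (pow_le_pow_left₀ this k1 3) (pow_le_pow_left₀ (by norm_num) (by linarith) 4)
      (by norm_num) (pow_nonneg (this.trans k1) 3)

end

/-! ### The pair of reductions -/

/-- A pair of reductions with the quantitative information used to return to the original
coordinates: the coordinate and parameter changes expand distances by at least the factor `μ`, the
smaller interval `|x| ≤ ε₀ / 2` already covers `|y| ≤ ε₁`, and both maps at most double `|x|`. -/
structure IsExpandingPair (p : ℕ) (s : ℝ) (Φ φ : ℝ → ℝ → ℝ → ℝ) (h₀ ε₀ α₀ ε₁ β₁ C μ : ℝ)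
    (χ : ℝ → ℝ → ℝ → ℝ) (b : ℝ → ℝ → ℝ) (r : ℝ → ℝ → ℝ → ℝ)
    (χ' : ℝ → ℝ → ℝ → ℝ) (b' : ℝ → ℝ → ℝ) (r' : ℝ → ℝ → ℝ → ℝ) : Prop where
  pair : IsReductionPair p s Φ φ h₀ ε₀ α₀ ε₁ β₁ C χ b r χ' b' r'
  μ_pos : 0 < μ
  χ_expand : ∀ h ∈ Icc 0 h₀, ∀ α ∈ Icc (-α₀) α₀, ∀ x ∈ Icc (-ε₀) ε₀, ∀ x' ∈ Icc (-ε₀) ε₀, x' ≤ x →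
    μ * (x - x') ≤ χ h x α - χ h x' α
  χ'_expand : ∀ h ∈ Icc 0 h₀, ∀ α ∈ Icc (-α₀) α₀, ∀ x ∈ Icc (-ε₀) ε₀, ∀ x' ∈ Icc (-ε₀) ε₀,
    x' ≤ x → μ * (x - x') ≤ χ' h x α - χ' h x' α
  b_expand : ∀ h ∈ Icc 0 h₀, ∀ α ∈ Icc (-α₀) α₀, ∀ α' ∈ Icc (-α₀) α₀,
    μ * |α - α'| ≤ |b h α - b h α'|
  b'_expand : ∀ h ∈ Icc 0 h₀, ∀ α ∈ Icc (-α₀) α₀, ∀ α' ∈ Icc (-α₀) α₀,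
    μ * |α - α'| ≤ |b' h α - b' h α'|
  χ_cover_half : ∀ h ∈ Icc 0 h₀, ∀ α ∈ Icc (-α₀) α₀, ∀ y ∈ Icc (-ε₁) ε₁,
    ∃ x ∈ Icc (-(ε₀ / 2)) (ε₀ / 2), χ h x α = y
  χ'_cover_half : ∀ h ∈ Icc 0 h₀, ∀ α ∈ Icc (-α₀) α₀, ∀ y ∈ Icc (-ε₁) ε₁,
    ∃ x ∈ Icc (-(ε₀ / 2)) (ε₀ / 2), χ' h x α = y
  Φ_le : ∀ h ∈ Icc 0 h₀, ∀ x ∈ Icc (-ε₀) ε₀, ∀ α ∈ Icc (-α₀) α₀, |Φ h x α| ≤ 2 * |x|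
  φ_le : ∀ h ∈ Icc 0 h₀, ∀ x ∈ Icc (-ε₀) ε₀, ∀ α ∈ Icc (-α₀) α₀, |φ h x α| ≤ 2 * |x|

section
variable {n p : ℕ} {M : ℝ → ℝ → ℝ → ℝ} {m s σ h₀ ε₀ α₀ ε₁ β₁ C μ h₁ ε₂ β₂ : ℝ}
  {Φ φ : ℝ → ℝ → ℝ → ℝ} {χ χ' r r' : ℝ → ℝ → ℝ → ℝ} {b b' : ℝ → ℝ → ℝ}

theorem IsReduction.mono (hr : IsReduction n s M h₀ ε₀ α₀ ε₁ β₁ χ b r) (hh : h₁ ≤ h₀)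
    (hε : ε₂ ≤ ε₁) (hβ : β₂ ≤ β₁) : IsReduction n s M h₁ ε₀ α₀ ε₂ β₂ χ b r := by
  have h1 : Icc 0 h₁ ⊆ Icc 0 h₀ := Icc_subset_Icc_right hh
  have h2 : Icc (-ε₂) ε₂ ⊆ Icc (-ε₁) ε₁ := Icc_subset_Icc (by linarith) hε
  have h3 : Icc (-β₂) β₂ ⊆ Icc (-β₁) β₁ := Icc_subset_Icc (by linarith) hβ
  exact ⟨ContDiffOn.mono hr.χ_smooth (box_mono hh le_rfl le_rfl),
    fun h hh => hr.χ_zero h (h1 hh), fun h hh => hr.χ_deriv h (h1 hh),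
    fun h hh α hα => h2.trans (hr.χ_cover h (h1 hh) α hα),
    hr.b_smooth.mono (prod_mono h1 subset_rfl), fun h hh => hr.b_zero h (h1 hh),
    fun h hh => hr.b_deriv h (h1 hh), fun h hh => h3.trans (hr.b_cover h (h1 hh)),
    ContDiffOn.mono hr.r_smooth (box_mono hh hε hβ),
    fun h hh α hα x hx k1 k2 k3 => hr.transforms h (h1 hh) α hα x hx k1 (h2 k2) (h3 k3)⟩

theorem IsExpandingPair.mono
    (hP : IsExpandingPair p s Φ φ h₀ ε₀ α₀ ε₁ β₁ C μ χ b r χ' b' r')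
    (hh₁ : 0 < h₁) (hh : h₁ ≤ h₀) (hε₂ : 0 < ε₂) (hε : ε₂ ≤ ε₁) (hβ₂ : 0 < β₂) (hβ : β₂ ≤ β₁) :
    IsExpandingPair p s Φ φ h₁ ε₀ α₀ ε₂ β₂ C μ χ b r χ' b' r' := by
  have h1 : Icc 0 h₁ ⊆ Icc 0 h₀ := Icc_subset_Icc_right hh
  have h2 : Icc (-ε₂) ε₂ ⊆ Icc (-ε₁) ε₁ := Icc_subset_Icc (by linarith) hε
  have h3 : Icc (-β₂) β₂ ⊆ Icc (-β₁) β₁ := Icc_subset_Icc (by linarith) hβ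
  have hp := hP.pair
  exact ⟨⟨hh₁, hp.ε₀_pos, hp.α₀_pos, hε₂, hβ₂, hp.sign, hp.exact.mono hh hε hβ,
      hp.discrete.mono hh hε hβ, fun h hh => hp.χ_close h (h1 hh), fun h hh => hp.b_close h (h1 hh),
      fun h hh y hy β hβ => hp.r_close h (h1 hh) y (h2 hy) β (h3 hβ)⟩, hP.μ_pos,
    fun h hh => hP.χ_expand h (h1 hh), fun h hh => hP.χ'_expand h (h1 hh),
    fun h hh => hP.b_expand h (h1 hh), fun h hh => hP.b'_expand h (h1 hh),
    fun h hh α hα y hy => hP.χ_cover_half h (h1 hh) α hα y (h2 hy),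
    fun h hh α hα y hy => hP.χ'_cover_half h (h1 hh) α hα y (h2 hy),
    fun h hh => hP.Φ_le h (h1 hh), fun h hh => hP.φ_le h (h1 hh)⟩

theorem IsExpandingPair.const_mono
    (hP : IsExpandingPair p s Φ φ h₀ ε₀ α₀ ε₁ β₁ C μ χ b r χ' b' r') {C' : ℝ} (hC : C ≤ C') :
    IsExpandingPair p s Φ φ h₀ ε₀ α₀ ε₁ β₁ C' μ χ b r χ' b' r' := by
  have hp := hP.pair
  have key : ∀ h ∈ Icc 0 h₀, C * h ^ p ≤ C' * h ^ p := fun h hh =>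
    mul_le_mul_of_nonneg_right hC (pow_nonneg hh.1 p)
  exact { hP with
    pair := { hp with
      χ_close := fun h hh x hx α hα => (hp.χ_close h hh x hx α hα).trans (key h hh)
      b_close := fun h hh α hα => (hp.b_close h hh α hα).trans (key h hh)
      r_close := fun h hh y hy β hβ => (hp.r_close h hh y hy β hβ).trans (key h hh) } }

theorem abs_expand_of_expand {u : ℝ → ℝ} {S : Set ℝ}
    (hu : ∀ x ∈ S, ∀ x' ∈ S, x' ≤ x → μ * (x - x') ≤ u x - u x') :
    ∀ x ∈ S, ∀ x' ∈ S, μ * |x - x'| ≤ |u x - u x'| := by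
  intro x hx x' hx'
  rcases le_total x' x with h | h
  · rw [abs_of_nonneg (sub_nonneg.2 h)]
    exact (hu x hx x' hx' h).trans (le_abs_self _)
  · rw [abs_sub_comm, abs_sub_comm (u x), abs_of_nonneg (sub_nonneg.2 h)]
    exact (hu x' hx' x hx h).trans (le_abs_self _)

theorem IsGoodJet.param_abs_expand {A₁ A₂ a₃ : ℝ → ℝ → ℝ} (hσ : σ = 1 ∨ σ = -1)
    (hg : IsGoodJet m s σ h₀ ε₀ α₀ A₁ A₂ a₃) :
    ∀ h ∈ Icc 0 h₀, ∀ α ∈ Icc (-α₀) α₀, ∀ α' ∈ Icc (-α₀) α₀,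
      m * |α - α'| ≤ |jetParam A₁ h α - jetParam A₁ h α'| := by
  intro h hh α hα α' hα'
  have := abs_expand_of_expand (hg.param_expand h hh) α hα α' hα'
  rw [← mul_sub, abs_mul] at this
  rcases hσ with h | h <;> simpa [h] using this

/-- Two `O(h^p)`-close nondegenerate expansions with the same leading coefficients at the origin
give, on small domains, a pair of `O(h^p)`-close reductions. -/
theorem exists_expandingPair {H E A : ℝ} {A₁ A₂ a₃ A₁' A₂' a₃' : ℝ → ℝ → ℝ}
    {R R' : ℝ → ℝ → ℝ → ℝ} (hp : 1 ≤ p) (hH : 0 < H) (hE : 0 < E) (hA : 0 < A)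
    (hj : IsJet (p + 2) Φ H E A A₁ A₂ a₃ R) (hj' : IsJet (p + 2) φ H E A A₁' A₂' a₃' R')
    (hc : JetsClose p H E A C A₁ A₂ a₃ R A₁' A₂' a₃' R')
    (hA₁ : A₁ 0 0 ≠ 0) (ha₃ : a₃ 0 0 ≠ 0) :
    ∃ s h₀ ε₀ α₀ ε₁ β₁ D μ r r', h₀ ≤ H ∧ ε₀ ≤ E ∧ α₀ ≤ A ∧ 0 < D ∧
      IsExpandingPair p s Φ φ h₀ ε₀ α₀ ε₁ β₁ D μ (jetChart s A₁ A₂ a₃) (jetParam A₁) r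
        (jetChart s A₁' A₂' a₃') (jetParam A₁') r' := by
  have hn : 1 ≤ p + 2 := by omega
  have sgn : ∀ z : ℝ, z ≠ 0 → ∃ s : ℝ, (s = 1 ∨ s = -1) ∧ 0 < s * z := fun z hz => by
    rcases lt_or_gt_of_ne hz with h | h
    · exact ⟨-1, Or.inr rfl, by linarith⟩
    · exact ⟨1, Or.inl rfl, by linarith⟩
  obtain ⟨σ, hσ, hσA⟩ := sgn _ hA₁
  obtain ⟨s, hs, hsa⟩ := sgn _ ha₃
  have h00 : (0:ℝ) ∈ Icc 0 H := ⟨le_rfl, hH.le⟩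
  have h0A : (0:ℝ) ∈ Icc (-A) A := ⟨by linarith, hA.le⟩
  have hp0 : p ≠ 0 := by omega
  -- at `h = 0` closeness is equality, so the signs of the two expansions agree
  have e1 : A₁ 0 0 = A₁' 0 0 := by
    have := hc.A₁_close 0 h00 0 h0A
    rw [zero_pow hp0, mul_zero, abs_nonpos_iff] at this
    linarith
  have e3 : a₃ 0 0 = a₃' 0 0 := by
    have := hc.a₃_close 0 h00 0 h0A
    rw [zero_pow hp0, mul_zero, abs_nonpos_iff] at this
    linarith
  obtain ⟨δ, hδ, m₁, hm₁, hgood⟩ := hj.exists_good hn hH hA hs hσ hσA hsa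
  obtain ⟨δ', hδ', m₂, hm₂, hgood'⟩ := hj'.exists_good hn hH hA hs hσ (e1 ▸ hσA) (e3 ▸ hsa)
  set h₀ := min H (min δ δ') with hh₀
  set ε₀ := min E (min δ δ') with hε₀
  set α₀ := min A (min δ δ') with hα₀
  have hδδ : 0 < min δ δ' := lt_min hδ hδ'
  have h₀pos : 0 < h₀ := lt_min hH hδδ
  have ε₀pos : 0 < ε₀ := lt_min hE hδδ
  have α₀pos : 0 < α₀ := lt_min hA hδδ
  set m := min m₁ m₂ with hm
  have mpos : 0 < m := lt_min hm₁ hm₂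
  obtain ⟨g0, hle⟩ := hgood h₀ (min_le_left _ _) ε₀ (min_le_left _ _) α₀ (min_le_left _ _)
    ((min_le_right _ _).trans (min_le_left _ _)) ((min_le_right _ _).trans (min_le_left _ _))
    ((min_le_right _ _).trans (min_le_left _ _))
  obtain ⟨g0', hle'⟩ := hgood' h₀ (min_le_left _ _) ε₀ (min_le_left _ _) α₀ (min_le_left _ _)
    ((min_le_right _ _).trans (min_le_right _ _)) ((min_le_right _ _).trans (min_le_right _ _))
    ((min_le_right _ _).trans (min_le_right _ _))
  have g : IsGoodJet m s σ h₀ ε₀ α₀ A₁ A₂ a₃ := g0.mono (min_le_left _ _)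
  have g' : IsGoodJet m s σ h₀ ε₀ α₀ A₁' A₂' a₃' := g0'.mono (min_le_right _ _)
  have j := hj.mono (h₀ := h₀) (ε₀ := ε₀) (α₀ := α₀) (min_le_left _ _) (min_le_left _ _)
    (min_le_left _ _)
  have j' := hj'.mono (h₀ := h₀) (ε₀ := ε₀) (α₀ := α₀) (min_le_left _ _) (min_le_left _ _)
    (min_le_left _ _)
  have c : JetsClose p h₀ ε₀ α₀ C A₁ A₂ a₃ R A₁' A₂' a₃' R' := by
    have s1 : Icc 0 h₀ ⊆ Icc 0 H := Icc_subset_Icc_right (min_le_left _ _)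
    have s2 : Icc (-ε₀) ε₀ ⊆ Icc (-E) E :=
      Icc_subset_Icc (neg_le_neg (min_le_left _ _)) (min_le_left _ _)
    have s3 : Icc (-α₀) α₀ ⊆ Icc (-A) A :=
      Icc_subset_Icc (neg_le_neg (min_le_left _ _)) (min_le_left _ _)
    exact ⟨fun h hh α hα => hc.A₁_close h (s1 hh) α (s3 hα),
      fun h hh α hα => hc.A₂_close h (s1 hh) α (s3 hα),
      fun h hh α hα => hc.a₃_close h (s1 hh) α (s3 hα),
      fun h hh x hx α hα => hc.R_close h (s1 hh) x (s2 hx) α (s3 hα)⟩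
  obtain ⟨⟨Cχ, hCχ0, hCχ⟩, ⟨Cb, hCb0, hCb⟩, ⟨CW, hCW0, hCW⟩⟩ := c.reductions_close mpos j g j' g'
  obtain ⟨r, hr, hcov, hrW⟩ := j.exists_reduction hn h₀pos ε₀pos α₀pos mpos hs hσ g
  obtain ⟨r', hr', hcov', hrW'⟩ := j'.exists_reduction hn h₀pos ε₀pos α₀pos mpos hs hσ g'
  have hbox := uniqueDiffOn_box h₀pos ε₀pos α₀pos
  have hcast : (1 : WithTop ℕ∞) ≤ ((p + 2 : ℕ) : WithTop ℕ∞) := by exact_mod_cast hn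
  obtain ⟨Lχ, hLχ0, hLχ⟩ := exists_lipschitz_of_contDiffOn (isCompact_box h₀ ε₀ α₀)
    (convex_box h₀ ε₀ α₀) hbox ((j.chart_smooth mpos g).of_le hcast)
  obtain ⟨LW, hLW0, hLW⟩ := exists_lipschitz_of_contDiffOn (isCompact_box h₀ ε₀ α₀)
    (convex_box h₀ ε₀ α₀) hbox ((j.tail_smooth mpos g).of_le hcast)
  set κ := Real.sqrt m / 2 with hκ
  have κpos : 0 < κ := by positivity
  have hexp := fun h (hh : h ∈ Icc 0 h₀) α (hα : α ∈ Icc (-α₀) α₀) x (hx : x ∈ Icc (-ε₀) ε₀) x'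
    (hx' : x' ∈ Icc (-ε₀) ε₀) hle => g.chart_expand hh hα hx hx' hle
  have hexp' := fun h (hh : h ∈ Icc 0 h₀) α (hα : α ∈ Icc (-α₀) α₀) x (hx : x ∈ Icc (-ε₀) ε₀) x'
    (hx' : x' ∈ Icc (-ε₀) ε₀) hle => g'.chart_expand hh hα hx hx' hle
  -- bounds for the change of preimages under the two parameter and coordinate changes
  set Kα := Cb / m with hKα
  set Kx := (Cχ + Lχ * Kα) / κ with hKx
  have Kα0 : 0 ≤ Kα := by positivity
  have Kx0 : 0 ≤ Kx := by positivity
  set D := max (max Cχ Cb) (LW * (Kx + Kα) + CW) + 1 with hD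
  have D1 : Cχ ≤ D := (le_max_left _ _).trans ((le_max_left _ _).trans (by linarith))
  have D2 : Cb ≤ D := (le_max_right _ _).trans ((le_max_left _ _).trans (by linarith))
  have D0 : 0 < D := by
    have : 0 ≤ max (max Cχ Cb) (LW * (Kx + Kα) + CW) :=
      le_max_of_le_left (le_max_of_le_left hCχ0)
    linarith
  have D3 : LW * (Kx + Kα) + CW ≤ D := (le_max_right _ _).trans (by linarith)
  have half : Icc (-(ε₀ / 2)) (ε₀ / 2) ⊆ Icc (-ε₀) ε₀ := Icc_subset_Icc (by linarith) (by linarith)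
  -- the tails at `(y, β)` are compared through the two preimages of this point
  have rclose : ∀ h ∈ Icc 0 h₀, ∀ y ∈ Icc (-(κ * ε₀ / 2)) (κ * ε₀ / 2),
      ∀ β ∈ Icc (-(m * α₀)) (m * α₀), |r h y β - r' h y β| ≤ D * h ^ p := by
    intro h hh y hy β hβ
    have hhp : 0 ≤ h ^ p := pow_nonneg hh.1 p
    obtain ⟨α, hα, hbα, hx⟩ := hrW h hh β hβ
    obtain ⟨x, hx, hχx, hrx⟩ := hx y hy
    obtain ⟨α', hα', hbα', hx'⟩ := hrW' h hh β hβ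
    obtain ⟨x', hx', hχx', hrx'⟩ := hx' y hy
    replace hx := half hx
    replace hx' := half hx'
    have k1 : |α - α'| ≤ Kα * h ^ p := by
      have a1 := g.param_abs_expand hσ h hh α hα α' hα'
      have a2 := (hCb (h, x', α') (mem_box.2 ⟨hh, hx', hα'⟩)).2.2
      simp only at a2
      rw [hbα, ← hbα', abs_sub_comm (jetParam A₁' h α')] at a1
      rw [hKα, div_mul_eq_mul_div, le_div_iff₀ mpos]
      linarith
    have k2 : |x - x'| ≤ Kx * h ^ p := by
      have a1 : κ * |x - x'| ≤ _ := abs_expand_of_expand (hexp h hh α hα) x hx x' hx'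
      have a2 := (hCχ (h, x', α') (mem_box.2 ⟨hh, hx', hα'⟩)).2.2
      have a3 := hLχ (h, x', α') (mem_box.2 ⟨hh, hx', hα'⟩) (h, x', α) (mem_box.2 ⟨hh, hx', hα⟩)
      simp only [Prod.mk_sub_mk, sub_self, Prod.norm_mk, norm_zero, Real.norm_eq_abs] at a2 a3
      rw [max_eq_right (abs_nonneg (α' - α)), max_eq_right (abs_nonneg (α' - α)),
        abs_sub_comm α' α] at a3
      rw [hχx, ← hχx'] at a1
      have a4 := abs_sub_le (jetChart s A₁' A₂' a₃' h x' α') (jetChart s A₁ A₂ a₃ h x' α')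
        (jetChart s A₁ A₂ a₃ h x' α)
      rw [abs_sub_comm] at a2
      have a5 := mul_le_mul_of_nonneg_left k1 hLχ0
      rw [hKx, div_mul_eq_mul_div, le_div_iff₀ κpos]
      linarith
    rw [hrx, hrx']
    have b1 := hLW (h, x, α) (mem_box.2 ⟨hh, hx, hα⟩) (h, x', α') (mem_box.2 ⟨hh, hx', hα'⟩)
    have b2 := (hCW (h, x', α') (mem_box.2 ⟨hh, hx', hα'⟩)).2.2
    simp only [Prod.mk_sub_mk, sub_self, Prod.norm_mk, norm_zero, Real.norm_eq_abs] at b1 b2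
    rw [max_eq_right (le_max_of_le_left (abs_nonneg _))] at b1
    have b3 : max |x - x'| |α - α'| ≤ (Kx + Kα) * h ^ p := by
      have t1 := mul_nonneg Kx0 hhp
      have t2 := mul_nonneg Kα0 hhp
      exact max_le (by linarith) (by linarith)
    have b4 := mul_le_mul_of_nonneg_left b3 hLW0
    have b5 := mul_le_mul_of_nonneg_right D3 hhp
    refine (abs_sub_le _ (jetTail s A₁ A₂ a₃ R h x' α') _).trans ?_
    linarith
  refine ⟨s, h₀, ε₀, α₀, κ * ε₀ / 2, m * α₀, D, min κ m, r, r', min_le_left _ _, min_le_left _ _,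
    min_le_left _ _, D0, ⟨⟨h₀pos, ε₀pos, α₀pos, by positivity, by positivity, hs, hr, hr',
    ?_, ?_, rclose⟩, lt_min κpos mpos, ?_, ?_, ?_, ?_, hcov, hcov', hle, hle'⟩⟩
  · exact fun h hh x hx α hα => (hCχ (h, x, α) (mem_box.2 ⟨hh, hx, hα⟩)).2.2.trans
      (mul_le_mul_of_nonneg_right D1 (pow_nonneg hh.1 p))
  · exact fun h hh α hα => (hCb (h, 0, α) (mem_box.2 ⟨hh, ⟨by linarith, ε₀pos.le⟩, hα⟩)).2.2.trans
      (mul_le_mul_of_nonneg_right D2 (pow_nonneg hh.1 p))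
  · exact fun h hh α hα x hx x' hx' hle => (mul_le_mul_of_nonneg_right (min_le_left _ _)
      (sub_nonneg.2 hle)).trans (hexp h hh α hα x hx x' hx' hle)
  · exact fun h hh α hα x hx x' hx' hle => (mul_le_mul_of_nonneg_right (min_le_left _ _)
      (sub_nonneg.2 hle)).trans (hexp' h hh α hα x hx x' hx' hle)
  · exact fun h hh α hα α' hα' => (mul_le_mul_of_nonneg_right (min_le_right _ _)
      (abs_nonneg _)).trans (g.param_abs_expand hσ h hh α hα α' hα')
  · exact fun h hh α hα α' hα' => (mul_le_mul_of_nonneg_right (min_le_right _ _)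
      (abs_nonneg _)).trans (g'.param_abs_expand hσ h hh α hα α' hα')

end

/-! ### Orbit parametrizations of increasing bijections -/

section
variable {g G : ℝ ≃o ℝ} {a w y : ℝ}

/-- The orbit parametrization of an increasing bijection `g`: it runs affinely through the
fundamental domain from `a` to `g a` for `t ∈ [0, 1]`, and satisfies `L (t + 1) = g (L t)`. -/
noncomputable def orbitParam (g : ℝ ≃o ℝ) (a t : ℝ) : ℝ :=
  (g ^ ⌊t⌋) (a + Int.fract t * (g a - a))

theorem orbitParam_add_one (g : ℝ ≃o ℝ) (a t : ℝ) :
    orbitParam g a (t + 1) = g (orbitParam g a t) := by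
  rw [orbitParam, orbitParam, Int.floor_add_one, Int.fract_add_one, add_comm, zpow_one_add]
  rfl

theorem orbitParam_add_nat (g : ℝ ≃o ℝ) (a t : ℝ) (n : ℕ) :
    orbitParam g a (t + n) = g^[n] (orbitParam g a t) := by
  induction n with
  | zero => simp
  | succ n ih =>
    rw [Nat.cast_succ, ← add_assoc, orbitParam_add_one, ih, Function.iterate_succ_apply']

theorem orbitParam_of_mem {t : ℝ} (ht : t ∈ Icc (0:ℝ) 1) :
    orbitParam g a t = a + t * (g a - a) := by
  rcases ht.2.lt_or_eq with h | rfl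
  · have h0 : ⌊t⌋ = 0 := Int.floor_eq_zero_iff.2 ⟨ht.1, h⟩
    rw [orbitParam, h0, Int.fract_eq_self.2 ⟨ht.1, h⟩, zpow_zero]
    rfl
  · have := orbitParam_add_one g a 0
    rw [zero_add] at this
    rw [this, orbitParam]
    simp

theorem orderIso_zpow_fixed (hw : g w = w) (n : ℤ) : (g ^ n) w = w := by
  have hw' : g⁻¹ w = w := by
    have : g⁻¹ (g w) = w := g.symm_apply_apply w
    rwa [hw] at this
  induction n using Int.induction_on with
  | zero => simp
  | succ n ih => rw [zpow_add_one, RelIso.mul_apply, hw, ih]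
  | pred n ih => rw [zpow_sub_one, RelIso.mul_apply, hw', ih]

theorem lt_orbitParam (hw : g w = w) (ha : w < a) (t : ℝ) : w < orbitParam g a t := by
  have h1 : w < g a := by rw [← hw]; exact g.lt_iff_lt.2 ha
  rw [← orderIso_zpow_fixed hw ⌊t⌋]
  refine (g ^ ⌊t⌋).lt_iff_lt.2 ?_
  have h2 := Int.fract_nonneg t
  have h3 := Int.fract_lt_one t
  nlinarith

theorem orbitParam_lt (hw : g w = w) (ha : a < w) (t : ℝ) : orbitParam g a t < w := by
  have h1 : g a < w := by rw [← hw]; exact g.lt_iff_lt.2 ha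
  rw [← orderIso_zpow_fixed hw ⌊t⌋]
  refine (g ^ ⌊t⌋).lt_iff_lt.2 ?_
  have h2 := Int.fract_nonneg t
  have h3 := Int.fract_lt_one t
  nlinarith

theorem orbitParam_strictMono (ha : a < g a) : StrictMono (orbitParam g a) := by
  have hz : StrictMono (fun k : ℤ => (g ^ k) a) := by
    refine strictMono_int_of_lt_succ (fun k => ?_)
    change (g ^ k) a < (g ^ (k + 1)) a
    rw [zpow_add_one, RelIso.mul_apply]
    exact (g ^ k).lt_iff_lt.2 ha
  intro x y hxy
  rcases (Int.floor_mono hxy.le).eq_or_lt with h | h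
  · rw [orbitParam, orbitParam, ← h]
    refine (g ^ ⌊x⌋).lt_iff_lt.2 ?_
    have : Int.fract x < Int.fract y := by rw [Int.fract, Int.fract, h]; linarith
    nlinarith
  · calc orbitParam g a x < (g ^ (⌊x⌋ + 1)) a := by
          rw [orbitParam, zpow_add_one, RelIso.mul_apply]
          refine (g ^ ⌊x⌋).lt_iff_lt.2 ?_
          have := Int.fract_lt_one x
          nlinarith
      _ ≤ (g ^ ⌊y⌋) a := hz.monotone (by omega)
      _ ≤ orbitParam g a y := by
          refine (g ^ ⌊y⌋).le_iff_le.2 ?_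
          have := Int.fract_nonneg y
          nlinarith

theorem orbitParam_strictAnti (ha : g a < a) : StrictAnti (orbitParam g a) := by
  have hz : StrictAnti (fun k : ℤ => (g ^ k) a) := by
    refine strictAnti_int_of_succ_lt (fun k => ?_)
    change (g ^ (k + 1)) a < (g ^ k) a
    rw [zpow_add_one, RelIso.mul_apply]
    exact (g ^ k).lt_iff_lt.2 ha
  intro x y hxy
  rcases (Int.floor_mono hxy.le).eq_or_lt with h | h
  · rw [orbitParam, orbitParam, ← h]
    refine (g ^ ⌊x⌋).lt_iff_lt.2 ?_
    have : Int.fract x < Int.fract y := by rw [Int.fract, Int.fract, h]; linarith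
    nlinarith
  · calc orbitParam g a y ≤ (g ^ ⌊y⌋) a := by
          refine (g ^ ⌊y⌋).le_iff_le.2 ?_
          have := Int.fract_nonneg y
          nlinarith
      _ ≤ (g ^ (⌊x⌋ + 1)) a := hz.antitone (by omega)
      _ < orbitParam g a x := by
          rw [orbitParam, zpow_add_one, RelIso.mul_apply]
          refine (g ^ ⌊x⌋).lt_iff_lt.2 ?_
          have := Int.fract_lt_one x
          nlinarith

theorem exists_lt_iterate (ha : a < g a) (hf : ∀ u ∈ Icc a y, g u ≠ u) :
    ∃ n : ℕ, y < g^[n] a := by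
  by_contra! hcon
  have hmono : Monotone (fun n : ℕ => g^[n] a) :=
    g.monotone.monotone_iterate_of_le_map ha.le
  have hbdd : BddAbove (range (fun n : ℕ => g^[n] a)) := ⟨y, by rintro _ ⟨n, rfl⟩; exact hcon n⟩
  have hlim := tendsto_atTop_ciSup hmono hbdd
  have hfix := isFixedPt_of_tendsto_iterate hlim g.continuous.continuousAt
  exact hf _ ⟨le_ciSup hbdd 0, ciSup_le hcon⟩ hfix

theorem exists_iterate_lt (ha : g a < a) (hf : ∀ u ∈ Icc y a, g u ≠ u) :
    ∃ n : ℕ, g^[n] a < y := by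
  by_contra! hcon
  have hmono : Antitone (fun n : ℕ => g^[n] a) :=
    g.monotone.antitone_iterate_of_map_le ha.le
  have hbdd : BddBelow (range (fun n : ℕ => g^[n] a)) := ⟨y, by rintro _ ⟨n, rfl⟩; exact hcon n⟩
  have hlim := tendsto_atTop_ciInf hmono hbdd
  have hfix := isFixedPt_of_tendsto_iterate hlim g.continuous.continuousAt
  exact hf _ ⟨le_ciInf hcon, ciInf_le hbdd 0⟩ hfix

theorem orderIso_iterate_eq_pow (g : ℝ ≃o ℝ) (n : ℕ) (a : ℝ) : g^[n] a = (g ^ (n : ℤ)) a := by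
  rw [zpow_natCast]
  induction n with
  | zero => simp
  | succ n ih => rw [Function.iterate_succ_apply', ih, pow_succ', RelIso.mul_apply]

theorem orderIso_symm_iterate_eq_zpow (g : ℝ ≃o ℝ) (n : ℕ) (a : ℝ) :
    g.symm^[n] a = (g ^ (-(n : ℤ))) a := by
  have h : g.symm = g⁻¹ := rfl
  rw [orderIso_iterate_eq_pow, h, inv_zpow, zpow_neg]

theorem symm_ne_of_ne {u : ℝ} (h : g u ≠ u) : g.symm u ≠ u := fun hu => h (by
  rw [← hu, g.apply_symm_apply]; exact hu.symm)

theorem exists_affine_of_mem_uIcc {a b u : ℝ} (hu : u ∈ uIcc a b) :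
    ∃ τ ∈ Icc (0:ℝ) 1, a + τ * (b - a) = u := by
  rwa [← segment_eq_uIcc, segment_eq_image'] at hu

/-- Every point that is not separated from `a` by a fixed point lies on the orbit of the first
fundamental domain. -/
theorem exists_orbitParam_eq (hf : ∀ u ∈ uIcc a y, g u ≠ u) : ∃ t, orbitParam g a t = y := by
  have haf := hf a left_mem_uIcc
  -- it suffices that some iterate of `g` carries the first fundamental domain onto `y`
  have key : ∀ n : ℤ, (g ^ n)⁻¹ y ∈ uIcc a (g a) → ∃ t, orbitParam g a t = y := by
    intro n hn
    obtain ⟨τ, hτ, hτe⟩ := exists_affine_of_mem_uIcc hn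
    have hval : (g ^ n) (a + τ * (g a - a)) = y := by
      rw [hτe]; exact (g ^ n).apply_symm_apply y
    rcases hτ.2.lt_or_eq with h1 | rfl
    · refine ⟨n + τ, ?_⟩
      rw [orbitParam, Int.floor_intCast_add, Int.fract_intCast_add, 
        Int.floor_eq_zero_iff.2 ⟨hτ.1, h1⟩, Int.fract_eq_self.2 ⟨hτ.1, h1⟩, add_zero, hval]
    · refine ⟨((n + 1 : ℤ) : ℝ), ?_⟩
      rw [orbitParam, Int.floor_intCast, Int.fract_intCast, zpow_add_one, RelIso.mul_apply, ← hval]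
      simp
  have hinv : ∀ n : ℤ, ∀ u v : ℝ, u ≤ (g ^ n)⁻¹ v ↔ (g ^ n) u ≤ v := fun n u v =>
    (g ^ n).le_symm_apply
  have hinv' : ∀ n : ℤ, ∀ u v : ℝ, (g ^ n)⁻¹ v ≤ u ↔ v ≤ (g ^ n) u := fun n u v =>
    (g ^ n).symm_apply_le
  rcases lt_or_gt_of_ne haf with h | h
  · -- the orbit decreases
    have hanti : Antitone (fun k : ℤ => (g ^ k) a) := by
      refine antitone_int_of_succ_le (fun k => ?_)
      change (g ^ (k + 1)) a ≤ (g ^ k) a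
      rw [zpow_add_one, RelIso.mul_apply]
      exact (g ^ k).le_iff_le.2 h.le
    have hlow : ∃ n : ℕ, g^[n] a < y ∨ y = a := by
      rcases lt_trichotomy y a with h1 | h1 | h1
      · obtain ⟨n, hn⟩ := exists_iterate_lt h (y := y) (fun u hu => hf u (by
          rwa [uIcc_of_ge h1.le]))
        exact ⟨n, Or.inl hn⟩
      · exact ⟨0, Or.inr h1⟩
      · exact ⟨0, Or.inl h1⟩
    have hup : ∃ n : ℕ, y ≤ g.symm^[n] a := by
      rcases le_total y a with h1 | h1
      · exact ⟨0, h1⟩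
      · obtain ⟨n, hn⟩ := exists_lt_iterate (g := g.symm) (a := a) (y := y)
          (by rw [g.lt_symm_apply]; exact h) (fun u hu => symm_ne_of_ne (hf u (by
            rwa [uIcc_of_le h1])))
        exact ⟨n, hn.le⟩
    obtain ⟨n, hn⟩ := hlow
    obtain ⟨m, hm⟩ := hup
    rcases hn with hn | rfl
    · rw [orderIso_iterate_eq_pow] at hn
      rw [orderIso_symm_iterate_eq_zpow] at hm
      obtain ⟨k, hk, hmax⟩ := Int.exists_greatest_of_bdd (P := fun k : ℤ => y ≤ (g ^ k) a)
        ⟨n, fun z hz => by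
          by_contra! hzn
          exact absurd (hz.trans (hanti hzn.le)) (not_le.2 hn)⟩ ⟨_, hm⟩
      refine key k ?_
      rw [uIcc_of_ge h.le]
      refine ⟨?_, (hinv' _ _ _).2 hk⟩
      rw [hinv]
      by_contra! hcon
      have := hmax (k + 1) (by rw [zpow_add_one, RelIso.mul_apply]; exact hcon.le)
      omega
    · exact key 0 (by simp)
  · -- the orbit increases
    have hmono : Monotone (fun k : ℤ => (g ^ k) a) := by
      refine monotone_int_of_le_succ (fun k => ?_)
      change (g ^ k) a ≤ (g ^ (k + 1)) a
      rw [zpow_add_one, RelIso.mul_apply]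
      exact (g ^ k).le_iff_le.2 h.le
    have hup : ∃ n : ℕ, y < g^[n] a ∨ y = a := by
      rcases lt_trichotomy y a with h1 | h1 | h1
      · exact ⟨0, Or.inl h1⟩
      · exact ⟨0, Or.inr h1⟩
      · obtain ⟨n, hn⟩ := exists_lt_iterate h (y := y) (fun u hu => hf u (by
          rwa [uIcc_of_le h1.le]))
        exact ⟨n, Or.inl hn⟩
    have hlow : ∃ n : ℕ, g.symm^[n] a ≤ y := by
      rcases le_total a y with h1 | h1
      · exact ⟨0, h1⟩
      · obtain ⟨n, hn⟩ := exists_iterate_lt (g := g.symm) (a := a) (y := y)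
          (by rw [g.symm_apply_lt]; exact h) (fun u hu => symm_ne_of_ne (hf u (by
            rwa [uIcc_of_ge h1])))
        exact ⟨n, hn.le⟩
    obtain ⟨n, hn⟩ := hup
    obtain ⟨m, hm⟩ := hlow
    rcases hn with hn | rfl
    · rw [orderIso_iterate_eq_pow] at hn
      rw [orderIso_symm_iterate_eq_zpow] at hm
      obtain ⟨k, hk, hmax⟩ := Int.exists_greatest_of_bdd (P := fun k : ℤ => (g ^ k) a ≤ y)
        ⟨n, fun z hz => by
          by_contra! hzn
          exact absurd ((hmono hzn.le).trans hz) (not_le.2 hn)⟩ ⟨_, hm⟩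
      refine key k ?_
      rw [uIcc_of_le h.le]
      refine ⟨(hinv _ _ _).2 hk, ?_⟩
      rw [hinv']
      by_contra! hcon
      have := hmax (k + 1) (by rw [zpow_add_one, RelIso.mul_apply]; exact hcon.le)
      omega
    · exact key 0 (by simp)

/-- The conjugacy from `g` to `G` on the orbit of the fundamental domain between `a` and `g a`:
affine on this domain, and extended by the dynamics. -/
noncomputable def orbitConj (g G : ℝ ≃o ℝ) (a y : ℝ) : ℝ :=
  orbitParam G a (Function.invFun (orbitParam g a) y)

/-- `g` and `G` move `a` in the same direction. -/
def SameDirection (g G : ℝ ≃o ℝ) (a : ℝ) : Prop :=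
  (a < g a ∧ a < G a) ∨ (g a < a ∧ G a < a)

theorem orbitConj_orbitParam (h : SameDirection g G a) (t : ℝ) :
    orbitConj g G a (orbitParam g a t) = orbitParam G a t := by
  have hinj : Function.Injective (orbitParam g a) := by
    rcases h with h | h
    · exact (orbitParam_strictMono h.1).injective
    · exact (orbitParam_strictAnti h.1).injective
  rw [orbitConj, Function.leftInverse_invFun hinj]

theorem orbitConj_strictMonoOn (h : SameDirection g G a) :
    StrictMonoOn (orbitConj g G a) (range (orbitParam g a)) := by
  rintro _ ⟨t, rfl⟩ _ ⟨t', rfl⟩ htt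
  rw [orbitConj_orbitParam h, orbitConj_orbitParam h]
  rcases h with h | h
  · exact orbitParam_strictMono h.2 ((orbitParam_strictMono h.1).lt_iff_lt.1 htt)
  · exact orbitParam_strictAnti h.2 ((orbitParam_strictAnti h.1).lt_iff_gt.1 htt)

theorem orbitConj_image (h : SameDirection g G a) :
    orbitConj g G a '' range (orbitParam g a) = range (orbitParam G a) := by
  rw [← range_comp]
  exact congrArg range (funext (orbitConj_orbitParam h))

theorem orbitConj_conj (h : SameDirection g G a) {y : ℝ} (hy : y ∈ range (orbitParam g a)) :
    orbitConj g G a (g y) = G (orbitConj g G a y) := by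
  obtain ⟨t, rfl⟩ := hy
  rw [← orbitParam_add_one, orbitConj_orbitParam h, orbitConj_orbitParam h, orbitParam_add_one]

/-- The map equal to `J₁` below `c`, to `J₂` above `c`, and with value `c'` at `c`. -/
noncomputable def glueAt (c c' : ℝ) (J₁ J₂ : ℝ → ℝ) (y : ℝ) : ℝ :=
  if y < c then J₁ y else if c < y then J₂ y else c'

section glue
variable {c c' : ℝ} {J₁ J₂ : ℝ → ℝ} {S₁ S₂ S₁' S₂' : Set ℝ}

theorem glueAt_of_lt (h : y < c) : glueAt c c' J₁ J₂ y = J₁ y := if_pos h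

theorem glueAt_of_gt (h : c < y) : glueAt c c' J₁ J₂ y = J₂ y := by
  rw [glueAt, if_neg h.not_gt, if_pos h]

theorem glueAt_self : glueAt c c' J₁ J₂ c = c' := by
  rw [glueAt, if_neg (lt_irrefl c), if_neg (lt_irrefl c)]

theorem glueAt_strictMonoOn (h₁ : StrictMonoOn J₁ S₁) (h₂ : StrictMonoOn J₂ S₂)
    (hS₁ : S₁ ⊆ Iio c) (hS₂ : S₂ ⊆ Ioi c) (hm₁ : MapsTo J₁ S₁ (Iio c'))
    (hm₂ : MapsTo J₂ S₂ (Ioi c')) :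
    StrictMonoOn (glueAt c c' J₁ J₂) (S₁ ∪ {c} ∪ S₂) := by
  rintro x ((hx | rfl) | hx) y ((hy | rfl) | hy) hxy
  · rw [glueAt_of_lt (hS₁ hx), glueAt_of_lt (hS₁ hy)]; exact h₁ hx hy hxy
  · rw [glueAt_of_lt (hS₁ hx), glueAt_self]; exact hm₁ hx
  · rw [glueAt_of_lt (hS₁ hx), glueAt_of_gt (hS₂ hy)]; exact (hm₁ hx).trans (hm₂ hy)
  · exact absurd hxy (lt_asymm (hS₁ hy))
  · exact absurd hxy (lt_irrefl _)
  · rw [glueAt_self, glueAt_of_gt (hS₂ hy)]; exact hm₂ hy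
  · exact absurd hxy (lt_asymm ((hS₁ hy).trans (hS₂ hx)))
  · exact absurd hxy (lt_asymm (hS₂ hx))
  · rw [glueAt_of_gt (hS₂ hx), glueAt_of_gt (hS₂ hy)]; exact h₂ hx hy hxy

theorem glueAt_image (hS₁ : S₁ ⊆ Iio c) (hS₂ : S₂ ⊆ Ioi c) :
    glueAt c c' J₁ J₂ '' (S₁ ∪ {c} ∪ S₂) = J₁ '' S₁ ∪ {c'} ∪ J₂ '' S₂ := by
  have e₁ : glueAt c c' J₁ J₂ '' S₁ = J₁ '' S₁ := image_congr fun y hy => glueAt_of_lt (hS₁ hy)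
  have e₂ : glueAt c c' J₁ J₂ '' S₂ = J₂ '' S₂ := image_congr fun y hy => glueAt_of_gt (hS₂ hy)
  rw [image_union, image_union, image_singleton, glueAt_self, e₁, e₂]

end glue
end

/-! ### The fundamental-domain conjugacy on half-lines and on the line -/

/-- The phase portrait of `g` on the half-line `y ≥ 0`: the origin is fixed, orbits move up
in `(0, w)` and down in `(w, ∞)`. Either there is a positive fixed point `w`, lying above the
starting point `a > 0` of the inner region, or `w = a = 0`. -/
structure HalfPhase (g : ℝ ≃o ℝ) (a w : ℝ) : Prop where
  zero : g 0 = 0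
  fixed : g w = w
  inner : ∀ y, 0 < y → y < w → y < g y
  outer : ∀ y, w < y → g y < y
  base : (0 < a ∧ a < w) ∨ (a = 0 ∧ w = 0)

/-- The estimates on `[0, ε]` behind the closeness of the fundamental-domain conjugacy: ratios of
corresponding points stay below `1 + δ` under forward iteration, and in the inner region
distances up to `δ` are not increased by backward iteration. -/
structure HalfEstimate (g G : ℝ ≃o ℝ) (ε a δ : ℝ) : Prop where
  ratio : ∀ z ∈ Icc 0 ε, G z ≤ (1 + δ) * g (z / (1 + δ))
  ratio' : ∀ z ∈ Icc 0 ε, g z ≤ (1 + δ) * G (z / (1 + δ))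
  backward : ∀ y ∈ Ioc 0 a, ∀ z ∈ Ioc 0 a, |g y - G z| ≤ δ → |y - z| ≤ δ

section
variable {g G : ℝ ≃o ℝ} {ε a w w' δ c : ℝ}

namespace HalfPhase

theorem w_nonneg (hg : HalfPhase g a w) : 0 ≤ w := by
  rcases hg.base with h | h <;> linarith

theorem range_outer (hg : HalfPhase g a w) (hε : w < ε) : range (orbitParam g ε) = Ioi w := by
  apply Subset.antisymm
  · rintro _ ⟨t, rfl⟩
    exact lt_orbitParam hg.fixed hε t
  · intro y hy
    refine exists_orbitParam_eq (fun u hu => (hg.outer u ?_).ne)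
    exact (lt_min hε hy).trans_le hu.1

theorem range_inner (hg : HalfPhase g a w) (ha : 0 < a) : range (orbitParam g a) = Ioo 0 w := by
  have haw : a < w := by rcases hg.base with h | h <;> linarith
  apply Subset.antisymm
  · rintro _ ⟨t, rfl⟩
    exact ⟨lt_orbitParam hg.zero ha t, orbitParam_lt hg.fixed haw t⟩
  · intro y hy
    refine exists_orbitParam_eq (fun u hu => (hg.inner u ?_ ?_).ne')
    · exact (lt_min ha hy.1).trans_le hu.1
    · exact hu.2.trans_lt (max_lt haw hy.2)

end HalfPhase

/-- As `g` is increasing, the ratio property is preserved by iteration: orbits from a common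
starting point keep a ratio of at most `1 + δ`. -/
theorem orbitParam_ratio (hδ : 0 ≤ δ) (hr : ∀ z ∈ Icc 0 ε, G z ≤ (1 + δ) * g (z / (1 + δ)))
    (hc : c ∈ Icc 0 ε) (hrange : ∀ t, 0 ≤ t → orbitParam G c t ∈ Icc 0 ε) {t : ℝ} (ht : 0 ≤ t) :
    orbitParam G c t ≤ (1 + δ) * orbitParam g c t := by
  have h1 : 0 < 1 + δ := by linarith
  have step : ∀ z ∈ Icc 0 ε, ∀ y, z ≤ (1 + δ) * y → G z ≤ (1 + δ) * g y := by
    intro z hz y hzy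
    refine (hr z hz).trans (mul_le_mul_of_nonneg_left (g.monotone ?_) h1.le)
    rw [div_le_iff₀ h1]; linarith
  have main : ∀ n : ℕ, ∀ τ ∈ Icc (0:ℝ) 1,
      orbitParam G c (τ + n) ≤ (1 + δ) * orbitParam g c (τ + n) := by
    intro n
    induction n with
    | zero =>
      intro τ hτ
      have h2 := step c hc c (by nlinarith [hc.1])
      rw [Nat.cast_zero, add_zero, orbitParam_of_mem hτ, orbitParam_of_mem hτ]
      have h3 := mul_le_mul_of_nonneg_left h2 hτ.1
      have h4 : 0 ≤ (1 - τ) * (δ * c) := mul_nonneg (by linarith [hτ.2]) (mul_nonneg hδ hc.1)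
      linarith
    | succ n ih =>
      intro τ hτ
      rw [Nat.cast_succ, ← add_assoc, orbitParam_add_one, orbitParam_add_one]
      exact step _ (hrange _ (add_nonneg hτ.1 (Nat.cast_nonneg n))) _ (ih τ hτ)
  have hfl : t = (t - ⌊t⌋₊) + (⌊t⌋₊ : ℕ) := by ring
  rw [hfl]
  exact main _ _ ⟨sub_nonneg.2 (Nat.floor_le ht), by linarith [Nat.lt_floor_add_one t]⟩

theorem abs_sub_le_of_ratio {y z : ℝ} (hδ : 0 ≤ δ) (hε : ε ≤ 1) (hy : y ∈ Icc 0 ε)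
    (hz : z ∈ Icc 0 ε) (h1 : z ≤ (1 + δ) * y) (h2 : y ≤ (1 + δ) * z) : |y - z| ≤ δ := by
  have h3 : δ * y ≤ δ * 1 := mul_le_mul_of_nonneg_left (hy.2.trans hε) hδ
  have h4 : δ * z ≤ δ * 1 := mul_le_mul_of_nonneg_left (hz.2.trans hε) hδ
  rw [abs_le]; constructor <;> linarith

/-- The ratio property passes to the positive fixed points. -/
theorem fixed_ratio (hδ : 0 ≤ δ) (hr : ∀ z ∈ Icc 0 ε, G z ≤ (1 + δ) * g (z / (1 + δ)))
    (hg : HalfPhase g a w) (hG : HalfPhase G a w') (hw' : w' ≤ ε) : w' ≤ (1 + δ) * w := by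
  have h1 : 0 < 1 + δ := by linarith
  by_contra! hcon
  have h2 : w < w' / (1 + δ) := by rw [lt_div_iff₀ h1]; linarith
  have h3 := hr w' ⟨hG.w_nonneg, hw'⟩
  have h4 := mul_lt_mul_of_pos_left (hg.outer _ h2) h1
  rw [hG.fixed] at h3
  rw [mul_div_cancel₀ _ h1.ne'] at h4
  linarith

/-- The fundamental-domain conjugacy on a half-line, with its estimate. -/
theorem exists_half_conj (hg : HalfPhase g a w) (hG : HalfPhase G a w') (hw : w < ε) (hw' : w' < ε)
    (hε : ε ≤ 1) (hδ : 0 ≤ δ) (hE : HalfEstimate g G ε a δ) :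
    ∃ J : ℝ → ℝ, StrictMonoOn J (Ioi 0) ∧ J '' Ioi 0 = Ioi 0 ∧ (∀ y > 0, J (g y) = G (J y)) ∧
      (∀ t, J (orbitParam g ε t) = orbitParam G ε t) ∧
      (0 < a → ∀ t, J (orbitParam g a t) = orbitParam G a t) ∧ (0 < w → J w = w') ∧
      ∀ y ∈ Ioc 0 ε, |y - J y| ≤ δ := by
  have hε0 : 0 < ε := hg.w_nonneg.trans_lt hw
  have hdo : SameDirection g G ε := Or.inr ⟨hg.outer _ hw, hG.outer _ hw'⟩
  have hro := hg.range_outer hw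
  have hro' := hG.range_outer hw'
  -- points on the outer orbits
  have hmem : ∀ {g : ℝ ≃o ℝ} {w : ℝ}, HalfPhase g a w → w < ε → ∀ t, 0 ≤ t →
      orbitParam g ε t ∈ Icc 0 ε := fun {g w} hg hw t ht => by
    refine ⟨hg.w_nonneg.trans (lt_orbitParam hg.fixed hw t).le, ?_⟩
    have h1 := (orbitParam_strictAnti (hg.outer _ hw)).antitone ht
    rwa [orbitParam_of_mem ⟨le_rfl, zero_le_one⟩, zero_mul, add_zero] at h1
  have hcε : ε ∈ Icc 0 ε := ⟨hε0.le, le_rfl⟩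
  have houter : ∀ y ∈ Ioc w ε, |y - orbitConj g G ε y| ≤ δ := by
    intro y hy
    obtain ⟨t, rfl⟩ : y ∈ range (orbitParam g ε) := by rw [hro]; exact hy.1
    have ht : 0 ≤ t := by
      refine (orbitParam_strictAnti (hg.outer _ hw)).le_iff_ge.1 ?_
      rw [orbitParam_of_mem ⟨le_rfl, zero_le_one⟩, zero_mul, add_zero]
      exact hy.2
    rw [orbitConj_orbitParam hdo]
    exact abs_sub_le_of_ratio hδ hε (hmem hg hw t ht) (hmem hG hw' t ht)
      (orbitParam_ratio hδ hE.ratio hcε (hmem hG hw') ht)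
      (orbitParam_ratio hδ hE.ratio' hcε (hmem hg hw) ht)
  rcases hg.base with ⟨ha, haw⟩ | ⟨rfl, rfl⟩
  · have haw' : a < w' := by rcases hG.base with h | h <;> linarith
    have hdi : SameDirection g G a := Or.inl ⟨hg.inner _ ha haw, hG.inner _ ha haw'⟩
    have hri := hg.range_inner ha
    have hri' := hG.range_inner ha
    have hw0 : 0 < w := ha.trans haw
    have hw0' : 0 < w' := ha.trans haw'
    have hsplit : ∀ {w : ℝ}, 0 < w → Ioi 0 = Ioo 0 w ∪ {w} ∪ Ioi w := fun {w} hw => by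
      rw [Ioo_union_right hw, Ioc_union_Ioi_eq_Ioi hw.le]
    have hJi : ∀ y ∈ Ioo 0 w, glueAt w w' (orbitConj g G a) (orbitConj g G ε) y =
      orbitConj g G a y := fun y hy => glueAt_of_lt hy.2
    have hJo : ∀ y ∈ Ioi w, glueAt w w' (orbitConj g G a) (orbitConj g G ε) y =
      orbitConj g G ε y := fun y hy => glueAt_of_gt hy
    have himi := orbitConj_image hdi
    have himo := orbitConj_image hdo
    have hmi := orbitConj_strictMonoOn hdi
    have hmo := orbitConj_strictMonoOn hdo
    rw [hri, hri'] at himi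
    rw [hro, hro'] at himo
    rw [hri] at hmi
    rw [hro] at hmo
    have hgi : ∀ y ∈ Ioo 0 w, g y ∈ Ioo 0 w := fun y hy =>
      ⟨by rw [← hg.zero]; exact g.lt_iff_lt.2 hy.1,
        (g.lt_iff_lt.2 hy.2).trans_eq hg.fixed⟩
    have hgo : ∀ y ∈ Ioi w, g y ∈ Ioi w := fun y hy =>
      hg.fixed.symm.trans_lt (g.lt_iff_lt.2 hy)
    refine ⟨glueAt w w' (orbitConj g G a) (orbitConj g G ε), ?_, ?_, ?_, ?_, ?_, ?_, ?_⟩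
    · rw [hsplit hw0]
      refine glueAt_strictMonoOn hmi hmo (fun y hy => hy.2) subset_rfl ?_ ?_
      · intro y hy
        have := mem_image_of_mem (orbitConj g G a) hy
        rw [himi] at this
        exact this.2
      · intro y hy
        have := mem_image_of_mem (orbitConj g G ε) hy
        rwa [himo] at this
    · rw [hsplit hw0, glueAt_image (fun y hy => hy.2) subset_rfl, himi, himo, ← hsplit hw0,
        ← hsplit hw0']
    · intro y hy
      rcases lt_trichotomy y w with h | rfl | h
      · rw [hJi _ (hgi y ⟨hy, h⟩), hJi y ⟨hy, h⟩]
        exact orbitConj_conj hdi (by rw [hri]; exact ⟨hy, h⟩)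
      · rw [hg.fixed, glueAt_self, hG.fixed]
      · rw [hJo _ (hgo y h), hJo y h]
        exact orbitConj_conj hdo (by rw [hro]; exact h)
    · intro t
      rw [hJo _ (lt_orbitParam hg.fixed hw t), orbitConj_orbitParam hdo]
    · intro _ t
      rw [hJi _ ⟨lt_orbitParam hg.zero ha t, orbitParam_lt hg.fixed haw t⟩,
        orbitConj_orbitParam hdi]
    · exact fun _ => glueAt_self
    · intro y hy
      rcases lt_trichotomy y w with h | rfl | h
      · rw [hJi y ⟨hy.1, h⟩]
        obtain ⟨t, rfl⟩ : y ∈ range (orbitParam g a) := by rw [hri]; exact ⟨hy.1, h⟩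
        rw [orbitConj_orbitParam hdi]
        have hm : ∀ t, orbitParam g a t ∈ Icc 0 ε := fun t =>
          ⟨(lt_orbitParam hg.zero ha t).le, ((orbitParam_lt hg.fixed haw t).trans hw).le⟩
        have hm' : ∀ t, orbitParam G a t ∈ Icc 0 ε := fun t =>
          ⟨(lt_orbitParam hG.zero ha t).le, ((orbitParam_lt hG.fixed haw' t).trans hw').le⟩
        have hca : a ∈ Icc 0 ε := ⟨ha.le, (haw.trans hw).le⟩
        -- backward in time the estimate is carried over one step after another
        have hback : ∀ n : ℕ, ∀ t : ℝ, -(n : ℝ) ≤ t →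
            |orbitParam g a t - orbitParam G a t| ≤ δ := by
          intro n
          induction n with
          | zero =>
            intro t ht
            have ht0 : 0 ≤ t := by simpa using ht
            exact abs_sub_le_of_ratio hδ hε (hm t) (hm' t)
              (orbitParam_ratio hδ hE.ratio hca (fun t _ => hm' t) ht0)
              (orbitParam_ratio hδ hE.ratio' hca (fun t _ => hm t) ht0)
          | succ n ih =>
            intro t ht
            rcases le_or_gt (-(n : ℝ)) t with h | h
            · exact ih t h
            · have ht0 : t ≤ 0 := h.le.trans (by simp)
              have hle : orbitParam g a t ≤ a := by
                have h1 := (orbitParam_strictMono (hg.inner _ ha haw)).monotone ht0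
                rwa [orbitParam_of_mem ⟨le_rfl, zero_le_one⟩, zero_mul, add_zero] at h1
              have hle' : orbitParam G a t ≤ a := by
                have h1 := (orbitParam_strictMono (hG.inner _ ha haw')).monotone ht0
                rwa [orbitParam_of_mem ⟨le_rfl, zero_le_one⟩, zero_mul, add_zero] at h1
              refine hE.backward _ ⟨lt_orbitParam hg.zero ha t, hle⟩ _
                ⟨lt_orbitParam hG.zero ha t, hle'⟩ ?_
              rw [← orbitParam_add_one, ← orbitParam_add_one]
              refine ih _ ?_
              push_cast at ht
              linarith
        obtain ⟨n, hn⟩ := exists_nat_ge (-t)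
        exact hback n t (by linarith)
      · rw [glueAt_self]
        exact abs_sub_le_of_ratio hδ hε ⟨hw0.le, hw.le⟩ ⟨hw0'.le, hw'.le⟩
          (fixed_ratio hδ hE.ratio hg hG hw'.le) (fixed_ratio hδ hE.ratio' hG hg hw.le)
      · rw [hJo y h]
        exact houter y ⟨h, hy.2⟩
  · have hw0' : w' = 0 := by rcases hG.base with h | h <;> linarith
    subst hw0'
    refine ⟨orbitConj g G ε, ?_, ?_, ?_, orbitConj_orbitParam hdo, fun h => absurd h (lt_irrefl _),
      fun h => absurd h (lt_irrefl _), houter⟩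
    · rw [← hro]; exact orbitConj_strictMonoOn hdo
    · have := orbitConj_image hdo
      rwa [hro, hro'] at this
    · intro y hy
      exact orbitConj_conj hdo (by rw [hro]; exact hy)

/-- The conjugate `y ↦ -g (-y)` of an increasing bijection by the reflection of the line. -/
def reflect (g : ℝ ≃o ℝ) : ℝ ≃o ℝ where
  toFun y := -g (-y)
  invFun y := -g.symm (-y)
  left_inv y := by simp
  right_inv y := by simp
  map_rel_iff' := by intro x y; simp

theorem reflect_apply (g : ℝ ≃o ℝ) (y : ℝ) : reflect g y = -g (-y) := rfl

theorem reflect_zpow (g : ℝ ≃o ℝ) (n : ℤ) (y : ℝ) : (reflect g ^ n) y = -(g ^ n) (-y) := by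
  have hinv : ∀ y, (reflect g)⁻¹ y = -g⁻¹ (-y) := fun y => rfl
  induction n using Int.induction_on generalizing y with
  | zero => simp
  | succ n ih =>
    rw [zpow_add_one, zpow_add_one, RelIso.mul_apply, RelIso.mul_apply, ih, reflect_apply, neg_neg]
  | pred n ih =>
    rw [zpow_sub_one, zpow_sub_one, RelIso.mul_apply, RelIso.mul_apply, ih, hinv, neg_neg]

theorem orbitParam_reflect (g : ℝ ≃o ℝ) (a t : ℝ) :
    orbitParam (reflect g) a t = -orbitParam g (-a) t := by
  rw [orbitParam, orbitParam, reflect_zpow, reflect_apply]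
  congr 2
  ring

variable {v v' : ℝ}

/-- The fundamental-domain conjugacy on the line, glued from those on the two half-lines. -/
theorem exists_line_conj (hg : HalfPhase g a w) (hG : HalfPhase G a w')
    (hgr : HalfPhase (reflect g) a v) (hGr : HalfPhase (reflect G) a v')
    (hw : w < ε) (hw' : w' < ε) (hv : v < ε) (hv' : v' < ε) (hε : ε ≤ 1) (hδ : 0 ≤ δ)
    (hE : HalfEstimate g G ε a δ) (hEr : HalfEstimate (reflect g) (reflect G) ε a δ) :
    ∃ J : ℝ → ℝ, StrictMono J ∧ Function.Surjective J ∧ (∀ y, J (g y) = G (J y)) ∧ J 0 = 0 ∧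
      (∀ z ∈ ({-ε, ε} : Set ℝ), ∀ t, J (orbitParam g z t) = orbitParam G z t) ∧
      (0 < a → ∀ z ∈ ({-a, a} : Set ℝ), ∀ t, J (orbitParam g z t) = orbitParam G z t) ∧
      (0 < w → J w = w') ∧ (0 < v → J (-v) = -v') ∧ ∀ y ∈ Icc (-ε) ε, |y - J y| ≤ δ := by
  have hε0 : 0 < ε := hg.w_nonneg.trans_lt hw
  obtain ⟨P, hPm, hPi, hPc, hPo, hPa, hPw, hPe⟩ := exists_half_conj hg hG hw hw' hε hδ hE
  obtain ⟨Q, hQm, hQi, hQc, hQo, hQa, hQv, hQe⟩ := exists_half_conj hgr hGr hv hv' hε hδ hEr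
  set J := glueAt 0 0 (fun y => -Q (-y)) P with hJ
  have hJp : ∀ y > 0, J y = P y := fun y hy => glueAt_of_gt hy
  have hJn : ∀ y < 0, J y = -Q (-y) := fun y hy => glueAt_of_lt hy
  have hJ0 : J 0 = 0 := glueAt_self
  have hline : Iio (0:ℝ) ∪ {0} ∪ Ioi 0 = univ := by
    rw [Iio_union_right, Iic_union_Ioi]
  have hQn : (fun y => -Q (-y)) '' Iio 0 = Iio 0 := by
    have : (fun y => -Q (-y)) = Neg.neg ∘ Q ∘ Neg.neg := rfl
    rw [this, image_comp, image_comp, image_neg_Iio, neg_zero, hQi, image_neg_Ioi, neg_zero]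
  have hJm : StrictMono J := by
    rw [← strictMonoOn_univ, ← hline]
    refine glueAt_strictMonoOn ?_ hPm subset_rfl subset_rfl ?_ ?_
    · intro x hx y hy hxy
      exact neg_lt_neg (hQm (mem_Ioi.2 (neg_pos.2 hy)) (mem_Ioi.2 (neg_pos.2 hx)) (neg_lt_neg hxy))
    · intro y hy
      rw [← hQn]; exact mem_image_of_mem _ hy
    · intro y hy
      rw [← hPi]; exact mem_image_of_mem _ hy
  have hsurj : Function.Surjective J := by
    rw [← range_eq_univ, ← image_univ, ← hline, hJ, glueAt_image subset_rfl subset_rfl, hQn, hPi]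
  have hlneg : ∀ z > 0, ∀ t, orbitParam g (-z) t < 0 := fun z hz t =>
    orbitParam_lt hg.zero (neg_neg_of_pos hz) t
  have hneg : ∀ z > 0, (∀ t, Q (orbitParam (reflect g) z t) = orbitParam (reflect G) z t) →
      ∀ t, J (orbitParam g (-z) t) = orbitParam G (-z) t := by
    intro z hz h t
    have := h t
    rw [orbitParam_reflect, orbitParam_reflect] at this
    rw [hJn _ (hlneg z hz t), this, neg_neg]
  refine ⟨J, hJm, hsurj, ?_, hJ0, ?_, ?_, ?_, ?_, ?_⟩
  · intro y
    rcases lt_trichotomy y 0 with h | rfl | h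
    · have hgy : g y < 0 := by rw [← hg.zero]; exact g.lt_iff_lt.2 h
      have := hQc (-y) (neg_pos.2 h)
      rw [reflect_apply, neg_neg, reflect_apply] at this
      rw [hJn _ hgy, hJn _ h, this, neg_neg]
    · rw [hg.zero, hJ0, hG.zero]
    · have hgy : 0 < g y := by rw [← hg.zero]; exact g.lt_iff_lt.2 h
      rw [hJp _ hgy, hJp _ h, hPc y h]
  · rintro z (rfl | rfl) t
    · exact hneg ε hε0 hQo t
    · rw [hJp _ (lt_orbitParam hg.zero hε0 t), hPo]
  · rintro ha z (rfl | rfl) t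
    · exact hneg a ha (hQa ha) t
    · rw [hJp _ (lt_orbitParam hg.zero ha t), hPa ha]
  · intro h
    rw [hJp w h, hPw h]
  · intro h
    rw [hJn _ (neg_neg_of_pos h), neg_neg, hQv h]
  · intro y hy
    rcases lt_trichotomy y 0 with h | rfl | h
    · have := hQe (-y) ⟨neg_pos.2 h, by linarith [hy.1]⟩
      rw [hJn y h, ← abs_neg]
      have e : -(y - -Q (-y)) = -y - Q (-y) := by ring
      rwa [e]
    · rw [hJ0, sub_zero, abs_zero]; exact hδ
    · rw [hJp y h]
      exact hPe y ⟨h, hy.2⟩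

end

/-! ### Comparison with the method of fundamental domains -/

section
variable {g G : ℝ ≃o ℝ} {ε a w w' v v' : ℝ} {g₀ G₀ J : ℝ → ℝ}

theorem iterate_eq_of_eqOn {S : Set ℝ} (h : ∀ y ∈ S, g₀ y = g y) (hm : ∀ y ∈ S, g y ∈ S) (n : ℕ) :
    ∀ y ∈ S, g₀^[n] y = g^[n] y ∧ g^[n] y ∈ S := by
  induction n with
  | zero => exact fun y hy => ⟨rfl, hy⟩
  | succ n ih =>
    intro y hy
    rw [Function.iterate_succ_apply, Function.iterate_succ_apply, h y hy]
    exact ih _ (hm y hy)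

theorem startMap_orbitParam {z t : ℝ} (hg : g₀ z = g z) (hG : G₀ z = G z) (hz : g z ≠ z)
    (ht : t ∈ Icc (0:ℝ) 1) : startMap g₀ G₀ z (orbitParam g z t) = orbitParam G z t := by
  have := sub_ne_zero.2 hz
  rw [startMap, hg, hG, orbitParam_of_mem ht, orbitParam_of_mem ht]
  field_simp
  ring

theorem HalfPhase.eq_of_fixed (hg : HalfPhase g a w) {y : ℝ} (hy : 0 < y) (h : g y = y) :
    y = w := by
  rcases lt_trichotomy y w with h1 | h1 | h1
  · exact absurd h (hg.inner y hy h1).ne'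
  · exact h1
  · exact absurd h (hg.outer y h1).ne

theorem HalfPhase.base_lt (hg : HalfPhase g a w) (ha : 0 < a) : a < w := by
  rcases hg.base with h | h <;> linarith

/-- A map of the line that intertwines the orbit parametrizations of `g` and `G` from all starting
points is the fundamental-domain map of their restrictions to `[-ε, ε]`. -/
theorem isFundamentalDomainMap_of_orbitParam (hg : HalfPhase g a w) (hG : HalfPhase G a w')
    (hgr : HalfPhase (reflect g) a v) (hGr : HalfPhase (reflect G) a v')
    (hw : w < ε) (hv : v < ε)
    (hg₀ : ∀ y ∈ Icc (-ε) ε, g₀ y = g y) (hG₀ : ∀ y ∈ Icc (-ε) ε, G₀ y = G y)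
    (hgm : ∀ y ∈ Icc (-ε) ε, g y ∈ Icc (-ε) ε) (hGm : ∀ y ∈ Icc (-ε) ε, G y ∈ Icc (-ε) ε)
    (hJm : StrictMono J) (hJε : J ε = ε) (hJε' : J (-ε) = -ε) (hJ0 : J 0 = 0)
    (hJo : ∀ z ∈ ({-ε, ε} : Set ℝ), ∀ t, J (orbitParam g z t) = orbitParam G z t)
    (hJa : 0 < a → ∀ z ∈ ({-a, a} : Set ℝ), ∀ t, J (orbitParam g z t) = orbitParam G z t)
    (hJw : 0 < w → J w = w') (hJv : 0 < v → J (-v) = -v') :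
    IsFundamentalDomainMap ε a g₀ G₀ J := by
  have hε0 : 0 < ε := hg.w_nonneg.trans_lt hw
  -- the reflected inequalities for `g` on the negative half-line
  have hrefl : ∀ {y : ℝ}, reflect g y ≠ y → g (-y) ≠ -y := fun {y} h h' => h (by
    rw [reflect_apply, h', neg_neg])
  have hzo : ∀ z ∈ ({-ε, ε} : Set ℝ), z ∈ Icc (-ε) ε ∧ g z ≠ z := by
    rintro z (rfl | rfl)
    · exact ⟨⟨le_rfl, by linarith⟩, hrefl (hgr.outer _ hv).ne⟩
    · exact ⟨⟨by linarith, le_rfl⟩, (hg.outer _ hw).ne⟩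
  have hza : 0 < a → ∀ z ∈ ({-a, a} : Set ℝ), z ∈ Icc (-ε) ε ∧ g z ≠ z := by
    rintro ha z (rfl | rfl)
    · have := (hgr.base_lt ha).trans hv
      exact ⟨⟨by linarith, by linarith⟩, hrefl (hgr.inner _ ha (hgr.base_lt ha)).ne'⟩
    · have := (hg.base_lt ha).trans hw
      exact ⟨⟨by linarith, by linarith⟩, (hg.inner _ ha (hg.base_lt ha)).ne'⟩
  have hforward : ∀ z, z ∈ Icc (-ε) ε → g z ≠ z →
      (∀ t, J (orbitParam g z t) = orbitParam G z t) → ∀ n : ℕ, ∀ u ∈ uIcc z (g₀ z),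
      J (g₀^[n] u) = G₀^[n] (startMap g₀ G₀ z u) := by
    intro z hz hne hJz n u hu
    rw [hg₀ z hz] at hu
    obtain ⟨t, ht, htu⟩ := exists_affine_of_mem_uIcc hu
    rw [← orbitParam_of_mem ht] at htu
    have hGu : orbitParam G z t ∈ Icc (-ε) ε := by
      rw [orbitParam_of_mem ht]
      exact (convex_Icc (-ε) ε).add_smul_sub_mem hz (hGm z hz) ht
    have huI : u ∈ Icc (-ε) ε := (ordConnected_Icc.uIcc_subset hz (hgm z hz)) hu
    rw [(iterate_eq_of_eqOn hg₀ hgm n u huI).1, ← htu,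
      startMap_orbitParam (hg₀ z hz) (hG₀ z hz) hne ht, (iterate_eq_of_eqOn hG₀ hGm n _ hGu).1,
        ← orbitParam_add_nat, ← orbitParam_add_nat, hJz]
  refine ⟨fun z hz => hforward z (hzo z hz).1 (hzo z hz).2 (hJo z hz),
    fun ha z hz => hforward z (hza ha z hz).1 (hza ha z hz).2 (hJa ha z hz), ?_, hJ0, ?_⟩
  · intro ha z hz n y hy hyu
    obtain ⟨hzI, hne⟩ := hza ha z hz
    rw [(iterate_eq_of_eqOn hg₀ hgm n y hy).1, hg₀ z hzI] at hyu
    rw [(iterate_eq_of_eqOn hg₀ hgm n y hy).1]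
    obtain ⟨t, ht, htu⟩ := exists_affine_of_mem_uIcc hyu
    rw [← orbitParam_of_mem ht] at htu
    -- a backward iterate of the fundamental domain consists of orbit points at negative times
    have hy' : y = orbitParam g z (t - n) := by
      have h1 := orbitParam_add_nat g z (t - n) n
      rw [sub_add_cancel, htu] at h1
      exact g.injective.iterate n h1
    have hJy : J y ∈ Icc (-ε) ε := ⟨hJε' ▸ hJm.monotone hy.1, hJε ▸ hJm.monotone hy.2⟩
    refine ⟨hJy, ?_⟩
    rw [(iterate_eq_of_eqOn hG₀ hGm n _ hJy).1, ← htu,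
      startMap_orbitParam (hg₀ z hzI) (hG₀ z hzI) hne ht, hy', hJa ha z hz, ← orbitParam_add_nat,
      sub_add_cancel]
  · -- on each half-line there is at most one fixed point
    intro y hy y' hy' hpos hfix hfix'
    rw [hg₀ y hy] at hfix
    rw [hG₀ y' hy'] at hfix'
    rcases lt_trichotomy y 0 with h | h | h
    · have h' : y' < 0 := by
        by_contra! hc
        exact absurd hpos (not_lt.2 (mul_nonpos_of_nonpos_of_nonneg h.le hc))
      have e : -y = v := hgr.eq_of_fixed (neg_pos.2 h) (by rw [reflect_apply, neg_neg, hfix])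
      have e' : -y' = v' := hGr.eq_of_fixed (neg_pos.2 h') (by rw [reflect_apply, neg_neg, hfix'])
      have := hJv (by linarith)
      rw [← e, ← e', neg_neg, neg_neg] at this
      exact this
    · simp [h] at hpos
    · have h' : 0 < y' := pos_of_mul_pos_right hpos h.le
      have e := hg.eq_of_fixed h hfix
      have e' := hG.eq_of_fixed h' hfix'
      rw [e, e']
      exact hJw (by linarith)

end

/-! ### The normal form at fixed step size and parameter -/

/-- The pitchfork normal form at fixed step size `h` and parameter `β`. -/
noncomputable def cubicMap (s h β : ℝ) (r : ℝ → ℝ) (y : ℝ) : ℝ :=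
  (1 + h * β) * y + s * h * y ^ 3 + h * y ^ 4 * r y

/-- A tail bounded by `B` and Lipschitz with constant `B` on `[-ε, ε]`. -/
structure IsTail (ε B : ℝ) (r : ℝ → ℝ) : Prop where
  bound : ∀ y ∈ Icc (-ε) ε, |r y| ≤ B
  lip : ∀ y ∈ Icc (-ε) ε, ∀ y' ∈ Icc (-ε) ε, |r y - r y'| ≤ B * |y - y'|

/-- Explicit smallness of the step size, of the parameter and of the interval `[-ε, ε]`, under
which the cubic terms dominate tails with bound `B`. -/
structure IsSmallScale (s h β ε B : ℝ) : Prop where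
  sign : s = 1 ∨ s = -1
  h_pos : 0 < h
  h_le : h ≤ 1 / 20
  ε_pos : 0 < ε
  ε_le : ε ≤ 1
  B_nonneg : 0 ≤ B
  B_mul_le : B * ε ≤ 1 / 40
  β_le : 4 * |β| ≤ ε ^ 2

section
variable {s h β ε B δ κ : ℝ} {r r' : ℝ → ℝ}

theorem IsSmallScale.β_le' (hS : IsSmallScale s h β ε B) : |β| ≤ 1 / 4 := by
  have h1 := hS.β_le
  have h2 : ε ^ 2 ≤ 1 := pow_le_one₀ hS.ε_pos.le hS.ε_le
  linarith

theorem IsSmallScale.sq_sign (hS : IsSmallScale s h β ε B) : s * s = 1 := by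
  rcases hS.sign with h | h <;> simp [h]

/-- The Lipschitz constant of the quartic term on `[-κ, κ]`, small against that of the cubic one. -/
theorem IsTail.quartic_lip (hS : IsSmallScale s h β ε B) (hr : IsTail ε B r) (hκ : κ ≤ ε)
    {u v : ℝ} (hu : |u| ≤ κ) (hv : |v| ≤ κ) :
    |u ^ 4 * r u - v ^ 4 * r v| ≤ κ ^ 2 / 8 * |u - v| := by
  have hκ0 : 0 ≤ κ := (abs_nonneg u).trans hu
  have hκ1 : κ ≤ 1 := hκ.trans hS.ε_le
  have huI : u ∈ Icc (-ε) ε := abs_le.1 (hu.trans hκ)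
  have hvI : v ∈ Icc (-ε) ε := abs_le.1 (hv.trans hκ)
  have hB0 := hS.B_nonneg
  have hBκ : B * κ ≤ 1 / 40 := (mul_le_mul_of_nonneg_left hκ hB0).trans hS.B_mul_le
  have h1 : |u ^ 3 + u ^ 2 * v + u * v ^ 2 + v ^ 3| ≤ 4 * κ ^ 3 := by
    have e1 : |u ^ 3| ≤ κ ^ 3 := by rw [abs_pow]; gcongr
    have e2 : |u ^ 2 * v| ≤ κ ^ 2 * κ := by rw [abs_mul, abs_pow]; gcongr
    have e3 : |u * v ^ 2| ≤ κ * κ ^ 2 := by rw [abs_mul, abs_pow]; gcongr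
    have e4 : |v ^ 3| ≤ κ ^ 3 := by rw [abs_pow]; gcongr
    refine (abs_add_le _ _).trans ((add_le_add_left ((abs_add_le _ _).trans
      (add_le_add_left (abs_add_le _ _) _)) _).trans ?_)
    linarith
  have h2 : |v ^ 4| ≤ κ ^ 4 := by rw [abs_pow]; gcongr
  have e : u ^ 4 * r u - v ^ 4 * r v =
      (u ^ 3 + u ^ 2 * v + u * v ^ 2 + v ^ 3) * (u - v) * r u + v ^ 4 * (r u - r v) := by ring
  rw [e]
  refine (abs_add_le _ _).trans ?_
  rw [abs_mul, abs_mul, abs_mul (v ^ 4)]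
  have k1 : |u ^ 3 + u ^ 2 * v + u * v ^ 2 + v ^ 3| * |u - v| * |r u| ≤
      4 * κ ^ 3 * |u - v| * B := by
    have := hr.bound u huI
    gcongr
  have k2 : |v ^ 4| * |r u - r v| ≤ κ ^ 4 * (B * |u - v|) := by
    have := hr.lip u huI v hvI
    gcongr
  have k3 : κ ^ 2 * (B * κ) ≤ κ ^ 2 * (1 / 40) := mul_le_mul_of_nonneg_left hBκ (sq_nonneg κ)
  have k5 : (4 * κ ^ 3 * B + κ ^ 4 * B) * |u - v| ≤ κ ^ 2 / 8 * |u - v| :=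
    mul_le_mul_of_nonneg_right (by nlinarith) (abs_nonneg _)
  linarith

theorem cubicMap_sub (s h β : ℝ) (r : ℝ → ℝ) (u v : ℝ) :
    cubicMap s h β r u - cubicMap s h β r v =
      (u - v) * (1 + h * (β + s * (u ^ 2 + u * v + v ^ 2))) + h * (u ^ 4 * r u - v ^ 4 * r v) := by
  simp only [cubicMap]; ring

theorem cubicMap_expand (hS : IsSmallScale s h β ε B) (hr : IsTail ε B r) {u v : ℝ}
    (hu : u ∈ Icc (-ε) ε) (hv : v ∈ Icc (-ε) ε) (hvu : v ≤ u) :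
    (u - v) / 2 ≤ cubicMap s h β r u - cubicMap s h β r v := by
  have hq := abs_le.1 (hr.quartic_lip hS le_rfl (abs_le.2 hu) (abs_le.2 hv))
  rw [abs_of_nonneg (sub_nonneg.2 hvu)] at hq
  have hε2 : ε ^ 2 ≤ 1 := pow_le_one₀ hS.ε_pos.le hS.ε_le
  have hd := sub_nonneg.2 hvu
  have hP : u ^ 2 + u * v + v ^ 2 ≤ 3 := by nlinarith [hu.1, hu.2, hv.1, hv.2, hS.ε_le]
  have hP0 : 0 ≤ u ^ 2 + u * v + v ^ 2 := by nlinarith [sq_nonneg (u + v), sq_nonneg u, sq_nonneg v]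
  have hsP : -3 ≤ s * (u ^ 2 + u * v + v ^ 2) := by
    rcases hS.sign with h | h <;> rw [h] <;> linarith
  have hβ := (abs_le.1 hS.β_le').1
  have h1 : -(7 / 2) * h ≤ h * (β + s * (u ^ 2 + u * v + v ^ 2)) := by
    nlinarith [mul_le_mul_of_nonneg_left (by linarith : -(7/2) ≤ β + s * (u ^ 2 + u * v + v ^ 2))
      hS.h_pos.le]
  have h2 : h * (-(ε ^ 2 / 8 * (u - v))) ≤ h * (u ^ 4 * r u - v ^ 4 * r v) :=
    mul_le_mul_of_nonneg_left hq.1 hS.h_pos.le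
  have h3 : h * (ε ^ 2 / 8 * (u - v)) ≤ 1 / 20 * (1 / 8 * (u - v)) := by
    have := hS.h_le
    have := hS.h_pos
    gcongr
  have h4 : (u - v) * (1 - 7 / 2 * (1 / 20)) ≤
      (u - v) * (1 + h * (β + s * (u ^ 2 + u * v + v ^ 2))) :=
    mul_le_mul_of_nonneg_left (by linarith [hS.h_le]) hd
  rw [cubicMap_sub]
  linarith

theorem cubicMap_strictMonoOn (hS : IsSmallScale s h β ε B) (hr : IsTail ε B r) :
    StrictMonoOn (cubicMap s h β r) (Icc (-ε) ε) := fun v hv u hu hvu => by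
  have := cubicMap_expand hS hr hu hv hvu.le
  linarith

theorem IsTail.continuousOn (hr : IsTail ε B r) : ContinuousOn r (Icc (-ε) ε) := by
  refine (LipschitzOnWith.of_dist_le_mul (K := B.toNNReal) (fun x hx y hy => ?_)).continuousOn
  rw [Real.dist_eq, Real.dist_eq]
  exact (hr.lip x hx y hy).trans (mul_le_mul_of_nonneg_right (Real.le_coe_toNNReal B)
    (abs_nonneg _))

theorem cubicMap_continuousOn (hr : IsTail ε B r) :
    ContinuousOn (cubicMap s h β r) (Icc (-ε) ε) := by
  have := hr.continuousOn
  unfold cubicMap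
  fun_prop

/-- The projection of the line to `[-ε, ε]`. -/
def clamp (ε y : ℝ) : ℝ := max (-ε) (min ε y)

theorem clamp_of_mem {y : ℝ} (hy : y ∈ Icc (-ε) ε) : clamp ε y = y := by
  rw [clamp, min_eq_right hy.2, max_eq_right hy.1]

theorem clamp_mem (hε : 0 ≤ ε) (y : ℝ) : clamp ε y ∈ Icc (-ε) ε :=
  ⟨le_max_left _ _, max_le (by linarith) (min_le_left _ _)⟩

theorem clamp_of_ge (hε : 0 ≤ ε) {y : ℝ} (hy : ε ≤ y) : clamp ε y = ε := by
  rw [clamp, min_eq_left hy, max_eq_right (by linarith)]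

theorem clamp_of_le (hε : 0 ≤ ε) {y : ℝ} (hy : y ≤ -ε) : clamp ε y = -ε := by
  rw [clamp, min_eq_right (by linarith), max_eq_left hy]

/-- The extension of a map of `[-ε, ε]` to the line by translations. -/
def lineExt (ε : ℝ) (N : ℝ → ℝ) (y : ℝ) : ℝ := N (clamp ε y) + (y - clamp ε y)

theorem lineExt_of_mem {N : ℝ → ℝ} {y : ℝ} (hy : y ∈ Icc (-ε) ε) : lineExt ε N y = N y := by
  rw [lineExt, clamp_of_mem hy, sub_self, add_zero]

theorem lineExt_strictMono {N : ℝ → ℝ} (hε : 0 ≤ ε) (hN : StrictMonoOn N (Icc (-ε) ε)) :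
    StrictMono (lineExt ε N) := by
  intro x y hxy
  have h1 : clamp ε x ≤ clamp ε y := max_le_max le_rfl (min_le_min le_rfl hxy.le)
  have h2 : x - clamp ε x ≤ y - clamp ε y := by
    simp only [clamp]
    rcases max_cases (-ε) (min ε x) with h | h <;> rcases min_cases ε x with k | k <;>
    rcases max_cases (-ε) (min ε y) with h' | h' <;> rcases min_cases ε y with k' | k' <;> linarith
  rcases h1.eq_or_lt with h | h
  · rw [lineExt, lineExt, h]; linarith
  · have := hN (clamp_mem hε x) (clamp_mem hε y) h
    rw [lineExt, lineExt]; linarith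

theorem lineExt_surjective {N : ℝ → ℝ} (hε : 0 ≤ ε) (hN : ContinuousOn N (Icc (-ε) ε)) :
    Function.Surjective (lineExt ε N) := by
  intro z
  rcases le_or_gt z (N (-ε)) with h | h
  · refine ⟨-ε + (z - N (-ε)), ?_⟩
    rw [lineExt, clamp_of_le hε (by linarith)]; ring
  rcases le_or_gt (N ε) z with h' | h'
  · refine ⟨ε + (z - N ε), ?_⟩
    rw [lineExt, clamp_of_ge hε (by linarith)]; ring
  · obtain ⟨y, hy, rfl⟩ := intermediate_value_Icc (by linarith) hN ⟨h.le, h'.le⟩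
    exact ⟨y, lineExt_of_mem hy⟩

/-- The normal form as an increasing bijection of the line: extended by translations outside
`[-ε, ε]`. -/
noncomputable def cubicIso (hS : IsSmallScale s h β ε B) (hr : IsTail ε B r) : ℝ ≃o ℝ :=
  StrictMono.orderIsoOfSurjective (lineExt ε (cubicMap s h β r))
    (lineExt_strictMono hS.ε_pos.le (cubicMap_strictMonoOn hS hr))
    (lineExt_surjective hS.ε_pos.le (cubicMap_continuousOn hr))

theorem cubicIso_apply (hS : IsSmallScale s h β ε B) (hr : IsTail ε B r) (y : ℝ) :
    cubicIso hS hr y = lineExt ε (cubicMap s h β r) y := rfl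

theorem cubicIso_of_mem (hS : IsSmallScale s h β ε B) (hr : IsTail ε B r) {y : ℝ}
    (hy : y ∈ Icc (-ε) ε) : cubicIso hS hr y = cubicMap s h β r y := lineExt_of_mem hy

/-- The reflected tail, which belongs to the reflected normal form `y ↦ -N (-y)`. -/
def reflectTail (r : ℝ → ℝ) (y : ℝ) : ℝ := -r (-y)

theorem neg_mem_Icc {y : ℝ} (hy : y ∈ Icc (-ε) ε) : -y ∈ Icc (-ε) ε :=
  ⟨by linarith [hy.2], by linarith [hy.1]⟩

theorem IsTail.reflect (hr : IsTail ε B r) : IsTail ε B (reflectTail r) :=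
  ⟨fun y hy => by rw [reflectTail, abs_neg]; exact hr.bound _ (neg_mem_Icc hy),
    fun y hy y' hy' => by
      have := hr.lip _ (neg_mem_Icc hy) _ (neg_mem_Icc hy')
      rw [reflectTail, reflectTail, neg_sub_neg, abs_sub_comm]
      rwa [neg_sub_neg, abs_sub_comm y'] at this⟩

theorem clamp_neg (hε : 0 ≤ ε) (y : ℝ) : clamp ε (-y) = -clamp ε y := by
  rcases le_total y (-ε) with h | h
  · rw [clamp_of_le hε h, clamp_of_ge hε (by linarith), neg_neg]
  rcases le_total ε y with h' | h'
  · rw [clamp_of_ge hε h', clamp_of_le hε (by linarith)]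
  · rw [clamp_of_mem ⟨h, h'⟩, clamp_of_mem (neg_mem_Icc ⟨h, h'⟩)]

theorem reflect_cubicIso (hS : IsSmallScale s h β ε B) (hr : IsTail ε B r) :
    reflect (cubicIso hS hr) = cubicIso hS hr.reflect := by
  ext y
  rw [reflect_apply, cubicIso_apply, cubicIso_apply, lineExt, lineExt, clamp_neg hS.ε_pos.le]
  simp only [cubicMap, reflectTail]
  ring

/-- The displacement of the normal form is `s h y` times this function, which has at most one zero
in `[0, ε]`. -/
noncomputable def displacement (s β : ℝ) (r : ℝ → ℝ) (y : ℝ) : ℝ :=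
  s * β + y ^ 2 + s * (y ^ 3 * r y)

theorem cubicMap_displacement (hs : s * s = 1) (y : ℝ) :
    s * (cubicMap s h β r y - y) = h * y * displacement s β r y := by
  simp only [cubicMap, displacement]
  linear_combination (h * y ^ 3) * hs

/-- The quotient of the displacement by `h y` increases, as the cubic term dominates the tail. Hence
there is at most one positive fixed point. -/
theorem displacement_strictMonoOn (hS : IsSmallScale s h β ε B) (hr : IsTail ε B r) :
    StrictMonoOn (displacement s β r) (Icc 0 ε) := by
  intro x hx y hy hxy
  have hxI : x ∈ Icc (-ε) ε := ⟨by linarith [hx.1, hS.ε_pos], hx.2⟩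
  have hyI : y ∈ Icc (-ε) ε := ⟨by linarith [hy.1, hS.ε_pos], hy.2⟩
  have e : y ^ 3 * r y - x ^ 3 * r x =
      (y - x) * (y ^ 2 + y * x + x ^ 2) * r y + x ^ 3 * (r y - r x) := by ring
  have hd : 0 < y - x := sub_pos.2 hxy
  have hx0 := hx.1
  have hy0 := hy.1
  have k1 : |(y - x) * (y ^ 2 + y * x + x ^ 2) * r y| ≤ (y - x) * (2 * ε * (y + x)) * B := by
    rw [abs_mul, abs_of_nonneg (by positivity : 0 ≤ (y - x) * (y ^ 2 + y * x + x ^ 2))]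
    have hb := hr.bound y hyI
    have : y ^ 2 + y * x + x ^ 2 ≤ 2 * ε * (y + x) := by nlinarith [hx.2, hy.2]
    have hε := hS.ε_pos
    gcongr
  have k2 : |x ^ 3 * (r y - r x)| ≤ (ε * (y + x)) * (B * (y - x)) := by
    rw [abs_mul, abs_of_nonneg (by positivity : 0 ≤ x ^ 3)]
    have hb := hr.lip y hyI x hxI
    rw [abs_of_pos hd] at hb
    have h1 : x ^ 2 ≤ ε := by nlinarith [hx.2, hS.ε_le]
    have : x ^ 3 ≤ ε * (y + x) := by
      have h2 : x ^ 2 * x ≤ ε * (y + x) := mul_le_mul h1 (by linarith) hx0 hS.ε_pos.le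
      linarith [h2, pow_succ x 2]
    have := hS.ε_pos
    gcongr
  have k3 : |s * (y ^ 3 * r y - x ^ 3 * r x)| ≤ 3 * (B * ε) * ((y + x) * (y - x)) := by
    have hs1 : |s| = 1 := by rcases hS.sign with h | h <;> simp [h]
    rw [abs_mul, hs1, one_mul, e]
    refine (abs_add_le _ _).trans ?_
    linarith
  have hpos : 0 < (y + x) * (y - x) := mul_pos (by linarith) hd
  have k4 : 3 * (B * ε) * ((y + x) * (y - x)) ≤ 3 * (1 / 40) * ((y + x) * (y - x)) :=
    mul_le_mul_of_nonneg_right (by linarith [hS.B_mul_le]) hpos.le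
  have k5 := (abs_le.1 k3).1
  simp only [displacement]
  have e2 : (y + x) * (y - x) = y ^ 2 - x ^ 2 := by ring
  rw [e2] at k4 k5 hpos
  linarith

theorem IsTail.cubic_term_le (hS : IsSmallScale s h β ε B) (hr : IsTail ε B r) {y : ℝ}
    (hy : y ∈ Icc 0 ε) : |s * (y ^ 3 * r y)| ≤ y ^ 2 / 40 := by
  have hyI : y ∈ Icc (-ε) ε := ⟨by linarith [hy.1, hS.ε_pos], hy.2⟩
  have hs1 : |s| = 1 := by rcases hS.sign with h | h <;> simp [h]
  have hy0 := hy.1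
  rw [abs_mul, hs1, one_mul, abs_mul, abs_of_nonneg (by positivity : 0 ≤ y ^ 3)]
  have h1 : y * |r y| ≤ ε * B := mul_le_mul hy.2 (hr.bound y hyI) (abs_nonneg _) hS.ε_pos.le
  have h2 : y ^ 2 * (y * |r y|) ≤ y ^ 2 * (1 / 40) :=
    mul_le_mul_of_nonneg_left (by linarith [hS.B_mul_le]) (sq_nonneg y)
  calc y ^ 3 * |r y| = y ^ 2 * (y * |r y|) := by ring
    _ ≤ y ^ 2 / 40 := by linarith

/-- The sign of the displacement on the half-line `y > 0`; there is a positive fixed point exactly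
if `-s β > 0`, and then it exceeds `√(-s β / 8)`. -/
theorem exists_fixed_point (hS : IsSmallScale s h β ε B) (hr : IsTail ε B r) :
    ∃ w < ε, cubicIso hS hr w = w ∧
      ((0 < Real.sqrt (-s * β / 8) ∧ Real.sqrt (-s * β / 8) < w) ∨
        (Real.sqrt (-s * β / 8) = 0 ∧ w = 0)) ∧
      (∀ y, 0 < y → y < w → s * (cubicIso hS hr y - y) < 0) ∧
      (∀ y, w < y → 0 < s * (cubicIso hS hr y - y)) := by
  have hε := hS.ε_pos
  have hmono := displacement_strictMonoOn hS hr
  have hcont : ContinuousOn (displacement s β r) (Icc 0 ε) := by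
    have := hr.continuousOn.mono (Icc_subset_Icc_left (by linarith) : Icc 0 ε ⊆ Icc (-ε) ε)
    unfold displacement
    fun_prop
  have hss := hS.sq_sign
  have hsub : ∀ {y}, y ∈ Icc 0 ε → y ∈ Icc (-ε) ε := fun hy => ⟨by linarith [hy.1], hy.2⟩
  have habs : |s * β| = |β| := by
    rw [abs_mul]; rcases hS.sign with h | h <;> simp [h]
  have hsβ := abs_le.1 (habs.le.trans (by linarith [hS.β_le] : |β| ≤ ε ^ 2 / 4))
  have hεε : ε ∈ Icc 0 ε := ⟨hε.le, le_rfl⟩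
  have hend : 0 < displacement s β r ε := by
    have := (abs_le.1 (hr.cubic_term_le hS hεε)).1
    have h2 : 0 < ε ^ 2 := by positivity
    simp only [displacement]
    linarith
  have hval : ∀ y ∈ Icc 0 ε, s * (cubicIso hS hr y - y) = h * y * displacement s β r y :=
    fun y hy => by rw [cubicIso_of_mem hS hr (hsub hy), cubicMap_displacement hss]
  -- beyond `ε` the displacement of the extension is constant
  have hfar : ∀ y, ε < y → 0 < s * (cubicIso hS hr y - y) := by
    intro y hy
    have h1 : cubicIso hS hr y - y = cubicIso hS hr ε - ε := by
      rw [cubicIso_apply, cubicIso_apply, lineExt, lineExt, clamp_of_ge hε.le hy.le,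
        clamp_of_ge hε.le le_rfl]
      ring
    rw [h1, hval ε hεε]
    have := hS.h_pos
    positivity
  have hfinish : ∀ w ∈ Icc 0 ε, w < ε → 0 ≤ displacement s β r w →
      ∀ y, w < y → 0 < s * (cubicIso hS hr y - y) := by
    intro w hw hwε h0 y hy
    rcases le_or_gt y ε with h | h
    · have hyI : y ∈ Icc 0 ε := ⟨hw.1.trans hy.le, h⟩
      rw [hval y hyI]
      have h1 := h0.trans_lt (hmono hw hyI hy)
      have h2 : 0 < y := hw.1.trans_lt hy
      have := hS.h_pos
      positivity
    · exact hfar y h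
  have h00 : (0:ℝ) ∈ Icc 0 ε := ⟨le_rfl, hε.le⟩
  rcases le_or_gt (-s * β) 0 with hb | hb
  · refine ⟨0, hε, ?_, Or.inr ⟨Real.sqrt_eq_zero_of_nonpos (by linarith), rfl⟩,
      fun y h1 h2 => absurd h1 (not_lt.2 h2.le), hfinish 0 h00 hε ?_⟩
    · rw [cubicIso_of_mem hS hr (hsub h00)]; simp [cubicMap]
    · simp only [displacement]
      have : s * β ≥ 0 := by linarith
      simpa using this
  · set a := Real.sqrt (-s * β / 8) with ha
    have ha2 : a ^ 2 = -s * β / 8 := Real.sq_sqrt (by linarith)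
    have ha0 : 0 < a := Real.sqrt_pos.2 (by linarith)
    have haε : a < ε := by
      refine lt_of_pow_lt_pow_left₀ 2 hε.le ?_
      rw [ha2]
      have : 0 < ε ^ 2 := by positivity
      linarith [hsβ.1]
    have haI : a ∈ Icc 0 ε := ⟨ha0.le, haε.le⟩
    have hneg : displacement s β r a < 0 := by
      have := (abs_le.1 (hr.cubic_term_le hS haI)).2
      simp only [displacement]
      rw [ha2] at this ⊢
      linarith
    obtain ⟨w, hw, hw0⟩ := intermediate_value_Icc haε.le
      (hcont.mono (Icc_subset_Icc_left ha0.le)) ⟨hneg.le, hend.le⟩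
    have hwI : w ∈ Icc 0 ε := ⟨ha0.le.trans hw.1, hw.2⟩
    have haw : a < w := lt_of_le_of_ne hw.1 (by
      rintro h; rw [h, hw0] at hneg; exact lt_irrefl _ hneg)
    have hwε : w < ε := lt_of_le_of_ne hw.2 (by
      rintro rfl; rw [hw0] at hend; exact lt_irrefl _ hend)
    refine ⟨w, hwε, ?_, Or.inl ⟨ha0, haw⟩, ?_, hfinish w hwI hwε hw0.ge⟩
    · have h1 := hval w hwI
      rw [hw0, mul_zero] at h1
      have hs0 : s ≠ 0 := by rcases hS.sign with h | h <;> simp [h]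
      rcases mul_eq_zero.1 h1 with h | h
      · exact absurd h hs0
      · linarith
    · intro y h1 h2
      have hyI : y ∈ Icc 0 ε := ⟨h1.le, h2.le.trans hw.2⟩
      rw [hval y hyI]
      have h3 := hmono hyI hwI h2
      rw [hw0] at h3
      exact mul_neg_of_pos_of_neg (mul_pos hS.h_pos h1) h3

end

/-! ### Estimates for the fundamental-domain conjugacy -/

section
variable {s h β ε B δ κ : ℝ} {r r' : ℝ → ℝ}

/-- The map iterated towards the interior: the normal form for `s = -1`, its inverse for `s = 1`. -/
noncomputable def inwardIso (hS : IsSmallScale s h β ε B) (hr : IsTail ε B r) : ℝ ≃o ℝ :=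
  open Classical in if s < 0 then cubicIso hS hr else (cubicIso hS hr).symm

theorem inwardIso_of_neg (hS : IsSmallScale s h β ε B) (hr : IsTail ε B r) (hs : s = -1) :
    inwardIso hS hr = cubicIso hS hr := if_pos (by rw [hs]; norm_num)

theorem inwardIso_of_pos (hS : IsSmallScale s h β ε B) (hr : IsTail ε B r) (hs : s = 1) :
    inwardIso hS hr = (cubicIso hS hr).symm := if_neg (by rw [hs]; norm_num)

theorem reflect_inwardIso (hS : IsSmallScale s h β ε B) (hr : IsTail ε B r) :
    reflect (inwardIso hS hr) = inwardIso hS hr.reflect := by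
  rcases hS.sign with hs | hs
  · rw [inwardIso_of_pos hS hr hs, inwardIso_of_pos hS hr.reflect hs, ← reflect_cubicIso]
    rfl
  · rw [inwardIso_of_neg hS hr hs, inwardIso_of_neg hS hr.reflect hs, reflect_cubicIso]

/-- The sign is rewritten in front of a term whose other occurrences of `s` are inside types. -/
theorem sign_mul {s c : ℝ} (hs : s = c) (x : ℝ) : s * x = c * x := by rw [hs]

theorem cubicIso_zero (hS : IsSmallScale s h β ε B) (hr : IsTail ε B r) : cubicIso hS hr 0 = 0 := by
  rw [cubicIso_of_mem hS hr ⟨by linarith [hS.ε_pos], hS.ε_pos.le⟩]; simp [cubicMap]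

theorem exists_halfPhase (hS : IsSmallScale s h β ε B) (hr : IsTail ε B r) :
    ∃ w < ε, HalfPhase (inwardIso hS hr) (Real.sqrt (-s * β / 8)) w := by
  obtain ⟨w, hwε, hfix, hbase, hin, hout⟩ := exists_fixed_point hS hr
  have h0 := cubicIso_zero hS hr
  refine ⟨w, hwε, ?_⟩
  rcases hS.sign with hs | hs
  · rw [inwardIso_of_pos hS hr hs]
    refine ⟨?_, ?_, fun y h1 h2 => ?_, fun y h1 => ?_, hbase⟩
    · rw [OrderIso.symm_apply_eq, h0]
    · rw [OrderIso.symm_apply_eq, hfix]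
    · rw [OrderIso.lt_symm_apply]
      have := hin y h1 h2
      rw [sign_mul hs] at this; linarith
    · rw [OrderIso.symm_apply_lt]
      have := hout y h1
      rw [sign_mul hs] at this; linarith
  · rw [inwardIso_of_neg hS hr hs]
    refine ⟨h0, hfix, fun y h1 h2 => ?_, fun y h1 => ?_, hbase⟩
    · have := hin y h1 h2
      rw [sign_mul hs] at this; linarith
    · have := hout y h1
      rw [sign_mul hs] at this; linarith

/-- Comparison of two close normal forms at proportional points. The linear terms cancel, and the
cubic terms contribute `h u³ δ` with sign `s`, which dominates the contribution of the tails. -/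
theorem cubicMap_ratio (hS : IsSmallScale s h β ε B) (hr : IsTail ε B r)
    (hδ0 : 0 ≤ δ) (hδ1 : δ ≤ 1) (hclose : ∀ y ∈ Icc (-ε) ε, |r y - r' y| ≤ B * δ) {u : ℝ}
    (hu : 0 ≤ u) (hX : (1 + δ) * u ≤ ε) :
    0 ≤ s * (cubicMap s h β r ((1 + δ) * u) - (1 + δ) * cubicMap s h β r' u) := by
  have hε := hS.ε_pos
  have hB0 := hS.B_nonneg
  have huX : u ≤ (1 + δ) * u := by nlinarith
  have huε : u ≤ ε := huX.trans hX
  have huI : u ∈ Icc (-ε) ε := ⟨by linarith, huε⟩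
  have hXI : (1 + δ) * u ∈ Icc (-ε) ε := ⟨by linarith, hX⟩
  have hss := hS.sq_sign
  set T := (1 + δ) ^ 3 * r ((1 + δ) * u) - r' u with hT
  have e : s * (cubicMap s h β r ((1 + δ) * u) - (1 + δ) * cubicMap s h β r' u) =
      h * u ^ 3 * (1 + δ) * (δ * (2 + δ) + u * (s * T)) := by
    simp only [cubicMap, hT]
    linear_combination (h * u ^ 3 * (1 + δ) * (δ * (2 + δ))) * hss
  have hTb : |T| ≤ 9 * (B * δ) := by
    have e2 : T = (3 * δ + 3 * δ ^ 2 + δ ^ 3) * r ((1 + δ) * u) +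
        ((r ((1 + δ) * u) - r u) + (r u - r' u)) := by rw [hT]; ring
    have k1 : |(3 * δ + 3 * δ ^ 2 + δ ^ 3) * r ((1 + δ) * u)| ≤ 7 * δ * B := by
      rw [abs_mul, abs_of_nonneg (by positivity : 0 ≤ 3 * δ + 3 * δ ^ 2 + δ ^ 3)]
      have h1 : δ ^ 2 ≤ δ := by nlinarith
      have h2 : δ ^ 3 ≤ δ := by nlinarith
      exact mul_le_mul (by linarith) (hr.bound _ hXI) (abs_nonneg _) (by positivity)
    have k2 : |r ((1 + δ) * u) - r u| ≤ B * δ := by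
      refine (hr.lip _ hXI _ huI).trans (mul_le_mul_of_nonneg_left ?_ hB0)
      have : (1 + δ) * u - u = δ * u := by ring
      rw [this, abs_of_nonneg (mul_nonneg hδ0 hu)]
      nlinarith [hS.ε_le]
    have k3 := hclose u huI
    rw [e2]
    refine (abs_add_le _ _).trans ?_
    have := abs_add_le (r ((1 + δ) * u) - r u) (r u - r' u)
    linarith
  have hs1 : |s| = 1 := by rcases hS.sign with h | h <;> simp [h]
  have hlow : -(9 / 40 * δ) ≤ u * (s * T) := by
    have h1 : |u * (s * T)| ≤ ε * (9 * (B * δ)) := by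
      rw [abs_mul, abs_mul, hs1, one_mul, abs_of_nonneg hu]
      exact mul_le_mul huε hTb (abs_nonneg _) hε.le
    have h2 : B * ε * (9 * δ) ≤ 1 / 40 * (9 * δ) :=
      mul_le_mul_of_nonneg_right hS.B_mul_le (by positivity)
    have := (abs_le.1 h1).1
    linarith
  rw [e]
  have h3 := hS.h_pos
  have h4 : 0 ≤ δ * (2 + δ) + u * (s * T) := by nlinarith
  positivity

/-- The ratio property of the inward maps. For `s = -1` it is `cubicMap_ratio`; for `s = 1` the
comparison of the normal forms is inverted together with the maps. -/
theorem inwardIso_ratio (hS : IsSmallScale s h β ε B) (hr : IsTail ε B r) (hr' : IsTail ε B r')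
    (hδ0 : 0 ≤ δ) (hδ1 : δ ≤ 1) (hclose : ∀ y ∈ Icc (-ε) ε, |r y - r' y| ≤ B * δ) :
    ∀ z ∈ Icc 0 ε, inwardIso hS hr z ≤ (1 + δ) * inwardIso hS hr' (z / (1 + δ)) := by
  intro z hz
  have hε := hS.ε_pos
  have h1 : 0 < 1 + δ := by linarith
  have hu0 : 0 ≤ z / (1 + δ) := div_nonneg hz.1 h1.le
  have hzu : (1 + δ) * (z / (1 + δ)) = z := mul_div_cancel₀ z h1.ne'
  have huz : z / (1 + δ) ≤ z := div_le_self hz.1 (by linarith)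
  rcases hS.sign with hs | hs
  · rw [inwardIso_of_pos hS hr hs, inwardIso_of_pos hS hr' hs]
    set u := (cubicIso hS hr').symm (z / (1 + δ)) with hu
    have hNu : cubicIso hS hr' u = z / (1 + δ) := by rw [hu, OrderIso.apply_symm_apply]
    have hend : ∀ {r : ℝ → ℝ} (hr : IsTail ε B r), ε ≤ cubicIso hS hr ε := fun hr => by
      obtain ⟨w, hwε, -, -, -, hout⟩ := exists_fixed_point hS hr
      have := hout ε hwε
      rw [sign_mul hs] at this; linarith
    have hu1 : 0 ≤ u := by rw [hu, OrderIso.le_symm_apply, cubicIso_zero]; exact hu0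
    have hu2 : u ≤ ε := by
      rw [hu, OrderIso.symm_apply_le]
      exact (huz.trans hz.2).trans (hend hr')
    rw [OrderIso.symm_apply_le]
    rcases le_or_gt ((1 + δ) * u) ε with hX | hX
    · have h2 := cubicMap_ratio hS hr hδ0 hδ1 hclose hu1 hX
      rw [cubicIso_of_mem hS hr ⟨by nlinarith, hX⟩]
      rw [cubicIso_of_mem hS hr' ⟨by linarith, hu2⟩] at hNu
      rw [hNu, hzu, hs, one_mul] at h2
      subst hs
      linarith
    · exact hz.2.trans ((hend hr).trans ((cubicIso hS hr).monotone hX.le))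
  · rw [inwardIso_of_neg hS hr hs, inwardIso_of_neg hS hr' hs]
    have h2 := cubicMap_ratio hS hr hδ0 hδ1 hclose hu0 (by rw [hzu]; exact hz.2)
    rw [hzu] at h2
    rw [cubicIso_of_mem hS hr ⟨by linarith [hz.1], hz.2⟩,
      cubicIso_of_mem hS hr' ⟨by linarith, huz.trans hz.2⟩]
    subst hs
    linarith

/-- Near the origin, in the inner region, the normal form expands (`s = -1`) or contracts (`s = 1`)
distances at the rate `1 - s h b / 4`, where `b = -s β > 0`. -/
theorem cubicMap_inner_slope (hS : IsSmallScale s h β ε B) (hr : IsTail ε B r) (hκ : κ ≤ ε)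
    (hκb : 6 * κ ^ 2 ≤ -s * β) {u v : ℝ} (hu : u ∈ Icc 0 κ) (hv : v ∈ Icc 0 κ) (hvu : v ≤ u) :
    h * (-s * β) / 4 * (u - v) ≤
      -s * (cubicMap s h β r u - cubicMap s h β r v - (u - v)) := by
  have hq := hr.quartic_lip hS hκ (abs_le.2 ⟨by linarith [hu.1, hu.2], hu.2⟩)
    (abs_le.2 ⟨by linarith [hv.1, hv.2], hv.2⟩)
  have hd := sub_nonneg.2 hvu
  rw [abs_of_nonneg hd] at hq
  have hss := hS.sq_sign
  set q := u ^ 4 * r u - v ^ 4 * r v with hqdef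
  have hsq : |s * q| ≤ κ ^ 2 / 8 * (u - v) := by
    have hs1 : |s| = 1 := by rcases hS.sign with h | h <;> simp [h]
    rw [abs_mul, hs1, one_mul]; exact hq
  have e : -s * (cubicMap s h β r u - cubicMap s h β r v - (u - v)) =
      h * ((u - v) * (-s * β - (u ^ 2 + u * v + v ^ 2)) - s * q) := by
    rw [cubicMap_sub]
    linear_combination (-h * (u - v) * (u ^ 2 + u * v + v ^ 2)) * hss
  have hP : u ^ 2 + u * v + v ^ 2 ≤ 3 * κ ^ 2 := by nlinarith [hu.1, hu.2, hv.1, hv.2]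
  have h1 : (u - v) * (-s * β - 3 * κ ^ 2 - κ ^ 2 / 8) ≤
      (u - v) * (-s * β - (u ^ 2 + u * v + v ^ 2)) - s * q := by
    have := (abs_le.1 hsq).2
    nlinarith [mul_le_mul_of_nonneg_left hP hd]
  have h2 : (u - v) * ((-s * β) / 4) ≤ (u - v) * (-s * β - 3 * κ ^ 2 - κ ^ 2 / 8) :=
    mul_le_mul_of_nonneg_left (by nlinarith [sq_nonneg κ]) hd
  have h3 := mul_le_mul_of_nonneg_left (h2.trans h1) hS.h_pos.le
  rw [e]
  linarith

/-- In the inner region two close normal forms differ by at most `h |β| δ / 4`. -/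
theorem cubicMap_close (hS : IsSmallScale s h β ε B) (hδ0 : 0 ≤ δ)
    (hclose : ∀ y ∈ Icc (-ε) ε, |r y - r' y| ≤ B * δ) (hκ : κ ≤ ε)
    (hκb : 6 * κ ^ 2 ≤ -s * β) {v : ℝ} (hv : v ∈ Icc 0 κ) :
    |cubicMap s h β r v - cubicMap s h β r' v| ≤ h * (-s * β) / 4 * δ := by
  have hB0 := hS.B_nonneg
  have hv0 := hv.1
  have hvε := hv.2.trans hκ
  have e : cubicMap s h β r v - cubicMap s h β r' v = h * v ^ 4 * (r v - r' v) := by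
    simp only [cubicMap]; ring
  have hh := hS.h_pos
  rw [e, abs_mul, abs_of_nonneg (by positivity : 0 ≤ h * v ^ 4)]
  have h1 := hclose v ⟨by linarith [hS.ε_pos], hvε⟩
  have h2 : v ^ 2 ≤ κ ^ 2 := pow_le_pow_left₀ hv0 hv.2 2
  have h3 : B * v ≤ 1 / 40 := (mul_le_mul_of_nonneg_left hvε hB0).trans hS.B_mul_le
  have h4 : v ≤ 1 := hvε.trans hS.ε_le
  have h5 : v * (B * v) ≤ 1 * (1 / 40) := mul_le_mul h4 h3 (by positivity) zero_le_one
  have h7 : v ^ 4 * B ≤ (-s * β) / 4 := by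
    have : v ^ 4 * B = v ^ 2 * (v * (B * v)) := by ring
    nlinarith [sq_nonneg κ]
  calc h * v ^ 4 * |r v - r' v| ≤ h * v ^ 4 * (B * δ) :=
        mul_le_mul_of_nonneg_left h1 (by positivity)
    _ = h * (v ^ 4 * B) * δ := by ring
    _ ≤ h * ((-s * β) / 4) * δ := by gcongr
    _ = h * (-s * β) / 4 * δ := by ring

/-- On `|y| ≤ √(-s β / 8)` one step back does not increase the distance beyond `δ`: the inward maps
expand distances there at a rate `h |β| / 4`, and the normal forms differ by at most
`h |β| δ / 4`. -/
theorem inwardIso_backward (hS : IsSmallScale s h β ε B) (hr : IsTail ε B r) (hr' : IsTail ε B r')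
    (hδ0 : 0 ≤ δ) (hclose : ∀ y ∈ Icc (-ε) ε, |r y - r' y| ≤ B * δ) :
    ∀ y ∈ Ioc 0 (Real.sqrt (-s * β / 8)), ∀ z ∈ Ioc 0 (Real.sqrt (-s * β / 8)),
      |inwardIso hS hr' y - inwardIso hS hr z| ≤ δ → |y - z| ≤ δ := by
  intro y hy z hz hyz
  set a := Real.sqrt (-s * β / 8) with ha
  have hε := hS.ε_pos
  have ha0 : 0 < a := hy.1.trans_le hy.2
  have hb8 : 0 < -s * β / 8 := Real.sqrt_pos.1 ha0
  have ha2 : a ^ 2 = -s * β / 8 := Real.sq_sqrt hb8.le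
  have hb : 0 < -s * β := by linarith
  have hbβ : -s * β ≤ ε ^ 2 / 4 := by
    have : |(-s) * β| = |β| := by
      rw [abs_mul]; rcases hS.sign with h | h <;> simp [h]
    linarith [le_abs_self (-s * β), hS.β_le]
  -- the factor `11/10` leaves room for one application of the map
  set κ := 11 / 10 * a with hκdef
  have hκ2 : κ ^ 2 = 121 / 800 * (-s * β) := by rw [hκdef, mul_pow, ha2]; ring
  have hκb : 6 * κ ^ 2 ≤ -s * β := by rw [hκ2]; linarith
  have hκε : κ ≤ ε := by
    refine le_of_sq_le_sq ?_ hε.le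
    rw [hκ2]; nlinarith
  have haκ : a ≤ κ := by rw [hκdef]; linarith
  have hh := hS.h_pos
  have hθ : 0 < h * (-s * β) / 4 := by positivity
  have slope : ∀ {u v : ℝ}, u ∈ Icc 0 κ → v ∈ Icc 0 κ → v ≤ u →
      h * (-s * β) / 4 * (u - v) ≤ -s * (cubicMap s h β r' u - cubicMap s h β r' v - (u - v)) :=
    fun hu hv hvu => cubicMap_inner_slope hS hr' hκε hκb hu hv hvu
  have hsub : ∀ {x : ℝ}, x ∈ Icc 0 κ → x ∈ Icc (-ε) ε := fun hx =>
    ⟨by linarith [hx.1], hx.2.trans hκε⟩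
  rcases hS.sign with hs | hs
  · rw [inwardIso_of_pos hS hr hs, inwardIso_of_pos hS hr' hs] at hyz
    -- the inverse images of points below `a` lie below `κ`
    have hinv : ∀ {r : ℝ → ℝ} (hr : IsTail ε B r), ∀ y ∈ Ioc 0 a,
        (cubicIso hS hr).symm y ∈ Icc 0 κ := by
      intro r hr y hy
      have hκI : κ ∈ Icc 0 ε := ⟨ha0.le.trans haκ, hκε⟩
      refine ⟨by rw [OrderIso.le_symm_apply, cubicIso_zero]; exact hy.1.le, ?_⟩
      rw [OrderIso.symm_apply_le, cubicIso_of_mem hS hr (hsub ⟨hκI.1, le_rfl⟩)]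
      refine hy.2.trans ?_
      have h1 := cubicMap_displacement (h := h) (β := β) (r := r) hS.sq_sign κ
      have h2 := (abs_le.1 (hr.cubic_term_le hS hκI)).1
      have h3 : -(1 / 4) ≤ displacement s β r κ := by
        simp only [displacement]
        have := (abs_le.1 hS.β_le').1
        rw [hs] at h2 ⊢
        nlinarith [sq_nonneg κ]
      have h4 : h * κ * (-(1 / 4)) ≤ h * κ * displacement s β r κ :=
        mul_le_mul_of_nonneg_left h3 (mul_nonneg hh.le hκI.1)
      have h5 : h * κ ≤ 1 / 20 * κ := mul_le_mul_of_nonneg_right hS.h_le hκI.1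
      rw [← h1, hs] at h4
      rw [hs]
      rw [hκdef] at *
      linarith
    have huI := hinv hr' y hy
    have hvI := hinv hr z hz
    obtain ⟨u, hu⟩ : ∃ u, u = (cubicIso hS hr').symm y := ⟨_, rfl⟩
    obtain ⟨v, hv⟩ : ∃ v, v = (cubicIso hS hr).symm z := ⟨_, rfl⟩
    rw [← hu, ← hv] at hyz
    rw [← hu] at huI
    rw [← hv] at hvI
    have hyu : y = cubicMap s h β r' u := by
      rw [← cubicIso_of_mem hS hr' (hsub huI), hu, OrderIso.apply_symm_apply]
    have hzv : z = cubicMap s h β r v := by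
      rw [← cubicIso_of_mem hS hr (hsub hvI), hv, OrderIso.apply_symm_apply]
    have hc := cubicMap_close (h := h) hS hδ0 hclose hκε hκb hvI
    have hcon : |cubicMap s h β r' u - cubicMap s h β r' v| ≤ (1 - h * (-s * β) / 4) * |u - v| := by
      have hm := cubicMap_strictMonoOn hS hr'
      rcases le_total v u with hvu | hvu
      · have h1 := slope huI hvI hvu
        rw [abs_of_nonneg (sub_nonneg.2 hvu),
          abs_of_nonneg (sub_nonneg.2 (hm.monotoneOn (hsub hvI) (hsub huI) hvu))]
        rw [hs] at h1 ⊢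
        linarith
      · have h1 := slope hvI huI hvu
        rw [abs_of_nonpos (sub_nonpos.2 hvu),
          abs_of_nonpos (sub_nonpos.2 (hm.monotoneOn (hsub huI) (hsub hvI) hvu))]
        rw [hs] at h1 ⊢
        linarith
    have hθ1 : h * (-s * β) / 4 ≤ 1 := by
      have : ε ^ 2 ≤ 1 := pow_le_one₀ hε.le hS.ε_le
      have h1 : h * (-s * β) ≤ 1 / 20 * 1 := mul_le_mul hS.h_le (by linarith) hb.le (by norm_num)
      linarith
    have h3 : (1 - h * (-s * β) / 4) * |u - v| ≤ (1 - h * (-s * β) / 4) * δ :=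
      mul_le_mul_of_nonneg_left hyz (by linarith)
    have h4 := abs_sub_le (cubicMap s h β r' u) (cubicMap s h β r' v) (cubicMap s h β r v)
    rw [abs_sub_comm (cubicMap s h β r' v)] at h4
    rw [hyu, hzv]
    linarith
  · have hyI : y ∈ Icc 0 κ := ⟨hy.1.le, hy.2.trans haκ⟩
    have hzI : z ∈ Icc 0 κ := ⟨hz.1.le, hz.2.trans haκ⟩
    rw [inwardIso_of_neg hS hr hs, inwardIso_of_neg hS hr' hs, cubicIso_of_mem hS hr (hsub hzI),
      cubicIso_of_mem hS hr' (hsub hyI)] at hyz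
    have hc := cubicMap_close (h := h) hS hδ0 hclose hκε hκb hzI
    have hexp : (1 + h * (-s * β) / 4) * |y - z| ≤
        |cubicMap s h β r' y - cubicMap s h β r' z| := by
      rcases le_total z y with hzy | hzy
      · have h1 := slope hyI hzI hzy
        rw [abs_of_nonneg (sub_nonneg.2 hzy)]
        refine le_trans ?_ (le_abs_self _)
        rw [hs] at h1 ⊢
        linarith
      · have h1 := slope hzI hyI hzy
        rw [abs_of_nonpos (sub_nonpos.2 hzy)]
        refine le_trans ?_ (neg_le_abs _)
        rw [hs] at h1 ⊢
        linarith
    have h4 := abs_sub_le (cubicMap s h β r' y) (cubicMap s h β r z) (cubicMap s h β r' z)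
    have h5 : (1 + h * (-s * β) / 4) * |y - z| ≤ (1 + h * (-s * β) / 4) * δ := by linarith
    exact le_of_mul_le_mul_left h5 (by linarith)

theorem exists_halfEstimate (hS : IsSmallScale s h β ε B) (hr : IsTail ε B r)
    (hr' : IsTail ε B r') (hδ0 : 0 ≤ δ) (hδ1 : δ ≤ 1)
    (hclose : ∀ y ∈ Icc (-ε) ε, |r y - r' y| ≤ B * δ) :
    HalfEstimate (inwardIso hS hr') (inwardIso hS hr) ε (Real.sqrt (-s * β / 8)) δ :=
  ⟨inwardIso_ratio hS hr hr' hδ0 hδ1 hclose,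
    inwardIso_ratio hS hr' hr hδ0 hδ1 (fun y hy => by rw [abs_sub_comm]; exact hclose y hy),
    inwardIso_backward hS hr hr' hδ0 hclose⟩

theorem inwardIso_maps (hS : IsSmallScale s h β ε B) (hr : IsTail ε B r) :
    ∀ y ∈ Icc (-ε) ε, inwardIso hS hr y ∈ Icc (-ε) ε := by
  have hup : ∀ {r : ℝ → ℝ} (hr : IsTail ε B r), inwardIso hS hr ε ≤ ε := fun hr => by
    obtain ⟨w, hw, hP⟩ := exists_halfPhase hS hr
    exact (hP.outer _ hw).le
  intro y hy
  have h1 := hup hr.reflect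
  rw [← reflect_inwardIso hS hr, reflect_apply] at h1
  exact ⟨by linarith [(inwardIso hS hr).monotone hy.1], ((inwardIso hS hr).monotone hy.2).trans
    (hup hr)⟩

theorem inward_eq (hS : IsSmallScale s h β ε B) (hr : IsTail ε B r) :
    ∀ y ∈ Icc (-ε) ε, inward s ε (cubicMap s h β r) y = inwardIso hS hr y := by
  intro y hy
  rcases hS.sign with hs | hs
  · have hmem := inwardIso_maps hS hr y hy
    rw [inwardIso_of_pos hS hr hs] at hmem ⊢
    have hval : cubicMap s h β r ((cubicIso hS hr).symm y) = y := by
      rw [← cubicIso_of_mem hS hr hmem, OrderIso.apply_symm_apply]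
    rw [inward, if_neg (by rw [hs]; norm_num)]
    have hex : ∃ x ∈ Icc (-ε) ε, cubicMap s h β r x = y := ⟨_, hmem, hval⟩
    exact (cubicMap_strictMonoOn hS hr).injOn (Function.invFunOn_mem hex) hmem
      ((Function.invFunOn_eq hex).trans hval.symm)
  · rw [inwardIso_of_neg hS hr hs, inward, if_pos (by rw [hs]; norm_num), cubicIso_of_mem hS hr hy]

/-- The fundamental-domain conjugacy of two close normal forms at fixed step size and parameter. -/
theorem exists_fundamentalDomainConjugacy (hS : IsSmallScale s h β ε B) (hr : IsTail ε B r)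
    (hr' : IsTail ε B r') (hδ0 : 0 ≤ δ) (hδ1 : δ ≤ 1)
    (hclose : ∀ y ∈ Icc (-ε) ε, |r y - r' y| ≤ B * δ) :
    ∃ J : ℝ → ℝ, StrictMono J ∧ Function.Surjective J ∧ J ε = ε ∧ J (-ε) = -ε ∧
      IsFundamentalDomainConjugacy s ε β (cubicMap s h β r') (cubicMap s h β r) J ∧
      (∀ y ∈ Icc (-ε) ε, J (cubicMap s h β r' y) = cubicMap s h β r (J y)) ∧
      ∀ y ∈ Icc (-ε) ε, |y - J y| ≤ δ := by
  obtain ⟨w, hw, hg⟩ := exists_halfPhase hS hr'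
  obtain ⟨w', hw', hG⟩ := exists_halfPhase hS hr
  obtain ⟨v, hv, hgr⟩ := exists_halfPhase hS hr'.reflect
  obtain ⟨v', hv', hGr⟩ := exists_halfPhase hS hr.reflect
  have hE := exists_halfEstimate hS hr hr' hδ0 hδ1 hclose
  have hEr := exists_halfEstimate hS hr.reflect hr'.reflect hδ0 hδ1 (fun y hy => by
    have := hclose _ (neg_mem_Icc hy)
    rwa [reflectTail, reflectTail, neg_sub_neg, abs_sub_comm])
  rw [← reflect_inwardIso hS hr'] at hgr
  rw [← reflect_inwardIso hS hr] at hGr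
  rw [← reflect_inwardIso hS hr', ← reflect_inwardIso hS hr] at hEr
  obtain ⟨J, hJm, hJs, hJc, hJ0, hJo, hJa, hJw, hJv, hJe⟩ :=
    exists_line_conj hg hG hgr hGr hw hw' hv hv' hS.ε_le hδ0 hE hEr
  have hbase : ∀ z ∈ ({-ε, ε} : Set ℝ), J z = z := fun z hz => by
    have := hJo z hz 0
    rwa [orbitParam_of_mem ⟨le_rfl, zero_le_one⟩, orbitParam_of_mem ⟨le_rfl, zero_le_one⟩, zero_mul,
      zero_mul, add_zero] at this
  have hJε := hbase ε (by simp)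
  have hJε' := hbase (-ε) (by simp)
  refine ⟨J, hJm, hJs, hJε, hJε', ?_, ?_, hJe⟩
  · exact isFundamentalDomainMap_of_orbitParam hg hG hgr hGr hw hv (inward_eq hS hr')
      (inward_eq hS hr) (inwardIso_maps hS hr') (inwardIso_maps hS hr) hJm hJε hJε' hJ0 hJo hJa hJw
      hJv
  · intro y hy
    have hJy : J y ∈ Icc (-ε) ε := ⟨hJε' ▸ hJm.monotone hy.1, hJε ▸ hJm.monotone hy.2⟩
    rw [← cubicIso_of_mem hS hr hJy, ← cubicIso_of_mem hS hr' hy]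
    rcases hS.sign with hs | hs
    · have := hJc (cubicIso hS hr' y)
      rw [inwardIso_of_pos hS hr hs, inwardIso_of_pos hS hr' hs, OrderIso.symm_apply_apply,
        OrderIso.eq_symm_apply] at this
      exact this.symm
    · have := hJc y
      rwa [inwardIso_of_neg hS hr hs, inwardIso_of_neg hS hr' hs] at this

end

/-! ### Conjugacies of the normal forms and of the original maps -/

section
variable {p : ℕ} {s h₀ ε₀ α₀ ε₁ β₁ C μ : ℝ} {Φ φ : ℝ → ℝ → ℝ → ℝ}
  {χ χ' r r' : ℝ → ℝ → ℝ → ℝ} {b b' : ℝ → ℝ → ℝ}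

theorem exists_tail_bound {n : ℕ} (hn : 1 ≤ n) (hh : 0 < h₀) (hε : 0 < ε₁) (hβ : 0 < β₁)
    (hr : SmoothOnBox n r h₀ ε₁ β₁) :
    ∃ B : ℝ, ∀ h ∈ Icc 0 h₀, ∀ β ∈ Icc (-β₁) β₁, ∀ B' ≥ B, IsTail ε₁ B' (fun y => r h y β) := by
  obtain ⟨B₁, -, hB₁⟩ := exists_bound_box (ContDiffOn.continuousOn hr)
  obtain ⟨L, -, hL⟩ := exists_lipschitz_of_contDiffOn (isCompact_box h₀ ε₁ β₁)
    (convex_box h₀ ε₁ β₁) (uniqueDiffOn_box hh hε hβ)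
    (ContDiffOn.of_le hr (by exact_mod_cast hn))
  refine ⟨max B₁ L, fun h hh β hβ B' hB' => ⟨fun y hy => ?_, fun y hy y' hy' => ?_⟩⟩
  · exact (hB₁ (h, y, β) (mem_box.2 ⟨hh, hy, hβ⟩)).trans ((le_max_left _ _).trans hB')
  · have := hL (h, y, β) (mem_box.2 ⟨hh, hy, hβ⟩) (h, y', β) (mem_box.2 ⟨hh, hy', hβ⟩)
    simp only [Prod.mk_sub_mk, sub_self, Prod.norm_mk, norm_zero, Real.norm_eq_abs] at this
    rw [max_eq_left (abs_nonneg (y - y')), max_eq_right (abs_nonneg (y - y'))] at this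
    exact this.trans (mul_le_mul_of_nonneg_right ((le_max_right _ _).trans hB') (abs_nonneg _))

theorem IsTail.mono {ε ε' B : ℝ} {r : ℝ → ℝ} (hr : IsTail ε B r) (hε : ε' ≤ ε) : IsTail ε' B r := by
  have : Icc (-ε') ε' ⊆ Icc (-ε) ε := Icc_subset_Icc (by linarith) hε
  exact ⟨fun y hy => hr.bound y (this hy), fun y hy y' hy' => hr.lip y (this hy) y' (this hy')⟩

/-- On small domains the two normal forms of a reduction pair are conjugate by the
fundamental-domain conjugacies, at distance at most `h^p` from the identity. -/
theorem IsReductionPair.exists_conjugacy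
    (hP : IsReductionPair p s Φ φ h₀ ε₀ α₀ ε₁ β₁ C χ b r χ' b' r') :
    ∃ h₁ ε₂ β₂ : ℝ, 0 < h₁ ∧ h₁ ≤ h₀ ∧ 0 < ε₂ ∧ ε₂ ≤ ε₁ ∧ 0 < β₂ ∧ β₂ ≤ β₁ ∧
      ∃ J : ℝ → ℝ → ℝ ≃o ℝ, ∀ h ∈ Ioc 0 h₁, ∀ β ∈ Icc (-β₂) β₂,
        J h β ε₂ = ε₂ ∧ J h β (-ε₂) = -ε₂ ∧
        IsFundamentalDomainConjugacy s ε₂ β (fun y => normalForm s r' h y β)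
          (fun y => normalForm s r h y β) (J h β) ∧
        (∀ y ∈ Icc (-ε₂) ε₂, J h β (normalForm s r' h y β) = normalForm s r h (J h β y) β) ∧
        ∀ y ∈ Icc (-ε₂) ε₂, |y - J h β y| ≤ h ^ p := by
  have hn : 1 ≤ p + 2 := by omega
  obtain ⟨B₁, hB₁⟩ := exists_tail_bound hn hP.h₀_pos hP.ε₁_pos hP.β₁_pos hP.exact.r_smooth
  obtain ⟨B₂, hB₂⟩ := exists_tail_bound hn hP.h₀_pos hP.ε₁_pos hP.β₁_pos hP.discrete.r_smooth
  set B := max (max B₁ B₂) (max C 1) with hB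
  have hB1 : 1 ≤ B := (le_max_right _ _).trans (le_max_right _ _)
  have hCB : C ≤ B := (le_max_left _ _).trans (le_max_right _ _)
  have hB0 : 0 < B := by linarith
  set ε₂ := min ε₁ (1 / (40 * B)) with hε₂
  have hε₂0 : 0 < ε₂ := lt_min hP.ε₁_pos (by positivity)
  have hε₂1 : ε₂ ≤ ε₁ := min_le_left _ _
  have hBε : B * ε₂ ≤ 1 / 40 := by
    calc B * ε₂ ≤ B * (1 / (40 * B)) := mul_le_mul_of_nonneg_left (min_le_right _ _) hB0.le
      _ = 1 / 40 := by field_simp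
  have hε₂2 : ε₂ ≤ 1 := by nlinarith
  set β₂ := min β₁ (ε₂ ^ 2 / 4) with hβ₂
  have hβ₂0 : 0 < β₂ := lt_min hP.β₁_pos (by positivity)
  set h₁ := min h₀ (1 / 20) with hh₁
  have hh₁0 : 0 < h₁ := lt_min hP.h₀_pos (by norm_num)
  have main : ∀ h ∈ Ioc 0 h₁, ∀ β ∈ Icc (-β₂) β₂, ∃ J : ℝ ≃o ℝ, J ε₂ = ε₂ ∧ J (-ε₂) = -ε₂ ∧
        IsFundamentalDomainConjugacy s ε₂ β (fun y => normalForm s r' h y β)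
          (fun y => normalForm s r h y β) J ∧
        (∀ y ∈ Icc (-ε₂) ε₂, J (normalForm s r' h y β) = normalForm s r h (J y) β) ∧
        ∀ y ∈ Icc (-ε₂) ε₂, |y - J y| ≤ h ^ p := by
    intro h hh β hβ
    have hh0 : h ∈ Icc 0 h₀ := ⟨hh.1.le, hh.2.trans (min_le_left _ _)⟩
    have hβ0 : β ∈ Icc (-β₁) β₁ :=
      Icc_subset_Icc (neg_le_neg (min_le_left _ _)) (min_le_left _ _) hβ
    have hh1 : h ≤ 1 / 20 := hh.2.trans (min_le_right _ _)
    have hS : IsSmallScale s h β ε₂ B := ⟨hP.sign, hh.1, hh1, hε₂0, hε₂2, hB0.le, hBε, by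
      have := (abs_le.2 hβ).trans (min_le_right _ _)
      linarith⟩
    have hr := (hB₁ h hh0 β hβ0 B ((le_max_left _ _).trans (le_max_left _ _))).mono hε₂1
    have hr' := (hB₂ h hh0 β hβ0 B ((le_max_right _ _).trans (le_max_left _ _))).mono hε₂1
    have hδ0 : 0 ≤ h ^ p := pow_nonneg hh.1.le p
    obtain ⟨J, hJm, hJs, h1, h2, h3, h4, h5⟩ := exists_fundamentalDomainConjugacy hS hr hr' hδ0
      (pow_le_one₀ hh.1.le (by linarith)) (fun y hy =>
        (hP.r_close h hh0 y (Icc_subset_Icc (neg_le_neg hε₂1) hε₂1 hy) β hβ0).trans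
          (mul_le_mul_of_nonneg_right hCB hδ0))
    exact ⟨hJm.orderIsoOfSurjective J hJs, h1, h2, h3, h4, h5⟩
  have : Nonempty (ℝ ≃o ℝ) := ⟨OrderIso.refl ℝ⟩
  choose! J hJ using main
  exact ⟨h₁, ε₂, β₂, hh₁0, min_le_left _ _, hε₂0, hε₂1, hβ₂0, min_le_left _ _, J, hJ⟩

/-- The conjugacy of the original maps induced by conjugacies `J` of their normal forms: `τ` solves
`b' (h, τ) = b (h, α)`, and the image of `x` is the preimage of `J⁻¹ (χ (h, x, α))` under
`χ' (h, ·, τ)`. As `b'` and `χ'` expand distances by at least the factor `μ`, their inverses turn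
`O(h^p)` errors into `O(h^p)` errors. -/
theorem IsExpandingPair.exists_original_conjugacy
    (hE : IsExpandingPair p s Φ φ h₀ ε₀ α₀ ε₁ β₁ C μ χ b r χ' b' r') (hC : 0 ≤ C)
    {J : ℝ → ℝ → ℝ ≃o ℝ} (hJ : ∀ h ∈ Ioc 0 h₀, ∀ β ∈ Icc (-β₁) β₁,
        J h β ε₁ = ε₁ ∧ J h β (-ε₁) = -ε₁ ∧
        (∀ y ∈ Icc (-ε₁) ε₁, J h β (normalForm s r' h y β) = normalForm s r h (J h β y) β) ∧
        ∀ y ∈ Icc (-ε₁) ε₁, |y - J h β y| ≤ h ^ p) :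
    ∃ (ε₂ α₂ D : ℝ) (τ : ℝ → ℝ → ℝ) (JJ : ℝ → ℝ → ℝ → ℝ), ε₂ ∈ Ioc 0 ε₀ ∧ α₂ ∈ Ioc 0 α₀ ∧
      IsConjugacyFamily Φ φ h₀ ε₂ α₂ τ JJ ∧
      ∀ h ∈ Ioc 0 h₀, ∀ α ∈ Icc (-α₂) α₂,
        τ h α ∈ Icc (-α₀) α₀ ∧ b h α ∈ Icc (-β₁) β₁ ∧ b' h (τ h α) = b h α ∧
        |α - τ h α| ≤ D * h ^ p ∧
        ∀ x ∈ Icc (-ε₂) ε₂,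
          JJ h x α ∈ Icc (-ε₀) ε₀ ∧ χ' h (JJ h x α) (τ h α) ∈ Icc (-ε₁) ε₁ ∧
          J h (b h α) (χ' h (JJ h x α) (τ h α)) = χ h x α ∧ |x - JJ h x α| ≤ D * h ^ p := by
  have hP := hE.pair
  have hμ := hE.μ_pos
  have hcast : (1 : WithTop ℕ∞) ≤ ((p + 2 : ℕ) : WithTop ℕ∞) := by
    have : 1 ≤ p + 2 := by omega
    exact_mod_cast this
  have hbox := uniqueDiffOn_box hP.h₀_pos hP.ε₀_pos hP.α₀_pos
  have hα₀ := hP.α₀_pos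
  have hε₀ := hP.ε₀_pos
  have hα00 : (0:ℝ) ∈ Icc (-α₀) α₀ := ⟨by linarith, hα₀.le⟩
  have hε00 : (0:ℝ) ∈ Icc (-ε₀) ε₀ := ⟨by linarith, hε₀.le⟩
  obtain ⟨L₁, hL₁0, hL₁⟩ := exists_lipschitz_of_contDiffOn (isCompact_box h₀ ε₀ α₀)
    (convex_box h₀ ε₀ α₀) hbox (ContDiffOn.of_le hP.exact.χ_smooth hcast)
  obtain ⟨L₂, hL₂0, hL₂⟩ := exists_lipschitz_of_contDiffOn (isCompact_box h₀ ε₀ α₀)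
    (convex_box h₀ ε₀ α₀) hbox (ContDiffOn.of_le hP.discrete.χ_smooth hcast)
  obtain ⟨L₃, hL₃0, hL₃⟩ := exists_lipschitz_of_contDiffOn (isCompact_Icc.prod isCompact_Icc)
    ((convex_Icc 0 h₀).prod (convex_Icc (-α₀) α₀))
    ((uniqueDiffOn_Icc hP.h₀_pos).prod (uniqueDiffOn_Icc (by linarith)))
    (hP.exact.b_smooth.of_le hcast)
  have lipχ : ∀ h ∈ Icc 0 h₀, ∀ α ∈ Icc (-α₀) α₀, ∀ x ∈ Icc (-ε₀) ε₀, ∀ x' ∈ Icc (-ε₀) ε₀,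
      |χ h x α - χ h x' α| ≤ L₁ * |x - x'| := by
    intro h hh α hα x hx x' hx'
    have := hL₁ (h, x, α) (mem_box.2 ⟨hh, hx, hα⟩) (h, x', α) (mem_box.2 ⟨hh, hx', hα⟩)
    simp only [Prod.mk_sub_mk, sub_self, Prod.norm_mk, norm_zero, Real.norm_eq_abs] at this
    rwa [max_eq_left (abs_nonneg (x - x')), max_eq_right (abs_nonneg (x - x'))] at this
  have lipχ' : ∀ h ∈ Icc 0 h₀, ∀ x ∈ Icc (-ε₀) ε₀, ∀ α ∈ Icc (-α₀) α₀, ∀ α' ∈ Icc (-α₀) α₀,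
      |χ' h x α - χ' h x α'| ≤ L₂ * |α - α'| := by
    intro h hh x hx α hα α' hα'
    have := hL₂ (h, x, α) (mem_box.2 ⟨hh, hx, hα⟩) (h, x, α') (mem_box.2 ⟨hh, hx, hα'⟩)
    simp only [Prod.mk_sub_mk, sub_self, Prod.norm_mk, norm_zero, Real.norm_eq_abs] at this
    rwa [max_eq_right (abs_nonneg (α - α')), max_eq_right (abs_nonneg (α - α'))] at this
  have lipb : ∀ h ∈ Icc 0 h₀, ∀ α ∈ Icc (-α₀) α₀, ∀ α' ∈ Icc (-α₀) α₀,
      |b h α - b h α'| ≤ L₃ * |α - α'| := by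
    intro h hh α hα α' hα'
    have := hL₃ (h, α) ⟨hh, hα⟩ (h, α') ⟨hh, hα'⟩
    simp only [Prod.mk_sub_mk, sub_self, Prod.norm_mk, norm_zero, Real.norm_eq_abs] at this
    rwa [max_eq_right (abs_nonneg (α - α'))] at this
  -- domains that `χ` and `b` map into those of the normal forms
  set ε₂ := min ε₀ (ε₁ / (L₁ + 1)) with hε₂
  set α₂ := min α₀ (β₁ / (L₃ + 1)) with hα₂
  have hε₂0 : 0 < ε₂ := lt_min hε₀ (div_pos hP.ε₁_pos (by linarith))
  have hα₂0 : 0 < α₂ := lt_min hα₀ (div_pos hP.β₁_pos (by linarith))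
  have subε : Icc (-ε₂) ε₂ ⊆ Icc (-ε₀) ε₀ :=
    Icc_subset_Icc (neg_le_neg (min_le_left _ _)) (min_le_left _ _)
  have subα : Icc (-α₂) α₂ ⊆ Icc (-α₀) α₀ :=
    Icc_subset_Icc (neg_le_neg (min_le_left _ _)) (min_le_left _ _)
  have hpos : ∀ {h}, h ∈ Ioc 0 h₀ → h ∈ Icc 0 h₀ := fun hh => ⟨hh.1.le, hh.2⟩
  have hbmem : ∀ h ∈ Ioc 0 h₀, ∀ α ∈ Icc (-α₂) α₂, b h α ∈ Icc (-β₁) β₁ := by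
    intro h hh α hα
    have h1 := lipb h (hpos hh) α (subα hα) 0 hα00
    rw [hP.exact.b_zero h (hpos hh), sub_zero, sub_zero] at h1
    have h2 : |α| ≤ β₁ / (L₃ + 1) := (abs_le.2 hα).trans (min_le_right _ _)
    rw [le_div_iff₀ (by linarith)] at h2
    have := abs_nonneg α
    exact abs_le.1 (h1.trans (by linarith))
  have hχmem : ∀ h ∈ Ioc 0 h₀, ∀ α ∈ Icc (-α₂) α₂, ∀ x ∈ Icc (-ε₂) ε₂,
      χ h x α ∈ Icc (-ε₁) ε₁ := by
    intro h hh α hα x hx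
    have h1 := lipχ h (hpos hh) α (subα hα) x (subε hx) 0 hε00
    rw [hP.exact.χ_zero h (hpos hh) α (subα hα), sub_zero, sub_zero] at h1
    have h2 : |x| ≤ ε₁ / (L₁ + 1) := (abs_le.2 hx).trans (min_le_right _ _)
    rw [le_div_iff₀ (by linarith)] at h2
    have := abs_nonneg x
    exact abs_le.1 (h1.trans (by linarith))
  have hτ : ∀ h ∈ Ioc 0 h₀, ∀ α ∈ Icc (-α₂) α₂, ∃ t ∈ Icc (-α₀) α₀, b' h t = b h α :=
    fun h hh α hα => hP.discrete.b_cover h (hpos hh) (hbmem h hh α hα)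
  choose! τ hτmem hτb using hτ
  have hJinv : ∀ h ∈ Ioc 0 h₀, ∀ β ∈ Icc (-β₁) β₁, ∀ y ∈ Icc (-ε₁) ε₁,
      (J h β).symm y ∈ Icc (-ε₁) ε₁ := by
    intro h hh β hβ y hy
    obtain ⟨h1, h2, -⟩ := hJ h hh β hβ
    rw [mem_Icc, OrderIso.le_symm_apply, OrderIso.symm_apply_le, h1, h2]
    exact hy
  have hJJ : ∀ h ∈ Ioc 0 h₀, ∀ α ∈ Icc (-α₂) α₂, ∀ x ∈ Icc (-ε₂) ε₂,
      ∃ x' ∈ Icc (-(ε₀ / 2)) (ε₀ / 2), χ' h x' (τ h α) = (J h (b h α)).symm (χ h x α) :=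
    fun h hh α hα x hx => hE.χ'_cover_half h (hpos hh) _ (hτmem h hh α hα) _
      (hJinv h hh _ (hbmem h hh α hα) _ (hχmem h hh α hα x hx))
  choose! K hKmem hKχ using hJJ
  have half : Icc (-(ε₀ / 2)) (ε₀ / 2) ⊆ Icc (-ε₀) ε₀ := Icc_subset_Icc (by linarith) (by linarith)
  have expχ' : ∀ h ∈ Icc 0 h₀, ∀ α ∈ Icc (-α₀) α₀, ∀ x ∈ Icc (-ε₀) ε₀, ∀ x' ∈ Icc (-ε₀) ε₀,
      μ * |x - x'| ≤ |χ' h x α - χ' h x' α| := fun h hh α hα =>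
    abs_expand_of_expand (hE.χ'_expand h hh α hα)
  have expχ : ∀ h ∈ Icc 0 h₀, ∀ α ∈ Icc (-α₀) α₀, ∀ x ∈ Icc (-ε₀) ε₀, ∀ x' ∈ Icc (-ε₀) ε₀,
      μ * |x - x'| ≤ |χ h x α - χ h x' α| := fun h hh α hα =>
    abs_expand_of_expand (hE.χ_expand h hh α hα)
  have eq_of_expand : ∀ {x x' : ℝ} {u u' : ℝ}, μ * |x - x'| ≤ |u - u'| → u = u' → x = x' := by
    intro x x' u u' h1 h2
    rw [h2, sub_self, abs_zero] at h1
    have h3 : |x - x'| ≤ 0 := by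
      by_contra! hc
      exact absurd h1 (not_le.2 (mul_pos hμ hc))
    exact sub_eq_zero.1 (abs_nonpos_iff.1 h3)
  have hτclose : ∀ h ∈ Ioc 0 h₀, ∀ α ∈ Icc (-α₂) α₂, |α - τ h α| ≤ C / μ * h ^ p := by
    intro h hh α hα
    have h1 := hE.b'_expand h (hpos hh) α (subα hα) _ (hτmem h hh α hα)
    rw [hτb h hh α hα, abs_sub_comm] at h1
    have h2 := hP.b_close h (hpos hh) α (subα hα)
    rw [div_mul_eq_mul_div, le_div_iff₀ hμ, mul_comm]
    rw [abs_sub_comm] at h1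
    rw [abs_sub_comm] at h2
    exact h1.trans h2
  set D := C / μ + (L₂ * (C / μ) + C + 1) / μ with hD
  have hD1 : C / μ ≤ D := by rw [hD]; have : 0 ≤ (L₂ * (C / μ) + C + 1) / μ := by positivity
                             linarith
  have hD2 : (L₂ * (C / μ) + C + 1) / μ ≤ D := by rw [hD]; have : 0 ≤ C / μ := by positivity
                                                  linarith
  refine ⟨ε₂, α₂, D, τ, fun h x α => K h α x, ⟨hε₂0, min_le_left _ _⟩, ⟨hα₂0, min_le_left _ _⟩,
    ⟨?_, ?_, ?_, ?_, ?_⟩, ?_⟩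
  · intro h hh
    refine (LipschitzOnWith.of_dist_le_mul (K := (L₃ / μ).toNNReal)
      (fun α hα α' hα' => ?_)).continuousOn
    rw [Real.dist_eq, Real.dist_eq, Real.coe_toNNReal _ (by positivity), div_mul_eq_mul_div,
      le_div_iff₀ hμ, mul_comm]
    have h1 := hE.b'_expand h (hpos hh) _ (hτmem h hh α hα) _ (hτmem h hh α' hα')
    rw [hτb h hh α hα, hτb h hh α' hα'] at h1
    exact h1.trans (lipb h (hpos hh) α (subα hα) α' (subα hα'))
  · intro h hh α hα α' hα' heq
    refine eq_of_expand (hE.b_expand h (hpos hh) α (subα hα) α' (subα hα')) ?_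
    rw [← hτb h hh α hα, ← hτb h hh α' hα', heq]
  · intro h hh α hα
    have hcont : ContinuousOn (fun x => χ' h (K h α x) (τ h α)) (Icc (-ε₂) ε₂) := by
      refine ContinuousOn.congr (f := fun x => (J h (b h α)).symm (χ h x α)) ?_
        (fun x hx => hKχ h hh α hα x hx)
      refine (J h (b h α)).symm.continuous.comp_continuousOn ?_
      refine (LipschitzOnWith.of_dist_le_mul (K := L₁.toNNReal)
        (fun x hx x' hx' => ?_)).continuousOn
      rw [Real.dist_eq, Real.dist_eq, Real.coe_toNNReal _ hL₁0]
      exact lipχ h (hpos hh) α (subα hα) x (subε hx) x' (subε hx')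
    intro x hx
    rw [ContinuousWithinAt, tendsto_iff_dist_tendsto_zero]
    have h1 := tendsto_iff_dist_tendsto_zero.1 (hcont x hx)
    refine squeeze_zero' (Eventually.of_forall fun _ => dist_nonneg)
      (eventually_nhdsWithin_of_forall fun x' hx' => ?_) (by simpa using h1.const_mul μ⁻¹)
    rw [Real.dist_eq, Real.dist_eq, inv_mul_eq_div, le_div_iff₀ hμ, mul_comm]
    exact expχ' h (hpos hh) _ (hτmem h hh α hα) _ (half (hKmem h hh α hα x' hx')) _
      (half (hKmem h hh α hα x hx))
  · intro h hh α hα x hx x' hx' heq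
    have heq' : K h α x = K h α x' := heq
    refine eq_of_expand (expχ h (hpos hh) α (subα hα) x (subε hx) x' (subε hx')) ?_
    have h1 := hKχ h hh α hα x hx
    rw [heq', hKχ h hh α hα x' hx'] at h1
    exact ((J h (b h α)).symm.injective h1).symm
  · intro h hh α hα x hx hΦ
    have hβ := hbmem h hh α hα
    have hτm := hτmem h hh α hα
    have hx' := hKmem h hh α hα x hx
    have hy' : χ' h (K h α x) (τ h α) ∈ Icc (-ε₁) ε₁ := by
      rw [hKχ h hh α hα x hx]
      exact hJinv h hh _ hβ _ (hχmem h hh α hα x hx)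
    -- the preimage was taken in `|x| ≤ ε₀ / 2`, and `φ` at most doubles `|x|`
    have hφmem : φ h (K h α x) (τ h α) ∈ Icc (-ε₀) ε₀ := by
      have h1 := hE.φ_le h (hpos hh) _ (half hx') _ hτm
      have h2 := abs_le.2 hx'
      exact abs_le.1 (by linarith)
    have t1 := hP.exact.transforms h (hpos hh) α (subα hα) x (subε hx) (subε hΦ)
      (hχmem h hh α hα x hx) hβ
    have t2 := hP.discrete.transforms h (hpos hh) _ hτm _ (half hx') hφmem hy'
      (by rw [hτb h hh α hα]; exact hβ)
    rw [hτb h hh α hα] at t2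
    have t3 := (hJ h hh _ hβ).2.2.1 _ hy'
    have t4 : J h (b h α) (χ' h (K h α x) (τ h α)) = χ h x α := by
      rw [hKχ h hh α hα x hx, OrderIso.apply_symm_apply]
    rw [← t2, t4, ← t1] at t3
    refine eq_of_expand (expχ' h (hpos hh) _ hτm _ (half (hKmem h hh α hα _ hΦ)) _ hφmem) ?_
    rw [hKχ h hh α hα _ hΦ, ← t3, OrderIso.symm_apply_apply]
  · intro h hh α hα
    have hhp : 0 ≤ h ^ p := pow_nonneg hh.1.le p
    have hβ := hbmem h hh α hα
    have hτm := hτmem h hh α hα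
    have hclose := hτclose h hh α hα
    refine ⟨hτm, hβ, hτb h hh α hα, hclose.trans (mul_le_mul_of_nonneg_right hD1 hhp),
      fun x hx => ?_⟩
    have hx' := hKmem h hh α hα x hx
    have hχ := hKχ h hh α hα x hx
    have hy' : χ' h (K h α x) (τ h α) ∈ Icc (-ε₁) ε₁ := by
      rw [hχ]
      exact hJinv h hh _ hβ _ (hχmem h hh α hα x hx)
    have hJy : J h (b h α) (χ' h (K h α x) (τ h α)) = χ h x α := by
      rw [hχ, OrderIso.apply_symm_apply]
    refine ⟨half hx', hy', hJy, ?_⟩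
    have k1 := expχ' h (hpos hh) _ hτm x (subε hx) _ (half hx')
    have k2 := lipχ' h (hpos hh) x (subε hx) _ hτm α (subα hα)
    have k3 := hP.χ_close h (hpos hh) x (subε hx) α (subα hα)
    have k4 := (hJ h hh _ hβ).2.2.2 _ hy'
    rw [hJy, abs_sub_comm] at k4
    rw [abs_sub_comm] at k2 k3
    have k5 := abs_sub_le (χ' h x (τ h α)) (χ' h x α) (χ' h (K h α x) (τ h α))
    have k6 := abs_sub_le (χ' h x α) (χ h x α) (χ' h (K h α x) (τ h α))
    rw [abs_sub_comm (χ' h x (τ h α)) (χ' h x α)] at k5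
    have k7 := mul_le_mul_of_nonneg_left hclose hL₂0
    rw [abs_sub_comm] at k7
    refine le_trans ?_ (mul_le_mul_of_nonneg_right hD2 hhp)
    rw [div_mul_eq_mul_div, le_div_iff₀ hμ]
    change |x - K h α x| * μ ≤ _
    linarith

end

/-! ### The conjugacy estimate -/

/-- Conjugacy and estimate: for `f` of class `C^(p+7)`, with a `C^(p+7)` discretization. -/
theorem Setting.exists_conjugacies {p : ℕ} (hp : 1 ≤ p) {f : ℝ → ℝ → ℝ} {Φ φ : ℝ → ℝ → ℝ → ℝ}
    {H E A : ℝ} (hS : Setting p (p + 7) f Φ φ H E A) :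
    ∃ (s h₀ ε₀ α₀ ε₁ β₁ ε₂ α₂ C : ℝ)
        (χ : ℝ → ℝ → ℝ → ℝ) (b : ℝ → ℝ → ℝ) (r : ℝ → ℝ → ℝ → ℝ)
        (χ' : ℝ → ℝ → ℝ → ℝ) (b' : ℝ → ℝ → ℝ) (r' : ℝ → ℝ → ℝ → ℝ)
        (J : ℝ → ℝ → ℝ → ℝ) (τ : ℝ → ℝ → ℝ) (JJ : ℝ → ℝ → ℝ → ℝ),
        h₀ ≤ H ∧ ε₀ ≤ E ∧ α₀ ≤ A ∧ 0 < C ∧ ε₂ ∈ Ioc 0 ε₀ ∧ α₂ ∈ Ioc 0 α₀ ∧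
        IsReductionPair p s Φ φ h₀ ε₀ α₀ ε₁ β₁ C χ b r χ' b' r' ∧
        IsConjugacyFamily (normalForm s r') (normalForm s r) h₀ ε₁ β₁ (fun _ β => β) J ∧
        (∀ h ∈ Ioc 0 h₀, ∀ β ∈ Icc (-β₁) β₁,
          IsFundamentalDomainConjugacy s ε₁ β
            (fun y => normalForm s r' h y β) (fun y => normalForm s r h y β)
            (fun y => J h y β) ∧
          StrictMonoOn (fun y => J h y β) (Icc (-ε₁) ε₁) ∧
          BijOn (fun y => J h y β) (Icc (-ε₁) ε₁) (Icc (-ε₁) ε₁) ∧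
          ∀ y ∈ Icc (-ε₁) ε₁, |y - J h y β| ≤ C * h ^ p) ∧
        IsConjugacyFamily Φ φ h₀ ε₂ α₂ τ JJ ∧
        (∀ h ∈ Ioc 0 h₀, ∀ α ∈ Icc (-α₂) α₂,
          τ h α ∈ Icc (-α₀) α₀ ∧ b h α ∈ Icc (-β₁) β₁ ∧ b' h (τ h α) = b h α ∧
          |α - τ h α| ≤ C * h ^ p ∧
          ∀ x ∈ Icc (-ε₂) ε₂,
            JJ h x α ∈ Icc (-ε₀) ε₀ ∧
            χ' h (JJ h x α) (τ h α) ∈ Icc (-ε₁) ε₁ ∧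
            J h (χ' h (JJ h x α) (τ h α)) (b h α) = χ h x α ∧
            |x - JJ h x α| ≤ C * h ^ p) := by
  obtain ⟨ε, hε, C₁, A₁, A₂, a₃, R, A₁', A₂', a₃', R', hj, hj', hc, hA₁, ha₃⟩ := hS.exists_jets hp
  obtain ⟨s, h₀, ε₀, α₀, ε₁, β₁, C₂, μ, r, r', hh₀, hε₀, hα₀, hC₂, hE⟩ :=
    exists_expandingPair hp hS.h₀_pos hε.1 hS.α₀_pos hj hj' hc hA₁ ha₃
  obtain ⟨h₁, ε₂, β₂, hh₁, hh₁', hε₂, hε₂', hβ₂, hβ₂', J, hJ⟩ := hE.pair.exists_conjugacy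
  replace hE := hE.mono hh₁ hh₁' hε₂ hε₂' hβ₂ hβ₂'
  obtain ⟨ε₃, α₃, D, τ, JJ, hε₃, hα₃, hconj, hest⟩ := hE.exists_original_conjugacy hC₂.le
    (fun h hh β hβ => ⟨(hJ h hh β hβ).1, (hJ h hh β hβ).2.1, (hJ h hh β hβ).2.2.2⟩)
  set C := max C₂ (max D 1) with hC
  have hCD : D ≤ C := (le_max_left _ _).trans (le_max_right _ _)
  have hC1 : 1 ≤ C := (le_max_right _ _).trans (le_max_right _ _)
  have key : ∀ h ∈ Ioc 0 h₁, ∀ {z : ℝ}, z ≤ D * h ^ p → z ≤ C * h ^ p := fun h hh z hz =>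
    hz.trans (mul_le_mul_of_nonneg_right hCD (pow_nonneg hh.1.le p))
  refine ⟨s, h₁, ε₀, α₀, ε₂, β₂, ε₃, α₃, C, _, _, r, _, _, r', fun h y β => J h β y, τ, JJ,
    hh₁'.trans hh₀, hε₀.trans hε.2, hα₀, by linarith, hε₃, hα₃,
    (hE.const_mono (le_max_left _ _)).pair, ⟨fun h _ => continuousOn_id, fun h _ => injOn_id _,
      fun h _ β _ => (J h β).continuous.continuousOn, fun h _ β _ => (J h β).injective.injOn,
      fun h hh β hβ y hy _ => (hJ h hh β hβ).2.2.2.1 y hy⟩, ?_, hconj, ?_⟩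
  · intro h hh β hβ
    obtain ⟨h1, h2, h3, h4, h5⟩ := hJ h hh β hβ
    refine ⟨h3, (J h β).strictMono.strictMonoOn _, ⟨fun y hy => ?_, (J h β).injective.injOn,
      fun y hy => ⟨(J h β).symm y, ?_, (J h β).apply_symm_apply y⟩⟩, fun y hy => ?_⟩
    · exact ⟨h2 ▸ (J h β).monotone hy.1, h1 ▸ (J h β).monotone hy.2⟩
    · rw [mem_Icc, OrderIso.le_symm_apply, OrderIso.symm_apply_le, h1, h2]
      exact hy
    · exact (h5 y hy).trans (le_mul_of_one_le_left (pow_nonneg hh.1.le p) hC1)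
  · intro h hh α hα
    obtain ⟨k1, k2, k3, k4, k5⟩ := hest h hh α hα
    exact ⟨k1, k2, k3, key h hh k4, fun x hx => ⟨(k5 x hx).1, (k5 x hx).2.1, (k5 x hx).2.2.1,
      key h hh (k5 x hx).2.2.2⟩⟩

/-! ### The model problem `x' = αx - x³` -/

/-- The entire function `(e^t - 1) / t`. -/
noncomputable def expSlope : ℝ → ℝ := dslope Real.exp 0

theorem mul_expSlope (t : ℝ) : t * expSlope t = Real.exp t - 1 := by
  have := sub_smul_dslope Real.exp 0 t
  rwa [sub_zero, smul_eq_mul, Real.exp_zero] at this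

theorem expSlope_zero : expSlope 0 = 1 := by
  rw [expSlope, dslope_same, Real.deriv_exp, Real.exp_zero]

theorem expSlope_pos (t : ℝ) : 0 < expSlope t := by
  rcases lt_trichotomy t 0 with h | rfl | h
  · have h1 := mul_expSlope t
    have h2 : Real.exp t < 1 := by simpa using Real.exp_lt_exp.2 h
    by_contra! hc
    have := mul_nonneg_of_nonpos_of_nonpos h.le hc
    linarith
  · rw [expSlope_zero]; exact one_pos
  · have h1 := mul_expSlope t
    have h2 := Real.one_lt_exp_iff.2 h
    by_contra! hc
    have := mul_nonpos_of_nonneg_of_nonpos h.le hc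
    linarith

theorem expSlope_contDiff {n : WithTop ℕ∞} : ContDiff ℝ n expSlope := by
  refine contDiff_iff_contDiffAt.2 (fun t => ?_)
  rcases eq_or_ne t 0 with rfl | ht
  · obtain ⟨P, hP⟩ := (analyticAt_rexp (x := 0))
    exact AnalyticAt.contDiffAt ⟨_, hP.has_fpower_series_dslope_fslope⟩
  · refine ContDiffAt.congr_of_eventuallyEq (f := fun t => (Real.exp t - 1) / t)
      ((Real.contDiff_exp.contDiffAt.sub contDiffAt_const).div contDiffAt_id ht) ?_
    filter_upwards [isOpen_ne.mem_nhds ht] with u hu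
    rw [← mul_expSlope, mul_div_cancel_left₀ _ hu]

/-- The function `(e^(2αh) - 1) / α` in the solution formula of `x' = αx - x³`. -/
noncomputable def modelE (h α : ℝ) : ℝ := h * (2 * expSlope (2 * α * h))

/-- The denominator `√(1 + x² E)` in the solution formula of `x' = αx - x³`. -/
noncomputable def modelV (h x α : ℝ) : ℝ := Real.sqrt (1 + x ^ 2 * modelE h α)

/-- The time-`h` map of `x' = αx - x³`. -/
noncomputable def modelFlow (h x α : ℝ) : ℝ := x * Real.exp (α * h) / modelV h x α

/-- The coefficient of the perturbation in the model discretization, chosen so that the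
nonzero fixed points of the latter are exactly the solutions of `α = x² - h^p x³`. -/
noncomputable def modelQ (h x α : ℝ) : ℝ :=
  2 * expSlope (2 * α * h) / (modelV h x α * (Real.exp (α * h) + modelV h x α))

/-- A one-step method of order `p` for `x' = αx - x³`: the exact flow with a fourth-order term of
size `h^(p+1)`. -/
noncomputable def modelMethod (p : ℕ) (h x α : ℝ) : ℝ :=
  modelFlow h x α + h ^ (p + 1) * x ^ 4 * modelQ h x α

theorem mul_modelE (h α : ℝ) : α * modelE h α = Real.exp (α * h) ^ 2 - 1 := by
  have := mul_expSlope (2 * α * h)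
  rw [modelE, ← Real.exp_nat_mul]
  have e : ((2 : ℕ) : ℝ) * (α * h) = 2 * α * h := by push_cast; ring
  rw [e]
  linarith

section
variable {h x α : ℝ}

theorem modelE_nonneg (hh : 0 ≤ h) : 0 ≤ modelE h α := by
  have := expSlope_pos (2 * α * h)
  unfold modelE
  positivity

theorem one_le_modelV (hh : 0 ≤ h) : 1 ≤ modelV h x α := by
  rw [modelV, Real.one_le_sqrt]
  have := mul_nonneg (sq_nonneg x) (modelE_nonneg (α := α) hh)
  linarith

theorem modelV_sq (hh : 0 ≤ h) : modelV h x α ^ 2 = 1 + x ^ 2 * modelE h α := by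
  rw [modelV, Real.sq_sqrt]
  have := mul_nonneg (sq_nonneg x) (modelE_nonneg (α := α) hh)
  linarith

theorem modelQ_pos (hh : 0 ≤ h) : 0 < modelQ h x α := by
  have h1 := expSlope_pos (2 * α * h)
  have h2 := one_le_modelV (x := x) (α := α) hh
  unfold modelQ
  positivity

theorem modelFlow_sub (hh : 0 ≤ h) :
    modelFlow h x α - x = h * x * (α - x ^ 2) * modelQ h x α := by
  have h1 := modelV_sq (x := x) (α := α) hh
  have h2 := one_le_modelV (x := x) (α := α) hh
  have h4 := mul_modelE h α
  rw [modelE] at h1 h4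
  rw [modelFlow, modelQ]
  generalize expSlope (2 * α * h) = P at h1 h4 ⊢
  field_simp
  linear_combination -x * h1 - x * h4

theorem modelMethod_sub (p : ℕ) (hh : 0 ≤ h) :
    modelMethod p h x α - x = h * x * (α - x ^ 2 + h ^ p * x ^ 3) * modelQ h x α := by
  rw [modelMethod, add_sub_right_comm, modelFlow_sub hh]
  ring

theorem modelFlow_fixed_iff (hh : 0 < h) : modelFlow h x α = x ↔ x = 0 ∨ α = x ^ 2 := by
  rw [← sub_eq_zero, modelFlow_sub hh.le]
  have := (modelQ_pos (x := x) (α := α) hh.le).ne'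
  simp [hh.ne', this, sub_eq_zero]

theorem modelMethod_fixed_iff (p : ℕ) (hh : 0 < h) :
    modelMethod p h x α = x ↔ x = 0 ∨ α = x ^ 2 - h ^ p * x ^ 3 := by
  rw [← sub_eq_zero, modelMethod_sub p hh.le]
  have := (modelQ_pos (x := x) (α := α) hh.le).ne'
  have e : α - x ^ 2 + h ^ p * x ^ 3 = 0 ↔ α = x ^ 2 - h ^ p * x ^ 3 := by
    constructor <;> intro h <;> linarith
  simp [hh.ne', this, e]

/-- The linear coefficient of the model flow. -/
noncomputable def modelA₁ (h α : ℝ) : ℝ := expSlope (α * h)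

/-- The cubic coefficient of the model flow. -/
noncomputable def modelA₃ (h α : ℝ) : ℝ := -(Real.exp (α * h) * expSlope (2 * α * h))

/-- The fourth-order remainder of the model flow. -/
noncomputable def modelR (h x α : ℝ) : ℝ :=
  x * (2 * h * expSlope (2 * α * h) ^ 2 * Real.exp (α * h) * (modelV h x α + 2) /
    (modelV h x α * (modelV h x α + 1) ^ 2))

theorem modelFlow_expand (hh : 0 ≤ h) : modelFlow h x α =
    x + h * (α * modelA₁ h α * x + α * 0 * x ^ 2 + modelA₃ h α * x ^ 3 + x ^ 4 * modelR h x α) := by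
  have h1 := modelV_sq (x := x) (α := α) hh
  have h2 := one_le_modelV (x := x) (α := α) hh
  have h3 := mul_expSlope (α * h)
  have key : (modelV h x α)⁻¹ = 1 - x ^ 2 * modelE h α / 2 + (x ^ 2 * modelE h α) ^ 2 *
      (modelV h x α + 2) / (2 * (modelV h x α * (modelV h x α + 1) ^ 2)) := by
    have h7 : x ^ 2 * modelE h α = modelV h x α ^ 2 - 1 := by linarith
    rw [h7]
    field_simp
    ring
  rw [modelFlow, div_eq_mul_inv, key, modelE, modelA₁, modelA₃, modelR]
  have h8 : Real.exp (α * h) = 1 + α * h * expSlope (α * h) := by linarith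
  field_simp
  linear_combination (x * modelV h x α * (modelV h x α + 1) ^ 2) * h8

theorem modelMethod_expand (p : ℕ) (hh : 0 ≤ h) : modelMethod p h x α =
    x + h * (α * modelA₁ h α * x + α * 0 * x ^ 2 + modelA₃ h α * x ^ 3 +
      x ^ 4 * (modelR h x α + h ^ p * modelQ h x α)) := by
  rw [modelMethod, modelFlow_expand hh]
  ring

end

section smooth
variable {n : WithTop ℕ∞}

theorem modelV_smooth : ContDiffOn ℝ n (fun q : ℝ × ℝ × ℝ => modelV q.1 q.2.1 q.2.2)
    {q | 0 ≤ q.1} := by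
  refine ContDiffOn.sqrt (ContDiff.contDiffOn ?_) (fun q hq => ?_)
  · have := expSlope_contDiff (n := n)
    unfold modelE
    fun_prop
  · have := mul_nonneg (sq_nonneg q.2.1) (modelE_nonneg (α := q.2.2) hq)
    positivity

theorem modelFlow_smooth : ContDiffOn ℝ n (fun q : ℝ × ℝ × ℝ => modelFlow q.1 q.2.1 q.2.2)
    {q | 0 ≤ q.1} :=
  ContDiffOn.div (ContDiff.contDiffOn (by fun_prop)) modelV_smooth
    (fun _ hq => (one_pos.trans_le (one_le_modelV hq)).ne')

theorem modelQ_smooth : ContDiffOn ℝ n (fun q : ℝ × ℝ × ℝ => modelQ q.1 q.2.1 q.2.2)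
    {q | 0 ≤ q.1} := by
  have h1 := expSlope_contDiff (n := n)
  have h2 := modelV_smooth (n := n)
  refine ContDiffOn.div (ContDiff.contDiffOn (by fun_prop))
    (h2.mul ((ContDiff.contDiffOn (by fun_prop)).add h2)) (fun q hq => ?_)
  have h3 := one_le_modelV (x := q.2.1) (α := q.2.2) hq
  positivity

theorem modelR_smooth : ContDiffOn ℝ n (fun q : ℝ × ℝ × ℝ => modelR q.1 q.2.1 q.2.2)
    {q | 0 ≤ q.1} := by
  have h1 := expSlope_contDiff (n := n)
  have h2 := modelV_smooth (n := n)
  refine ContDiffOn.mul (ContDiff.contDiffOn (by fun_prop)) (ContDiffOn.div (ContDiffOn.mul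
    (ContDiff.contDiffOn (by fun_prop)) (h2.add contDiffOn_const))
    (h2.mul ((h2.add contDiffOn_const).pow 2)) (fun q hq => ?_))
  have h3 := one_le_modelV (x := q.2.1) (α := q.2.2) hq
  positivity

theorem modelMethod_smooth (p : ℕ) :
    ContDiffOn ℝ n (fun q : ℝ × ℝ × ℝ => modelMethod p q.1 q.2.1 q.2.2) {q | 0 ≤ q.1} :=
  modelFlow_smooth.add ((ContDiff.contDiffOn (by fun_prop)).mul modelQ_smooth)

end smooth

theorem box_subset_nonneg (h₀ ε₀ α₀ : ℝ) : box h₀ ε₀ α₀ ⊆ {q | 0 ≤ q.1} := fun _ hq => hq.1.1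

theorem hasDerivAt_modelE (t α : ℝ) :
    HasDerivAt (fun t => modelE t α) (2 * Real.exp (α * t) ^ 2) t := by
  rcases eq_or_ne α 0 with rfl | hα
  · have e : (fun t => modelE t 0) = fun t => t * 2 := by
      funext t; simp [modelE, expSlope_zero]
    rw [e]
    simpa using (hasDerivAt_id t).mul_const 2
  · have e : (fun t => modelE t α) = fun t => (Real.exp (α * t) ^ 2 - 1) / α := by
      funext t
      rw [← mul_modelE, mul_div_cancel_left₀ _ hα]
    rw [e]
    have h1 := ((((hasDerivAt_id t).const_mul α).exp.pow 2).sub_const 1).div_const α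
    refine h1.congr_deriv ?_
    simp only [id]
    field_simp
    norm_num
    ring

theorem hasDerivAt_modelFlow {t : ℝ} (ht : 0 ≤ t) (x α : ℝ) :
    HasDerivAt (fun t => modelFlow t x α)
      (α * modelFlow t x α - modelFlow t x α ^ 3) t := by
  have hV := one_le_modelV (x := x) (α := α) ht
  have hV2 := modelV_sq (x := x) (α := α) ht
  have hne : 1 + x ^ 2 * modelE t α ≠ 0 := by rw [← hV2]; positivity
  have h1 := (((hasDerivAt_modelE t α).const_mul (x ^ 2)).const_add 1).sqrt hne
  have h2 := ((((hasDerivAt_id t).const_mul α).exp.const_mul x).div h1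
    (by change modelV t x α ≠ 0; positivity))
  refine h2.congr_deriv ?_
  have h3 : Real.sqrt (1 + x ^ 2 * modelE t α) = modelV t x α := rfl
  simp only [h3, modelFlow, id]
  field_simp

/-- A function of the form `x + x³ k (x)` has first derivative `1` and second derivative `0` at the
origin. -/
theorem deriv_add_cube_mul {k : ℝ → ℝ} (hk : ContDiff ℝ 1 k) :
    deriv (fun x => x + x ^ 3 * k x) 0 = 1 ∧ iteratedDeriv 2 (fun x => x + x ^ 3 * k x) 0 = 0 := by
  have hd : ∀ x, HasDerivAt (fun x => x + x ^ 3 * k x)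
      (1 + x * (x * (3 * k x + x * deriv k x))) x := by
    intro x
    have h1 := (hk.differentiable (by norm_num) x).hasDerivAt
    refine ((hasDerivAt_id x).add ((hasDerivAt_pow 3 x).mul h1)).congr_deriv ?_
    push_cast
    ring
  have e : deriv (fun x => x + x ^ 3 * k x) = fun x => 1 + x * (x * (3 * k x + x * deriv k x)) :=
    funext fun x => (hd x).deriv
  refine ⟨by rw [e]; simp, ?_⟩
  rw [iteratedDeriv_succ, iteratedDeriv_one, e]
  have hc : ContinuousAt (fun x => x * (3 * k x + x * deriv k x)) 0 := by
    have h1 := hk.continuous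
    fun_prop
  have h3 := (hasDerivAt_mul_of_continuousAt hc).const_add 1
  rw [h3.deriv]
  simp

theorem pitchforkODE_model : PitchforkODE (fun x α => α * x - x ^ 3) 1 := by
  have hx : ∀ α x : ℝ, HasDerivAt (fun x => α * x - x ^ 3) (α - 3 * x ^ 2) x := by
    intro α x
    refine (((hasDerivAt_id x).const_mul α).sub (hasDerivAt_pow 3 x)).congr_deriv ?_
    push_cast
    ring
  have e1 : deriv (fun x : ℝ => 0 * x - x ^ 3) = fun x => -(3 * x ^ 2) := by
    funext x; rw [(hx 0 x).deriv]; ring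
  have e2 : deriv (fun x : ℝ => -(3 * x ^ 2)) = fun x => -(6 * x) := by
    funext x
    refine (((hasDerivAt_pow 2 x).const_mul (3:ℝ)).neg.congr_deriv ?_).deriv
    push_cast
    ring
  refine ⟨fun α _ => by simp, ?_, ?_, ?_, ?_⟩
  · rw [e1]; simp
  · rw [iteratedDeriv_succ, iteratedDeriv_one, e1, e2]; simp
  · have e3 : deriv (fun x : ℝ => -(6 * x)) 0 = -6 :=
      (((hasDerivAt_id (0:ℝ)).const_mul 6).neg.congr_deriv (by norm_num)).deriv
    rw [iteratedDeriv_succ, iteratedDeriv_succ, iteratedDeriv_one, e1, e2, e3]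
    norm_num
  · have e3 : (fun α : ℝ => deriv (fun x => α * x - x ^ 3) 0) = fun α => α := by
      funext α; rw [(hx α 0).deriv]; ring
    rw [e3, deriv_id'']
    exact one_ne_zero

theorem model_derivs {p : ℕ} {h : ℝ} (hh : 0 ≤ h) :
    deriv (fun x => modelMethod p h x 0) 0 = 1 ∧
      iteratedDeriv 2 (fun x => modelMethod p h x 0) 0 = 0 := by
  have hq : ContDiff ℝ 1 (fun x : ℝ => (h, x, (0:ℝ))) := by fun_prop
  have h1 : ContDiff ℝ 1 (fun x => modelR h x 0) := by
    rw [← contDiffOn_univ]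
    exact (modelR_smooth (n := 1)).comp hq.contDiffOn (fun x _ => hh)
  have h2 : ContDiff ℝ 1 (fun x => modelQ h x 0) := by
    rw [← contDiffOn_univ]
    exact (modelQ_smooth (n := 1)).comp hq.contDiffOn (fun x _ => hh)
  have e : (fun x => modelMethod p h x 0) = fun x => x + x ^ 3 *
      (h * (modelA₃ h 0 + x * (modelR h x 0 + h ^ p * modelQ h x 0))) := by
    funext x
    rw [modelMethod_expand p hh]
    ring
  rw [e]
  exact deriv_add_cube_mul (by fun_prop)

theorem setting_model {p : ℕ} (k : ℕ) :
    Setting p k (fun x α => α * x - x ^ 3) modelFlow (modelMethod p) 1 1 1 where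
  h₀_pos := one_pos
  ε₀_pos := one_pos
  α₀_pos := one_pos
  f_smooth := by fun_prop
  pitchfork := pitchforkODE_model
  timeMap := by
    intro x _ α _
    refine ⟨?_, fun t ht => (hasDerivAt_modelFlow ht.1 x α).hasDerivWithinAt⟩
    simp [modelFlow, modelV, modelE]
  φ_smooth := (modelMethod_smooth p).mono (box_subset_nonneg 1 1 1)
  order := by
    obtain ⟨C, -, hC⟩ := exists_bound_box (h₀ := 1) (ε₀ := 1) (α₀ := 1)
      (g := fun q => q.2.1 ^ 4 * modelQ q.1 q.2.1 q.2.2)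
      (ContinuousOn.mul (by fun_prop) ((modelQ_smooth (n := 0)).continuousOn.mono
        (box_subset_nonneg 1 1 1)))
    refine ⟨C, fun h hh x hx α hα => ?_⟩
    have := hC (h, x, α) (mem_box.2 ⟨hh, hx, hα⟩)
    have e : modelFlow h x α - modelMethod p h x α =
        -(x ^ 4 * modelQ h x α * h ^ (p + 1)) := by rw [modelMethod]; ring
    rw [e, abs_neg, abs_mul, abs_of_nonneg (pow_nonneg hh.1 (p + 1))]
    exact mul_le_mul_of_nonneg_right this (pow_nonneg hh.1 _)
  φ_equilibrium := by
    intro h _ α _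
    simp [modelMethod, modelFlow]
  φ_x := fun h hh => (model_derivs hh.1).1
  φ_xx := fun h hh => (model_derivs hh.1).2

/-! ### Optimality of the order -/

section
variable {p n : ℕ}

theorem isJet_model {R : ℝ → ℝ → ℝ → ℝ} {M : ℝ → ℝ → ℝ → ℝ}
    (hR : ContDiffOn ℝ n (fun q : ℝ × ℝ × ℝ => R q.1 q.2.1 q.2.2) {q | 0 ≤ q.1})
    (hM : ∀ h x α : ℝ, 0 ≤ h → M h x α = x + h * (α * modelA₁ h α * x + α * 0 * x ^ 2 +
      modelA₃ h α * x ^ 3 + x ^ 4 * R h x α)) :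
    IsJet n M 1 1 1 modelA₁ (fun _ _ => 0) modelA₃ R := by
  have h1 := expSlope_contDiff (n := n)
  refine ⟨ContDiff.contDiffOn ?_, contDiffOn_const, ContDiff.contDiffOn ?_,
    hR.mono (box_subset_nonneg 1 1 1), fun h hh x _ α _ => hM h x α hh.1⟩
  · unfold modelA₁; fun_prop
  · unfold modelA₃; fun_prop

theorem isJet_modelFlow : IsJet n modelFlow 1 1 1 modelA₁ (fun _ _ => 0) modelA₃ modelR :=
  isJet_model modelR_smooth (fun _ _ _ hh => modelFlow_expand hh)

theorem isJet_modelMethod : IsJet n (modelMethod p) 1 1 1 modelA₁ (fun _ _ => 0) modelA₃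
    (fun h x α => modelR h x α + h ^ p * modelQ h x α) :=
  isJet_model (modelR_smooth.add ((ContDiff.contDiffOn (by fun_prop)).mul modelQ_smooth))
    (fun _ _ _ hh => modelMethod_expand p hh)

theorem exists_jetsClose_model : ∃ C, JetsClose p 1 1 1 C modelA₁ (fun _ _ => 0) modelA₃ modelR
    modelA₁ (fun _ _ => 0) modelA₃ (fun h x α => modelR h x α + h ^ p * modelQ h x α) := by
  obtain ⟨C, hC0, hC⟩ := exists_bound_box (h₀ := 1) (ε₀ := 1) (α₀ := 1)
      (g := fun q => modelQ q.1 q.2.1 q.2.2)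
      ((modelQ_smooth (n := 0)).continuousOn.mono (box_subset_nonneg 1 1 1))
  have key : ∀ h ∈ Icc (0:ℝ) 1, ∀ z : ℝ, |z - z| ≤ C * h ^ p := fun h hh z => by
    rw [sub_self, abs_zero]; exact mul_nonneg hC0 (pow_nonneg hh.1 p)
  refine ⟨C, fun h hh α _ => key h hh _, fun h hh α _ => key h hh _, fun h hh α _ => key h hh _,
    fun h hh x hx α hα => ?_⟩
  have e : modelR h x α - (modelR h x α + h ^ p * modelQ h x α) = -(modelQ h x α * h ^ p) := by
    ring
  rw [e, abs_neg, abs_mul, abs_of_nonneg (pow_nonneg hh.1 p)]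
  exact mul_le_mul_of_nonneg_right (hC (h, x, α) (mem_box.2 ⟨hh, hx, hα⟩)) (pow_nonneg hh.1 p)

/-- The two nonzero fixed points `±√α` of the model flow are symmetric, while the sum of the
two corresponding fixed points of the model method is of exact order `h^p`. As a conjugacy maps
fixed points to fixed points, it cannot be closer to the identity, for any alignment of the
parameters. -/
theorem noBetterThan_model {h₀ ε α₀ : ℝ} (hh₀ : h₀ ∈ Ioc (0:ℝ) 1) (hε : 0 < ε) (hα₀ : 0 < α₀)
    (τ : ℝ → ℝ → ℝ) : NoBetterThan p modelFlow (modelMethod p) h₀ ε α₀ τ := by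
  set x := min ε (min α₀ 1) with hx
  have hx0 : 0 < x := lt_min hε (lt_min hα₀ one_pos)
  have hxε : x ≤ ε := min_le_left _ _
  have hx1 : x ≤ 1 := (min_le_right _ _).trans (min_le_right _ _)
  have hxα : x ≤ α₀ := (min_le_right _ _).trans (min_le_left _ _)
  have hxx : x ^ 2 ≤ x := by nlinarith
  refine ⟨x ^ 2 / 4, by positivity, h₀, ⟨hh₀.1, le_rfl⟩, fun J hJ h hh => ?_⟩
  have hα : x ^ 2 ∈ Icc (-α₀) α₀ := ⟨by nlinarith, hxx.trans hxα⟩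
  refine ⟨x ^ 2, hα, ?_⟩
  by_contra! hcon
  have hd0 : 0 < h ^ p := pow_pos hh.1 p
  have hd1 : h ^ p ≤ 1 := pow_le_one₀ hh.1.le (hh.2.trans hh₀.2)
  have hc1 : x ^ 2 / 4 * h ^ p ≤ x / 4 := by nlinarith [mul_le_mul_of_nonneg_left hd1 hx0.le]
  have hmem : ∀ z : ℝ, z ^ 2 = x ^ 2 → z ∈ Icc (-ε) ε := fun z hz => by
    have := abs_le.1 (abs_le_of_sq_le_sq hz.le hx0.le)
    exact ⟨by linarith [this.1], by linarith [this.2]⟩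
  -- the images of the two fixed points are fixed points of the model method
  have hfix : ∀ z : ℝ, z ^ 2 = x ^ 2 → J h z (x ^ 2) = 0 ∨
      τ h (x ^ 2) = J h z (x ^ 2) ^ 2 - h ^ p * J h z (x ^ 2) ^ 3 := by
    intro z hz
    have h1 : modelFlow h z (x ^ 2) = z := (modelFlow_fixed_iff hh.1).2 (Or.inr hz.symm)
    have h2 := hJ.conj h hh _ hα z (hmem z hz) (by rw [h1]; exact hmem z hz)
    rw [h1] at h2
    exact (modelMethod_fixed_iff p hh.1).1 h2.symm
  have hp := abs_lt.1 (hcon x (hmem x rfl))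
  have hn := abs_lt.1 (hcon (-x) (hmem (-x) (by ring)))
  have fp := hfix x rfl
  have fn := hfix (-x) (by ring)
  set u := J h x (x ^ 2) with hu
  set v := J h (-x) (x ^ 2) with hv
  have hu0 : 3 / 4 * x ≤ u := by linarith [hp.2]
  rcases fp with h1 | h1
  · linarith
  rcases fn with h2 | h2
  · linarith
  have huv : u - v ≠ 0 := by
    have : 0 < u - v := by linarith
    exact this.ne'
  -- `u² - h^p u³` and `v² - h^p v³` are the same parameter, for both fixed points
  have hsum : u + v = h ^ p * (u ^ 2 + u * v + v ^ 2) := by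
    apply mul_left_cancel₀ huv
    linear_combination h2 - h1
  have hlow : 9 / 16 * x ^ 2 ≤ u ^ 2 + u * v + v ^ 2 := by
    nlinarith [mul_self_nonneg (u + v), mul_le_mul hu0 (by linarith : 3 / 4 * x ≤ -v)
      (by positivity) (by linarith : (0:ℝ) ≤ u)]
  have hge : h ^ p * (9 / 16 * x ^ 2) ≤ u + v := by
    rw [hsum]; exact mul_le_mul_of_nonneg_left hlow hd0.le
  linarith [hp.1, hn.1]

/-- The normal forms of the model flow and of the model method, computed with the same coordinate
changes, have positive fixed points at a distance of exact order `h^p`. -/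
theorem noBetterThan_model_normalForms {s h₀ ε₀ α₀ ε₁ β₁ C μ : ℝ} {χ r r' : ℝ → ℝ → ℝ → ℝ}
    {b : ℝ → ℝ → ℝ} (hE : IsExpandingPair p s modelFlow (modelMethod p) h₀ ε₀ α₀ ε₁ β₁ C μ χ b r
      χ b r') (hh₀ : h₀ ≤ 1) {h₁ ε β₀ : ℝ} (hh₁ : h₁ ∈ Ioc 0 h₀) (hε : ε ∈ Ioc 0 ε₁)
    (hβ₀ : β₀ ∈ Ioc 0 β₁) :
    NoBetterThan p (normalForm s r') (normalForm s r) h₁ ε β₀ (fun _ β => β) := by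
  have hP := hE.pair
  have hμ := hE.μ_pos
  have hα₀ := hP.α₀_pos
  have hε₀ := hP.ε₀_pos
  have hcast : (1 : WithTop ℕ∞) ≤ ((p + 2 : ℕ) : WithTop ℕ∞) := by
    have : 1 ≤ p + 2 := by omega
    exact_mod_cast this
  have hα00 : (0:ℝ) ∈ Icc (-α₀) α₀ := ⟨by linarith, hα₀.le⟩
  have hε00 : (0:ℝ) ∈ Icc (-ε₀) ε₀ := ⟨by linarith, hε₀.le⟩
  obtain ⟨L, hL0, hL⟩ := exists_lipschitz_of_contDiffOn (isCompact_box h₀ ε₀ α₀)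
    (convex_box h₀ ε₀ α₀) (uniqueDiffOn_box hP.h₀_pos hε₀ hα₀)
    (ContDiffOn.of_le hP.exact.χ_smooth hcast)
  obtain ⟨L', hL'0, hL'⟩ := exists_lipschitz_of_contDiffOn (isCompact_Icc.prod isCompact_Icc)
    ((convex_Icc 0 h₀).prod (convex_Icc (-α₀) α₀))
    ((uniqueDiffOn_Icc hP.h₀_pos).prod (uniqueDiffOn_Icc (by linarith)))
    (hP.exact.b_smooth.of_le hcast)
  -- a small state `x`, the fixed point of the model method at the parameter `x² - h^p x³`
  obtain ⟨x, hx0, hx1, hxε, hxα, hxL, hxL'⟩ : ∃ x : ℝ, 0 < x ∧ x ≤ 1 / 2 ∧ x ≤ ε₀ ∧ x ≤ α₀ ∧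
      L * x ≤ ε / 2 ∧ L' * x ≤ β₀ := by
    have hε' := hε.1
    have hβ' := hβ₀.1
    refine ⟨min (min (1 / 2) (min ε₀ α₀)) (min (ε / 2 / (L + 1)) (β₀ / (L' + 1))),
      lt_min (lt_min (by norm_num) (lt_min hε₀ hα₀)) (lt_min (by positivity) (by positivity)),
      (min_le_left _ _).trans (min_le_left _ _),
      (min_le_left _ _).trans ((min_le_right _ _).trans (min_le_left _ _)),
      (min_le_left _ _).trans ((min_le_right _ _).trans (min_le_right _ _)), ?_, ?_⟩
    · refine (mul_le_mul_of_nonneg_left ((min_le_right _ _).trans (min_le_left _ _)) hL0).trans ?_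
      rw [← mul_div_assoc, div_le_iff₀ (by linarith)]
      nlinarith
    · refine (mul_le_mul_of_nonneg_left ((min_le_right _ _).trans (min_le_right _ _)) hL'0).trans ?_
      rw [← mul_div_assoc, div_le_iff₀ (by linarith)]
      nlinarith
  have hxx : x ^ 2 ≤ x / 2 := by nlinarith
  refine ⟨min (μ * x ^ 2 / 2) (min (μ * x) (ε / 2)) / 2, ?_, h₁, ⟨hh₁.1, le_rfl⟩,
    fun J hJ h hh => ?_⟩
  · have := hε.1
    have : 0 < min (μ * x ^ 2 / 2) (min (μ * x) (ε / 2)) :=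
      lt_min (by positivity) (lt_min (by positivity) (by positivity))
    linarith
  set c := min (μ * x ^ 2 / 2) (min (μ * x) (ε / 2)) with hc
  have hc1 : c ≤ μ * x ^ 2 / 2 := min_le_left _ _
  have hc2 : c ≤ μ * x := (min_le_right _ _).trans (min_le_left _ _)
  have hc3 : c ≤ ε / 2 := (min_le_right _ _).trans (min_le_right _ _)
  have hc0 : 0 ≤ c := by
    have := hε.1
    exact le_min (by positivity) (le_min (by positivity) (by positivity))
  have hhI : h ∈ Icc 0 h₀ := ⟨hh.1.le, hh.2.trans hh₁.2⟩
  have hd0 : 0 < h ^ p := pow_pos hh.1 p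
  have hd1 : h ^ p ≤ 1 := pow_le_one₀ hh.1.le (hhI.2.trans hh₀)
  set α := x ^ 2 - h ^ p * x ^ 3 with hαdef
  have hx3 : h ^ p * x ^ 3 ≤ x ^ 2 / 2 := by
    have h1 : h ^ p * x ^ 3 ≤ 1 * x ^ 3 := mul_le_mul_of_nonneg_right hd1 (by positivity)
    nlinarith [sq_nonneg x]
  have hx3' : 0 < h ^ p * x ^ 3 := by positivity
  have hα0 : x ^ 2 / 2 ≤ α := by linarith
  have hαx : α < x ^ 2 := by linarith
  have hαI : α ∈ Icc (-α₀) α₀ := ⟨by linarith, by linarith⟩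
  have hxI : x ∈ Icc (-ε₀) ε₀ := ⟨by linarith, hxε⟩
  set β := b h α with hβdef
  have hβ : β ∈ Icc (-β₀) β₀ := by
    have h1 := hL' (h, α) ⟨hhI, hαI⟩ (h, 0) ⟨hhI, hα00⟩
    simp only [Prod.mk_sub_mk, sub_self, sub_zero, Prod.norm_mk, norm_zero, Real.norm_eq_abs,
      hP.exact.b_zero h hhI] at h1
    rw [max_eq_right (abs_nonneg α), abs_of_pos (by linarith : 0 < α)] at h1
    have h2 : L' * α ≤ L' * x := mul_le_mul_of_nonneg_left (by linarith) hL'0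
    exact abs_le.1 (h1.trans (h2.trans hxL'))
  have hβI : β ∈ Icc (-β₁) β₁ := Icc_subset_Icc (neg_le_neg hβ₀.2) hβ₀.2 hβ
  set y := χ h x α with hydef
  have hyε : |y| ≤ ε / 2 := by
    have h1 := hL (h, x, α) (mem_box.2 ⟨hhI, hxI, hαI⟩) (h, 0, α) (mem_box.2 ⟨hhI, hε00, hαI⟩)
    simp only [Prod.mk_sub_mk, sub_self, sub_zero, Prod.norm_mk, norm_zero, Real.norm_eq_abs,
      hP.exact.χ_zero h hhI α hαI] at h1
    rw [max_eq_left (abs_nonneg x), max_eq_right (abs_nonneg x), abs_of_pos hx0] at h1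
    exact h1.trans hxL
  have hyI : y ∈ Icc (-ε) ε := abs_le.1 (by linarith [hε.1])
  have subε : Icc (-ε) ε ⊆ Icc (-ε₁) ε₁ := Icc_subset_Icc (neg_le_neg hε.2) hε.2
  have hφx : modelMethod p h x α = x := (modelMethod_fixed_iff p hh.1).2 (Or.inr rfl)
  have hNy : normalForm s r' h y β = y := by
    have := hP.discrete.transforms h hhI α hαI x hxI (by rw [hφx]; exact hxI) (subε hyI) hβI
    rw [hφx] at this
    exact this.symm
  have hJfix := hJ.conj h hh β hβ y hyI (by rw [hNy]; exact hyI)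
  rw [hNy] at hJfix
  set z := J h y β with hz
  refine ⟨β, hβ, y, hyI, ?_⟩
  by_contra! hcon
  have hsmall : |y - z| < c := hcon.trans_le (by nlinarith)
  have hzI : z ∈ Icc (-ε₁) ε₁ := by
    have h1 := abs_le.1 hyε
    have h2 := abs_lt.1 hsmall
    exact subε ⟨by linarith, by linarith⟩
  obtain ⟨x', hx', hχx'⟩ := hE.χ_cover_half h hhI α hαI z hzI
  have hx'I : x' ∈ Icc (-ε₀) ε₀ := Icc_subset_Icc (by linarith) (by linarith) hx'
  have hΦI : modelFlow h x' α ∈ Icc (-ε₀) ε₀ := by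
    have h1 := hE.Φ_le h hhI x' hx'I α hαI
    have h2 := abs_le.2 hx'
    exact abs_le.1 (by linarith)
  have hexp := abs_expand_of_expand (hE.χ_expand h hhI α hαI)
  have hΦx : modelFlow h x' α = x' := by
    have h1 := hP.exact.transforms h hhI α hαI x' hx'I hΦI (by rw [hχx']; exact hzI) hβI
    rw [hχx', ← hβdef, ← hJfix, ← hχx'] at h1
    have h2 := hexp _ hΦI _ hx'I
    rw [h1, sub_self, abs_zero] at h2
    have h3 : |modelFlow h x' α - x'| ≤ 0 := by
      by_contra! hc
      exact absurd h2 (not_le.2 (mul_pos hμ hc))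
    exact sub_eq_zero.1 (abs_nonpos_iff.1 h3)
  have hdist := hexp x hxI x' hx'I
  rw [hχx', ← hydef] at hdist
  have hx'x : x' < x := by
    rcases (modelFlow_fixed_iff hh.1).1 hΦx with h1 | h1
    · rw [h1]; exact hx0
    · by_contra! hc
      nlinarith
  rw [abs_of_pos (sub_pos.2 hx'x)] at hdist
  rcases le_or_gt x' 0 with hneg | hpos
  · have : μ * x ≤ μ * (x - x') := mul_le_mul_of_nonneg_left (by linarith) hμ.le
    linarith
  · -- both fixed points are positive, with `x² - x'² = h^p x³`
    have h1 : α = x' ^ 2 := by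
      rcases (modelFlow_fixed_iff hh.1).1 hΦx with h1 | h1
      · linarith
      · exact h1
    have h2 : h ^ p * x ^ 2 / 2 ≤ x - x' := by
      have h3 : (x - x') * (x + x') = h ^ p * x ^ 3 := by
        rw [hαdef] at h1
        linear_combination h1
      have h4 : (x - x') * (x + x') ≤ (x - x') * (2 * x) :=
        mul_le_mul_of_nonneg_left (by linarith) (by linarith)
      have h5 : h ^ p * x ^ 2 / 2 * (2 * x) ≤ (x - x') * (2 * x) := by
        rw [h3] at h4
        calc h ^ p * x ^ 2 / 2 * (2 * x) = h ^ p * x ^ 3 := by ring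
          _ ≤ _ := h4
      exact le_of_mul_le_mul_right h5 (by linarith)
    have h6 := mul_le_mul_of_nonneg_left h2 hμ.le
    have h7 : c * h ^ p ≤ μ * x ^ 2 / 2 * h ^ p := mul_le_mul_of_nonneg_right hc1 hd0.le
    have h8 : 0 ≤ c * h ^ p := mul_nonneg hc0 hd0.le
    linarith

/-- Optimality of the order `h^p`, for the model problem. -/
theorem exists_optimal (hp : 1 ≤ p) : ∃ (f : ℝ → ℝ → ℝ) (Φ φ : ℝ → ℝ → ℝ → ℝ) (H E A : ℝ),
      (∀ k : ℕ, Setting p k f Φ φ H E A) ∧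
      (∀ h₀ ∈ Ioc 0 H, ∀ ε ∈ Ioc 0 E, ∀ α₀ ∈ Ioc 0 A, ∀ τ : ℝ → ℝ → ℝ,
        NoBetterThan p Φ φ h₀ ε α₀ τ) ∧
      ∃ (s h₀ ε₀ α₀ ε₁ β₁ C : ℝ)
        (χ : ℝ → ℝ → ℝ → ℝ) (b : ℝ → ℝ → ℝ) (r : ℝ → ℝ → ℝ → ℝ)
        (χ' : ℝ → ℝ → ℝ → ℝ) (b' : ℝ → ℝ → ℝ) (r' : ℝ → ℝ → ℝ → ℝ),
        IsReductionPair p s Φ φ h₀ ε₀ α₀ ε₁ β₁ C χ b r χ' b' r' ∧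
        ∀ h₁ ∈ Ioc 0 h₀, ∀ ε ∈ Ioc 0 ε₁, ∀ β₀ ∈ Ioc 0 β₁,
          NoBetterThan p (normalForm s r') (normalForm s r) h₁ ε β₀ (fun _ β => β) := by
  refine ⟨fun x α => α * x - x ^ 3, modelFlow, modelMethod p, 1, 1, 1, setting_model,
    fun h₀ hh₀ ε hε α₀ hα₀ τ => noBetterThan_model hh₀ hε.1 hα₀.1 τ, ?_⟩
  obtain ⟨C, hC⟩ := exists_jetsClose_model (p := p)
  obtain ⟨s, h₀, ε₀, α₀, ε₁, β₁, D, μ, r, r', hh₀, -, -, -, hE⟩ :=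
    exists_expandingPair hp one_pos one_pos one_pos isJet_modelFlow isJet_modelMethod hC
      (by simp [modelA₁, expSlope_zero]) (by simp [modelA₃, expSlope_zero])
  exact ⟨s, h₀, ε₀, α₀, ε₁, β₁, D, _, _, r, _, _, r', hE.pair, fun h₁ hh₁ ε hε β₀ hβ₀ =>
    noBetterThan_model_normalForms hE hh₀ hh₁ hε hβ₀⟩

end

end Pitchfork

theorem mainTheorem2 (p : ℕ) (hp : 1 ≤ p) :
    -- the conjugacy exists and is `O(h^p)`-close to the identity
    (∃ k : ℕ, ∀ (f : ℝ → ℝ → ℝ) (Φ φ : ℝ → ℝ → ℝ → ℝ) (H E A : ℝ),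
      Pitchfork.Setting p k f Φ φ H E A →
      ∃ (s h₀ ε₀ α₀ ε₁ β₁ ε₂ α₂ C : ℝ)
        (χ : ℝ → ℝ → ℝ → ℝ) (b : ℝ → ℝ → ℝ) (r : ℝ → ℝ → ℝ → ℝ)
        (χ' : ℝ → ℝ → ℝ → ℝ) (b' : ℝ → ℝ → ℝ) (r' : ℝ → ℝ → ℝ → ℝ)
        (J : ℝ → ℝ → ℝ → ℝ) (τ : ℝ → ℝ → ℝ) (JJ : ℝ → ℝ → ℝ → ℝ),
        h₀ ≤ H ∧ ε₀ ≤ E ∧ α₀ ≤ A ∧ 0 < C ∧ ε₂ ∈ Set.Ioc 0 ε₀ ∧ α₂ ∈ Set.Ioc 0 α₀ ∧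
        Pitchfork.IsReductionPair p s Φ φ h₀ ε₀ α₀ ε₁ β₁ C χ b r χ' b' r' ∧
        -- the fundamental-domain conjugacy `J` of the normal forms
        Pitchfork.IsConjugacyFamily (Pitchfork.normalForm s r') (Pitchfork.normalForm s r)
          h₀ ε₁ β₁ (fun _ β => β) J ∧
        (∀ h ∈ Set.Ioc 0 h₀, ∀ β ∈ Set.Icc (-β₁) β₁,
          Pitchfork.IsFundamentalDomainConjugacy s ε₁ β
            (fun y => Pitchfork.normalForm s r' h y β) (fun y => Pitchfork.normalForm s r h y β)
            (fun y => J h y β) ∧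
          StrictMonoOn (fun y => J h y β) (Set.Icc (-ε₁) ε₁) ∧
          Set.BijOn (fun y => J h y β) (Set.Icc (-ε₁) ε₁) (Set.Icc (-ε₁) ε₁) ∧
          ∀ y ∈ Set.Icc (-ε₁) ε₁, |y - J h y β| ≤ C * h ^ p) ∧
        -- the conjugacy `JJ` of `Φ` and `φ` that it induces through the coordinate changes
        Pitchfork.IsConjugacyFamily Φ φ h₀ ε₂ α₂ τ JJ ∧
        (∀ h ∈ Set.Ioc 0 h₀, ∀ α ∈ Set.Icc (-α₂) α₂,
          τ h α ∈ Set.Icc (-α₀) α₀ ∧ b h α ∈ Set.Icc (-β₁) β₁ ∧ b' h (τ h α) = b h α ∧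
          |α - τ h α| ≤ C * h ^ p ∧
          ∀ x ∈ Set.Icc (-ε₂) ε₂,
            JJ h x α ∈ Set.Icc (-ε₀) ε₀ ∧
            χ' h (JJ h x α) (τ h α) ∈ Set.Icc (-ε₁) ε₁ ∧
            J h (χ' h (JJ h x α) (τ h α)) (b h α) = χ h x α ∧
            |x - JJ h x α| ≤ C * h ^ p)) ∧
    -- the order `h^p` is optimal
    (∃ (f : ℝ → ℝ → ℝ) (Φ φ : ℝ → ℝ → ℝ → ℝ) (H E A : ℝ),
      (∀ k : ℕ, Pitchfork.Setting p k f Φ φ H E A) ∧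
      (∀ h₀ ∈ Set.Ioc 0 H, ∀ ε ∈ Set.Ioc 0 E, ∀ α₀ ∈ Set.Ioc 0 A, ∀ τ : ℝ → ℝ → ℝ,
        Pitchfork.NoBetterThan p Φ φ h₀ ε α₀ τ) ∧
      ∃ (s h₀ ε₀ α₀ ε₁ β₁ C : ℝ)
        (χ : ℝ → ℝ → ℝ → ℝ) (b : ℝ → ℝ → ℝ) (r : ℝ → ℝ → ℝ → ℝ)
        (χ' : ℝ → ℝ → ℝ → ℝ) (b' : ℝ → ℝ → ℝ) (r' : ℝ → ℝ → ℝ → ℝ),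
        Pitchfork.IsReductionPair p s Φ φ h₀ ε₀ α₀ ε₁ β₁ C χ b r χ' b' r' ∧
        ∀ h₁ ∈ Set.Ioc 0 h₀, ∀ ε ∈ Set.Ioc 0 ε₁, ∀ β₀ ∈ Set.Ioc 0 β₁,
          Pitchfork.NoBetterThan p (Pitchfork.normalForm s r') (Pitchfork.normalForm s r)
            h₁ ε β₀ (fun _ β => β)) := by
  exact ⟨⟨p + 7, fun _ _ _ _ _ _ hS => hS.exists_conjugacies hp⟩, Pitchfork.exists_optimal hp⟩
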